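/- Let $\gamma\in C^3(\mathbb{R})$ be real-valued and either odd or even, with $\gamma(0)=\gamma'(0)=0$, convex on $(0,\infty)$, with $\gamma'$ and $\gamma''$ non-vanishing on $(0,\infty)$, and such that (i) $\gamma'(2t)/\gamma'(t)$ is (weakly) decreasing and bounded from above by a constant $C_1$ on $(0,\infty)$; (ii) there is $C_2>0$ with $t\gamma''(t)/\gamma'(t)\le C_2$ for all $t\in(0,\infty)$; (iii) there is $C_3>0$ with $\left|(\gamma''/\gamma')'(t)\right|\ge C_3/t^2$ for all $t\in(0,\infty)$; (iv) $\gamma'''/\gamma''$ is strictly monotone or equal to a constant on $(0,\infty)$. Let $\psi:\mathbb{R}\to[0,1]$ be a smooth function supported in $\{t:\tfrac12\le|t|\le2\}$ with $\sum_{l\in\mathbb{Z}}\psi(2^{-l}t)=1$ for every $t\ne0$. For $l\in\mathbb{Z}$ put $\psi_l(\xi):=\psi(2^{-l}\xi)$, let $\check\psi_l(z):=\int_{\mathbb{R}}\psi_l(\xi)e^{2\pi i z\xi}\,d\xi$, and let $$P_lf(x_1,x_2):=\int_{\mathbb{R}}f(x_1,x_2-z)\,\check\psi_l(z)\,dz$$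 be the Littlewood–Paley projection in the second variable. For a measurable function $u:\mathbb{R}\to\mathbb{R}$ let $$H_{u,\gamma}g(x_1,x_2):=\mathrm{p.v.}\int_{-\infty}^{\infty}g(x_1-t,\,x_2-u(x_1)\gamma(t))\,\frac{dt}{t}=\lim_{\varepsilon\to0^+}\int_{|t|>\varepsilon}g(x_1-t,\,x_2-u(x_1)\gamma(t))\,\frac{dt}{t}.$$ Then for every $p\in(1,\infty)$ there is a constant $C>0$, depending only on $\gamma$, $\psi$ and $p$, such that for every measurable $u:\mathbb{R}\to\mathbb{R}$, every $l\in\mathbb{Z}$ and every complex-valued $f\in L^p(\mathbb{R}^2)$: $P_lf\in L^p(\mathbb{R}^2)$, the principal value defining $H_{u,\gamma}P_lf(x)$ exists for almost every $x\in\mathbb{R}^2$ (the truncated integrals being absolutely convergent), $H_{u,\gamma}P_lf\in L^p(\mathbb{R}^2)$, and $$\|H_{u,\gamma}P_lf\|_{L^p(\mathbb{R}^2)}\le C\,\|P_lf\|_{L^p(\mathbb{R}^2)}.$$ In particular $C$ is uniform in $l$ and independent of $u$. -/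

import Mathlib

open MeasureTheory Filter Set
open scoped Topology ENNReal ContDiff FourierTransform

noncomputable section

/-- The class of plane curves `γ`: of class `C³` on `ℝ`, odd or even, `γ(0) = γ'(0) = 0`, convex on
`(0, ∞)`, and subject to four curvature conditions on `(0, ∞)`. The two fields `deriv_ne_zero` and
`deriv2_ne_zero` only say that the quotients in the curvature conditions are meaningful. -/
structure IsAdmissibleCurve (γ : ℝ → ℝ) : Prop where
  contDiff : ContDiff ℝ 3 γ
  odd_or_even : Function.Odd γ ∨ Function.Even γ
  zero : γ 0 = 0
  deriv_zero : deriv γ 0 = 0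
  convexOn : ConvexOn ℝ (Ioi 0) γ
  deriv_ne_zero : ∀ t ∈ Ioi (0 : ℝ), deriv γ t ≠ 0
  deriv2_ne_zero : ∀ t ∈ Ioi (0 : ℝ), iteratedDeriv 2 γ t ≠ 0
  /-- `γ'(2t) / γ'(t)` is decreasing (in the weak sense) on `(0, ∞)` -/
  doubling_antitone : AntitoneOn (fun t => deriv γ (2 * t) / deriv γ t) (Ioi 0)
  /-- `γ'(2t) / γ'(t)` is bounded from above on `(0, ∞)` -/
  doubling_bounded : ∃ C₁ : ℝ, ∀ t ∈ Ioi (0 : ℝ), deriv γ (2 * t) / deriv γ t ≤ C₁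
  /-- `t γ''(t) / γ'(t)` is bounded from above on `(0, ∞)` -/
  growth : ∃ C₂ : ℝ, 0 < C₂ ∧ ∀ t ∈ Ioi (0 : ℝ), t * iteratedDeriv 2 γ t / deriv γ t ≤ C₂
  /-- `|(γ''/γ')'(t)| ≥ C₃ / t²` on `(0, ∞)` -/
  curvature : ∃ C₃ : ℝ, 0 < C₃ ∧ ∀ t ∈ Ioi (0 : ℝ),
    C₃ / t ^ 2 ≤ |deriv (fun s => iteratedDeriv 2 γ s / deriv γ s) t|
  /-- `γ'''/γ''` is strictly monotone on `(0, ∞)` or equal to a constant there -/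
  third_order :
    StrictMonoOn (fun t => iteratedDeriv 3 γ t / iteratedDeriv 2 γ t) (Ioi 0) ∨
    StrictAntiOn (fun t => iteratedDeriv 3 γ t / iteratedDeriv 2 γ t) (Ioi 0) ∨
    ∃ c : ℝ, ∀ t ∈ Ioi (0 : ℝ), iteratedDeriv 3 γ t / iteratedDeriv 2 γ t = c

/-- A Littlewood–Paley cut-off: a smooth `ψ : ℝ → [0, 1]` supported in `{1/2 ≤ |t| ≤ 2}` with
`∑_{l ∈ ℤ} ψ(2⁻ˡ t) = 1` for every `t ≠ 0`. -/
structure IsLittlewoodPaleyCutoff (ψ : ℝ → ℝ) : Prop where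
  smooth : ContDiff ℝ ∞ ψ
  supp : Function.support ψ ⊆ {t : ℝ | 1 / 2 ≤ |t| ∧ |t| ≤ 2}
  nonneg : ∀ t, 0 ≤ ψ t
  le_one : ∀ t, ψ t ≤ 1
  hasSum : ∀ t : ℝ, t ≠ 0 → HasSum (fun l : ℤ => ψ ((2 : ℝ) ^ (-l) * t)) 1

/-- The convolution kernel of the `l`-th Littlewood–Paley projection: the inverse Fourier
transform of `ψ_l(ξ) = ψ(2⁻ˡ ξ)`. -/
def lpKernel (ψ : ℝ → ℝ) (l : ℤ) : ℝ → ℂ :=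
  𝓕⁻ (fun ξ : ℝ => ((ψ ((2 : ℝ) ^ (-l) * ξ) : ℝ) : ℂ))

/-- The Littlewood–Paley projection in the second variable,
`P_l f(x₁, x₂) = ∫ f(x₁, x₂ - z) ψ̌_l(z) dz`. -/
def lpProj (ψ : ℝ → ℝ) (l : ℤ) (f : ℝ × ℝ → ℂ) (x : ℝ × ℝ) : ℂ :=
  ∫ z : ℝ, f (x.1, x.2 - z) * lpKernel ψ l z

/-- The integrand `g(x₁ - t, x₂ - u(x₁) γ(t)) / t`. -/
def curveIntegrand (u γ : ℝ → ℝ) (g : ℝ × ℝ → ℂ) (x : ℝ × ℝ) (t : ℝ) : ℂ :=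
  g (x.1 - t, x.2 - u x.1 * γ t) / (t : ℂ)

/-- The truncated integral `∫_{|t| > ε} g(x₁ - t, x₂ - u(x₁) γ(t)) dt / t`. -/
def truncHilbert (u γ : ℝ → ℝ) (g : ℝ × ℝ → ℂ) (ε : ℝ) (x : ℝ × ℝ) : ℂ :=
  ∫ t in {t : ℝ | ε < |t|}, curveIntegrand u γ g x t

/-- The principal value defining `H_{u,γ} g(x)` exists: all truncated integrals converge
absolutely, and they have a limit as `ε → 0⁺`. -/
def PVExists (u γ : ℝ → ℝ) (g : ℝ × ℝ → ℂ) (x : ℝ × ℝ) : Prop :=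
  (∀ ε : ℝ, 0 < ε → IntegrableOn (curveIntegrand u γ g x) {t : ℝ | ε < |t|}) ∧
    ∃ L : ℂ, Tendsto (fun ε : ℝ => truncHilbert u γ g ε x) (𝓝[>] 0) (𝓝 L)

/-- The Hilbert transform along the variable curve `u(x₁) γ`,
`H_{u,γ} g(x₁, x₂) = p.v. ∫ g(x₁ - t, x₂ - u(x₁) γ(t)) dt / t`
(meaningful at the points where `PVExists` holds). -/
def curveHilbert (u γ : ℝ → ℝ) (g : ℝ × ℝ → ℂ) (x : ℝ × ℝ) : ℂ :=
  limUnder (𝓝[>] (0 : ℝ)) (fun ε : ℝ => truncHilbert u γ g ε x)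

end

/-!
# Uniform bounds for Hilbert transforms along variable curves, one frequency at a time

Put `μ = 2^l`. The function `g = P_l f` lives at frequencies of size `μ` in the second variable, so
that on almost every vertical line it is reproduced by convolution with an `L¹`-normalized kernel
`k` of width `1/μ` which has an integrable primitive (`Reproduces`, `IsBandKernel`,
`reproduces_lpProj`). Nothing else about `g` is used, and `u` may be merely measurable because every
estimate below is a convolution estimate in the second variable, whose constant does not depend on
translations, followed by an estimate for maximal functions in the first.

Let `τ(x₁)` be the scale at which the curve leaves the strip of width `1/μ`, i.e.
`μ |u(x₁)| γ(τ(x₁)) = 1` (`IsAdmissibleCurve.exists_scale`).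

For `|t| ≤ τ` the curve may be replaced by the horizontal line. The displacement `u(x₁) γ(t)` can be
moved to `k`, and by convexity of `γ` it costs at most `|t| / τ`; this cancels the singularity
`1/t` and leaves an average that the Hardy–Littlewood maximal function controls
(`IsAdmissibleCurve.lpn_lowPart_le`). What remains is a difference of a Hilbert transform and a
truncated Hilbert transform along horizontal lines. Both are controlled by the maximal truncated
Hilbert transform (`exists_lpn_hilbMax_le`), whose `L^p` theory is developed here from Cotlar's
identity (`hilb_mul_hilb`), which yields `L²` and the step from `L^p` to `L^{2p}`, together with
Marcinkiewicz interpolation, duality and Cotlar's inequality. The principal value exists because the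
difference from the horizontal one converges absolutely, while the horizontal one exists almost
everywhere by density of smooth functions and the maximal inequality (`ae_exists_tendsto_hilb`).

For `|t| > τ` the integral is decomposed into the annuli `2ⁿ τ < |t| ≤ 2ⁿ⁺¹ τ`, and the `n`-th piece
has norm `O(2^(-δ n))` on `L^p` (`IsAdmissibleCurve.exists_lpn_annOp_le`). On every `L^p` it is
bounded by maximal functions, so by interpolation the decay is needed on `L²` only. There it follows
from the `T T*` method (`lpn_two_le_of_mul_adjoint`): the kernel of `T T*` is an average of
translates `κ(ζ - θ(t))`, where `κ` is the autocorrelation of `k` and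
`θ(t) = u(x₁) γ(t) - u(y₁) γ(t - x₁ + y₁)`. As `κ` has an integrable primitive, such an average can
be integrated by parts as in van der Corput's lemma (`lintegral_enorm_integral_comp_le`). Two facts
about the phase are needed: `θ'` and `θ''` are not small simultaneously, since otherwise `γ''/γ'`
would take nearly equal values at `t` and `t - x₁ + y₁` (`exists_phase_lower_bound`); and `θ''`
changes sign at most once, since the monotonicity of `γ'''/γ''` makes
`γ''(t) / γ''(t - x₁ + y₁)` monotone (`monotoneOn_or_antitoneOn_ratio`). The resulting kernel
`O(2^(-n/2) (r |x₁ - y₁|)^(-1/2))`, on `|x₁ - y₁| ≤ 2 r`, is again controlled by the maximal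
function, even though the radius `r` depends on the point.

Negative `t` are reduced to positive ones by reflecting the first variable, `γ` being odd or even.
-/

open scoped ComplexConjugate

/-! ### `L^p` norms of nonnegative functions -/

/-- The `L^p` norm of a function with values in `[0, ∞]`, for a real exponent `p`. -/
noncomputable def lpn {α : Type*} [MeasurableSpace α] (p : ℝ) (μ : Measure α) (F : α → ℝ≥0∞) :
    ℝ≥0∞ :=
  (∫⁻ a, F a ^ p ∂μ) ^ (1 / p)

section lpn

variable {α β : Type*} [MeasurableSpace α] [MeasurableSpace β] {μ : Measure α} {ν : Measure β}

lemma lpn_mono {p : ℝ} (hp : 0 < p) {F G : α → ℝ≥0∞} (h : ∀ᵐ a ∂μ, F a ≤ G a) :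
    lpn p μ F ≤ lpn p μ G := by
  unfold lpn
  apply ENNReal.rpow_le_rpow _ (by positivity)
  apply lintegral_mono_ae
  filter_upwards [h] with a ha
  exact ENNReal.rpow_le_rpow ha hp.le

lemma lpn_congr {p : ℝ} {F G : α → ℝ≥0∞} (h : ∀ᵐ a ∂μ, F a = G a) :
    lpn p μ F = lpn p μ G := by
  unfold lpn
  congr 1
  apply lintegral_congr_ae
  filter_upwards [h] with a ha
  rw [ha]

lemma lpn_add_le {p : ℝ} (hp : 1 ≤ p) {F G : α → ℝ≥0∞} (hF : AEMeasurable F μ)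
    (hG : AEMeasurable G μ) :
    lpn p μ (fun a => F a + G a) ≤ lpn p μ F + lpn p μ G :=
  ENNReal.lintegral_Lp_add_le hF hG hp

lemma lpn_const_mul {p : ℝ} (hp : 0 < p) (c : ℝ≥0∞) {F : α → ℝ≥0∞} (hF : AEMeasurable F μ) :
    lpn p μ (fun a => c * F a) = c * lpn p μ F := by
  unfold lpn
  simp_rw [ENNReal.mul_rpow_of_nonneg _ _ hp.le]
  rw [lintegral_const_mul'' _ (hF.pow_const p), ENNReal.mul_rpow_of_nonneg _ _ (by positivity),
    ← ENNReal.rpow_mul, mul_one_div_cancel hp.ne', ENNReal.rpow_one]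

lemma lpn_rpow {p : ℝ} (hp : 0 < p) (F : α → ℝ≥0∞) :
    lpn p μ F ^ p = ∫⁻ a, F a ^ p ∂μ := by
  unfold lpn
  rw [← ENNReal.rpow_mul, one_div_mul_cancel hp.ne', ENNReal.rpow_one]

lemma lintegral_mul_le_lpn {p q : ℝ} (hpq : p.HolderConjugate q) {F G : α → ℝ≥0∞}
    (hF : AEMeasurable F μ) (hG : AEMeasurable G μ) :
    ∫⁻ a, F a * G a ∂μ ≤ lpn p μ F * lpn q μ G :=
  ENNReal.lintegral_mul_le_Lp_mul_Lq μ hpq hF hG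

lemma eLpNorm_eq_lpn {E : Type*} [NormedAddCommGroup E] {p : ℝ≥0∞} (h0 : p ≠ 0) (h1 : p ≠ ⊤)
    (f : α → E) : eLpNorm f p μ = lpn p.toReal μ (fun a => ‖f a‖ₑ) := by
  rw [eLpNorm_eq_lintegral_rpow_enorm_toReal h0 h1]; rfl

/-- Monotone convergence for the `L^p` norm. -/
lemma lpn_iSup_le {p : ℝ} (hp : 0 < p) {F : ℕ → α → ℝ≥0∞} (hF : ∀ n, Measurable (F n))
    (hmono : Monotone F) {C : ℝ≥0∞} (h : ∀ n, lpn p μ (F n) ≤ C) :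
    lpn p μ (fun a => ⨆ n, F n a) ≤ C := by
  have key : ∫⁻ a, (⨆ n, F n a) ^ p ∂μ = ⨆ n, ∫⁻ a, F n a ^ p ∂μ := by
    rw [← lintegral_iSup (fun n => (hF n).pow_const p)]
    · congr 1 with a
      exact (ENNReal.monotone_rpow_of_nonneg hp.le).map_iSup_of_continuousAt
        (ENNReal.continuous_rpow_const.continuousAt) (by simp [hp])
    · intro m n hmn a
      exact ENNReal.rpow_le_rpow (hmono hmn a) hp.le
  unfold lpn
  rw [key, one_div, ENNReal.rpow_inv_le_iff hp]
  refine iSup_le fun n => ?_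
  rw [← lpn_rpow hp]
  exact ENNReal.rpow_le_rpow (h n) hp.le

/-- Fatou's lemma for the `L^p` norm. -/
lemma lpn_liminf_le {p : ℝ} (hp : 0 < p) {F : ℕ → α → ℝ≥0∞} (hF : ∀ n, Measurable (F n))
    {G : α → ℝ≥0∞} (hG : ∀ᵐ a ∂μ, Tendsto (fun n => F n a) atTop (𝓝 (G a)))
    {C : ℝ≥0∞} (h : ∀ n, lpn p μ (F n) ≤ C) :
    lpn p μ G ≤ C := by
  unfold lpn
  rw [one_div, ENNReal.rpow_inv_le_iff hp]
  calc ∫⁻ a, G a ^ p ∂μ = ∫⁻ a, liminf (fun n => F n a ^ p) atTop ∂μ := by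
        apply lintegral_congr_ae
        filter_upwards [hG] with a ha
        exact (((ENNReal.continuous_rpow_const (y := p)).tendsto _).comp ha).liminf_eq.symm
    _ ≤ liminf (fun n => ∫⁻ a, F n a ^ p ∂μ) atTop :=
        lintegral_liminf_le (fun n => (hF n).pow_const p)
    _ ≤ C ^ p := by
        apply liminf_le_of_le (by isBoundedDefault)
        intro b hb
        obtain ⟨n, hn⟩ := hb.exists
        refine hn.trans ?_
        rw [← lpn_rpow hp]
        exact ENNReal.rpow_le_rpow (h n) hp.le

/-- Duality for the `L^p` norm: it suffices to test against bounded functions that vanish outside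
one of the sets of a finite-measure exhaustion. -/
lemma lpn_le_of_dual {p q : ℝ} (hpq : p.HolderConjugate q) {E : ℕ → Set α}
    (hE : ∀ n, MeasurableSet (E n)) (hEmono : Monotone E) (hEu : ⋃ n, E n = univ)
    (hEfin : ∀ n, μ (E n) ≠ ⊤) {F : α → ℝ≥0∞} (hF : Measurable F) {C : ℝ≥0∞}
    (h : ∀ (n : ℕ) (G : α → ℝ≥0∞), Measurable G → (∃ c : ℝ≥0∞, c ≠ ⊤ ∧ ∀ a, G a ≤ c) →
      (∀ a, a ∉ E n → G a = 0) → ∫⁻ a, F a * G a ∂μ ≤ C * lpn q μ G) :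
    lpn p μ F ≤ C := by
  -- truncated versions of `F`, whose norms are finite, so that one may divide by them; the test
  -- function is `Φ n ^ (p - 1)`
  set Φ : ℕ → α → ℝ≥0∞ := fun n => (E n).indicator (fun a => min (F a) n) with hΦ
  have hΦm : ∀ n, Measurable (Φ n) := fun n => (hF.min measurable_const).indicator (hE n)
  have hsup : (fun a => ⨆ n, Φ n a) = F := by
    funext a
    apply le_antisymm
    · refine iSup_le fun n => ?_
      refine (indicator_le_self' (fun _ _ => zero_le) a).trans (min_le_left _ _)
    · refine le_of_forall_lt fun c hc => ?_
      obtain ⟨m, hm⟩ := ENNReal.exists_nat_gt (ne_top_of_lt hc)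
      obtain ⟨k, hk⟩ : ∃ k, a ∈ E k := by
        have : a ∈ ⋃ n, E n := hEu ▸ mem_univ a
        simpa using this
      refine lt_of_lt_of_le ?_ (le_iSup (fun n => Φ n a) (max m k))
      simp only [hΦ, indicator_of_mem (hEmono (le_max_right m k) hk)]
      refine lt_min hc (hm.trans_le ?_)
      exact_mod_cast le_max_left m k
  have hmono : Monotone Φ := by
    intro m n hmn a
    refine indicator_le_indicator_of_subset (hEmono hmn) (fun _ => zero_le) a |>.trans ?_
    apply indicator_le_indicator
    refine min_le_min le_rfl ?_
    exact_mod_cast hmn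
  rw [← hsup]
  refine lpn_iSup_le hpq.pos hΦm hmono fun n => ?_
  have hfin : ∫⁻ a, Φ n a ^ p ∂μ ≠ ⊤ := by
    have : ∫⁻ a, Φ n a ^ p ∂μ ≤ ∫⁻ a, (E n).indicator (fun _ => (n : ℝ≥0∞) ^ p) a ∂μ := by
      apply lintegral_mono
      intro a
      simp only [hΦ]
      by_cases ha : a ∈ E n
      · simp only [indicator_of_mem ha]
        exact ENNReal.rpow_le_rpow (min_le_right _ _) hpq.nonneg
      · simp [indicator_of_notMem ha, hpq.pos]
    refine ne_top_of_le_ne_top ?_ this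
    rw [lintegral_indicator (hE n), setLIntegral_const]
    exact ENNReal.mul_ne_top (ENNReal.rpow_ne_top_of_nonneg hpq.nonneg (by simp)) (hEfin n)
  by_cases h0 : ∫⁻ a, Φ n a ^ p ∂μ = 0
  · rw [lpn, h0, ENNReal.zero_rpow_of_pos (by simpa using hpq.pos)]; exact zero_le
  have hpm : 0 < p - 1 := by linarith [hpq.lt]
  have key : ∫⁻ a, Φ n a ^ p ∂μ ≤ C * lpn q μ (fun a => Φ n a ^ (p - 1)) := by
    refine le_trans (lintegral_mono fun a => ?_) (h n (fun a => Φ n a ^ (p - 1))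
      ((hΦm n).pow_const _) ⟨(n : ℝ≥0∞) ^ (p - 1),
        ENNReal.rpow_ne_top_of_nonneg hpm.le (by simp), fun a => ?_⟩ fun a ha => ?_)
    · have : Φ n a ^ p = Φ n a * Φ n a ^ (p - 1) := by
        conv_lhs => rw [show p = 1 + (p - 1) by ring]
        rw [ENNReal.rpow_add_of_nonneg _ _ zero_le_one hpm.le, ENNReal.rpow_one]
      rw [this]
      gcongr
      exact (indicator_le_self' (fun _ _ => zero_le) a).trans (min_le_left _ _)
    · apply ENNReal.rpow_le_rpow _ hpm.le
      simp only [hΦ]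
      exact indicator_le (fun _ _ => min_le_right _ _) a
    · simp [hΦ, indicator_of_notMem ha, hpm]
  have hq : lpn q μ (fun a => Φ n a ^ (p - 1)) = (∫⁻ a, Φ n a ^ p ∂μ) ^ (1 / q) := by
    unfold lpn
    congr 2 with a
    rw [← ENNReal.rpow_mul, hpq.sub_one_mul_conj]
  rw [hq] at key
  have hsplit : ∫⁻ a, Φ n a ^ p ∂μ = lpn p μ (Φ n) * (∫⁻ a, Φ n a ^ p ∂μ) ^ (1 / q) := by
    unfold lpn
    rw [← ENNReal.rpow_add _ _ h0 hfin, one_div, one_div, hpq.inv_add_inv_eq_one, ENNReal.rpow_one]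
  replace key := hsplit.symm.trans_le key
  refine (ENNReal.mul_le_mul_iff_left ?_ ?_).1 key
  · exact (ENNReal.rpow_pos (pos_iff_ne_zero.2 h0) hfin).ne'
  · exact ENNReal.rpow_ne_top_of_nonneg (by have := hpq.symm.pos; positivity) hfin

/-- The exhaustion of a sigma-finite space used with `lpn_le_of_dual`. -/
lemma exists_exhaustion (μ : Measure α) [SigmaFinite μ] : ∃ E : ℕ → Set α,
    (∀ n, MeasurableSet (E n)) ∧ Monotone E ∧ ⋃ n, E n = univ ∧ ∀ n, μ (E n) ≠ ⊤ :=
  ⟨spanningSets μ, measurableSet_spanningSets μ, monotone_spanningSets μ, iUnion_spanningSets μ,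
    fun n => (measure_spanningSets_lt_top μ n).ne⟩

/-- **Minkowski's integral inequality.** -/
lemma lpn_lintegral_le [SigmaFinite μ] [SFinite ν] {p : ℝ} (hp : 1 ≤ p) {F : α → β → ℝ≥0∞}
    (hF : Measurable (Function.uncurry F)) :
    lpn p μ (fun x => ∫⁻ y, F x y ∂ν) ≤ ∫⁻ y, lpn p μ (fun x => F x y) ∂ν := by
  rcases hp.eq_or_lt with rfl | hp
  · simp only [lpn, ENNReal.rpow_one, one_div_one]
    rw [lintegral_lintegral_swap hF.aemeasurable]
  obtain ⟨E, h1, h2, h3, h4⟩ := exists_exhaustion μ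
  have hpq := Real.HolderConjugate.conjExponent hp
  refine lpn_le_of_dual hpq h1 h2 h3 h4 (hF.lintegral_prod_right') fun n G hG _ _ => ?_
  calc ∫⁻ x, (∫⁻ y, F x y ∂ν) * G x ∂μ = ∫⁻ x, ∫⁻ y, F x y * G x ∂ν ∂μ := by
        congr 1 with x
        rw [lintegral_mul_const _ (hF.of_uncurry_left)]
    _ = ∫⁻ y, ∫⁻ x, F x y * G x ∂μ ∂ν := by
        rw [lintegral_lintegral_swap]
        exact (hF.mul (hG.comp measurable_fst)).aemeasurable
    _ ≤ ∫⁻ y, lpn p μ (fun x => F x y) * lpn p.conjExponent μ G ∂ν := by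
        apply lintegral_mono
        intro y
        exact lintegral_mul_le_lpn hpq (hF.of_uncurry_right).aemeasurable hG.aemeasurable
    _ = _ := by
        rw [lintegral_mul_const]
        unfold lpn
        refine Measurable.pow_const ?_ _
        exact (hF.pow_const p).lintegral_prod_left'

lemma measurable_lpn [SFinite ν] {p : ℝ} {F : α × β → ℝ≥0∞} (hF : Measurable F) :
    Measurable (fun x => lpn p ν (fun y => F (x, y))) :=
  ((hF.pow_const p).lintegral_prod_right').pow_const _

/-- Fubini for mixed norms: the `L^p` norm of a function on a product space is the `L^p` norm of
the `L^p` norms of its slices. -/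
lemma lpn_prod [SFinite ν] {p : ℝ} (hp : 0 < p) {F : α × β → ℝ≥0∞} (hF : Measurable F) :
    lpn p (μ.prod ν) F = lpn p μ (fun x => lpn p ν (fun y => F (x, y))) := by
  unfold lpn
  rw [lintegral_prod _ (hF.pow_const p).aemeasurable]
  congr 2 with x
  rw [← ENNReal.rpow_mul, one_div_mul_cancel hp.ne', ENNReal.rpow_one]

lemma lpn_sum_le {p : ℝ} (hp : 1 ≤ p) {F : ℕ → α → ℝ≥0∞} (hF : ∀ n, Measurable (F n)) (N : ℕ) :
    lpn p μ (fun a => ∑ n ∈ Finset.range N, F n a) ≤ ∑ n ∈ Finset.range N, lpn p μ (F n) := by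
  have hp0 : 0 < p := by linarith
  induction N with
  | zero => simp [lpn, hp0]
  | succ N ih =>
    simp only [Finset.sum_range_succ]
    refine (lpn_add_le hp (Finset.measurable_fun_sum _ fun n _ => hF n).aemeasurable
      (hF N).aemeasurable).trans ?_
    gcongr

lemma lpn_tsum_le {p : ℝ} (hp : 1 ≤ p) {F : ℕ → α → ℝ≥0∞} (hF : ∀ n, Measurable (F n)) :
    lpn p μ (fun a => ∑' n, F n a) ≤ ∑' n, lpn p μ (F n) := by
  simp_rw [ENNReal.tsum_eq_iSup_nat]
  refine lpn_iSup_le (by linarith) (fun N => Finset.measurable_fun_sum _ fun n _ => hF n) ?_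
    fun N => ?_
  · intro m n hmn a
    exact Finset.sum_le_sum_of_subset (Finset.range_mono hmn)
  · exact (lpn_sum_le hp hF N).trans (le_iSup (fun N => ∑ n ∈ Finset.range N, lpn p μ (F n)) N)

/-- If a nonnegative kernel defines a bounded operator on `L²`, then the transposed kernel has the
same bound. -/
lemma lpn_two_transpose_le [SigmaFinite μ] [SigmaFinite ν] {L : α → β → ℝ≥0∞}
    (hL : Measurable (Function.uncurry L)) {C : ℝ≥0∞}
    (h : ∀ f : β → ℝ≥0∞, Measurable f →
      lpn 2 μ (fun x => ∫⁻ z, L x z * f z ∂ν) ≤ C * lpn 2 ν f)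
    {g : α → ℝ≥0∞} (hg : Measurable g) :
    lpn 2 ν (fun z => ∫⁻ x, L x z * g x ∂μ) ≤ C * lpn 2 μ g := by
  obtain ⟨E, h1, h2, h3, h4⟩ := exists_exhaustion ν
  have h22 : (2 : ℝ).HolderConjugate 2 := by
    rw [Real.holderConjugate_iff]; norm_num
  have hm : Measurable (Function.uncurry fun z x => L x z * g x) :=
    (hL.comp measurable_swap).mul (hg.comp measurable_snd)
  refine lpn_le_of_dual h22 h1 h2 h3 h4 hm.lintegral_prod_right' fun n G hG _ _ => ?_
  have e : ∫⁻ z, (∫⁻ x, L x z * g x ∂μ) * G z ∂ν = ∫⁻ x, g x * ∫⁻ z, L x z * G z ∂ν ∂μ := by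
    calc _ = ∫⁻ z, ∫⁻ x, L x z * g x * G z ∂μ ∂ν := by
          congr 1 with z
          rw [lintegral_mul_const _ (hm.of_uncurry_left)]
      _ = ∫⁻ x, ∫⁻ z, L x z * g x * G z ∂ν ∂μ := by
          rw [lintegral_lintegral_swap]
          exact (hm.mul (hG.comp measurable_fst)).aemeasurable
      _ = _ := by
          congr 1 with x
          rw [← lintegral_const_mul _ (by exact (hL.of_uncurry_left).mul hG)]
          congr 1 with z
          ring
  refine e.trans_le ?_
  refine (lintegral_mul_le_lpn h22 hg.aemeasurable ?_).trans ?_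
  · exact (Measurable.lintegral_prod_right' (f := fun w : α × β => L w.1 w.2 * G w.2)
      (hL.mul (hG.comp measurable_snd))).aemeasurable
  · calc _ ≤ lpn 2 μ g * (C * lpn 2 ν G) := by gcongr; exact h G hG
      _ = _ := by ring

end lpn

/-! ### Marcinkiewicz interpolation -/

section interpolation

lemma lintegral_Ioo_rpow {r a : ℝ} (hr : -1 < r) (ha : 0 ≤ a) :
    ∫⁻ s in Ioo 0 a, ENNReal.ofReal (s ^ r) = ENNReal.ofReal (a ^ (r + 1) / (r + 1)) := by
  have hi : IntegrableOn (fun s : ℝ => s ^ r) (Ioo 0 a) := by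
    rw [← integrableOn_Ioc_iff_integrableOn_Ioo, ← intervalIntegrable_iff_integrableOn_Ioc_of_le ha]
    exact intervalIntegral.intervalIntegrable_rpow' hr
  rw [← ofReal_integral_eq_lintegral_ofReal hi, ← integral_Ioc_eq_integral_Ioo,
    ← intervalIntegral.integral_of_le ha, integral_rpow (Or.inl hr), Real.zero_rpow (by linarith),
    sub_zero]
  filter_upwards [ae_restrict_mem measurableSet_Ioo] with s hs
  exact Real.rpow_nonneg hs.1.le _

lemma lintegral_Ioi_rpow {r a : ℝ} (hr : r < -1) (ha : 0 < a) :
    ∫⁻ s in Ioi a, ENNReal.ofReal (s ^ r) = ENNReal.ofReal (-a ^ (r + 1) / (r + 1)) := by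
  rw [← ofReal_integral_eq_lintegral_ofReal (integrableOn_Ioi_rpow_of_lt hr ha),
    integral_Ioi_rpow_of_lt hr ha]
  filter_upwards [ae_restrict_mem measurableSet_Ioi] with s hs
  exact Real.rpow_nonneg (ha.trans hs).le _

lemma lintegral_Ioi_rpow_eq_top {r : ℝ} (hr : -1 < r) :
    ∫⁻ s in Ioi (0 : ℝ), ENNReal.ofReal (s ^ r) = ⊤ := by
  refine ENNReal.eq_top_of_forall_nnreal_le fun c => ?_
  have hr1 : 0 < r + 1 := by linarith
  have := lintegral_Ioo_rpow (a := ((r + 1) * c) ^ (1 / (r + 1))) hr (by positivity)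
  rw [← Real.rpow_mul (by positivity), one_div_mul_cancel hr1.ne', Real.rpow_one,
    mul_div_cancel_left₀ _ hr1.ne', ENNReal.ofReal_coe_nnreal] at this
  rw [← this]
  exact lintegral_mono_set Ioo_subset_Ioi_self

/-- The layer-cake formula for a single value, including `y = ∞`; integrating it over a measure
space turns `L^p` norms into integrals of distribution functions. -/
lemma rpow_eq_lintegral_layer {p : ℝ} (hp : 0 < p) (y : ℝ≥0∞) :
    y ^ p = ENNReal.ofReal p *
      ∫⁻ s in Ioi (0 : ℝ), {s : ℝ | ENNReal.ofReal s < y}.indicator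
        (fun s => ENNReal.ofReal (s ^ (p - 1))) s := by
  have hm : MeasurableSet {s : ℝ | ENNReal.ofReal s < y} :=
    measurableSet_lt ENNReal.measurable_ofReal measurable_const
  rw [lintegral_indicator hm, Measure.restrict_restrict hm]
  rcases eq_or_ne y ⊤ with rfl | hy
  · have : {s : ℝ | ENNReal.ofReal s < ⊤} ∩ Ioi 0 = Ioi 0 := by ext s; simp
    rw [this, lintegral_Ioi_rpow_eq_top (by linarith), ENNReal.top_rpow_of_pos hp,
      ENNReal.mul_top (by simpa using hp)]
  · have : {s : ℝ | ENNReal.ofReal s < y} ∩ Ioi 0 = Ioo 0 y.toReal := by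
      ext s
      simp only [mem_inter_iff, mem_ofPred_eq, mem_Ioi, mem_Ioo]
      constructor
      · rintro ⟨h1, h2⟩
        exact ⟨h2, (ENNReal.ofReal_lt_iff_lt_toReal h2.le hy).1 h1⟩
      · rintro ⟨h1, h2⟩
        exact ⟨(ENNReal.ofReal_lt_iff_lt_toReal h1.le hy).2 h2, h1⟩
    rw [this, lintegral_Ioo_rpow (by linarith) ENNReal.toReal_nonneg, sub_add_cancel,
      ← ENNReal.ofReal_mul hp.le, mul_div_cancel₀ _ hp.ne',
      ← ENNReal.ofReal_rpow_of_nonneg ENNReal.toReal_nonneg hp.le, ENNReal.ofReal_toReal hy]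

variable {α β : Type*} [MeasurableSpace α] [MeasurableSpace β] {μ : Measure α} {ν : Measure β}

/-- **Marcinkiewicz interpolation**, as a statement on distribution functions. If the set
`{F > s}` is controlled by the `p₀`-mass of `f` above the height `c s` and by the `p₁`-mass of `f`
below it, then `‖F‖_p` is controlled by `‖f‖_p` for `p₀ < p < p₁`. The free parameter `c` serves to
balance the two constants `A₀` and `A₁`. -/
lemma lintegral_rpow_le_of_distribution [SFinite μ] [SFinite ν] {p₀ p p₁ : ℝ} (h0 : 0 < p₀)
    (h01 : p₀ < p) (h11 : p < p₁) {f : α → NNReal} (hf : Measurable f) {F : β → ℝ≥0∞}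
    (hF : Measurable F) {A₀ A₁ : ℝ≥0∞} {c : ℝ} (hc : 0 < c)
    (h : ∀ s : ℝ, 0 < s → ν {x | ENNReal.ofReal s < F x} ≤
      A₀ * ENNReal.ofReal (s ^ (-p₀)) *
        ∫⁻ a, {a | c * s < f a}.indicator (fun a => (f a : ℝ≥0∞) ^ p₀) a ∂μ +
      A₁ * ENNReal.ofReal (s ^ (-p₁)) *
        ∫⁻ a, {a | (f a : ℝ) ≤ c * s}.indicator (fun a => (f a : ℝ≥0∞) ^ p₁) a ∂μ) :
    ∫⁻ x, F x ^ p ∂ν ≤ (A₀ * ENNReal.ofReal (p / (p - p₀) * c ^ (p₀ - p)) +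
      A₁ * ENNReal.ofReal (p / (p₁ - p) * c ^ (p₁ - p))) * ∫⁻ a, (f a : ℝ≥0∞) ^ p ∂μ := by
  have hp : 0 < p := h0.trans h01
  have mf : Measurable fun q : ℝ × α => ((f q.2 : NNReal) : ℝ) := by fun_prop
  have ms0 : MeasurableSet {q : ℝ × α | c * q.1 < f q.2} :=
    measurableSet_lt (by fun_prop) mf
  have ms1 : MeasurableSet {q : ℝ × α | (f q.2 : ℝ) ≤ c * q.1} :=
    measurableSet_le mf (by fun_prop)
  have mF : MeasurableSet {q : β × ℝ | ENNReal.ofReal q.2 < F q.1} :=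
    measurableSet_lt (by fun_prop) (by fun_prop)
  -- Tonelli: both sides are integrals over the level `s`
  have e1 : ∫⁻ x, F x ^ p ∂ν = ENNReal.ofReal p *
      ∫⁻ s in Ioi (0 : ℝ), ENNReal.ofReal (s ^ (p - 1)) * ν {x | ENNReal.ofReal s < F x} := by
    have mm : Measurable (Function.uncurry fun (x : β) (s : ℝ) =>
        {s : ℝ | ENNReal.ofReal s < F x}.indicator (fun s => ENNReal.ofReal (s ^ (p - 1))) s) := by
      have : (Function.uncurry fun (x : β) (s : ℝ) =>
          {s : ℝ | ENNReal.ofReal s < F x}.indicator (fun s => ENNReal.ofReal (s ^ (p - 1))) s)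
          = {q : β × ℝ | ENNReal.ofReal q.2 < F q.1}.indicator
            (fun q => ENNReal.ofReal (q.2 ^ (p - 1))) := by
        ext ⟨x, s⟩; simp [indicator]
      rw [this]
      exact Measurable.indicator (by fun_prop) mF
    rw [lintegral_congr fun x => rpow_eq_lintegral_layer hp (F x)]
    rw [lintegral_const_mul _ (by exact mm.lintegral_prod_right'),
      lintegral_lintegral_swap mm.aemeasurable]
    congr 1
    apply lintegral_congr fun s => ?_
    have hmx : MeasurableSet {x | ENNReal.ofReal s < F x} := measurableSet_lt measurable_const hF
    rw [← setLIntegral_const, ← lintegral_indicator hmx]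
    rfl
  have swap0 : ∀ (r q : ℝ), 0 ≤ q → ∫⁻ s in Ioi (0 : ℝ), ENNReal.ofReal (s ^ r) *
      ∫⁻ a, {a | c * s < f a}.indicator (fun a => (f a : ℝ≥0∞) ^ q) a ∂μ
      = ∫⁻ a, (f a : ℝ≥0∞) ^ q * (∫⁻ s in Ioo 0 ((f a : ℝ) / c), ENNReal.ofReal (s ^ r)) ∂μ := by
    intro r q hq
    have mm : Measurable (fun q' : ℝ × α => {q : ℝ × α | c * q.1 < f q.2}.indicator
        (fun q' => ENNReal.ofReal (q'.1 ^ r) * (f q'.2 : ℝ≥0∞) ^ q) q') :=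
      Measurable.indicator (by fun_prop) ms0
    calc _ = ∫⁻ s in Ioi (0 : ℝ), (∫⁻ a, ({q : ℝ × α | c * q.1 < f q.2}.indicator
        (fun q' => ENNReal.ofReal (q'.1 ^ r) * (f q'.2 : ℝ≥0∞) ^ q) (s, a)) ∂μ) := by
          apply lintegral_congr fun s => ?_
          rw [← lintegral_const_mul]
          · apply lintegral_congr fun a => ?_
            simp only [indicator, mem_ofPred_eq]
            split_ifs <;> simp
          · exact Measurable.indicator (by fun_prop) (measurableSet_lt (by fun_prop) (by fun_prop))
      _ = ∫⁻ a, (∫⁻ s in Ioi (0 : ℝ), {q : ℝ × α | c * q.1 < f q.2}.indicator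
        (fun q' => ENNReal.ofReal (q'.1 ^ r) * (f q'.2 : ℝ≥0∞) ^ q) (s, a)) ∂μ := by
          rw [lintegral_lintegral_swap]
          exact mm.aemeasurable
      _ = _ := by
          apply lintegral_congr fun a => ?_
          rw [← lintegral_const_mul' _ _ (ENNReal.rpow_ne_top_of_nonneg hq (by simp)),
            ← lintegral_indicator measurableSet_Ioi, ← lintegral_indicator measurableSet_Ioo]
          apply lintegral_congr fun s => ?_
          simp only [indicator, mem_ofPred_eq, mem_Ioi, mem_Ioo, lt_div_iff₀ hc, mul_comm c s]
          by_cases h1 : 0 < s <;> by_cases h2 : s * c < f a <;> simp [h1, mul_comm]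
  have swap1 : ∀ (r q : ℝ), 0 ≤ q → ∫⁻ s in Ioi (0 : ℝ), ENNReal.ofReal (s ^ r) *
      ∫⁻ a, {a | (f a : ℝ) ≤ c * s}.indicator (fun a => (f a : ℝ≥0∞) ^ q) a ∂μ
      = ∫⁻ a, (f a : ℝ≥0∞) ^ q *
        (∫⁻ s in Ioi (0 : ℝ) ∩ Ici ((f a : ℝ) / c), ENNReal.ofReal (s ^ r)) ∂μ := by
    intro r q hq
    have mm : Measurable (fun q' : ℝ × α => {q : ℝ × α | (f q.2 : ℝ) ≤ c * q.1}.indicator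
        (fun q' => ENNReal.ofReal (q'.1 ^ r) * (f q'.2 : ℝ≥0∞) ^ q) q') :=
      Measurable.indicator (by fun_prop) ms1
    calc _ = ∫⁻ s in Ioi (0 : ℝ), (∫⁻ a, ({q : ℝ × α | (f q.2 : ℝ) ≤ c * q.1}.indicator
        (fun q' => ENNReal.ofReal (q'.1 ^ r) * (f q'.2 : ℝ≥0∞) ^ q) (s, a)) ∂μ) := by
          apply lintegral_congr fun s => ?_
          rw [← lintegral_const_mul]
          · apply lintegral_congr fun a => ?_
            simp only [indicator, mem_ofPred_eq]
            split_ifs <;> simp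
          · exact Measurable.indicator (by fun_prop) (measurableSet_le (by fun_prop) (by fun_prop))
      _ = ∫⁻ a, (∫⁻ s in Ioi (0 : ℝ), {q : ℝ × α | (f q.2 : ℝ) ≤ c * q.1}.indicator
        (fun q' => ENNReal.ofReal (q'.1 ^ r) * (f q'.2 : ℝ≥0∞) ^ q) (s, a)) ∂μ := by
          rw [lintegral_lintegral_swap]
          exact mm.aemeasurable
      _ = _ := by
          apply lintegral_congr fun a => ?_
          rw [← lintegral_const_mul' _ _ (ENNReal.rpow_ne_top_of_nonneg hq (by simp)),
            ← lintegral_indicator measurableSet_Ioi,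
            ← lintegral_indicator (measurableSet_Ioi.inter measurableSet_Ici)]
          apply lintegral_congr fun s => ?_
          simp only [indicator, mem_ofPred_eq, mem_Ioi, mem_inter_iff, mem_Ici, div_le_iff₀ hc,
            mul_comm c s]
          by_cases h1 : 0 < s <;> by_cases h2 : f a ≤ s * c <;> simp [h1, mul_comm]
  have I0 : ∀ a, (f a : ℝ≥0∞) ^ p₀ *
      ∫⁻ s in Ioo 0 ((f a : ℝ) / c), ENNReal.ofReal (s ^ (p - 1 - p₀)) ≤
      ENNReal.ofReal (1 / (p - p₀) * c ^ (p₀ - p)) * (f a : ℝ≥0∞) ^ p := by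
    intro a
    rw [lintegral_Ioo_rpow (by linarith) (by positivity)]
    rw [← ENNReal.ofReal_coe_nnreal, ENNReal.ofReal_rpow_of_nonneg (by positivity) h0.le,
      ENNReal.ofReal_rpow_of_nonneg (by positivity) hp.le, ← ENNReal.ofReal_mul (by positivity),
      ← ENNReal.ofReal_mul (by have := sub_pos.2 h01; positivity)]
    apply ENNReal.ofReal_le_ofReal
    apply le_of_eq
    rw [show p - 1 - p₀ + 1 = p - p₀ by ring, Real.div_rpow (by positivity) hc.le,
      show p₀ - p = -(p - p₀) by ring, Real.rpow_neg hc.le]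
    have : (f a : ℝ) ^ p = (f a : ℝ) ^ p₀ * (f a : ℝ) ^ (p - p₀) := by
      rw [← Real.rpow_add_of_nonneg (by positivity) h0.le (by linarith)]; congr 1; ring
    rw [this]; ring
  have I1 : ∀ a, (f a : ℝ≥0∞) ^ p₁ *
      ∫⁻ s in Ioi (0 : ℝ) ∩ Ici ((f a : ℝ) / c), ENNReal.ofReal (s ^ (p - 1 - p₁)) ≤
      ENNReal.ofReal (1 / (p₁ - p) * c ^ (p₁ - p)) * (f a : ℝ≥0∞) ^ p := by
    intro a
    rcases eq_or_lt_of_le (show (0 : ℝ) ≤ f a from (f a).2) with h | hfa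
    · have : f a = 0 := by exact_mod_cast h.symm
      rw [this]; simp [ENNReal.zero_rpow_of_pos (h0.trans (h01.trans h11))]
    have hd : 0 < (f a : ℝ) / c := by positivity
    have hs : Ioi (0 : ℝ) ∩ Ici ((f a : ℝ) / c) = Ici ((f a : ℝ) / c) := by
      apply inter_eq_right.2; intro s hs; exact hd.trans_le hs
    rw [hs, ← restrict_Ioi_eq_restrict_Ici, lintegral_Ioi_rpow (by linarith) hd]
    rw [← ENNReal.ofReal_coe_nnreal, ENNReal.ofReal_rpow_of_pos hfa,
      ENNReal.ofReal_rpow_of_pos hfa, ← ENNReal.ofReal_mul (by positivity),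
      ← ENNReal.ofReal_mul (by have := sub_pos.2 h11; positivity)]
    apply ENNReal.ofReal_le_ofReal
    apply le_of_eq
    rw [show p - 1 - p₁ + 1 = -(p₁ - p) by ring, Real.rpow_neg hd.le, neg_div_neg_eq,
      Real.div_rpow (by positivity) hc.le]
    have : (f a : ℝ) ^ p₁ = (f a : ℝ) ^ p * (f a : ℝ) ^ (p₁ - p) := by
      rw [← Real.rpow_add hfa]; congr 1; ring
    rw [this]
    have h1 := (Real.rpow_pos_of_pos hfa (p₁ - p)).ne'
    have h2 := (Real.rpow_pos_of_pos hc (p₁ - p)).ne'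
    field_simp
  have m0 : ∀ q : ℝ, Measurable fun s : ℝ =>
      ∫⁻ a, {a | c * s < f a}.indicator (fun a => (f a : ℝ≥0∞) ^ q) a ∂μ := by
    intro q
    exact Measurable.lintegral_prod_right' (f := {q : ℝ × α | c * q.1 < f q.2}.indicator
        (fun q' => (f q'.2 : ℝ≥0∞) ^ q)) (Measurable.indicator (by fun_prop) ms0)
  have m1 : ∀ q : ℝ, Measurable fun s : ℝ =>
      ∫⁻ a, {a | (f a : ℝ) ≤ c * s}.indicator (fun a => (f a : ℝ≥0∞) ^ q) a ∂μ := by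
    intro q
    exact Measurable.lintegral_prod_right' (f := {q : ℝ × α | (f q.2 : ℝ) ≤ c * q.1}.indicator
        (fun q' => (f q'.2 : ℝ≥0∞) ^ q)) (Measurable.indicator (by fun_prop) ms1)
  have mr : ∀ r : ℝ, Measurable fun s : ℝ => ENNReal.ofReal (s ^ r) := fun r => by fun_prop
  have hp0' : 0 < p - p₀ := sub_pos.2 h01
  have hp1' : 0 < p₁ - p := sub_pos.2 h11
  calc ∫⁻ x, F x ^ p ∂ν
      ≤ ENNReal.ofReal p * ∫⁻ s in Ioi (0 : ℝ), (A₀ * (ENNReal.ofReal (s ^ (p - 1 - p₀)) *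
        ∫⁻ a, {a | c * s < f a}.indicator (fun a => (f a : ℝ≥0∞) ^ p₀) a ∂μ) +
        A₁ * (ENNReal.ofReal (s ^ (p - 1 - p₁)) *
        ∫⁻ a, {a | (f a : ℝ) ≤ c * s}.indicator (fun a => (f a : ℝ≥0∞) ^ p₁) a ∂μ)) := by
        rw [e1]
        gcongr 1
        refine setLIntegral_mono' measurableSet_Ioi fun s hs => ?_
        have hs : 0 < s := hs
        refine (mul_le_mul_right (h s hs) _).trans (le_of_eq ?_)
        have hx : ∀ q : ℝ, ENNReal.ofReal (s ^ (p - 1 - q)) =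
            ENNReal.ofReal (s ^ (p - 1)) * ENNReal.ofReal (s ^ (-q)) := by
          intro q
          rw [← ENNReal.ofReal_mul (by positivity), ← Real.rpow_add hs]; rfl
        rw [hx, hx]; ring
    _ = ENNReal.ofReal p * (A₀ * ∫⁻ a, (f a : ℝ≥0∞) ^ p₀ *
          (∫⁻ s in Ioo 0 ((f a : ℝ) / c), ENNReal.ofReal (s ^ (p - 1 - p₀))) ∂μ +
        A₁ * ∫⁻ a, (f a : ℝ≥0∞) ^ p₁ *
          (∫⁻ s in Ioi (0 : ℝ) ∩ Ici ((f a : ℝ) / c), ENNReal.ofReal (s ^ (p - 1 - p₁))) ∂μ) := by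
        rw [lintegral_add_left (by exact ((mr _).mul (m0 _)).const_mul _),
          lintegral_const_mul _ (by exact (mr _).mul (m0 _)),
          lintegral_const_mul _ (by exact (mr _).mul (m1 _)),
          swap0 _ _ h0.le, swap1 _ _ (by linarith)]
    _ ≤ ENNReal.ofReal p * (A₀ * ∫⁻ a, ENNReal.ofReal (1 / (p - p₀) * c ^ (p₀ - p)) *
          (f a : ℝ≥0∞) ^ p ∂μ +
        A₁ * ∫⁻ a, ENNReal.ofReal (1 / (p₁ - p) * c ^ (p₁ - p)) * (f a : ℝ≥0∞) ^ p ∂μ) := by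
        exact mul_le_mul_right (add_le_add (mul_le_mul_right (lintegral_mono I0) _)
          (mul_le_mul_right (lintegral_mono I1) _)) _
    _ = _ := by
        rw [lintegral_const_mul' _ _ (by simp), lintegral_const_mul' _ _ (by simp)]
        have : ∀ x y : ℝ, 0 < y → ENNReal.ofReal (p / y * x) =
            ENNReal.ofReal p * ENNReal.ofReal (1 / y * x) := by
          intro x y hy
          rw [← ENNReal.ofReal_mul hp.le]; congr 1; ring
        rw [this _ _ hp0', this _ _ hp1']
        ring

end interpolation

/-! ### The Hardy–Littlewood maximal function -/

section maximal

/-- The centred Hardy–Littlewood maximal function on the line, up to a factor: the supremum is taken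
over dyadic radii only (so that measurability is immediate), and integrals over intervals of radius
`2 ^ k` are divided by `2 ^ k`. -/
noncomputable def hlMax (f : ℝ → ℝ≥0∞) (x : ℝ) : ℝ≥0∞ :=
  ⨆ k : ℤ, ENNReal.ofReal ((2 : ℝ) ^ (-k)) * ∫⁻ y in Metric.closedBall x ((2 : ℝ) ^ k), f y

lemma measurable_lintegral_closedBall {f : ℝ → ℝ≥0∞} (hf : Measurable f) (r : ℝ) :
    Measurable fun x => ∫⁻ y in Metric.closedBall x r, f y := by
  have hm : MeasurableSet {q : ℝ × ℝ | dist q.2 q.1 ≤ r} :=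
    measurableSet_le (by fun_prop) measurable_const
  have : Measurable fun x : ℝ => ∫⁻ y, {q : ℝ × ℝ | dist q.2 q.1 ≤ r}.indicator
      (fun q => f q.2) (x, y) :=
    Measurable.lintegral_prod_right' ((hf.comp measurable_snd).indicator hm)
  convert this using 2 with x
  rw [← lintegral_indicator Metric.isClosed_closedBall.measurableSet]
  rfl

lemma measurable_hlMax {f : ℝ → ℝ≥0∞} (hf : Measurable f) : Measurable (hlMax f) :=
  Measurable.iSup fun _ => (measurable_lintegral_closedBall hf _).const_mul _

lemma hlMax_mono {f g : ℝ → ℝ≥0∞} (h : ∀ x, f x ≤ g x) (x : ℝ) : hlMax f x ≤ hlMax g x := by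
  unfold hlMax
  gcongr
  exact h _

lemma hlMax_congr {f g : ℝ → ℝ≥0∞} (h : f =ᵐ[volume] g) (x : ℝ) : hlMax f x = hlMax g x := by
  unfold hlMax
  congr 1 with k
  congr 1
  exact lintegral_congr_ae (ae_restrict_of_ae h)

lemma hlMax_add {f g : ℝ → ℝ≥0∞} (hf : Measurable f) (x : ℝ) :
    hlMax (fun y => f y + g y) x ≤ hlMax f x + hlMax g x := by
  refine iSup_le fun k => ?_
  rw [lintegral_add_left hf, mul_add]
  gcongr
  · exact le_iSup (fun k : ℤ => ENNReal.ofReal ((2 : ℝ) ^ (-k)) *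
      ∫⁻ y in Metric.closedBall x ((2 : ℝ) ^ k), f y) k
  · exact le_iSup (fun k : ℤ => ENNReal.ofReal ((2 : ℝ) ^ (-k)) *
      ∫⁻ y in Metric.closedBall x ((2 : ℝ) ^ k), g y) k

lemma hlMax_le_of_le {f : ℝ → ℝ≥0∞} {c : ℝ≥0∞} (h : ∀ x, f x ≤ c) (x : ℝ) :
    hlMax f x ≤ 2 * c := by
  refine iSup_le fun k => ?_
  calc _ ≤ ENNReal.ofReal ((2 : ℝ) ^ (-k)) * ∫⁻ y in Metric.closedBall x ((2 : ℝ) ^ k), c := by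
        gcongr; exact h _
    _ = _ := by
        rw [setLIntegral_const, Real.volume_closedBall, mul_comm c, ← mul_assoc,
          ← ENNReal.ofReal_mul (by positivity)]
        congr 1
        rw [show (2 : ℝ) ^ (-k) * (2 * 2 ^ k) = 2 * (2 ^ (-k) * 2 ^ k) by ring, ← zpow_add₀ two_ne_zero]
        simp

lemma lintegral_closedBall_le_hlMax (f : ℝ → ℝ≥0∞) (x : ℝ) {r : ℝ} (hr : 0 < r) :
    ∫⁻ y in Metric.closedBall x r, f y ≤ ENNReal.ofReal (2 * r) * hlMax f x := by
  obtain ⟨k, hk1, hk2⟩ := exists_mem_Ioc_zpow hr (one_lt_two : (1 : ℝ) < 2)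
  have h1 : ∫⁻ y in Metric.closedBall x r, f y ≤
      ∫⁻ y in Metric.closedBall x ((2 : ℝ) ^ (k + 1)), f y :=
    lintegral_mono_set (Metric.closedBall_subset_closedBall hk2)
  have h2 : ENNReal.ofReal ((2 : ℝ) ^ (k + 1)) * (ENNReal.ofReal ((2 : ℝ) ^ (-(k + 1))) *
      ∫⁻ y in Metric.closedBall x ((2 : ℝ) ^ (k + 1)), f y) =
      ∫⁻ y in Metric.closedBall x ((2 : ℝ) ^ (k + 1)), f y := by
    rw [← mul_assoc, ← ENNReal.ofReal_mul (by positivity), ← zpow_add₀ two_ne_zero]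
    simp
  refine h1.trans (h2.symm.trans_le ?_)
  gcongr
  · rw [zpow_add_one₀ two_ne_zero]; linarith
  · exact le_iSup (fun k : ℤ => ENNReal.ofReal ((2 : ℝ) ^ (-k)) *
      ∫⁻ y in Metric.closedBall x ((2 : ℝ) ^ k), f y) (k + 1)

/-- The weak type `(1, 1)` bound for the maximal function. -/
lemma volume_hlMax_gt_le {f : ℝ → ℝ≥0∞} {s : ℝ} (hs : 0 < s) :
    volume {x | ENNReal.ofReal s < hlMax f x} ≤ 10 * ENNReal.ofReal (s ^ (-1 : ℝ)) * ∫⁻ y, f y := by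
  rcases eq_or_ne (∫⁻ y, f y) ⊤ with hI | hI
  · rw [hI, ENNReal.mul_top]
    · exact le_top
    · have : (0 : ℝ) < s ^ (-1 : ℝ) := by positivity
      simp [this]
  -- a ball `B(x, r)` on which the average of `f` is large; the radii are bounded because `f` is
  -- integrable, so Vitali's covering lemma applies
  have hsel : ∀ x ∈ {x | ENNReal.ofReal s < hlMax f x}, ∃ r : ℝ, 0 < r ∧
      ENNReal.ofReal (s * r) < ∫⁻ y in Metric.closedBall x r, f y := by
    intro x hx
    have hx' : ENNReal.ofReal s < hlMax f x := hx
    obtain ⟨k, hk⟩ := lt_iSup_iff.1 (by unfold hlMax at hx'; exact hx')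
    refine ⟨2 ^ k, by positivity, ?_⟩
    have h2 : ENNReal.ofReal ((2 : ℝ) ^ k) * (ENNReal.ofReal ((2 : ℝ) ^ (-k)) *
      ∫⁻ y in Metric.closedBall x ((2 : ℝ) ^ k), f y) =
      ∫⁻ y in Metric.closedBall x ((2 : ℝ) ^ k), f y := by
      rw [← mul_assoc, ← ENNReal.ofReal_mul (by positivity), ← zpow_add₀ two_ne_zero]
      simp
    rw [← h2, mul_comm s, ENNReal.ofReal_mul (by positivity)]
    exact (ENNReal.mul_lt_mul_iff_right (by simp; positivity) (by simp)).2 hk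
  choose! r hr0 hr using hsel
  set S := {x | ENNReal.ofReal s < hlMax f x}
  have hbound : ∀ x ∈ S, r x ≤ (∫⁻ y, f y).toReal / s := by
    intro x hx
    rw [le_div_iff₀ hs, mul_comm]
    have := (hr x hx).le.trans (setLIntegral_le_lintegral _ _)
    exact (ENNReal.ofReal_le_iff_le_toReal hI).1 this
  obtain ⟨u, huS, hdisj, hcov⟩ := Vitali.exists_disjoint_subfamily_covering_enlargement_closedBall
    S id r _ hbound 5 (by norm_num)
  simp only [id] at hdisj hcov
  have hcount : u.Countable := by
    refine hdisj.countable_of_nonempty_interior fun x hx => ?_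
    exact ⟨x, Metric.ball_subset_interior_closedBall (Metric.mem_ball_self (hr0 x (huS hx)))⟩
  have hsub : S ⊆ ⋃ x ∈ u, Metric.closedBall x (5 * r x) := by
    intro x hx
    obtain ⟨b, hb, h⟩ := hcov x hx
    exact mem_biUnion hb (h (Metric.mem_closedBall_self (hr0 x hx).le))
  have hb : ∀ x : u, volume (Metric.closedBall (x : ℝ) (5 * r x)) ≤
      10 * ENNReal.ofReal (s ^ (-1 : ℝ)) * ∫⁻ y in Metric.closedBall (x : ℝ) (r x), f y := by
    intro x
    have h1 := (hr x (huS x.2)).le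
    have h0 := hr0 x (huS x.2)
    calc volume (Metric.closedBall (x : ℝ) (5 * r x)) =
        10 * ENNReal.ofReal (s ^ (-1 : ℝ)) * ENNReal.ofReal (s * r x) := by
          rw [Real.volume_closedBall, mul_assoc, ← ENNReal.ofReal_mul (by positivity),
            Real.rpow_neg_one, inv_mul_cancel_left₀ hs.ne',
            show (10 : ℝ≥0∞) = ENNReal.ofReal 10 by norm_num, ← ENNReal.ofReal_mul (by norm_num)]
          congr 1; ring
      _ ≤ _ := by gcongr
  have := hcount.to_subtype
  calc volume S ≤ volume (⋃ x ∈ u, Metric.closedBall x (5 * r x)) := measure_mono hsub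
    _ ≤ ∑' x : u, volume (Metric.closedBall (x : ℝ) (5 * r x)) := measure_biUnion_le _ hcount _
    _ ≤ ∑' x : u, 10 * ENNReal.ofReal (s ^ (-1 : ℝ)) *
        ∫⁻ y in Metric.closedBall (x : ℝ) (r x), f y := ENNReal.tsum_le_tsum hb
    _ = 10 * ENNReal.ofReal (s ^ (-1 : ℝ)) *
        ∫⁻ y in ⋃ x ∈ u, Metric.closedBall (x : ℝ) (r x), f y := by
        rw [ENNReal.tsum_mul_left, lintegral_biUnion hcount
          (fun x _ => Metric.isClosed_closedBall.measurableSet) hdisj]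
    _ ≤ _ := by gcongr; exact Measure.restrict_le_self

/-- The constant in the `L^p` bound for the maximal function. -/
noncomputable def hlConst (p : ℝ) : ℝ≥0∞ :=
  (20 * ENNReal.ofReal (p / (p - 1) * (1 / 4 : ℝ) ^ (1 - p))) ^ (1 / p)

lemma hlConst_ne_top {p : ℝ} (hp : 1 < p) : hlConst p ≠ ⊤ :=
  ENNReal.rpow_ne_top_of_nonneg (by positivity)
    (ENNReal.mul_ne_top (by norm_num) ENNReal.ofReal_ne_top)

/-- The **Hardy–Littlewood maximal theorem** on the line. -/
lemma lpn_hlMax_le {p : ℝ} (hp : 1 < p) {f : ℝ → ℝ≥0∞} (hf : Measurable f) :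
    lpn p volume (hlMax f) ≤ hlConst p * lpn p volume f := by
  have hp0 : 0 < p := by linarith
  rcases eq_or_ne (∫⁻ y, f y ^ p) ⊤ with hI | hI
  · have h1 : lpn p volume f = ⊤ := by
      rw [lpn, hI, ENNReal.top_rpow_of_pos (by positivity)]
    rw [h1, ENNReal.mul_top]
    · exact le_top
    · have h2 : 0 < p / (p - 1) * (1 / 4 : ℝ) ^ (1 - p) := by
        have : 0 < p - 1 := by linarith
        positivity
      have h3 : (0 : ℝ≥0∞) < 20 * ENNReal.ofReal (p / (p - 1) * (1 / 4 : ℝ) ^ (1 - p)) :=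
        ENNReal.mul_pos (by norm_num) (by simpa using h2)
      exact (ENNReal.rpow_pos h3 (ENNReal.mul_ne_top (by norm_num) ENNReal.ofReal_ne_top)).ne'
  have hfin : ∀ᵐ y, f y ≠ ⊤ := by
    filter_upwards [ae_lt_top (hf.pow_const p) hI] with y hy h
    rw [h, ENNReal.top_rpow_of_pos hp0] at hy
    exact lt_irrefl _ hy
  set g : ℝ → NNReal := fun y => (f y).toNNReal
  have hg : Measurable g := hf.ennreal_toNNReal
  have hfg : f =ᵐ[volume] fun y => (g y : ℝ≥0∞) := by
    filter_upwards [hfin] with y hy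
    exact (ENNReal.coe_toNNReal hy).symm
  have e1 : hlMax f = hlMax fun y => (g y : ℝ≥0∞) := funext fun x => hlMax_congr hfg x
  rw [e1, lpn_congr hfg]
  have key := lintegral_rpow_le_of_distribution (μ := volume) (ν := volume) (p₀ := 1) (p := p)
    (p₁ := p + 1) (f := g) (F := hlMax fun y => (g y : ℝ≥0∞)) (A₀ := 20) (A₁ := 0) (c := 1 / 4)
    one_pos hp (by linarith) hg (measurable_hlMax hg.coe_nnreal_ennreal) (by norm_num) ?_
  · rw [zero_mul, add_zero] at key
    unfold lpn hlConst
    rw [← ENNReal.mul_rpow_of_nonneg _ _ (by positivity)]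
    exact ENNReal.rpow_le_rpow key (by positivity)
  · intro s hs
    have ms : MeasurableSet {a : ℝ | 1 / 4 * s < g a} := measurableSet_lt (by fun_prop) (by fun_prop)
    -- the part of `g` below the height `s / 4` contributes at most `s / 2`
    have hsub : {x | ENNReal.ofReal s < hlMax (fun y => (g y : ℝ≥0∞)) x} ⊆
        {x | ENNReal.ofReal (s / 2) < hlMax ({a : ℝ | 1 / 4 * s < g a}.indicator
          fun y => (g y : ℝ≥0∞)) x} := by
      intro x hx
      simp only [mem_ofPred_eq] at hx ⊢
      by_contra hcon
      push Not at hcon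
      refine absurd hx (not_lt.2 ?_)
      have h1 : hlMax (fun y => (g y : ℝ≥0∞)) x ≤
          hlMax (fun y => ({a : ℝ | 1 / 4 * s < g a}.indicator
            (fun y => (g y : ℝ≥0∞))) y + ENNReal.ofReal (s / 4)) x := by
        apply hlMax_mono
        intro y
        by_cases hy : 1 / 4 * s < g y
        · rw [indicator_of_mem (by exact hy)]; exact le_self_add
        · refine le_add_left ?_
          rw [← ENNReal.ofReal_coe_nnreal]
          apply ENNReal.ofReal_le_ofReal
          push Not at hy; linarith
      refine h1.trans ((hlMax_add (hg.coe_nnreal_ennreal.indicator ms) x).trans ?_)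
      refine (add_le_add hcon (hlMax_le_of_le (fun _ => le_rfl) x)).trans (le_of_eq ?_)
      rw [show (2 : ℝ≥0∞) = ENNReal.ofReal 2 by norm_num, ← ENNReal.ofReal_mul (by norm_num),
        ← ENNReal.ofReal_add (by positivity) (by positivity)]
      congr 1; ring
    refine (measure_mono hsub).trans ((volume_hlMax_gt_le (by positivity)).trans ?_)
    rw [zero_mul, zero_mul, add_zero]
    simp only [ENNReal.rpow_one]
    apply mul_le_mul_left
    rw [Real.rpow_neg_one, Real.rpow_neg_one, show (20 : ℝ≥0∞) = 10 * ENNReal.ofReal 2 by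
      norm_num, mul_assoc, ← ENNReal.ofReal_mul (by norm_num)]
    apply le_of_eq
    congr 2
    field_simp

end maximal

/-! ### Radial majorants -/

section majorant

/-- A radially decreasing majorant of `min (1 / ε) (ε / a ^ 2)`, written as a superposition of
indicators of intervals with dyadic radii. -/
noncomputable def bumpMajorant (ε a : ℝ) : ℝ≥0∞ :=
  ∑' k : ℕ, ENNReal.ofReal (ε⁻¹ * (1 / 4) ^ k) *
    (Metric.closedBall (0 : ℝ) (2 ^ (k + 1) * ε)).indicator (fun _ => 1) a

lemma measurable_bumpMajorant (ε : ℝ) : Measurable (bumpMajorant ε) :=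
  Measurable.tsum fun _ =>
    (measurable_const.indicator Metric.isClosed_closedBall.measurableSet).const_mul _

lemma le_bumpMajorant_of_le {ε a : ℝ} (hε : 0 < ε) (ha : |a| ≤ ε) :
    ENNReal.ofReal ε⁻¹ ≤ bumpMajorant ε a := by
  refine le_trans ?_ (ENNReal.le_tsum 0)
  rw [indicator_of_mem]
  · simp
  · simp only [Metric.mem_closedBall, dist_zero_right, Real.norm_eq_abs, zero_add, pow_one]; linarith

/-- One term of the series, that of the dyadic scale of `|a| / ε`, already gives the lower bound. -/
lemma le_bumpMajorant_of_lt {ε a : ℝ} (hε : 0 < ε) (ha : ε < |a|) :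
    ENNReal.ofReal (ε / a ^ 2) ≤ bumpMajorant ε a := by
  have h1 : 1 < |a| / ε := by rwa [one_lt_div hε]
  obtain ⟨k, hk1, hk2⟩ := exists_nat_pow_near h1.le (one_lt_two : (1 : ℝ) < 2)
  refine le_trans ?_ (ENNReal.le_tsum k)
  rw [indicator_of_mem, mul_one]
  · apply ENNReal.ofReal_le_ofReal
    rw [le_div_iff₀ hε] at hk1
    have h2 : (2 ^ k * ε) ^ 2 ≤ a ^ 2 := by
      rw [← sq_abs a]; gcongr
    have h3 : (4 : ℝ) ^ k = (2 ^ k) ^ 2 := by rw [← pow_mul, mul_comm, pow_mul]; norm_num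
    calc ε / a ^ 2 ≤ ε / (2 ^ k * ε) ^ 2 := by gcongr
      _ = ε⁻¹ * (1 / 4) ^ k := by
          rw [one_div, inv_pow, h3]; field_simp
  · simp only [Metric.mem_closedBall, dist_zero_right, Real.norm_eq_abs]
    rw [div_lt_iff₀ hε] at hk2
    exact hk2.le

lemma lintegral_closedBall_eq (F : ℝ → ℝ≥0∞) (x r : ℝ) :
    ∫⁻ s, (Metric.closedBall (0 : ℝ) r).indicator (fun _ => 1) (x - s) * F s =
      ∫⁻ s in Metric.closedBall x r, F s := by
  rw [← lintegral_indicator Metric.isClosed_closedBall.measurableSet]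
  congr 1 with s
  by_cases h : |x - s| ≤ r
  · rw [indicator_of_mem, indicator_of_mem, one_mul]
    · simpa [Real.dist_eq, abs_sub_comm] using h
    · simpa using h
  · rw [indicator_of_notMem, indicator_of_notMem, zero_mul]
    · simpa [Real.dist_eq, abs_sub_comm] using h
    · simpa using h

/-- Convolution with a superposition of indicators of intervals is controlled by the maximal
function. -/
lemma lintegral_tsum_indicator_mul_le {F : ℝ → ℝ≥0∞} (hF : Measurable F) {w r : ℕ → ℝ}
    (hw : ∀ k, 0 ≤ w k) (hr : ∀ k, 0 < r k) (x : ℝ) :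
    ∫⁻ s, (∑' k : ℕ, ENNReal.ofReal (w k) *
      (Metric.closedBall (0 : ℝ) (r k)).indicator (fun _ => 1) (x - s)) * F s ≤
      (∑' k : ℕ, ENNReal.ofReal (w k * (2 * r k))) * hlMax F x := by
  have hm : ∀ k, Measurable fun s : ℝ =>
      (Metric.closedBall (0 : ℝ) (r k)).indicator (fun _ => (1 : ℝ≥0∞)) (x - s) * F s := fun k =>
    ((measurable_const.indicator Metric.isClosed_closedBall.measurableSet).comp
      (measurable_const.sub measurable_id)).mul hF
  simp_rw [← ENNReal.tsum_mul_right, mul_assoc]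
  rw [lintegral_tsum fun k => ((hm k).const_mul _).aemeasurable]
  refine ENNReal.tsum_le_tsum fun k => ?_
  rw [lintegral_const_mul _ (hm k), lintegral_closedBall_eq, ENNReal.ofReal_mul (hw k), mul_assoc]
  gcongr
  exact lintegral_closedBall_le_hlMax F x (hr k)

lemma tsum_bumpMajorant {ε : ℝ} (hε : 0 < ε) :
    ∑' k : ℕ, ENNReal.ofReal (ε⁻¹ * (1 / 4) ^ k * (2 * (2 ^ (k + 1) * ε))) = 8 := by
  have : ∀ k : ℕ, ε⁻¹ * (1 / 4) ^ k * (2 * (2 ^ (k + 1) * ε)) = 4 * (1 / 2 : ℝ) ^ k := by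
    intro k
    have : (1 / 4 : ℝ) ^ k = (1 / 2) ^ k * (1 / 2) ^ k := by rw [← mul_pow]; norm_num
    rw [this, pow_succ]
    have h2 : (1 / 2 : ℝ) ^ k * 2 ^ k = 1 := by rw [← mul_pow]; norm_num
    field_simp
    linear_combination 4 * h2
  simp_rw [this]
  rw [← ENNReal.ofReal_tsum_of_nonneg (fun k => by positivity)
    ((summable_geometric_two).mul_left 4), tsum_mul_left, tsum_geometric_two]
  norm_num

lemma lintegral_bumpMajorant_mul_le {ε : ℝ} (hε : 0 < ε) {F : ℝ → ℝ≥0∞} (hF : Measurable F)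
    (x : ℝ) : ∫⁻ s, bumpMajorant ε (x - s) * F s ≤ 8 * hlMax F x := by
  have := lintegral_tsum_indicator_mul_le hF (w := fun k => ε⁻¹ * (1 / 4) ^ k)
    (r := fun k => 2 ^ (k + 1) * ε) (fun k => by positivity) (fun k => by positivity) x
  rwa [tsum_bumpMajorant hε] at this

lemma lintegral_bumpMajorant {ε : ℝ} (hε : 0 < ε) : ∫⁻ s, bumpMajorant ε s = 8 := by
  have hm : ∀ k : ℕ, Measurable fun a : ℝ =>
    (Metric.closedBall (0 : ℝ) (2 ^ (k + 1) * ε)).indicator (fun _ => (1 : ℝ≥0∞)) a := fun k =>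
      measurable_const.indicator Metric.isClosed_closedBall.measurableSet
  unfold bumpMajorant
  rw [lintegral_tsum fun k => ((hm k).const_mul _).aemeasurable, ← tsum_bumpMajorant hε]
  congr 1 with k
  rw [lintegral_const_mul _ (hm k), lintegral_indicator Metric.isClosed_closedBall.measurableSet,
    setLIntegral_const, one_mul, Real.volume_closedBall, ← ENNReal.ofReal_mul (by positivity)]

end majorant

/-! ### The truncated Hilbert kernel -/

section hilbertKernel

/-- The truncated Hilbert kernel `1 / t` on `{|t| > ε}`. -/
noncomputable def hKer (ε t : ℝ) : ℝ := {t : ℝ | ε < |t|}.indicator (fun t => 1 / t) t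

lemma hKer_of_lt {ε t : ℝ} (h : ε < |t|) : hKer ε t = 1 / t :=
  indicator_of_mem (s := {t : ℝ | ε < |t|}) h _

lemma hKer_of_le {ε t : ℝ} (h : |t| ≤ ε) : hKer ε t = 0 :=
  indicator_of_notMem (s := {t : ℝ | ε < |t|}) (by simpa using h) _

lemma measurableSet_lt_abs (ε : ℝ) : MeasurableSet {t : ℝ | ε < |t|} :=
  measurableSet_lt measurable_const (by fun_prop)

@[fun_prop]
lemma measurable_hKer (ε : ℝ) : Measurable (hKer ε) := by
  unfold hKer
  exact Measurable.indicator (by fun_prop) (measurableSet_lt_abs ε)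

lemma hKer_neg (ε t : ℝ) : hKer ε (-t) = -hKer ε t := by
  by_cases h : ε < |t|
  · rw [hKer_of_lt h, hKer_of_lt (by rwa [abs_neg])]
    ring
  · rw [hKer_of_le (not_lt.1 h), hKer_of_le (by rw [abs_neg]; exact not_lt.1 h), neg_zero]

lemma abs_hKer_le {ε : ℝ} (hε : 0 < ε) (t : ℝ) : |hKer ε t| ≤ 1 / ε := by
  by_cases h : ε < |t|
  · rw [hKer_of_lt h, abs_div, abs_one]
    gcongr
  · rw [hKer_of_le (not_lt.1 h), abs_zero]
    positivity

/-- The defect in the algebraic identity `1 / (a b) + (1 / a - 1 / b) / (a - b) = 0` when `1 / t`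
is replaced by the truncated kernel. -/
noncomputable def cotlarDefect (ε a b : ℝ) : ℝ :=
  hKer ε a * hKer ε b + hKer ε a * hKer ε (a - b) - hKer ε b * hKer ε (a - b)

lemma measurable_cotlarDefect (ε : ℝ) : Measurable (Function.uncurry (cotlarDefect ε)) := by
  unfold cotlarDefect Function.uncurry
  fun_prop

lemma cotlarDefect_comm (ε a b : ℝ) : cotlarDefect ε a b = cotlarDefect ε b a := by
  unfold cotlarDefect
  rw [show b - a = -(a - b) by ring, hKer_neg]
  ring

/-- When `|a| ≤ |b| + ε` and both exceed `ε`, the size of `b` is at least `|a| / 2`. -/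
lemma abs_mul_inv_le_of_near {ε a b : ℝ} (hε : 0 < ε) (ha : ε < |a|) (hb : ε < |b|)
    (hab : |a| ≤ |b| + ε) : |1 / a * (1 / b)| ≤ 2 / a ^ 2 := by
  have h1 : 0 < |a| := hε.trans ha
  have h2 : 0 < |b| := hε.trans hb
  rw [abs_mul, abs_div, abs_div, abs_one, ← sq_abs a, div_mul_div_comm, one_mul,
    div_le_div_iff₀ (by positivity) (by positivity)]
  nlinarith

lemma abs_cotlarDefect_le_of_le {ε a b : ℝ} (hε : 0 < ε) (ha : |a| ≤ ε) :
    ‖cotlarDefect ε a b‖ₑ ≤ ENNReal.ofReal (2 / ε) * bumpMajorant ε b := by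
  by_cases hb : ε < |b|
  · by_cases hab : ε < |a - b|
    · have h := abs_mul_inv_le_of_near hε hb hab (by
        have := abs_sub_abs_le_abs_sub b a
        rw [abs_sub_comm b a] at this; linarith)
      unfold cotlarDefect
      rw [hKer_of_le ha, hKer_of_lt hb, hKer_of_lt hab, ← ofReal_norm, Real.norm_eq_abs]
      refine le_trans ?_ (mul_le_mul_right (le_bumpMajorant_of_lt hε hb) _)
      rw [← ENNReal.ofReal_mul (by positivity)]
      apply ENNReal.ofReal_le_ofReal
      rw [show 2 / ε * (ε / b ^ 2) = 2 / b ^ 2 by field_simp]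
      simpa [abs_mul] using h
    · unfold cotlarDefect
      rw [hKer_of_le ha, hKer_of_le (not_lt.1 hab)]
      simp
  · unfold cotlarDefect
    rw [hKer_of_le ha, hKer_of_le (not_lt.1 hb)]
    simp

/-- For `|a| > ε` the defect vanishes by the algebraic identity unless one of the other two
arguments is truncated. -/
lemma abs_cotlarDefect_le_of_lt {ε a b : ℝ} (hε : 0 < ε) (ha : ε < |a|) :
    ‖cotlarDefect ε a b‖ₑ ≤ ENNReal.ofReal (2 / a ^ 2) *
      ((Metric.closedBall (0 : ℝ) ε).indicator (fun _ => 1) b +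
        (Metric.closedBall (0 : ℝ) ε).indicator (fun _ => 1) (a - b)) := by
  by_cases hb : ε < |b|
  · by_cases hab : ε < |a - b|
    · have ha0 : a ≠ 0 := by rintro rfl; simp at ha; linarith
      have hb0 : b ≠ 0 := by rintro rfl; simp at hb; linarith
      have hab0 : a - b ≠ 0 := by intro h; rw [h] at hab; simp at hab; linarith
      have : cotlarDefect ε a b = 0 := by
        unfold cotlarDefect
        rw [hKer_of_lt ha, hKer_of_lt hb, hKer_of_lt hab]
        field_simp
        ring
      rw [this]; simp
    · rw [indicator_of_mem (a := a - b) (by simpa using hab)]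
      have h := abs_mul_inv_le_of_near hε ha hb (by
        have := abs_sub_abs_le_abs_sub a b; linarith)
      unfold cotlarDefect
      rw [hKer_of_le (not_lt.1 hab), hKer_of_lt ha, hKer_of_lt hb]
      calc _ ≤ ENNReal.ofReal (2 / a ^ 2) * 1 := by
            rw [mul_one, ← ofReal_norm, Real.norm_eq_abs]
            apply ENNReal.ofReal_le_ofReal
            simpa [abs_mul] using h
        _ ≤ _ := by gcongr; exact le_add_self
  · rw [indicator_of_mem (a := b) (by simpa using hb)]
    by_cases hab : ε < |a - b|
    · have h := abs_mul_inv_le_of_near hε ha hab (by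
        have := abs_sub_abs_le_abs_sub a (a - b)
        rw [sub_sub_cancel] at this; linarith [not_lt.1 hb])
      unfold cotlarDefect
      rw [hKer_of_le (not_lt.1 hb), hKer_of_lt ha, hKer_of_lt hab]
      calc _ ≤ ENNReal.ofReal (2 / a ^ 2) * 1 := by
            rw [mul_one, ← ofReal_norm, Real.norm_eq_abs]
            apply ENNReal.ofReal_le_ofReal
            simpa [abs_mul] using h
        _ ≤ _ := by gcongr; exact le_self_add
    · unfold cotlarDefect
      rw [hKer_of_le (not_lt.1 hb), hKer_of_le (not_lt.1 hab)]
      simp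

/-- The error kernel in Cotlar's identity is, after integration of one variable, a bump of width `ε`
and mass `O(1)`; this is what makes the error harmless uniformly in `ε`. -/
lemma lintegral_cotlarDefect_le {ε : ℝ} (hε : 0 < ε) (a : ℝ) :
    ∫⁻ b, ‖cotlarDefect ε a b‖ₑ ≤ 16 * bumpMajorant ε a := by
  by_cases ha : ε < |a|
  · refine (lintegral_mono fun b => abs_cotlarDefect_le_of_lt hε ha).trans ?_
    have hm : Measurable fun b : ℝ =>
        (Metric.closedBall (0 : ℝ) ε).indicator (fun _ => (1 : ℝ≥0∞)) b :=
      measurable_const.indicator Metric.isClosed_closedBall.measurableSet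
    rw [lintegral_const_mul' _ _ (by simp), lintegral_add_left hm,
      lintegral_sub_left_eq_self (fun b => (Metric.closedBall (0 : ℝ) ε).indicator
        (fun _ => (1 : ℝ≥0∞)) b) a, lintegral_indicator Metric.isClosed_closedBall.measurableSet,
      setLIntegral_const, one_mul, Real.volume_closedBall,
      ← ENNReal.ofReal_add (by positivity) (by positivity), ← ENNReal.ofReal_mul (by positivity)]
    refine le_trans ?_ (mul_le_mul_right (le_bumpMajorant_of_lt hε ha) _)
    rw [show (16 : ℝ≥0∞) = ENNReal.ofReal 16 by norm_num, ← ENNReal.ofReal_mul (by norm_num)]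
    apply ENNReal.ofReal_le_ofReal
    have : 0 < a ^ 2 := by rw [← sq_abs]; have := hε.trans ha; positivity
    rw [div_mul_eq_mul_div, mul_div_assoc', div_le_div_iff_of_pos_right this]
    linarith
  · have ha := not_lt.1 ha
    refine (lintegral_mono fun b => abs_cotlarDefect_le_of_le hε ha).trans ?_
    rw [lintegral_const_mul' _ _ (by simp), lintegral_bumpMajorant hε]
    refine le_trans ?_ (mul_le_mul_right (le_bumpMajorant_of_le hε ha) _)
    rw [show (16 : ℝ≥0∞) = ENNReal.ofReal 16 by norm_num, show (8 : ℝ≥0∞) = ENNReal.ofReal 8 by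
      norm_num, ← ENNReal.ofReal_mul (by positivity), ← ENNReal.ofReal_mul (by norm_num)]
    apply ENNReal.ofReal_le_ofReal
    apply le_of_eq
    field_simp
    norm_num

end hilbertKernel

/-! ### Truncated Hilbert transforms and Cotlar's identity -/

section hilbertTransform

/-- The truncated Hilbert transform on the line. -/
noncomputable def hilb (ε : ℝ) (f : ℝ → ℂ) (x : ℝ) : ℂ :=
  ∫ s, f s * (hKer ε (x - s) : ℂ)

/-- Bounded measurable functions that vanish outside a bounded set. -/
structure IsBddSupp (f : ℝ → ℂ) : Prop where
  meas : Measurable f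
  bdd : ∃ c : ℝ, ∀ x, ‖f x‖ ≤ c
  supp : ∃ S : ℝ, ∀ x, S < |x| → f x = 0

namespace IsBddSupp

variable {f g : ℝ → ℂ}

lemma conjugate (hf : IsBddSupp f) : IsBddSupp (fun x => conj (f x)) where
  meas := Complex.continuous_conj.measurable.comp hf.meas
  bdd := by simpa using hf.bdd
  supp := by simpa using hf.supp

lemma mul_bdd (hf : IsBddSupp f) (hg : Measurable g) (hb : ∃ c : ℝ, ∀ x, ‖g x‖ ≤ c) :
    IsBddSupp (fun x => f x * g x) where
  meas := hf.meas.mul hg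
  bdd := by
    obtain ⟨c, hc⟩ := hf.bdd
    obtain ⟨d, hd⟩ := hb
    refine ⟨c * d, fun x => ?_⟩
    rw [norm_mul]
    exact mul_le_mul (hc x) (hd x) (norm_nonneg _) ((norm_nonneg _).trans (hc x))
  supp := by
    obtain ⟨S, hS⟩ := hf.supp
    exact ⟨S, fun x hx => by rw [hS x hx, zero_mul]⟩

lemma indicator (hf : IsBddSupp f) {A : Set ℝ} (hA : MeasurableSet A) :
    IsBddSupp (A.indicator f) where
  meas := hf.meas.indicator hA
  bdd := by
    obtain ⟨c, hc⟩ := hf.bdd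
    exact ⟨c, fun x => (norm_indicator_le_norm_self f x).trans (hc x)⟩
  supp := by
    obtain ⟨S, hS⟩ := hf.supp
    exact ⟨S, fun x hx => by simp [Set.indicator, hS x hx]⟩

lemma memLp (hf : IsBddSupp f) (q : ℝ≥0∞) : MemLp f q volume := by
  obtain ⟨c, hc⟩ := hf.bdd
  obtain ⟨S, hS⟩ := hf.supp
  have h : f = (Icc (-S) S).indicator f := by
    ext x
    by_cases hx : x ∈ Icc (-S) S
    · rw [indicator_of_mem hx]
    · rw [indicator_of_notMem hx, hS x]
      rw [mem_Icc, ← abs_le] at hx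
      exact not_le.1 hx
  rw [h, memLp_indicator_iff_restrict measurableSet_Icc]
  exact MemLp.of_bound hf.meas.aestronglyMeasurable c (Eventually.of_forall hc)

lemma integrable (hf : IsBddSupp f) : Integrable f := memLp_one_iff_integrable.1 (hf.memLp 1)

end IsBddSupp

lemma norm_ofReal_hKer_le {ε : ℝ} (hε : 0 < ε) (t : ℝ) : ‖(hKer ε t : ℂ)‖ ≤ 1 / ε := by
  rw [Complex.norm_real]; exact abs_hKer_le hε t

lemma integrable_mul_hKer {ε : ℝ} (hε : 0 < ε) {f : ℝ → ℂ} (hf : Integrable f) (x : ℝ) :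
    Integrable fun s => f s * (hKer ε (x - s) : ℂ) := by
  refine hf.mul_bdd (c := 1 / ε) ?_ (Eventually.of_forall fun s => norm_ofReal_hKer_le hε _)
  exact (by fun_prop : Measurable fun s => (hKer ε (x - s) : ℂ)).aestronglyMeasurable

lemma measurable_hilb {ε : ℝ} {f : ℝ → ℂ} (hf : Measurable f) : Measurable (hilb ε f) := by
  have : StronglyMeasurable (Function.uncurry fun (x s : ℝ) => f s * (hKer ε (x - s) : ℂ)) := by
    apply Measurable.stronglyMeasurable
    unfold Function.uncurry
    fun_prop
  exact this.integral_prod_right.measurable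

lemma norm_hilb_le {ε : ℝ} (hε : 0 < ε) {f : ℝ → ℂ} (hf : Integrable f) (x : ℝ) :
    ‖hilb ε f x‖ ≤ (∫ s, ‖f s‖) * (1 / ε) := by
  unfold hilb
  refine (norm_integral_le_integral_norm _).trans ?_
  rw [← integral_mul_const]
  refine integral_mono (integrable_mul_hKer hε hf x).norm (hf.norm.mul_const _) fun s => ?_
  rw [norm_mul]
  exact mul_le_mul_of_nonneg_left (norm_ofReal_hKer_le hε _) (norm_nonneg _)

lemma hilb_conj (ε : ℝ) (f : ℝ → ℂ) (x : ℝ) :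
    hilb ε (fun y => conj (f y)) x = conj (hilb ε f x) := by
  unfold hilb
  rw [← integral_conj]
  simp

lemma lpn_hKer_ne_top {ε : ℝ} (hε : 0 < ε) {q : ℝ} (hq : 1 < q) :
    lpn q volume (fun t => ‖hKer ε t‖ₑ) ≠ ⊤ := by
  unfold lpn
  refine ENNReal.rpow_ne_top_of_nonneg (by positivity) ?_
  have h1 : ∀ t, ‖hKer ε t‖ₑ ^ q ≤ (Ioi ε).indicator (fun t => ENNReal.ofReal (t ^ (-q))) t +
      (Ioi ε).indicator (fun t => ENNReal.ofReal (t ^ (-q))) (-t) := by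
    intro t
    by_cases h : ε < |t|
    · have ht : 0 < |t| := hε.trans h
      have e : ‖hKer ε t‖ₑ ^ q = ENNReal.ofReal (|t| ^ (-q)) := by
        rw [hKer_of_lt h, ← ofReal_norm, ENNReal.ofReal_rpow_of_nonneg (norm_nonneg _) (by linarith),
          Real.norm_eq_abs, abs_div, abs_one, Real.div_rpow zero_le_one ht.le, Real.one_rpow,
          Real.rpow_neg ht.le, one_div]
      rw [e]
      rcases lt_abs.1 h with h' | h'
      · rw [indicator_of_mem (a := t) (by exact h'), abs_of_pos (hε.trans h')]
        exact le_self_add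
      · rw [indicator_of_mem (a := -t) (by exact h'), abs_of_neg (by linarith)]
        exact le_add_self
    · rw [hKer_of_le (not_lt.1 h)]
      simp [ENNReal.zero_rpow_of_pos (by linarith : 0 < q)]
  have hm : Measurable fun t : ℝ => (Ioi ε).indicator (fun t => ENNReal.ofReal (t ^ (-q))) t :=
    Measurable.indicator (by fun_prop) measurableSet_Ioi
  refine ne_top_of_le_ne_top ?_ (lintegral_mono h1)
  rw [lintegral_add_left hm, lintegral_neg_eq_self (fun t : ℝ => (Ioi ε).indicator
    (fun t => ENNReal.ofReal (t ^ (-q))) t), lintegral_indicator measurableSet_Ioi,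
    lintegral_Ioi_rpow (by linarith) hε]
  simp

lemma lpn_comp_sub {q : ℝ} (F : ℝ → ℝ≥0∞) (s : ℝ) :
    lpn q volume (fun x => F (x - s)) = lpn q volume F := by
  unfold lpn
  rw [lintegral_sub_right_eq_self (fun x => F x ^ q) s]

lemma lpn_comp_sub_left {q : ℝ} (F : ℝ → ℝ≥0∞) (s : ℝ) :
    lpn q volume (fun x => F (s - x)) = lpn q volume F := by
  unfold lpn
  rw [lintegral_sub_left_eq_self (fun x => F x ^ q) s]

/-- **Young's inequality** `L^1 * L^p ⊆ L^p`. -/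
lemma lpn_convolution_le {p : ℝ} (hp : 1 ≤ p) {F K : ℝ → ℝ≥0∞} (hF : Measurable F)
    (hK : Measurable K) :
    lpn p volume (fun x => ∫⁻ s, K (x - s) * F s) ≤ (∫⁻ s, F s) * lpn p volume K := by
  refine (lpn_lintegral_le hp (F := fun x s => K (x - s) * F s) ?_).trans (le_of_eq ?_)
  · unfold Function.uncurry; fun_prop
  · rw [← lintegral_mul_const _ hF]
    congr 1 with s
    rw [← lpn_comp_sub K s, ← lpn_const_mul (by linarith) _ (by fun_prop)]
    congr 1 with x
    rw [mul_comm]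

lemma lpn_convolution_le' {p : ℝ} (hp : 1 ≤ p) {F K : ℝ → ℝ≥0∞} (hF : Measurable F)
    (hK : Measurable K) :
    lpn p volume (fun x => ∫⁻ s, K (x - s) * F s) ≤ (∫⁻ s, K s) * lpn p volume F := by
  refine le_trans (le_of_eq ?_) (lpn_convolution_le hp hK hF)
  congr 1 with x
  rw [← lintegral_sub_left_eq_self _ x]
  simp [mul_comm]

lemma enorm_hilb_le (ε : ℝ) (f : ℝ → ℂ) (x : ℝ) :
    ‖hilb ε f x‖ₑ ≤ ∫⁻ s, ‖hKer ε (x - s)‖ₑ * ‖f s‖ₑ := by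
  unfold hilb
  refine (enorm_integral_le_lintegral_enorm _).trans (le_of_eq ?_)
  congr 1 with s
  rw [enorm_mul, mul_comm]
  congr 1
  rw [← ofReal_norm, Complex.norm_real, ofReal_norm]

lemma IsBddSupp.lpn_hilb_ne_top {f : ℝ → ℂ} (hf : IsBddSupp f) {ε : ℝ} (hε : 0 < ε) {q : ℝ}
    (hq : 1 < q) : lpn q volume (fun x => ‖hilb ε f x‖ₑ) ≠ ⊤ := by
  have h := lpn_convolution_le hq.le (F := fun s => ‖f s‖ₑ) (K := fun t => ‖hKer ε t‖ₑ)
    hf.meas.enorm (measurable_hKer ε).enorm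
  refine ne_top_of_le_ne_top ?_ ((lpn_mono (by linarith) (Eventually.of_forall
    fun x => enorm_hilb_le ε f x)).trans h)
  exact ENNReal.mul_ne_top hf.integrable.2.ne (lpn_hKer_ne_top hε hq)

lemma IsBddSupp.mul_hilb {f g : ℝ → ℂ} (hf : IsBddSupp f) (hg : IsBddSupp g) {ε : ℝ} (hε : 0 < ε) :
    IsBddSupp (fun x => f x * hilb ε g x) :=
  hf.mul_bdd (measurable_hilb hg.meas) ⟨_, norm_hilb_le hε hg.integrable⟩

lemma mul_le_sq_add_sq (a b : ℝ≥0∞) : a * b ≤ a ^ 2 + b ^ 2 := by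
  rcases le_total a b with h | h
  · calc a * b ≤ b * b := by gcongr
      _ = b ^ 2 := by ring
      _ ≤ _ := le_add_self
  · calc a * b ≤ a * a := by gcongr
      _ = a ^ 2 := by ring
      _ ≤ _ := le_self_add

/-- **Cotlar's identity** for the truncated Hilbert transform, with its error term. -/
lemma hilb_mul_hilb {f g : ℝ → ℂ} (hf : IsBddSupp f) (hg : IsBddSupp g) {ε : ℝ} (hε : 0 < ε)
    (x : ℝ) :
    hilb ε f x * hilb ε g x = hilb ε (fun s => f s * hilb ε g s) x +
      hilb ε (fun s => g s * hilb ε f s) x +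
      ∫ q : ℝ × ℝ, f q.1 * g q.2 * (cotlarDefect ε (x - q.1) (x - q.2) : ℂ) := by
  have hfg : Integrable fun q : ℝ × ℝ => f q.1 * g q.2 := hf.integrable.mul_prod hg.integrable
  have hb : ∀ {k : ℝ × ℝ → ℂ} {c : ℝ}, Measurable k → (∀ q, ‖k q‖ ≤ c) →
      Integrable fun q : ℝ × ℝ => f q.1 * g q.2 * k q := fun hk hc =>
    hfg.mul_bdd hk.aestronglyMeasurable (Eventually.of_forall hc)
  have hK := norm_ofReal_hKer_le hε
  have bd : ∀ a b : ℝ, ‖(hKer ε a : ℂ) * (hKer ε b : ℂ)‖ ≤ 1 / ε * (1 / ε) := fun a b => by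
    rw [norm_mul]; exact mul_le_mul (hK a) (hK b) (norm_nonneg _) (by positivity)
  have i1 := hb (k := fun q => (hKer ε (x - q.1) : ℂ) * (hKer ε (x - q.2) : ℂ)) (by fun_prop)
    fun q => bd _ _
  have i2 := hb (k := fun q => (hKer ε (x - q.1) : ℂ) * (hKer ε (q.1 - q.2) : ℂ)) (by fun_prop)
    fun q => bd _ _
  have i3 := hb (k := fun q => (hKer ε (x - q.2) : ℂ) * (hKer ε (q.2 - q.1) : ℂ)) (by fun_prop)
    fun q => bd _ _
  have e1 : hilb ε f x * hilb ε g x =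
      ∫ q : ℝ × ℝ, f q.1 * g q.2 * ((hKer ε (x - q.1) : ℂ) * (hKer ε (x - q.2) : ℂ)) := by
    unfold hilb
    rw [← integral_prod_mul]
    congr 1 with q
    ring
  have e2 : hilb ε (fun s => f s * hilb ε g s) x =
      ∫ q : ℝ × ℝ, f q.1 * g q.2 * ((hKer ε (x - q.1) : ℂ) * (hKer ε (q.1 - q.2) : ℂ)) := by
    rw [Measure.volume_eq_prod, integral_prod _ i2]
    unfold hilb
    congr 1 with s
    rw [mul_right_comm, ← integral_const_mul]
    congr 1 with s'
    ring
  have e3 : hilb ε (fun s => g s * hilb ε f s) x =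
      ∫ q : ℝ × ℝ, f q.1 * g q.2 * ((hKer ε (x - q.2) : ℂ) * (hKer ε (q.2 - q.1) : ℂ)) := by
    rw [Measure.volume_eq_prod, integral_prod_symm _ i3]
    unfold hilb
    congr 1 with s
    rw [mul_right_comm, ← integral_const_mul]
    congr 1 with s'
    ring
  have i4 : Integrable fun q : ℝ × ℝ =>
      f q.1 * g q.2 * (cotlarDefect ε (x - q.1) (x - q.2) : ℂ) := by
    refine hb (k := fun q => (cotlarDefect ε (x - q.1) (x - q.2) : ℂ))
      (c := 3 * (1 / ε * (1 / ε))) ?_ fun q => ?_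
    · have := measurable_cotlarDefect ε
      exact Complex.measurable_ofReal.comp (this.comp (by fun_prop :
        Measurable fun q : ℝ × ℝ => (x - q.1, x - q.2)))
    · unfold cotlarDefect
      push_cast
      refine (norm_sub_le _ _).trans ?_
      refine (add_le_add (norm_add_le _ _) le_rfl).trans ?_
      refine (add_le_add (add_le_add (bd _ _) (bd _ _)) (bd _ _)).trans ?_
      linarith
  have h23 := integral_add i2 i3
  have h234 := integral_add (i2.add i3) i4
  simp only [Pi.add_apply] at h234
  rw [e1, e2, e3, ← h23, ← h234]
  congr 1 with q
  have h1 := hKer_neg ε (q.1 - q.2)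
  have h2 : hKer ε (x - q.1 - (x - q.2)) = hKer ε (q.2 - q.1) := by congr 1; ring
  unfold cotlarDefect
  rw [h2]
  rw [neg_sub] at h1
  rw [h1]
  push_cast
  ring

/-- The error in Cotlar's identity is bilinear; by `ab ≤ a² + b²` and the symmetry of the kernel it
is controlled by a single average of `|f|²`. -/
lemma enorm_integral_cotlarDefect_le {f g : ℝ → ℂ} (hf : Measurable f)
    (hfg : ∀ s, ‖g s‖ₑ = ‖f s‖ₑ) {ε : ℝ} (hε : 0 < ε) (x : ℝ) :
    ‖∫ q : ℝ × ℝ, f q.1 * g q.2 * (cotlarDefect ε (x - q.1) (x - q.2) : ℂ)‖ₑ ≤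
      32 * ∫⁻ s, bumpMajorant ε (x - s) * ‖f s‖ₑ ^ 2 := by
  have mE : Measurable fun q : ℝ × ℝ => ‖cotlarDefect ε (x - q.1) (x - q.2)‖ₑ := by
    unfold cotlarDefect
    fun_prop
  have mE1 : ∀ s, Measurable fun s' : ℝ => ‖cotlarDefect ε (x - s) (x - s')‖ₑ := fun s => by
    unfold cotlarDefect
    fun_prop
  have key : ∀ s, ∫⁻ s', ‖f s‖ₑ ^ 2 * ‖cotlarDefect ε (x - s) (x - s')‖ₑ ≤
      16 * (bumpMajorant ε (x - s) * ‖f s‖ₑ ^ 2) := by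
    intro s
    rw [lintegral_const_mul _ (mE1 s),
      lintegral_sub_left_eq_self (fun b => ‖cotlarDefect ε (x - s) b‖ₑ) x]
    calc _ ≤ ‖f s‖ₑ ^ 2 * (16 * bumpMajorant ε (x - s)) := by
          gcongr; exact lintegral_cotlarDefect_le hε _
      _ = _ := by ring
  have key' : ∀ s', ∫⁻ s, ‖f s'‖ₑ ^ 2 * ‖cotlarDefect ε (x - s) (x - s')‖ₑ ≤
      16 * (bumpMajorant ε (x - s') * ‖f s'‖ₑ ^ 2) := by
    intro s'
    simpa only [cotlarDefect_comm ε _ (x - s')] using key s'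
  have m1 : Measurable fun q : ℝ × ℝ => ‖f q.1‖ₑ ^ 2 * ‖cotlarDefect ε (x - q.1) (x - q.2)‖ₑ :=
    Measurable.mul (by fun_prop) mE
  have m2 : Measurable fun q : ℝ × ℝ => ‖f q.2‖ₑ ^ 2 * ‖cotlarDefect ε (x - q.1) (x - q.2)‖ₑ :=
    Measurable.mul (by fun_prop) mE
  have hmaj : Measurable fun s => bumpMajorant ε (x - s) * ‖f s‖ₑ ^ 2 :=
    ((measurable_bumpMajorant ε).comp (by fun_prop)).mul (by fun_prop)
  calc _ ≤ ∫⁻ q : ℝ × ℝ, ‖f q.1 * g q.2 * (cotlarDefect ε (x - q.1) (x - q.2) : ℂ)‖ₑ :=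
        enorm_integral_le_lintegral_enorm _
    _ ≤ ∫⁻ q : ℝ × ℝ, (‖f q.1‖ₑ ^ 2 * ‖cotlarDefect ε (x - q.1) (x - q.2)‖ₑ +
          ‖f q.2‖ₑ ^ 2 * ‖cotlarDefect ε (x - q.1) (x - q.2)‖ₑ) := by
        refine lintegral_mono fun q => ?_
        simp only
        rw [enorm_mul, enorm_mul, hfg, ← add_mul]
        have : ‖((cotlarDefect ε (x - q.1) (x - q.2) : ℝ) : ℂ)‖ₑ =
            ‖cotlarDefect ε (x - q.1) (x - q.2)‖ₑ := by
          rw [← ofReal_norm, Complex.norm_real, ofReal_norm]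
        rw [this]
        exact mul_le_mul_left (mul_le_sq_add_sq _ _) _
    _ = (∫⁻ s, ∫⁻ s', ‖f s‖ₑ ^ 2 * ‖cotlarDefect ε (x - s) (x - s')‖ₑ) +
          ∫⁻ s', ∫⁻ s, ‖f s'‖ₑ ^ 2 * ‖cotlarDefect ε (x - s) (x - s')‖ₑ := by
        rw [lintegral_add_left m1, Measure.volume_eq_prod, lintegral_prod _ m1.aemeasurable,
          lintegral_prod_symm _ m2.aemeasurable]
    _ ≤ (∫⁻ s, 16 * (bumpMajorant ε (x - s) * ‖f s‖ₑ ^ 2)) +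
          ∫⁻ s, 16 * (bumpMajorant ε (x - s) * ‖f s‖ₑ ^ 2) := by
        exact add_le_add (lintegral_mono key) (lintegral_mono key')
    _ = _ := by
        rw [← two_mul, lintegral_const_mul _ hmaj, ← mul_assoc,
          show (2 : ℝ≥0∞) * 16 = 32 by norm_num]

end hilbertTransform

/-! ### The Hilbert transform on `L²` and the passage from `L^p` to `L^{2p}` -/

section hilbertLp

lemma lpn_sq {α : Type*} [MeasurableSpace α] {μ : Measure α} (p : ℝ) (F : α → ℝ≥0∞) :
    lpn p μ (fun x => F x ^ 2) = lpn (2 * p) μ F ^ 2 := by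
  unfold lpn
  rw [← ENNReal.rpow_natCast, ← ENNReal.rpow_mul]
  have : ∀ x, (F x ^ 2) ^ p = F x ^ (2 * p) := fun x => by
    rw [← ENNReal.rpow_natCast, ← ENNReal.rpow_mul]; norm_num
  simp_rw [this]
  congr 1
  push_cast
  rcases eq_or_ne p 0 with rfl | hp
  · simp
  · field_simp

lemma lpn_mul_le {α : Type*} [MeasurableSpace α] {μ : Measure α} {p : ℝ} (hp : 0 < p)
    {F G : α → ℝ≥0∞} (hF : Measurable F) (hG : Measurable G) :
    lpn p μ (fun x => F x * G x) ≤ lpn (2 * p) μ F * lpn (2 * p) μ G := by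
  have h22 : (2 : ℝ).HolderConjugate 2 := by
    rw [Real.holderConjugate_iff]; norm_num
  have h := lintegral_mul_le_lpn (μ := μ) h22 (hF.pow_const p).aemeasurable
    (hG.pow_const p).aemeasurable
  have e : ∀ F : α → ℝ≥0∞, lpn 2 μ (fun x => F x ^ p) ^ (1 / p) = lpn (2 * p) μ F := by
    intro F
    unfold lpn
    rw [← ENNReal.rpow_mul]
    congr 1
    · congr 1 with x
      rw [← ENNReal.rpow_mul, mul_comm p]
    · field_simp
  rw [← e F, ← e G, ← ENNReal.mul_rpow_of_nonneg _ _ (by positivity)]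
  unfold lpn at h ⊢
  simp_rw [ENNReal.mul_rpow_of_nonneg _ _ hp.le]
  exact ENNReal.rpow_le_rpow h (by positivity)

/-- Pointwise form of Cotlar's identity. -/
lemma sq_enorm_hilb_le {f : ℝ → ℂ} (hf : IsBddSupp f) {ε : ℝ} (hε : 0 < ε) (x : ℝ) :
    ‖hilb ε f x‖ₑ ^ 2 ≤ 2 * ‖hilb ε (fun s => f s * hilb ε (fun y => conj (f y)) s) x‖ₑ +
      32 * ∫⁻ s, bumpMajorant ε (x - s) * ‖f s‖ₑ ^ 2 := by
  have h := hilb_mul_hilb hf hf.conjugate hε x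
  have e1 : hilb ε (fun s => conj (f s) * hilb ε f s) x =
      conj (hilb ε (fun s => f s * hilb ε (fun y => conj (f y)) s) x) := by
    rw [← hilb_conj]
    simp [hilb_conj]
  have hc : ∀ z : ℂ, ‖conj z‖ₑ = ‖z‖ₑ := fun z => by
    rw [← ofReal_norm, Complex.norm_conj, ofReal_norm]
  rw [e1] at h
  calc ‖hilb ε f x‖ₑ ^ 2 = ‖hilb ε f x * hilb ε (fun y => conj (f y)) x‖ₑ := by
        rw [hilb_conj, enorm_mul, hc, sq]
    _ ≤ _ := by
        rw [h]
        refine (enorm_add_le _ _).trans (add_le_add ((enorm_add_le _ _).trans ?_)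
          (enorm_integral_cotlarDefect_le hf.meas (fun s => hc _) hε x))
        rw [hc, two_mul]

/-- As the kernel is odd, the integral over the largest symmetric interval around `s` vanishes and
only an end piece of length `2 |s|`, far from the singularity, survives. -/
lemma norm_integral_hKer_le {ε S R s : ℝ} (hs : |s| ≤ S) (hR : S + ε < R) (hε : 0 < ε) :
    ‖∫ x in Icc (-R) R, (hKer ε (x - s) : ℂ)‖ ≤ 2 * S / (R - S) := by
  have hS : 0 ≤ S := (abs_nonneg s).trans hs
  obtain ⟨hs1, hs2⟩ := abs_le.1 hs
  have hi : ∀ a b : ℝ, IntervalIntegrable (fun t => (hKer ε t : ℂ)) volume a b := fun a b => by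
    refine (intervalIntegrable_const (c := 1 / ε)).mono_fun (by fun_prop) ?_
    refine Eventually.of_forall fun t => ?_
    rw [Real.norm_of_nonneg (by positivity)]
    exact norm_ofReal_hKer_le hε t
  rw [integral_Icc_eq_integral_Ioc, ← intervalIntegral.integral_of_le (by linarith),
    intervalIntegral.integral_comp_sub_right (fun t => (hKer ε t : ℂ)) s,
    ← intervalIntegral.integral_add_adjacent_intervals (hi _ (-(R - s))) (hi _ _)]
  have hodd : ∫ t in (-(R - s))..(R - s), (hKer ε t : ℂ) = 0 := by
    have h := intervalIntegral.integral_comp_neg (fun t => (hKer ε t : ℂ)) (a := -(R - s))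
      (b := R - s)
    simp only [hKer_neg, neg_neg, Complex.ofReal_neg, intervalIntegral.integral_neg] at h
    exact self_eq_neg.1 h.symm
  rw [hodd, add_zero]
  refine (intervalIntegral.norm_integral_le_of_norm_le_const (C := 1 / (R - S)) fun t ht => ?_).trans ?_
  · have ht' : R - S ≤ |t| := by
      rw [uIoc, mem_Ioc] at ht
      have : t ≤ -(R - S) := ht.2.trans (max_le (by linarith) (by linarith))
      rw [abs_of_neg (by linarith)]; linarith
    rw [hKer_of_lt (by linarith), Complex.norm_real, Real.norm_eq_abs, abs_div, abs_one]
    exact one_div_le_one_div_of_le (by linarith) ht'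
  · rw [show -(R - s) - (-R - s) = 2 * s by ring, abs_mul, abs_two, one_div_mul_eq_div]
    have : 0 < R - S := by linarith
    gcongr

/-- The integral of a truncated Hilbert transform over symmetric intervals tends to zero. -/
lemma tendsto_integral_hilb {f : ℝ → ℂ} (hf : IsBddSupp f) {ε : ℝ} (hε : 0 < ε) :
    Tendsto (fun n : ℕ => ∫ x in Icc (-(n : ℝ)) n, hilb ε f x) atTop (𝓝 0) := by
  obtain ⟨S, hS⟩ := hf.supp
  have swap : ∀ n : ℕ, ∫ x in Icc (-(n : ℝ)) n, hilb ε f x =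
      ∫ s, f s * ∫ x in Icc (-(n : ℝ)) n, (hKer ε (x - s) : ℂ) := by
    intro n
    unfold hilb
    rw [integral_integral_swap]
    · simp_rw [integral_const_mul]
    · have h1 : Integrable (fun q : ℝ × ℝ => (1 : ℂ) * f q.2)
          ((volume.restrict (Icc (-(n : ℝ)) n)).prod volume) :=
        (integrable_const (1 : ℂ)).mul_prod hf.integrable
      have h2 := h1.mul_bdd (g := fun q : ℝ × ℝ => (hKer ε (q.1 - q.2) : ℂ)) (c := 1 / ε)
        (by fun_prop : Measurable fun q : ℝ × ℝ =>
          (hKer ε (q.1 - q.2) : ℂ)).aestronglyMeasurable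
        (Eventually.of_forall fun q => norm_ofReal_hKer_le hε _)
      simpa only [one_mul] using! h2
  have hbound : ∀ᶠ n : ℕ in atTop, ‖∫ x in Icc (-(n : ℝ)) n, hilb ε f x‖ ≤
      (∫ s, ‖f s‖) * (2 * |S| / (n - |S|)) := by
    have : ∀ᶠ n : ℕ in atTop, |S| + ε < n :=
      tendsto_natCast_atTop_atTop.eventually_gt_atTop _
    filter_upwards [this] with n hn
    rw [swap]
    have hn' : 0 < (n : ℝ) - |S| := by linarith
    refine norm_integral_le_of_norm_le (hf.integrable.norm.mul_const (2 * |S| / (n - |S|)))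
      (Eventually.of_forall fun s => ?_) |>.trans ?_
    · rw [norm_mul]
      by_cases hs : |s| ≤ |S|
      · gcongr
        exact norm_integral_hKer_le hs hn hε
      · rw [hS s ((le_abs_self S).trans_lt (not_le.1 hs))]
        simp
    · rw [integral_mul_const]
  refine squeeze_zero_norm' hbound ?_
  rw [← mul_zero (∫ s, ‖f s‖)]
  apply Tendsto.const_mul
  apply Tendsto.const_div_atTop
  exact tendsto_atTop_add_const_right _ _ tendsto_natCast_atTop_atTop

/-- Young's inequality for the error term in `sq_enorm_hilb_le`. -/
lemma lpn_bumpMajorant_conv_le {ε : ℝ} (hε : 0 < ε) {p : ℝ} (hp : 1 ≤ p) {f : ℝ → ℂ}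
    (hf : Measurable f) :
    lpn p volume (fun x => 32 * ∫⁻ s, bumpMajorant ε (x - s) * ‖f s‖ₑ ^ 2) ≤
      256 * lpn (2 * p) volume (fun s => ‖f s‖ₑ) ^ 2 := by
  have hm : Measurable fun q : ℝ × ℝ => bumpMajorant ε (q.1 - q.2) * ‖f q.2‖ₑ ^ 2 :=
    ((measurable_bumpMajorant ε).comp (by fun_prop)).mul (by fun_prop)
  rw [lpn_const_mul (by linarith) _ hm.lintegral_prod_right'.aemeasurable]
  have h := lpn_convolution_le' hp (F := fun s => ‖f s‖ₑ ^ 2) (K := bumpMajorant ε) (by fun_prop)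
    (measurable_bumpMajorant ε)
  rw [lintegral_bumpMajorant hε, lpn_sq] at h
  calc _ ≤ 32 * (8 * lpn (2 * p) volume (fun s => ‖f s‖ₑ) ^ 2) := by gcongr
    _ = _ := by rw [← mul_assoc]; norm_num

/-- The truncated Hilbert transforms are bounded on `L^p`, uniformly in the truncation. -/
def HilbBounded (p : ℝ) : Prop :=
  ∃ C : ℝ≥0∞, C ≠ ⊤ ∧ ∀ ε : ℝ, 0 < ε → ∀ f : ℝ → ℂ, IsBddSupp f →
    lpn p volume (fun x => ‖hilb ε f x‖ₑ) ≤ C * lpn p volume (fun x => ‖f x‖ₑ)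

/-- The `L²` bound. Cotlar's identity for the pair `f`, `conj f` is integrated over `[-n, n]`: the
two Hilbert transforms on its right-hand side have integrals that tend to zero, and the error is
integrable with norm at most `256 ‖f‖₂²`. -/
lemma hilbBounded_two : HilbBounded 2 := by
  refine ⟨16, by norm_num, fun ε hε f hf => ?_⟩
  set W : ℝ → ℂ := fun s => f s * hilb ε (fun y => conj (f y)) s with hW
  set W' : ℝ → ℂ := fun s => conj (f s) * hilb ε f s with hW'
  have nW : IsBddSupp W := hf.mul_hilb hf.conjugate hε
  have nW' : IsBddSupp W' := hf.conjugate.mul_hilb hf hε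
  have hc : ∀ z : ℂ, ‖conj z‖ₑ = ‖z‖ₑ := fun z => by
    rw [← ofReal_norm, Complex.norm_conj, ofReal_norm]
  have iI : ∀ (g : ℝ → ℂ), IsBddSupp g → ∀ n : ℕ,
      Integrable (hilb ε g) (volume.restrict (Icc (-(n : ℝ)) n)) := fun g hg n =>
    Measure.integrableOn_of_bounded (by simp) (measurable_hilb hg.meas).aestronglyMeasurable
      (ae_of_all _ (norm_hilb_le hε hg.integrable))
  have step : ∀ n : ℕ, ∫⁻ x in Icc (-(n : ℝ)) n, ‖hilb ε f x‖ₑ ^ (2 : ℝ) ≤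
      ‖∫ x in Icc (-(n : ℝ)) n, hilb ε W x‖ₑ + ‖∫ x in Icc (-(n : ℝ)) n, hilb ε W' x‖ₑ +
        256 * lpn 2 volume (fun s => ‖f s‖ₑ) ^ 2 := by
    intro n
    set I := volume.restrict (Icc (-(n : ℝ)) n)
    set err : ℝ → ℂ := fun x => hilb ε f x * hilb ε (fun y => conj (f y)) x -
      hilb ε W x - hilb ε W' x with herr
    have iff : Integrable (fun x => hilb ε f x * hilb ε (fun y => conj (f y)) x) I :=
      (iI f hf n).mul_bdd (c := (∫ s, ‖conj (f s)‖) * (1 / ε))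
        (measurable_hilb hf.conjugate.meas).aestronglyMeasurable
        (ae_of_all _ (norm_hilb_le hε hf.conjugate.integrable))
    have ierr : Integrable err I := (iff.sub (iI W nW n)).sub (iI W' nW' n)
    have e1 : ∫⁻ x, ‖hilb ε f x‖ₑ ^ (2 : ℝ) ∂I =
        ‖∫ x, hilb ε f x * hilb ε (fun y => conj (f y)) x ∂I‖ₑ := by
      have : ∀ x, hilb ε f x * hilb ε (fun y => conj (f y)) x = ((‖hilb ε f x‖ ^ 2 : ℝ) : ℂ) := by
        intro x
        rw [hilb_conj, Complex.mul_conj, Complex.normSq_eq_norm_sq]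
      simp_rw [this] at iff ⊢
      have hr : Integrable (fun x => ‖hilb ε f x‖ ^ 2) I := by
        simpa only [RCLike.re_to_complex, Complex.ofReal_re] using iff.re
      rw [integral_complex_ofReal, ← ofReal_norm, Complex.norm_real, Real.norm_of_nonneg
        (integral_nonneg fun x => by positivity), ofReal_integral_eq_lintegral_ofReal hr
        (ae_of_all _ fun x => by positivity)]
      congr 1 with x
      rw [ENNReal.ofReal_pow (norm_nonneg _), ofReal_norm]
      norm_num
    have e2 : ∫ x, hilb ε f x * hilb ε (fun y => conj (f y)) x ∂I =
        ∫ x, hilb ε W x ∂I + ∫ x, hilb ε W' x ∂I + ∫ x, err x ∂I := by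
      rw [← integral_add (iI W nW n) (iI W' nW' n)]
      have := integral_add ((iI W nW n).add (iI W' nW' n)) ierr
      simp only [Pi.add_apply] at this
      rw [← this]
      congr 1 with x
      simp only [herr]
      ring
    rw [e1, e2]
    refine (enorm_add_le _ _).trans (add_le_add (enorm_add_le _ _) ?_)
    calc ‖∫ x, err x ∂I‖ₑ ≤ ∫⁻ x, ‖err x‖ₑ ∂I := enorm_integral_le_lintegral_enorm _
      _ ≤ ∫⁻ x, ‖err x‖ₑ := setLIntegral_le_lintegral _ _
      _ ≤ ∫⁻ x, 32 * ∫⁻ s, bumpMajorant ε (x - s) * ‖f s‖ₑ ^ 2 := by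
          refine lintegral_mono fun x => ?_
          have h := hilb_mul_hilb hf hf.conjugate hε x
          have : err x =
              ∫ q : ℝ × ℝ, f q.1 * conj (f q.2) * (cotlarDefect ε (x - q.1) (x - q.2) : ℂ) := by
            simp only [herr, hW, hW']
            rw [h, add_assoc, add_sub_cancel_left, add_sub_cancel_left]
          rw [this]
          exact enorm_integral_cotlarDefect_le hf.meas (fun s => hc _) hε x
      _ ≤ _ := by
          have := lpn_bumpMajorant_conv_le hε le_rfl hf.meas
          simpa [lpn] using this
  have lim : Tendsto (fun n : ℕ => ‖∫ x in Icc (-(n : ℝ)) n, hilb ε W x‖ₑ +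
      ‖∫ x in Icc (-(n : ℝ)) n, hilb ε W' x‖ₑ + 256 * lpn 2 volume (fun s => ‖f s‖ₑ) ^ 2) atTop
      (𝓝 (0 + 0 + 256 * lpn 2 volume (fun s => ‖f s‖ₑ) ^ 2)) := by
    refine (Tendsto.add ?_ ?_).add tendsto_const_nhds
    · simpa using (tendsto_integral_hilb nW hε).enorm
    · simpa using (tendsto_integral_hilb nW' hε).enorm
  have lim2 : Tendsto (fun n : ℕ => ∫⁻ x in Icc (-(n : ℝ)) n, ‖hilb ε f x‖ₑ ^ (2 : ℝ)) atTop
      (𝓝 (∫⁻ x, ‖hilb ε f x‖ₑ ^ (2 : ℝ))) := by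
    have hmono : Monotone fun n : ℕ => Icc (-(n : ℝ)) n := by
      intro m n hmn
      have : (m : ℝ) ≤ n := by exact_mod_cast hmn
      exact Icc_subset_Icc (by linarith) this
    have hU : ⋃ n : ℕ, Icc (-(n : ℝ)) n = univ := by
      ext x
      obtain ⟨n, hn⟩ := exists_nat_ge |x|
      simp only [mem_iUnion, mem_Icc, mem_univ, iff_true]
      exact ⟨n, abs_le.1 hn⟩
    have := setLIntegral_iUnion_of_directed (μ := volume) (fun x => ‖hilb ε f x‖ₑ ^ (2 : ℝ))
      (directed_of_isDirected_le hmono)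
    rw [hU, Measure.restrict_univ] at this
    rw [this]
    exact tendsto_atTop_iSup fun m n hmn => lintegral_mono_set (hmono hmn)
  have fin := le_of_tendsto_of_tendsto' lim2 lim step
  rw [zero_add, zero_add, ← lpn_rpow two_pos] at fin
  have h16 : (256 : ℝ≥0∞) * lpn 2 volume (fun s => ‖f s‖ₑ) ^ 2 =
      (16 * lpn 2 volume (fun s => ‖f s‖ₑ)) ^ (2 : ℝ) := by
    rw [ENNReal.rpow_two, mul_pow]; norm_num
  rw [h16] at fin
  exact (ENNReal.rpow_le_rpow_iff two_pos).1 fin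

/-- Cotlar's bootstrap. With `X = ‖H f‖_{2p}` and `Y = ‖f‖_{2p}`, the pointwise identity and the
bound on `L^p` give `X² ≤ 2 C X Y + 256 Y²`; as `X` is finite, this bounds `X` by a multiple of `Y`.
-/
lemma HilbBounded.two_mul {p : ℝ} (hp : 1 < p) (h : HilbBounded p) : HilbBounded (2 * p) := by
  obtain ⟨C, hC, hb⟩ := h
  refine ⟨2 * C + 256, by finiteness, fun ε hε f hf => ?_⟩
  set X := lpn (2 * p) volume (fun x => ‖hilb ε f x‖ₑ) with hX
  set Y := lpn (2 * p) volume (fun x => ‖f x‖ₑ) with hY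
  have hXfin : X ≠ ⊤ := hf.lpn_hilb_ne_top hε (by linarith)
  set W : ℝ → ℂ := fun s => f s * hilb ε (fun y => conj (f y)) s with hW
  have nW : IsBddSupp W := hf.mul_hilb hf.conjugate hε
  have hc : ∀ z : ℂ, ‖conj z‖ₑ = ‖z‖ₑ := fun z => by
    rw [← ofReal_norm, Complex.norm_conj, ofReal_norm]
  have mH := (measurable_hilb (ε := ε) hf.meas).enorm
  -- the `L^p` norm of `f · conj (H f)` is at most `Y X`
  have key : X ^ 2 ≤ 2 * (C * (Y * X)) + 256 * Y ^ 2 := by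
    rw [hX, ← lpn_sq]
    refine (lpn_mono (by linarith) (ae_of_all _ (sq_enorm_hilb_le hf hε))).trans ?_
    have hfm := hf.meas
    have hm : Measurable fun q : ℝ × ℝ => bumpMajorant ε (q.1 - q.2) * ‖f q.2‖ₑ ^ 2 :=
      ((measurable_bumpMajorant ε).comp (by fun_prop)).mul (by fun_prop)
    have mW := (measurable_hilb (ε := ε) nW.meas).enorm
    refine (lpn_add_le hp.le (mW.const_mul _).aemeasurable
      (hm.lintegral_prod_right'.const_mul _).aemeasurable).trans ?_
    refine add_le_add ?_ (lpn_bumpMajorant_conv_le hε hp.le hf.meas)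
    rw [lpn_const_mul (by linarith) _ mW.aemeasurable]
    gcongr
    refine (hb ε hε W nW).trans ?_
    gcongr
    have : ∀ x, ‖W x‖ₑ = ‖f x‖ₑ * ‖hilb ε f x‖ₑ := fun x => by
      rw [hW, enorm_mul, hilb_conj, hc]
    simp_rw [this]
    exact lpn_mul_le (by linarith) hf.meas.enorm mH
  by_contra hcon
  push Not at hcon
  -- otherwise `X > (2 C + 256) Y`, and replacing one factor `Y` by `X` in the error term
  -- contradicts `key`
  have h1 : Y ≤ X := by
    refine le_trans ?_ hcon.le
    calc Y = 1 * Y := (one_mul _).symm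
      _ ≤ _ := by
          gcongr
          exact le_add_left (by norm_num)
  have h0 : X ≠ 0 := fun h => by rw [h] at hcon; exact not_lt_zero hcon
  have : X ^ 2 < X ^ 2 := by
    calc X ^ 2 ≤ 2 * (C * (Y * X)) + 256 * Y ^ 2 := key
      _ ≤ 2 * (C * (Y * X)) + 256 * (Y * X) := by rw [sq]; gcongr
      _ = (2 * C + 256) * Y * X := by ring
      _ < X * X := (ENNReal.mul_lt_mul_iff_left h0 hXfin).2 hcon
      _ = X ^ 2 := (sq X).symm
  exact lt_irrefl _ this

end hilbertLp

/-! ### M. Riesz's theorem -/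

section hilbertAllP

/-- Marcinkiewicz interpolation for an operator that is bounded on `L^{p₀}` and on `L^{p₁}`:
`F` stands for `|T f|`, while `F₀ s` and `F₁ s` stand for `|T (f 1_{|f| > c s})|` and
`|T (f 1_{|f| ≤ c s})|`. -/
lemma lpn_le_of_interpolation {α β : Type*} [MeasurableSpace α] [MeasurableSpace β]
    {μ : Measure α} {ν : Measure β} [SFinite μ] [SFinite ν] {p₀ p p₁ : ℝ} (h0 : 0 < p₀)
    (h01 : p₀ < p) (h11 : p < p₁) {f : α → ℂ} (hf : Measurable f) {F : β → ℝ≥0∞}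
    (hF : Measurable F) {F₀ F₁ : ℝ → β → ℝ≥0∞} (hF₀ : ∀ s, Measurable (F₀ s))
    (hF₁ : ∀ s, Measurable (F₁ s)) {c : ℝ} (hc : 0 < c)
    (hsub : ∀ s, 0 < s → ∀ᵐ x ∂ν, F x ≤ F₀ s x + F₁ s x) {B₀ B₁ : ℝ≥0∞}
    (hB₀ : ∀ s, 0 < s → lpn p₀ ν (F₀ s) ≤
      B₀ * lpn p₀ μ (fun a => ‖{a | c * s < ‖f a‖}.indicator f a‖ₑ))
    (hB₁ : ∀ s, 0 < s → lpn p₁ ν (F₁ s) ≤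
      B₁ * lpn p₁ μ (fun a => ‖{a | ‖f a‖ ≤ c * s}.indicator f a‖ₑ)) :
    lpn p ν F ≤ (B₀ ^ p₀ * ENNReal.ofReal (2 ^ p₀ * (p / (p - p₀) * c ^ (p₀ - p))) +
      B₁ ^ p₁ * ENNReal.ofReal (2 ^ p₁ * (p / (p₁ - p) * c ^ (p₁ - p)))) ^ (1 / p) *
        lpn p μ (fun a => ‖f a‖ₑ) := by
  have hp : 0 < p := h0.trans h01
  have hp₁ : 0 < p₁ := hp.trans h11
  have cheb : ∀ (G : β → ℝ≥0∞) (q : ℝ), Measurable G → 0 < q → ∀ s : ℝ, 0 < s →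
      ν {x | ENNReal.ofReal (s / 2) < G x} ≤ ENNReal.ofReal (2 ^ q * s ^ (-q)) * lpn q ν G ^ q := by
    intro G q hG hq s hs
    rw [lpn_rpow hq]
    have h1 : ν {x | ENNReal.ofReal (s / 2) < G x} ≤
        ν {x | ENNReal.ofReal ((s / 2) ^ q) ≤ G x ^ q} := by
      refine measure_mono fun x hx => ?_
      simp only [mem_ofPred_eq] at hx ⊢
      rw [← ENNReal.ofReal_rpow_of_pos (by positivity)]
      exact ENNReal.rpow_le_rpow hx.le hq.le
    refine h1.trans ((meas_ge_le_lintegral_div (hG.pow_const q).aemeasurable (by simp; positivity)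
      (by simp)).trans (le_of_eq ?_))
    rw [div_eq_mul_inv, mul_comm, ← ENNReal.ofReal_inv_of_pos (by positivity)]
    congr 2
    rw [Real.div_rpow hs.le (by norm_num), Real.rpow_neg hs.le, inv_div, div_eq_mul_inv]
  have key := lintegral_rpow_le_of_distribution (μ := μ) (ν := ν) h0 h01 h11 (f := fun a => ‖f a‖₊)
    hf.nnnorm hF (A₀ := B₀ ^ p₀ * ENNReal.ofReal (2 ^ p₀))
    (A₁ := B₁ ^ p₁ * ENNReal.ofReal (2 ^ p₁)) hc ?_
  · have e : ∀ a, ((‖f a‖₊ : NNReal) : ℝ≥0∞) = ‖f a‖ₑ := fun a => rfl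
    simp_rw [e] at key
    rw [mul_assoc, mul_assoc, ← ENNReal.ofReal_mul (by positivity),
      ← ENNReal.ofReal_mul (by positivity)] at key
    unfold lpn
    rw [← ENNReal.mul_rpow_of_nonneg _ _ (by positivity)]
    exact ENNReal.rpow_le_rpow key (by positivity)
  · intro s hs
    have hsplit : ν {x | ENNReal.ofReal s < F x} ≤ ν {x | ENNReal.ofReal (s / 2) < F₀ s x} +
        ν {x | ENNReal.ofReal (s / 2) < F₁ s x} := by
      refine le_trans (measure_mono_ae ?_) (measure_union_le _ _)
      filter_upwards [hsub s hs] with x hx hxs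
      have hxs : ENNReal.ofReal s < F x := hxs
      by_contra hcon
      change ¬ (ENNReal.ofReal (s / 2) < F₀ s x ∨ ENNReal.ofReal (s / 2) < F₁ s x) at hcon
      push Not at hcon
      refine absurd hxs (not_lt.2 (hx.trans ((add_le_add hcon.1 hcon.2).trans ?_)))
      rw [← ENNReal.ofReal_add (by positivity) (by positivity), add_halves]
    refine hsplit.trans (add_le_add ?_ ?_)
    · refine (cheb _ p₀ (hF₀ s) h0 s hs).trans ?_
      calc _ ≤ ENNReal.ofReal (2 ^ p₀ * s ^ (-p₀)) *
            (B₀ * lpn p₀ μ (fun a => ‖{a | c * s < ‖f a‖}.indicator f a‖ₑ)) ^ p₀ := by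
            gcongr; exact hB₀ s hs
        _ = _ := by
            rw [ENNReal.mul_rpow_of_nonneg _ _ h0.le, lpn_rpow h0,
              ENNReal.ofReal_mul (by positivity)]
            have : ∀ a, ‖{a | c * s < ‖f a‖}.indicator f a‖ₑ ^ p₀ =
                {a | c * s < (‖f a‖₊ : ℝ)}.indicator (fun a => ((‖f a‖₊ : NNReal) : ℝ≥0∞) ^ p₀) a := by
              intro a
              by_cases ha : c * s < ‖f a‖
              · rw [indicator_of_mem (by exact ha), indicator_of_mem (by exact ha)]; rfl
              · rw [indicator_of_notMem (by exact ha), indicator_of_notMem (by exact ha)]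
                simp [h0]
            simp_rw [this]
            ring
    · refine (cheb _ p₁ (hF₁ s) hp₁ s hs).trans ?_
      calc _ ≤ ENNReal.ofReal (2 ^ p₁ * s ^ (-p₁)) *
            (B₁ * lpn p₁ μ (fun a => ‖{a | ‖f a‖ ≤ c * s}.indicator f a‖ₑ)) ^ p₁ := by
            gcongr; exact hB₁ s hs
        _ = _ := by
            rw [ENNReal.mul_rpow_of_nonneg _ _ hp₁.le, lpn_rpow hp₁,
              ENNReal.ofReal_mul (by positivity)]
            have : ∀ a, ‖{a | ‖f a‖ ≤ c * s}.indicator f a‖ₑ ^ p₁ =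
                {a | (‖f a‖₊ : ℝ) ≤ c * s}.indicator (fun a => ((‖f a‖₊ : NNReal) : ℝ≥0∞) ^ p₁) a := by
              intro a
              by_cases ha : ‖f a‖ ≤ c * s
              · rw [indicator_of_mem (by exact ha), indicator_of_mem (by exact ha)]; rfl
              · rw [indicator_of_notMem (by exact ha), indicator_of_notMem (by exact ha)]
                simp [hp₁]
            simp_rw [this]
            ring

lemma hilb_add {ε : ℝ} (hε : 0 < ε) {f g : ℝ → ℂ} (hf : Integrable f) (hg : Integrable g) (x : ℝ) :
    hilb ε (fun y => f y + g y) x = hilb ε f x + hilb ε g x := by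
  unfold hilb
  rw [← integral_add (integrable_mul_hKer hε hf x) (integrable_mul_hKer hε hg x)]
  congr 1 with s
  ring

lemma HilbBounded.interpolate {p₀ p p₁ : ℝ} (h0 : 0 < p₀) (h01 : p₀ < p) (h11 : p < p₁)
    (h₀ : HilbBounded p₀) (h₁ : HilbBounded p₁) : HilbBounded p := by
  obtain ⟨C₀, hC₀, hb₀⟩ := h₀
  obtain ⟨C₁, hC₁, hb₁⟩ := h₁
  have hp : 0 < p := h0.trans h01
  refine ⟨_, ?_, fun ε hε f hf => lpn_le_of_interpolation h0 h01 h11 hf.meas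
    (measurable_hilb hf.meas).enorm (c := 1) (B₀ := C₀) (B₁ := C₁)
    (F₀ := fun s x => ‖hilb ε ({a | 1 * s < ‖f a‖}.indicator f) x‖ₑ)
    (F₁ := fun s x => ‖hilb ε ({a | ‖f a‖ ≤ 1 * s}.indicator f) x‖ₑ) ?_ ?_ one_pos ?_ ?_ ?_⟩
  · refine ENNReal.rpow_ne_top_of_nonneg (by positivity) (ENNReal.add_ne_top.2 ⟨?_, ?_⟩)
    · exact ENNReal.mul_ne_top (ENNReal.rpow_ne_top_of_nonneg h0.le hC₀) ENNReal.ofReal_ne_top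
    · exact ENNReal.mul_ne_top (ENNReal.rpow_ne_top_of_nonneg (hp.trans h11).le hC₁)
        ENNReal.ofReal_ne_top
  all_goals
    have m0 : ∀ s : ℝ, MeasurableSet {a | 1 * s < ‖f a‖} := fun s =>
      measurableSet_lt measurable_const hf.meas.norm
    have m1 : ∀ s : ℝ, MeasurableSet {a | ‖f a‖ ≤ 1 * s} := fun s =>
      measurableSet_le hf.meas.norm measurable_const
  · exact fun s => (measurable_hilb (hf.indicator (m0 s)).meas).enorm
  · exact fun s => (measurable_hilb (hf.indicator (m1 s)).meas).enorm
  · refine fun s hs => ae_of_all _ fun x => ?_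
    refine le_trans (le_of_eq ?_) (enorm_add_le _ _)
    rw [← hilb_add hε (hf.indicator (m0 s)).integrable (hf.indicator (m1 s)).integrable]
    congr 2 with y
    by_cases hy : 1 * s < ‖f y‖
    · rw [indicator_of_mem (by exact hy), indicator_of_notMem (by exact not_le.2 hy), add_zero]
    · rw [indicator_of_notMem (by exact hy), indicator_of_mem (by exact not_lt.1 hy), zero_add]
  · exact fun s hs => hb₀ ε hε _ (hf.indicator (m0 s))
  · exact fun s hs => hb₁ ε hε _ (hf.indicator (m1 s))

/-- Exponents `2ⁿ` come from repeated doubling, the others from interpolation. -/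
lemma hilbBounded_of_two_le {p : ℝ} (hp : 2 ≤ p) : HilbBounded p := by
  have hpow : ∀ n : ℕ, HilbBounded (2 ^ (n + 1)) := by
    intro n
    induction n with
    | zero => simpa using hilbBounded_two
    | succ n ih =>
      have := ih.two_mul (one_lt_pow₀ one_lt_two (by omega))
      rwa [← pow_succ'] at this
  rcases hp.eq_or_lt with rfl | hp
  · exact hilbBounded_two
  obtain ⟨n, hn⟩ := pow_unbounded_of_one_lt p (one_lt_two : (1 : ℝ) < 2)
  refine HilbBounded.interpolate two_pos hp (hn.trans ?_) hilbBounded_two (hpow n)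
  exact pow_lt_pow_right₀ one_lt_two (by omega)

/-- The truncated Hilbert transform is skew-symmetric, its kernel being odd. -/
lemma integral_hilb_mul {f g : ℝ → ℂ} (hf : IsBddSupp f) (hg : IsBddSupp g) {ε : ℝ} (hε : 0 < ε) :
    ∫ x, hilb ε f x * g x = -∫ x, f x * hilb ε g x := by
  have hi : Integrable (fun q : ℝ × ℝ => g q.1 * f q.2 * (hKer ε (q.1 - q.2) : ℂ))
      (volume.prod volume) :=
    (hg.integrable.mul_prod hf.integrable).mul_bdd (c := 1 / ε)
      (by fun_prop : Measurable fun q : ℝ × ℝ => (hKer ε (q.1 - q.2) : ℂ)).aestronglyMeasurable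
      (Eventually.of_forall fun q => norm_ofReal_hKer_le hε _)
  calc ∫ x, hilb ε f x * g x = ∫ x, ∫ s, g x * f s * (hKer ε (x - s) : ℂ) := by
        congr 1 with x
        unfold hilb
        rw [mul_comm, ← integral_const_mul]
        congr 1 with s
        ring
    _ = ∫ s, ∫ x, g x * f s * (hKer ε (x - s) : ℂ) := integral_integral_swap hi
    _ = _ := by
        rw [← integral_neg]
        congr 1 with s
        unfold hilb
        rw [← integral_const_mul, ← integral_neg]
        congr 1 with x
        rw [show x - s = -(s - x) by ring, hKer_neg]
        push_cast
        ring

/-- The bound on `L^q` passes to the dual exponent by skew-symmetry. -/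
lemma HilbBounded.dual {p q : ℝ} (hpq : p.HolderConjugate q) (h : HilbBounded q) :
    HilbBounded p := by
  obtain ⟨C, hC, hb⟩ := h
  refine ⟨C, hC, fun ε hε f hf => ?_⟩
  have mH := measurable_hilb (ε := ε) hf.meas
  have hmono : Monotone fun n : ℕ => Icc (-(n : ℝ)) n := by
    intro m n hmn
    have : (m : ℝ) ≤ n := by exact_mod_cast hmn
    exact Icc_subset_Icc (by linarith) this
  have hU : ⋃ n : ℕ, Icc (-(n : ℝ)) n = univ := by
    ext x
    obtain ⟨n, hn⟩ := exists_nat_ge |x|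
    simp only [mem_iUnion, mem_Icc, mem_univ, iff_true]
    exact ⟨n, abs_le.1 hn⟩
  refine lpn_le_of_dual hpq (fun n => measurableSet_Icc) hmono hU (fun n => by simp) mH.enorm
    fun n G hG hGb hGs => ?_
  obtain ⟨c, hc, hGc⟩ := hGb
  -- the test function that realizes the modulus of `hilb ε f`
  set g : ℝ → ℂ := fun x => (G x).toReal * (conj (hilb ε f x) / ‖hilb ε f x‖) with hg
  have hGtop : ∀ x, G x ≠ ⊤ := fun x => ne_top_of_le_ne_top hc (hGc x)
  have hone : ∀ z : ℂ, ‖conj z / (‖z‖ : ℂ)‖ ≤ 1 := by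
    intro z
    rw [norm_div, Complex.norm_conj, Complex.norm_real, norm_norm]
    exact div_self_le_one _
  have gle : ∀ x, ‖g x‖ ≤ (G x).toReal := by
    intro x
    rw [hg, norm_mul, Complex.norm_real, Real.norm_of_nonneg ENNReal.toReal_nonneg]
    exact mul_le_of_le_one_right ENNReal.toReal_nonneg (hone _)
  have ng : IsBddSupp g := by
    refine ⟨?_, ⟨c.toReal, fun x => (gle x).trans (ENNReal.toReal_mono hc (hGc x))⟩,
      ⟨n, fun x hx => ?_⟩⟩
    · exact (Complex.measurable_ofReal.comp hG.ennreal_toReal).mul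
        ((Complex.continuous_conj.measurable.comp mH).div
          (Complex.measurable_ofReal.comp mH.norm))
    · have : G x = 0 := hGs x fun hx' => absurd hx (not_lt.2 (abs_le.2 hx'))
      simp [hg, this]
  have e : ∀ x, hilb ε f x * g x = ((‖hilb ε f x‖ * (G x).toReal : ℝ) : ℂ) := by
    intro x
    have h1 : hilb ε f x * conj (hilb ε f x) = ((‖hilb ε f x‖ ^ 2 : ℝ) : ℂ) := by
      rw [Complex.mul_conj, Complex.normSq_eq_norm_sq]
    by_cases h0 : hilb ε f x = 0
    · simp [hg, h0]
    · have hn : (‖hilb ε f x‖ : ℂ) ≠ 0 := by simpa using h0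
      simp only [hg]
      push_cast at h1 ⊢
      field_simp
      linear_combination (G x).toReal * h1
  have hint : Integrable (fun x => hilb ε f x * g x) := by
    simpa only [mul_comm] using ng.integrable.mul_bdd (c := (∫ s, ‖f s‖) * (1 / ε))
      mH.aestronglyMeasurable (ae_of_all _ (norm_hilb_le hε hf.integrable))
  have e2 : ∫⁻ x, ‖hilb ε f x‖ₑ * G x = ‖∫ x, hilb ε f x * g x‖ₑ := by
    simp_rw [e] at hint ⊢
    have hr : Integrable (fun x => ‖hilb ε f x‖ * (G x).toReal) := by
      simpa only [RCLike.re_to_complex, Complex.ofReal_re] using hint.re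
    rw [integral_complex_ofReal, ← ofReal_norm, Complex.norm_real, Real.norm_of_nonneg
      (integral_nonneg fun x => by positivity), ofReal_integral_eq_lintegral_ofReal hr
      (ae_of_all _ fun x => by positivity)]
    congr 1 with x
    rw [ENNReal.ofReal_mul (norm_nonneg _), ofReal_norm, ENNReal.ofReal_toReal (hGtop x)]
  rw [e2, integral_hilb_mul hf ng hε, enorm_neg]
  calc _ ≤ ∫⁻ x, ‖f x‖ₑ * ‖hilb ε g x‖ₑ := by
        refine (enorm_integral_le_lintegral_enorm _).trans (le_of_eq ?_)
        congr 1 with x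
        rw [enorm_mul]
    _ ≤ lpn p volume (fun x => ‖f x‖ₑ) * lpn q volume (fun x => ‖hilb ε g x‖ₑ) :=
        lintegral_mul_le_lpn hpq hf.meas.enorm.aemeasurable
          (measurable_hilb ng.meas).enorm.aemeasurable
    _ ≤ lpn p volume (fun x => ‖f x‖ₑ) * (C * lpn q volume G) := by
        gcongr
        refine (hb ε hε g ng).trans ?_
        gcongr
        refine lpn_mono hpq.symm.pos (ae_of_all _ fun x => ?_)
        rw [← ofReal_norm, ← ENNReal.ofReal_toReal (hGtop x)]
        exact ENNReal.ofReal_le_ofReal (gle x)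
    _ = _ := by ring

/-- **M. Riesz's theorem** for truncated Hilbert transforms. -/
lemma hilbBounded {p : ℝ} (hp : 1 < p) : HilbBounded p := by
  rcases le_or_gt 2 p with h | h
  · exact hilbBounded_of_two_le h
  · have hpq := Real.HolderConjugate.conjExponent hp
    refine (hilbBounded_of_two_le ?_).dual hpq
    unfold Real.conjExponent
    rw [le_div_iff₀ (by linarith)]
    linarith

lemma lintegral_mul_hKer_lt_top {p : ℝ} (hp : 1 < p) {f : ℝ → ℂ} (hf : Measurable f)
    (hfp : lpn p volume (fun x => ‖f x‖ₑ) ≠ ⊤) {ε : ℝ} (hε : 0 < ε) (x : ℝ) :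
    ∫⁻ s, ‖hKer ε (x - s)‖ₑ * ‖f s‖ₑ < ⊤ := by
  have hpq := Real.HolderConjugate.conjExponent hp
  have hm : Measurable fun s => ‖hKer ε (x - s)‖ₑ := by fun_prop
  refine (lintegral_mul_le_lpn hpq.symm (F := fun s => ‖hKer ε (x - s)‖ₑ) hm.aemeasurable
    hf.enorm.aemeasurable).trans_lt (ENNReal.mul_lt_top ?_ hfp.lt_top)
  · rw [lpn_comp_sub_left (fun t => ‖hKer ε t‖ₑ)]
    exact (lpn_hKer_ne_top hε hpq.symm.lt).lt_top

lemma integrable_mul_hKer_of_lpn {p : ℝ} (hp : 1 < p) {f : ℝ → ℂ} (hf : Measurable f)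
    (hfp : lpn p volume (fun x => ‖f x‖ₑ) ≠ ⊤) {ε : ℝ} (hε : 0 < ε) (x : ℝ) :
    Integrable fun s => f s * (hKer ε (x - s) : ℂ) := by
  have hm : Measurable fun s => f s * (hKer ε (x - s) : ℂ) := by fun_prop
  refine ⟨hm.aestronglyMeasurable, ?_⟩
  rw [HasFiniteIntegral]
  convert lintegral_mul_hKer_lt_top hp hf hfp hε x using 3 with s
  rw [enorm_mul, mul_comm]
  congr 1
  rw [← ofReal_norm, Complex.norm_real, ofReal_norm]

/-- The bound for truncated Hilbert transforms extends from bounded functions with bounded support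
to all of `L^p`. -/
lemma exists_lpn_hilb_le {p : ℝ} (hp : 1 < p) : ∃ C : ℝ≥0∞, C ≠ ⊤ ∧ ∀ ε : ℝ, 0 < ε →
    ∀ f : ℝ → ℂ, Measurable f →
      lpn p volume (fun x => ‖hilb ε f x‖ₑ) ≤ C * lpn p volume (fun x => ‖f x‖ₑ) := by
  obtain ⟨C, hC, hb⟩ := hilbBounded hp
  refine ⟨C + 1, by finiteness, fun ε hε f hf => ?_⟩
  have hp0 : 0 < p := by linarith
  by_cases hfp : lpn p volume (fun x => ‖f x‖ₑ) = ⊤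
  · rw [hfp, ENNReal.mul_top (by simp)]; exact le_top
  set A : ℕ → Set ℝ := fun n => {x | ‖f x‖ ≤ n ∧ |x| ≤ n} with hA
  have mA : ∀ n, MeasurableSet (A n) := fun n =>
    (measurableSet_le hf.norm measurable_const).inter (measurableSet_le
      continuous_abs.measurable measurable_const)
  have nA : ∀ n, IsBddSupp ((A n).indicator f) := by
    intro n
    refine ⟨hf.indicator (mA n), ⟨n, fun x => ?_⟩, ⟨n, fun x hx => ?_⟩⟩
    · by_cases h : x ∈ A n
      · rw [indicator_of_mem h]; exact h.1
      · rw [indicator_of_notMem h]; simp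
    · exact indicator_of_notMem (fun h => absurd hx (not_lt.2 h.2)) _
  refine lpn_liminf_le hp0 (F := fun n x => ‖hilb ε ((A n).indicator f) x‖ₑ)
    (fun n => (measurable_hilb (nA n).meas).enorm) (ae_of_all _ fun x => ?_) fun n => ?_
  · refine Tendsto.enorm ?_
    unfold hilb
    refine tendsto_integral_of_dominated_convergence (fun s => ‖f s * (hKer ε (x - s) : ℂ)‖)
      (fun n => ?_) (integrable_mul_hKer_of_lpn hp hf hfp hε x).norm (fun n => ?_) ?_
    · have := (nA n).meas
      exact (by fun_prop : Measurable fun s =>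
        (A n).indicator f s * (hKer ε (x - s) : ℂ)).aestronglyMeasurable
    · refine ae_of_all _ fun s => ?_
      rw [norm_mul, norm_mul]
      gcongr
      exact norm_indicator_le_norm_self _ _
    · refine ae_of_all _ fun s => ?_
      apply tendsto_const_nhds.congr'
      obtain ⟨n₀, hn₀⟩ := exists_nat_ge (max ‖f s‖ |s|)
      filter_upwards [eventually_ge_atTop n₀] with n hn
      have hn : (n₀ : ℝ) ≤ n := by exact_mod_cast hn
      rw [indicator_of_mem]
      exact ⟨(le_max_left _ _).trans (hn₀.trans hn), (le_max_right _ _).trans (hn₀.trans hn)⟩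
  · refine (hb ε hε _ (nA n)).trans ?_
    gcongr
    · exact le_self_add
    · exact lpn_mono hp0 (ae_of_all _ fun x => by
        rw [← ofReal_norm, ← ofReal_norm]
        exact ENNReal.ofReal_le_ofReal (norm_indicator_le_norm_self _ _))

end hilbertAllP

/-! ### The maximal truncated Hilbert transform -/

section hilbertMaximal

lemma lpn_rpow_fun {α : Type*} [MeasurableSpace α] {μ : Measure α} {p r : ℝ} (hp : p ≠ 0)
    (hr : r ≠ 0) (F : α → ℝ≥0∞) :
    lpn p μ (fun x => F x ^ r) = lpn (r * p) μ F ^ r := by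
  unfold lpn
  simp_rw [← ENNReal.rpow_mul]
  congr 1
  field_simp

/-- **Cotlar's inequality**: a truncated Hilbert transform is controlled by maximal functions, with
a less truncated Hilbert transform under one of them. -/
lemma exists_cotlar_inequality {q : ℝ} (hq : 1 < q) : ∃ C : ℝ≥0∞, C ≠ ⊤ ∧ ∀ p : ℝ, 1 < p →
    ∀ f : ℝ → ℂ, Measurable f → lpn p volume (fun x => ‖f x‖ₑ) ≠ ⊤ →
    ∀ δ ε : ℝ, 0 < δ → δ ≤ ε / 2 → ∀ x : ℝ, ‖hilb ε f x‖ₑ ≤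
      hlMax (fun y => ‖hilb δ f y‖ₑ) x + C * hlMax (fun y => ‖f y‖ₑ ^ q) x ^ (1 / q) +
        8 * hlMax (fun y => ‖f y‖ₑ) x := by
  obtain ⟨C, hC, hb⟩ := exists_lpn_hilb_le hq
  refine ⟨4 * C, by finiteness, fun p hp f hf hfp δ ε hδ hδε x => ?_⟩
  have hε : 0 < ε := by linarith
  have hq0 : 0 < q := by linarith
  -- `f = f₁ + f₂` with `f₁` supported in `B(x, ε)`; the average over `y ∈ B(x, ε / 4)` of the
  -- decomposition `H_ε f (x) = H_δ f (y) - H_δ f₁ (y) + (H_ε f (x) - H_δ f₂ (y))` gives the three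
  -- terms
  set B := Metric.closedBall x ε with hB
  have mB : MeasurableSet B := Metric.isClosed_closedBall.measurableSet
  set f₁ := B.indicator f with hf₁
  set f₂ := Bᶜ.indicator f with hf₂
  have mf₁ : Measurable f₁ := hf.indicator mB
  have mf₂ : Measurable f₂ := hf.indicator mB.compl
  have hp0 : 0 < p := by linarith
  have le_f : ∀ A : Set ℝ, lpn p volume (fun x => ‖A.indicator f x‖ₑ) ≠ ⊤ := fun A =>
    ne_top_of_le_ne_top hfp (lpn_mono hp0 (ae_of_all _ fun x => by
        rw [← ofReal_norm, ← ofReal_norm]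
        exact ENNReal.ofReal_le_ofReal (norm_indicator_le_norm_self _ _)))
  have mem : ∀ s, s ∈ B ↔ |x - s| ≤ ε := fun s => by
    rw [hB, Metric.mem_closedBall, Real.dist_eq, abs_sub_comm]
  -- off `B(x, ε)` the kernels at `x` and at `y` differ by `O(ε / |x - s|²)`, and neither is
  -- truncated because `δ ≤ ε / 2`
  have far : ∀ y ∈ Metric.closedBall x (ε / 4),
      ‖hilb ε f x - hilb δ f₂ y‖ₑ ≤ 8 * hlMax (fun y => ‖f y‖ₑ) x := by
    intro y hy
    have hy : |y - x| ≤ ε / 4 := by simpa [Real.dist_eq] using hy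
    unfold hilb
    rw [← integral_sub (integrable_mul_hKer_of_lpn hp hf hfp hε x)
      (integrable_mul_hKer_of_lpn hp mf₂ (le_f _) hδ y)]
    refine (enorm_integral_le_lintegral_enorm _).trans
      (le_trans (lintegral_mono fun s => ?_) (lintegral_bumpMajorant_mul_le hε hf.enorm x))
    simp only
    by_cases hs : s ∈ B
    · rw [hf₂, indicator_of_notMem (by simpa using hs), hKer_of_le ((mem s).1 hs)]
      simp
    · have h1 : ε < |x - s| := not_le.1 fun h => hs ((mem s).2 h)
      have h2 : 3 / 4 * |x - s| ≤ |y - s| := by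
        have := abs_sub_abs_le_abs_sub (x - s) (x - y)
        rw [show x - s - (x - y) = y - s by ring, abs_sub_comm x y] at this
        linarith
      have h3 : 0 < |x - s| := hε.trans h1
      have h4 : 0 < |y - s| := by linarith
      rw [hf₂, indicator_of_mem (by simpa using hs), ← mul_sub, enorm_mul, mul_comm]
      gcongr
      refine le_trans ?_ (le_bumpMajorant_of_lt hε h1)
      rw [hKer_of_lt h1, hKer_of_lt (by linarith), ← ofReal_norm]
      apply ENNReal.ofReal_le_ofReal
      rw [← Complex.ofReal_sub, Complex.norm_real, Real.norm_eq_abs,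
        div_sub_div _ _ (abs_pos.1 h3) (abs_pos.1 h4), abs_div, abs_mul, ← sq_abs (x - s),
        show 1 * (y - s) - (x - s) * 1 = y - x by ring, div_le_div_iff₀ (by positivity)
        (by positivity)]
      have : |x - s| * |x - s| ≤ 4 / 3 * (|x - s| * |y - s|) := by nlinarith
      calc |y - x| * |x - s| ^ 2 ≤ ε / 4 * (4 / 3 * (|x - s| * |y - s|)) := by
            rw [sq]; gcongr
        _ ≤ _ := by nlinarith [mul_pos hε (mul_pos h3 h4)]
  have split : ∀ y, hilb δ f y = hilb δ f₁ y + hilb δ f₂ y := by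
    intro y
    unfold hilb
    rw [← integral_add (integrable_mul_hKer_of_lpn hp mf₁ (le_f _) hδ y)
      (integrable_mul_hKer_of_lpn hp mf₂ (le_f _) hδ y)]
    congr 1 with s
    rw [← add_mul, hf₁, hf₂, indicator_self_add_compl_apply]
  have pt : ∀ y ∈ Metric.closedBall x (ε / 4), ‖hilb ε f x‖ₑ ≤
      ‖hilb δ f y‖ₑ + ‖hilb δ f₁ y‖ₑ + 8 * hlMax (fun y => ‖f y‖ₑ) x := by
    intro y hy
    have : hilb ε f x = hilb δ f y - hilb δ f₁ y + (hilb ε f x - hilb δ f₂ y) := by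
      rw [split]; ring
    rw [this]
    exact (enorm_add_le _ _).trans (add_le_add (enorm_sub_le) (far y hy))
  -- Hölder's inequality and the `L^q` bound for `H_δ`
  have I1 : ∫⁻ y in Metric.closedBall x (ε / 4), ‖hilb δ f₁ y‖ₑ ≤
      ENNReal.ofReal (ε / 2) * (4 * C * hlMax (fun y => ‖f y‖ₑ ^ q) x ^ (1 / q)) := by
    have hpq := Real.HolderConjugate.conjExponent hq
    have hold := lintegral_mul_le_lpn (μ := volume) hpq (F := fun y => ‖hilb δ f₁ y‖ₑ)
      (G := (Metric.closedBall x (ε / 4)).indicator fun _ => 1)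
      (measurable_hilb mf₁).enorm.aemeasurable
      (measurable_const.indicator Metric.isClosed_closedBall.measurableSet).aemeasurable
    have e1 : ∫⁻ y, ‖hilb δ f₁ y‖ₑ * (Metric.closedBall x (ε / 4)).indicator (fun _ => 1) y =
        ∫⁻ y in Metric.closedBall x (ε / 4), ‖hilb δ f₁ y‖ₑ := by
      rw [← lintegral_indicator Metric.isClosed_closedBall.measurableSet]
      congr 1 with y
      by_cases hy : y ∈ Metric.closedBall x (ε / 4)
      · simp [indicator_of_mem hy]
      · simp [indicator_of_notMem hy]
    have e2 : lpn (Real.conjExponent q) volume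
        ((Metric.closedBall x (ε / 4)).indicator fun _ => 1) =
        ENNReal.ofReal (ε / 2) ^ (1 / Real.conjExponent q) := by
      unfold lpn
      have : ∀ y, (Metric.closedBall x (ε / 4)).indicator (fun _ => (1 : ℝ≥0∞)) y ^
          Real.conjExponent q = (Metric.closedBall x (ε / 4)).indicator (fun _ => (1 : ℝ≥0∞)) y := by
        intro y
        by_cases hy : y ∈ Metric.closedBall x (ε / 4)
        · simp [indicator_of_mem hy]
        · simp [indicator_of_notMem hy, hpq.symm.pos]
      simp_rw [this]
      rw [lintegral_indicator Metric.isClosed_closedBall.measurableSet, setLIntegral_const, one_mul,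
        Real.volume_closedBall]
      congr 2; ring
    have e3 : lpn q volume (fun y => ‖f₁ y‖ₑ) ≤
        (ENNReal.ofReal (2 * ε) * hlMax (fun y => ‖f y‖ₑ ^ q) x) ^ (1 / q) := by
      unfold lpn
      apply ENNReal.rpow_le_rpow _ (by positivity)
      refine le_trans (le_of_eq ?_) (lintegral_closedBall_le_hlMax _ x hε)
      rw [← lintegral_indicator mB]
      congr 1 with y
      by_cases hy : y ∈ B
      · simp only [hf₁, indicator_of_mem hy]
      · simp only [hf₁, indicator_of_notMem hy]
        simp [hq0]
    rw [e1, e2] at hold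
    refine hold.trans ?_
    have h4 : ENNReal.ofReal (2 * ε) = 4 * ENNReal.ofReal (ε / 2) := by
      rw [show (4 : ℝ≥0∞) = ENNReal.ofReal 4 by norm_num, ← ENNReal.ofReal_mul (by norm_num)]
      congr 1; ring
    have h4' : (4 : ℝ≥0∞) ^ (1 / q) ≤ 4 := by
      calc (4 : ℝ≥0∞) ^ (1 / q) ≤ 4 ^ (1 : ℝ) :=
            ENNReal.rpow_le_rpow_of_exponent_le (by norm_num) (by
              rw [div_le_one hq0]; exact hq.le)
        _ = 4 := ENNReal.rpow_one _
    have hsplit : ENNReal.ofReal (ε / 2) ^ (1 / q) *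
        ENNReal.ofReal (ε / 2) ^ (1 / Real.conjExponent q) = ENNReal.ofReal (ε / 2) := by
      rw [← ENNReal.rpow_add _ _ (by simpa using hε) (by simp), one_div, one_div,
        hpq.inv_add_inv_eq_one, ENNReal.rpow_one]
    set H := hlMax (fun y => ‖f y‖ₑ ^ q) x
    calc _ ≤ C * (ENNReal.ofReal (2 * ε) * H) ^ (1 / q) *
          ENNReal.ofReal (ε / 2) ^ (1 / Real.conjExponent q) := by
          gcongr
          refine (hb δ hδ f₁ mf₁).trans ?_
          gcongr
      _ = 4 ^ (1 / q) * (ENNReal.ofReal (ε / 2) ^ (1 / q) *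
            ENNReal.ofReal (ε / 2) ^ (1 / Real.conjExponent q)) * (C * H ^ (1 / q)) := by
          rw [h4, ENNReal.mul_rpow_of_nonneg _ _ (by positivity),
            ENNReal.mul_rpow_of_nonneg _ _ (by positivity)]
          ring
      _ ≤ 4 * ENNReal.ofReal (ε / 2) * (C * H ^ (1 / q)) := by
          rw [hsplit]; gcongr
      _ = _ := by ring
  have hvol : volume (Metric.closedBall x (ε / 4)) = ENNReal.ofReal (ε / 2) := by
    rw [Real.volume_closedBall]; congr 1; ring
  have avg : ENNReal.ofReal (ε / 2) * ‖hilb ε f x‖ₑ ≤ ENNReal.ofReal (ε / 2) *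
      (hlMax (fun y => ‖hilb δ f y‖ₑ) x + 4 * C * hlMax (fun y => ‖f y‖ₑ ^ q) x ^ (1 / q) +
        8 * hlMax (fun y => ‖f y‖ₑ) x) := by
    calc ENNReal.ofReal (ε / 2) * ‖hilb ε f x‖ₑ =
          ∫⁻ _ in Metric.closedBall x (ε / 4), ‖hilb ε f x‖ₑ := by
          rw [setLIntegral_const, hvol, mul_comm]
      _ ≤ ∫⁻ y in Metric.closedBall x (ε / 4), (‖hilb δ f y‖ₑ + ‖hilb δ f₁ y‖ₑ +
            8 * hlMax (fun y => ‖f y‖ₑ) x) :=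
          setLIntegral_mono' Metric.isClosed_closedBall.measurableSet pt
      _ = (∫⁻ y in Metric.closedBall x (ε / 4), ‖hilb δ f y‖ₑ) +
            (∫⁻ y in Metric.closedBall x (ε / 4), ‖hilb δ f₁ y‖ₑ) +
            8 * hlMax (fun y => ‖f y‖ₑ) x * ENNReal.ofReal (ε / 2) := by
          rw [lintegral_add_right _ measurable_const, lintegral_add_right _
            (measurable_hilb mf₁).enorm, setLIntegral_const, hvol]
      _ ≤ ENNReal.ofReal (ε / 2) * hlMax (fun y => ‖hilb δ f y‖ₑ) x +
            ENNReal.ofReal (ε / 2) * (4 * C * hlMax (fun y => ‖f y‖ₑ ^ q) x ^ (1 / q)) +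
            8 * hlMax (fun y => ‖f y‖ₑ) x * ENNReal.ofReal (ε / 2) := by
          gcongr
          have := lintegral_closedBall_le_hlMax (fun y => ‖hilb δ f y‖ₑ) x
            (show 0 < ε / 4 by positivity)
          rwa [show 2 * (ε / 4) = ε / 2 by ring] at this
      _ = _ := by ring
  exact (ENNReal.mul_le_mul_iff_right (by simpa using hε) (by simp)).1 avg

/-- The maximal truncated Hilbert transform. Only rational truncations enter, so that measurability
is immediate. -/
noncomputable def hilbMax (f : ℝ → ℂ) (x : ℝ) : ℝ≥0∞ :=
  ⨆ n : ℕ, ⨆ r : {r : ℚ // 1 / (n + 1 : ℝ) ≤ r}, ‖hilb (r : ℚ) f x‖ₑ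

lemma enorm_hilb_le_hilbMax {p : ℝ} (hp : 1 < p) {f : ℝ → ℂ} (hf : Measurable f)
    (hfp : lpn p volume (fun x => ‖f x‖ₑ) ≠ ⊤) {ε : ℝ} (hε : 0 < ε) (x : ℝ) :
    ‖hilb ε f x‖ₑ ≤ hilbMax f x := by
  have hr : ∀ n : ℕ, ∃ r : ℚ, ε < r ∧ (r : ℝ) < ε + 1 / (n + 1) := fun n =>
    exists_rat_btwn (lt_add_of_pos_right _ (by positivity))
  choose r hr1 hr2 using hr
  have hlim : Tendsto (fun n => (r n : ℝ)) atTop (𝓝 ε) := by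
    refine tendsto_of_tendsto_of_tendsto_of_le_of_le tendsto_const_nhds ?_ (fun n => (hr1 n).le)
      (fun n => (hr2 n).le)
    simpa using tendsto_const_nhds.add (tendsto_one_div_add_atTop_nhds_zero_nat (𝕜 := ℝ))
  have key : Tendsto (fun n => ‖hilb (r n) f x‖ₑ) atTop (𝓝 ‖hilb ε f x‖ₑ) := by
    refine Tendsto.enorm ?_
    unfold hilb
    refine tendsto_integral_of_dominated_convergence (fun s => ‖f s * (hKer ε (x - s) : ℂ)‖)
      (fun n => ?_) (integrable_mul_hKer_of_lpn hp hf hfp hε x).norm (fun n => ?_) ?_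
    · have hm : Measurable fun s => f s * (hKer (r n) (x - s) : ℂ) := by fun_prop
      exact hm.aestronglyMeasurable
    · refine ae_of_all _ fun s => ?_
      rw [norm_mul, norm_mul]
      gcongr
      by_cases h : (r n : ℝ) < |x - s|
      · rw [hKer_of_lt h, hKer_of_lt ((hr1 n).trans h)]
      · rw [hKer_of_le (not_lt.1 h)]; simp
    · refine ae_of_all _ fun s => ?_
      apply tendsto_const_nhds.congr'
      by_cases h : ε < |x - s|
      · filter_upwards [hlim.eventually_lt_const h] with n hn
        rw [hKer_of_lt h, hKer_of_lt hn]
      · refine Eventually.of_forall fun n => ?_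
        simp only [hKer_of_le (not_lt.1 h), hKer_of_le ((not_lt.1 h).trans (hr1 n).le)]
  refine le_of_tendsto' key fun n => ?_
  obtain ⟨m, hm⟩ := exists_nat_one_div_lt hε
  exact le_iSup_of_le m (le_iSup_of_le ⟨r n, (hm.trans (hr1 n)).le⟩ le_rfl)

/-- The maximal truncated Hilbert transform is bounded on `L^p`. -/
lemma exists_lpn_hilbMax_le {p : ℝ} (hp : 1 < p) : ∃ C : ℝ≥0∞, C ≠ ⊤ ∧
    ∀ f : ℝ → ℂ, Measurable f →
      lpn p volume (hilbMax f) ≤ C * lpn p volume (fun x => ‖f x‖ₑ) := by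
  -- an exponent strictly between `1` and `p`, so that the maximal function of `|f| ^ q` is bounded
  -- on `L^{p/q}`
  set q := (1 + p) / 2 with hqdef
  have hq : 1 < q := by rw [hqdef]; linarith
  have hqp : q < p := by rw [hqdef]; linarith
  have hq0 : 0 < q := by linarith
  have hp0 : 0 < p := by linarith
  have hpq : 1 < 1 / q * p := by rw [one_div_mul_eq_div, one_lt_div hq0]; exact hqp
  obtain ⟨A, hA, hcot⟩ := exists_cotlar_inequality hq
  obtain ⟨B, hB, hbd⟩ := exists_lpn_hilb_le hp
  have f1 := hlConst_ne_top hp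
  have f2 := ENNReal.rpow_ne_top_of_nonneg (by positivity : 0 ≤ 1 / q) (hlConst_ne_top hpq)
  refine ⟨hlConst p * B + A * hlConst (1 / q * p) ^ (1 / q) + 8 * hlConst p + 1, by finiteness,
    fun f hf => ?_⟩
  by_cases hfp : lpn p volume (fun x => ‖f x‖ₑ) = ⊤
  · rw [hfp, ENNReal.mul_top (by simp)]; exact le_top
  refine lpn_iSup_le hp0 (fun n => Measurable.iSup fun _ => (measurable_hilb hf).enorm) ?_ fun n => ?_
  · intro m n hmn x
    refine iSup_le fun r => ?_
    have hr := r.2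
    have hmn' : (m : ℝ) ≤ n := by exact_mod_cast hmn
    exact le_iSup (fun r : {r : ℚ // 1 / (n + 1 : ℝ) ≤ r} => ‖hilb (r : ℚ) f x‖ₑ)
      ⟨r, le_trans (by gcongr) hr⟩
  -- one inner truncation serves all truncations `≥ 1 / (n + 1)` in Cotlar's inequality
  · set δ : ℝ := 1 / (n + 1) / 2 with hδ
    have hδ0 : 0 < δ := by positivity
    have mH := (measurable_hilb (ε := δ) hf).enorm
    have m1 := measurable_hlMax mH
    have m2 := measurable_hlMax (hf.enorm.pow_const q)
    have m3 := measurable_hlMax hf.enorm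
    calc _ ≤ lpn p volume (fun x => hlMax (fun y => ‖hilb δ f y‖ₑ) x +
          A * hlMax (fun y => ‖f y‖ₑ ^ q) x ^ (1 / q) + 8 * hlMax (fun y => ‖f y‖ₑ) x) := by
          refine lpn_mono hp0 (ae_of_all _ fun x => iSup_le fun r => ?_)
          have hr := r.2
          exact hcot p hp f hf hfp δ r hδ0 (by rw [hδ]; linarith) x
      _ ≤ lpn p volume (hlMax (fun y => ‖hilb δ f y‖ₑ)) +
          A * lpn p volume (fun x => hlMax (fun y => ‖f y‖ₑ ^ q) x ^ (1 / q)) +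
          8 * lpn p volume (hlMax (fun y => ‖f y‖ₑ)) := by
          refine (lpn_add_le hp.le (m1.add ((m2.pow_const _).const_mul _)).aemeasurable
            (m3.const_mul _).aemeasurable).trans ?_
          refine add_le_add ?_ (lpn_const_mul hp0 _ m3.aemeasurable).le
          exact (lpn_add_le hp.le m1.aemeasurable
            ((m2.pow_const _).const_mul _).aemeasurable).trans
            (add_le_add le_rfl (lpn_const_mul hp0 _ (m2.pow_const _).aemeasurable).le)
      _ ≤ hlConst p * (B * lpn p volume (fun x => ‖f x‖ₑ)) +
          A * (hlConst (1 / q * p) ^ (1 / q) * lpn p volume (fun x => ‖f x‖ₑ)) +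
          8 * (hlConst p * lpn p volume (fun x => ‖f x‖ₑ)) := by
          refine add_le_add (add_le_add ?_ (mul_le_mul' le_rfl ?_)) (mul_le_mul' le_rfl ?_)
          · refine (lpn_hlMax_le hp mH).trans ?_
            gcongr
            exact hbd δ hδ0 f hf
          · rw [lpn_rpow_fun hp0.ne' (by positivity)]
            have h := lpn_hlMax_le hpq (hf.enorm.pow_const q)
            rw [lpn_rpow_fun (by positivity) hq0.ne', ← mul_assoc, mul_one_div_cancel hq0.ne',
              one_mul] at h
            refine (ENNReal.rpow_le_rpow h (by positivity)).trans (le_of_eq ?_)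
            rw [ENNReal.mul_rpow_of_nonneg _ _ (by positivity), ← ENNReal.rpow_mul,
              mul_one_div_cancel hq0.ne', ENNReal.rpow_one]
          · exact lpn_hlMax_le hp hf.enorm
      _ = (hlConst p * B + A * hlConst (1 / q * p) ^ (1 / q) + 8 * hlConst p) *
          lpn p volume (fun x => ‖f x‖ₑ) := by ring
      _ ≤ _ := mul_le_mul' le_self_add le_rfl

end hilbertMaximal

/-! ### A van der Corput estimate without Fourier analysis -/

section vanDerCorput

variable {a b : ℝ} {θ θ₁ θ₂ : ℝ → ℝ} {m : ℝ}

lemma continuousOn_of_hasDerivAt {f f' : ℝ → ℝ} {s : Set ℝ} (h : ∀ t ∈ s, HasDerivAt f (f' t) t) :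
    ContinuousOn f s := fun t ht => (h t ht).continuousAt.continuousWithinAt

/-- Where `θ''` has constant sign, `arctan (θ' / m) / m` is an antiderivative of the integrand up to
sign. -/
lemma integral_abs_div_le_of_sign (hab : a ≤ b) (hm : 0 < m)
    (h : ∀ t ∈ Icc a b, HasDerivAt θ₁ (θ₂ t) t) (hc : ContinuousOn θ₂ (Icc a b))
    (hs : (∀ t ∈ Ioo a b, 0 ≤ θ₂ t) ∨ ∀ t ∈ Ioo a b, θ₂ t ≤ 0) :
    ∫ t in a..b, |θ₂ t| / (θ₁ t ^ 2 + m ^ 2) ≤ Real.pi / m := by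
  have hD : ∀ t, 0 < θ₁ t ^ 2 + m ^ 2 := fun t => by positivity
  have c1 := continuousOn_of_hasDerivAt h
  have hder : ∀ t ∈ uIcc a b, HasDerivAt (fun t => Real.arctan (θ₁ t / m) / m)
      (θ₂ t / (θ₁ t ^ 2 + m ^ 2)) t := by
    intro t ht
    rw [uIcc_of_le hab] at ht
    refine ((((h t ht).div_const m).arctan).div_const m).congr_deriv ?_
    have := (hD t).ne'
    have h2 : 1 + (θ₁ t / m) ^ 2 = (θ₁ t ^ 2 + m ^ 2) / m ^ 2 := by field_simp; ring
    rw [h2]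
    field_simp
  have i1 : IntervalIntegrable (fun t => θ₂ t / (θ₁ t ^ 2 + m ^ 2)) volume a b := by
    apply ContinuousOn.intervalIntegrable
    rw [uIcc_of_le hab]
    exact hc.div (by fun_prop) fun t _ => (hD t).ne'
  have i2 : IntervalIntegrable (fun t => |θ₂ t| / (θ₁ t ^ 2 + m ^ 2)) volume a b := by
    apply ContinuousOn.intervalIntegrable
    rw [uIcc_of_le hab]
    exact hc.abs.div (by fun_prop) fun t _ => (hD t).ne'
  have ftc := intervalIntegral.integral_eq_sub_of_hasDerivAt hder i1
  have bd : ∀ x y : ℝ, Real.arctan x / m - Real.arctan y / m ≤ Real.pi / m := by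
    intro x y
    rw [← sub_div]
    gcongr
    linarith [Real.arctan_lt_pi_div_two x, Real.neg_pi_div_two_lt_arctan y]
  rcases hs with hs | hs
  · refine le_trans ?_ (ftc.trans_le (bd _ _))
    refine intervalIntegral.integral_mono_on_of_le_Ioo hab i2 i1 fun t ht => ?_
    rw [abs_of_nonneg (hs t ht)]
  · have : ∫ t in a..b, |θ₂ t| / (θ₁ t ^ 2 + m ^ 2) ≤ ∫ t in a..b, -(θ₂ t / (θ₁ t ^ 2 + m ^ 2)) := by
      refine intervalIntegral.integral_mono_on_of_le_Ioo hab i2 i1.neg fun t ht => ?_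
      rw [abs_of_nonpos (hs t ht), neg_div]
    rw [intervalIntegral.integral_neg, ftc, neg_sub] at this
    exact this.trans (bd _ _)

/-- If `θ''` changes sign at most once, then `θ''/(θ'² + m²)` is absolutely integrable with a bound
that depends on `m` only. -/
lemma integral_abs_div_le (hab : a ≤ b) (hm : 0 < m)
    (h : ∀ t ∈ Icc a b, HasDerivAt θ₁ (θ₂ t) t) (hc : ContinuousOn θ₂ (Icc a b))
    {P H : ℝ → ℝ} (hP : ∀ t ∈ Icc a b, 0 < P t) (hH : MonotoneOn H (Icc a b) ∨ AntitoneOn H (Icc a b))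
    (hPH : ∀ t ∈ Icc a b, θ₂ t = P t * H t) :
    ∫ t in a..b, |θ₂ t| / (θ₁ t ^ 2 + m ^ 2) ≤ 2 * (Real.pi / m) := by
  wlog hmono : MonotoneOn H (Icc a b) generalizing θ₁ θ₂ H
  · have hanti : AntitoneOn H (Icc a b) := hH.resolve_left hmono
    have := this (θ₁ := fun t => -θ₁ t) (θ₂ := fun t => -θ₂ t) (H := fun t => -H t)
      (fun t ht => (h t ht).neg) hc.neg (Or.inl hanti.neg)
      (fun t ht => by rw [hPH t ht]; ring) hanti.neg
    simpa using this
  -- `c = sup S` is the point at which the sign of `θ''` changes; the point `a` is added so that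
  -- `S` is not empty
  set S : Set ℝ := {t ∈ Icc a b | H t < 0} ∪ {a} with hS
  have hSb : ∀ t ∈ S, t ≤ b := by
    rintro t (ht | rfl)
    · exact ht.1.2
    · exact hab
  have hne : S.Nonempty := ⟨a, Or.inr rfl⟩
  have hbd : BddAbove S := ⟨b, hSb⟩
  set c := sSup S with hcdef
  have hac : a ≤ c := le_csSup hbd (Or.inr rfl)
  have hcb : c ≤ b := csSup_le hne hSb
  have hneg : ∀ t ∈ Ioo a c, θ₂ t ≤ 0 := by
    intro t ht
    obtain ⟨t', ht', htt'⟩ := exists_lt_of_lt_csSup hne ht.2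
    have htI : t ∈ Icc a b := ⟨ht.1.le, ht.2.le.trans hcb⟩
    rcases ht' with ht' | rfl
    · rw [hPH t htI]
      exact mul_nonpos_of_nonneg_of_nonpos (hP t htI).le
        ((hmono htI ht'.1 htt'.le).trans ht'.2.le)
    · exact absurd ht.1 (not_lt.2 htt'.le)
  have hpos : ∀ t ∈ Ioo c b, 0 ≤ θ₂ t := by
    intro t ht
    have htI : t ∈ Icc a b := ⟨hac.trans ht.1.le, ht.2.le⟩
    rw [hPH t htI]
    refine mul_nonneg (hP t htI).le (not_lt.1 fun hlt => ?_)
    exact absurd ht.1 (not_lt.2 (le_csSup hbd (Or.inl ⟨htI, hlt⟩)))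
  have hsub1 : Icc a c ⊆ Icc a b := Icc_subset_Icc_right hcb
  have hsub2 : Icc c b ⊆ Icc a b := Icc_subset_Icc_left hac
  have hD : ∀ t, 0 < θ₁ t ^ 2 + m ^ 2 := fun t => by positivity
  have c1 := continuousOn_of_hasDerivAt h
  have cc : ContinuousOn (fun t => |θ₂ t| / (θ₁ t ^ 2 + m ^ 2)) (Icc a b) :=
    hc.abs.div (by fun_prop) fun t _ => (hD t).ne'
  rw [← intervalIntegral.integral_add_adjacent_intervals (b := c)
    ((cc.mono hsub1).intervalIntegrable_of_Icc hac) ((cc.mono hsub2).intervalIntegrable_of_Icc hcb),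
    two_mul]
  exact add_le_add
    (integral_abs_div_le_of_sign hac hm (fun t ht => h t (hsub1 ht)) (hc.mono hsub1) (Or.inr hneg))
    (integral_abs_div_le_of_sign hcb hm (fun t ht => h t (hsub2 ht)) (hc.mono hsub2) (Or.inl hpos))

lemma abs_div_sq_add_sq_le (hm : 0 < m) (x : ℝ) : |x| / (x ^ 2 + m ^ 2) ≤ 1 / (2 * m) := by
  rw [div_le_div_iff₀ (by positivity) (by positivity), ← sq_abs x]
  nlinarith [sq_nonneg (|x| - m)]

/-- A van der Corput estimate in which the oscillating factor `e^{iθ}` is replaced by translates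
`κ(ζ - θ)` of the derivative `κ = Q'` of an integrable function, measured in `L¹` of the translation
variable `ζ`. The integrand is split with the weight `1 = θ'²/(θ'² + m²) + m²/(θ'² + m²)`: the first
part is integrated by parts, the second is small on account of the lower bound for
`β |θ'| + ρ |θ''|`. -/
lemma lintegral_enorm_integral_comp_le (hab : a ≤ b) (hm : 0 < m)
    (h₀ : ∀ t ∈ Icc a b, HasDerivAt θ (θ₁ t) t)
    (h₁ : ∀ t ∈ Icc a b, HasDerivAt θ₁ (θ₂ t) t) (hc : ContinuousOn θ₂ (Icc a b))
    {P H : ℝ → ℝ} (hP : ∀ t ∈ Icc a b, 0 < P t) (hH : MonotoneOn H (Icc a b) ∨ AntitoneOn H (Icc a b))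
    (hPH : ∀ t ∈ Icc a b, θ₂ t = P t * H t)
    {w w₁ : ℝ → ℝ} (hw : ∀ t ∈ Icc a b, HasDerivAt w (w₁ t) t) (hwc : ContinuousOn w₁ (Icc a b))
    (hw0 : ∀ t ∈ Icc a b, 0 ≤ w t) (hw1 : ∀ t ∈ Icc a b, w₁ t ≤ 0) {M : ℝ}
    (hwM : ∀ t ∈ Icc a b, w t ≤ M)
    {κ Q : ℝ → ℂ} (hκ : Continuous κ) (hQ : ∀ z, HasDerivAt Q (κ z) z) {B₀ B₁ : ℝ≥0∞}
    (hB₀ : ∫⁻ z, ‖κ z‖ₑ ≤ B₀) (hB₁ : ∫⁻ z, ‖Q z‖ₑ ≤ B₁)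
    {α β ρ : ℝ} (hα : 0 < α) (hβ : 0 ≤ β) (hρ : b - a ≤ ρ)
    (hlow : ∀ t ∈ Icc a b, α ≤ β * |θ₁ t| + ρ * |θ₂ t|) :
    ∫⁻ ζ, ‖∫ t in a..b, κ (ζ - θ t) * (w t : ℂ)‖ₑ ≤
      B₁ * ENNReal.ofReal (M * (9 / m)) + B₀ * ENNReal.ofReal (M * (m * ρ / α * (β + 7))) := by
  have hM : 0 ≤ M := (hw0 a (left_mem_Icc.2 hab)).trans (hwM a (left_mem_Icc.2 hab))
  have hρ0 : 0 ≤ ρ := (sub_nonneg.2 hab).trans hρ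
  have hD : ∀ t, 0 < θ₁ t ^ 2 + m ^ 2 := fun t => by positivity
  have cθ := continuousOn_of_hasDerivAt h₀
  have cθ₁ := continuousOn_of_hasDerivAt h₁
  have cw := continuousOn_of_hasDerivAt hw
  have cQ : Continuous Q := continuous_iff_continuousAt.2 fun z => (hQ z).continuousAt
  have hpi : Real.pi ≤ 3.5 := by linarith [Real.pi_lt_d2]
  set D : ℝ → ℝ := fun t => θ₁ t ^ 2 + m ^ 2 with hDdef
  set u : ℝ → ℝ := fun t => w t * θ₁ t / D t with hu
  set u₁ : ℝ → ℝ := fun t => ((w₁ t * θ₁ t + w t * θ₂ t) * D t - w t * θ₁ t * (2 * θ₁ t * θ₂ t)) /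
    D t ^ 2 with hu₁
  set v : ℝ → ℝ := fun t => w t * (m ^ 2 / D t) with hv
  have cD : ContinuousOn D (Icc a b) := by simp only [hDdef]; fun_prop
  have cu₁ : ContinuousOn u₁ (Icc a b) :=
    ContinuousOn.div (by fun_prop) (by fun_prop) fun t _ => (pow_pos (hD t) 2).ne'
  have cv : ContinuousOn v (Icc a b) :=
    cw.mul (ContinuousOn.div (by fun_prop) (by fun_prop) fun t _ => (hD t).ne')
  have hud : ∀ t ∈ Icc a b, HasDerivAt u (u₁ t) t := by
    intro t ht
    have hDd : HasDerivAt D (2 * θ₁ t * θ₂ t) t := by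
      refine (((h₁ t ht).pow 2).add_const (m ^ 2)).congr_deriv ?_
      norm_num
    exact ((hw t ht).mul (h₁ t ht)).div hDd (hD t).ne'
  -- pointwise bounds
  have hub : ∀ t ∈ Icc a b, |u t| ≤ M * (1 / (2 * m)) := by
    intro t ht
    simp only [hu]
    rw [mul_div_assoc, abs_mul, abs_div, abs_of_pos (hD t), abs_of_nonneg (hw0 t ht)]
    exact mul_le_mul (hwM t ht) (abs_div_sq_add_sq_le hm _) (by have := hD t; positivity) hM
  -- the amplitude `w` is decreasing, which gives `|w'| = -w'`
  have hu₁b : ∀ t ∈ Icc a b, |u₁ t| ≤ 1 / (2 * m) * (-w₁ t) + M * (|θ₂ t| / D t) := by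
    intro t ht
    have hDt := hD t
    have e : u₁ t = w₁ t * (θ₁ t / D t) + w t * (θ₂ t / D t) * ((m ^ 2 - θ₁ t ^ 2) / D t) := by
      simp only [hu₁]
      field_simp
      simp only [hDdef]
      ring
    have e1 : |(m ^ 2 - θ₁ t ^ 2) / D t| ≤ 1 := by
      rw [abs_div, abs_of_pos hDt, div_le_one hDt, abs_le]
      constructor <;> nlinarith [sq_nonneg (θ₁ t), sq_nonneg m]
    rw [e]
    refine (abs_add_le _ _).trans (add_le_add ?_ ?_)
    · rw [abs_mul, abs_of_nonpos (hw1 t ht), mul_comm, abs_div, abs_of_pos hDt]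
      exact mul_le_mul_of_nonneg_right (abs_div_sq_add_sq_le hm _) (by linarith [hw1 t ht])
    · rw [abs_mul, abs_mul, abs_of_nonneg (hw0 t ht), abs_div (θ₂ t), abs_of_pos hDt]
      refine (mul_le_of_le_one_right (by have := hw0 t ht; positivity) e1).trans ?_
      exact mul_le_mul_of_nonneg_right (hwM t ht) (by positivity)
  -- here the lower bound for `β |θ'| + ρ |θ''|` enters: `1 ≤ (β |θ'| + ρ |θ''|) / α`
  have hvb : ∀ t ∈ Icc a b, v t ≤ M * (m ^ 2 / α * (β * (1 / (2 * m)) + ρ * (|θ₂ t| / D t))) := by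
    intro t ht
    have hDt := hD t
    refine mul_le_mul (hwM t ht) ?_ (by positivity) hM
    have h1 : 1 ≤ (β * |θ₁ t| + ρ * |θ₂ t|) / α := (one_le_div hα).2 (hlow t ht)
    calc m ^ 2 / D t = m ^ 2 / D t * 1 := (mul_one _).symm
      _ ≤ m ^ 2 / D t * ((β * |θ₁ t| + ρ * |θ₂ t|) / α) := by gcongr
      _ = m ^ 2 / α * (β * (|θ₁ t| / D t) + ρ * (|θ₂ t| / D t)) := by field_simp
      _ ≤ _ := by
          have := abs_div_sq_add_sq_le hm (θ₁ t)
          exact mul_le_mul_of_nonneg_left (add_le_add_left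
            (mul_le_mul_of_nonneg_left this hβ) _) (by positivity)
  -- integrated bounds
  have V := integral_abs_div_le hab hm h₁ hc hP hH hPH
  have cV : ContinuousOn (fun t => |θ₂ t| / D t) (Icc a b) :=
    hc.abs.div cD fun t _ => (hD t).ne'
  have iV := cV.intervalIntegrable_of_Icc (μ := volume) hab
  have iw₁ := hwc.intervalIntegrable_of_Icc (μ := volume) hab
  have hV7 : 2 * (Real.pi / m) ≤ 7 / m := by
    rw [mul_div_assoc', div_le_div_iff_of_pos_right hm]; linarith
  have Iu : ∫ t in a..b, |u₁ t| ≤ M * (8 / m) := by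
    calc ∫ t in a..b, |u₁ t| ≤ ∫ t in a..b, (1 / (2 * m) * (-w₁ t) + M * (|θ₂ t| / D t)) := by
          refine intervalIntegral.integral_mono_on hab (cu₁.abs.intervalIntegrable_of_Icc hab) ?_ hu₁b
          exact (iw₁.neg.const_mul _).add (iV.const_mul _)
      _ = 1 / (2 * m) * (w a - w b) + M * ∫ t in a..b, |θ₂ t| / D t := by
          rw [intervalIntegral.integral_add (by exact iw₁.neg.const_mul _) (iV.const_mul _),
            intervalIntegral.integral_const_mul, intervalIntegral.integral_const_mul,
            intervalIntegral.integral_neg, intervalIntegral.integral_eq_sub_of_hasDerivAt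
            (fun t ht => hw t (by rwa [uIcc_of_le hab] at ht)) iw₁, neg_sub]
      _ ≤ 1 / (2 * m) * M + M * (7 / m) := by
          gcongr
          · linarith [hw0 b (right_mem_Icc.2 hab), hwM a (left_mem_Icc.2 hab)]
          · exact V.trans hV7
      _ ≤ M * (8 / m) := by
          have : 1 / (2 * m) ≤ 1 / m := one_div_le_one_div_of_le hm (by linarith)
          calc _ ≤ 1 / m * M + M * (7 / m) := by gcongr
            _ = _ := by ring
  have Iv : ∫ t in a..b, v t ≤ M * (m * ρ / α * (β + 7)) := by
    calc ∫ t in a..b, v t ≤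
          ∫ t in a..b, M * (m ^ 2 / α * (β * (1 / (2 * m)) + ρ * (|θ₂ t| / D t))) := by
          refine intervalIntegral.integral_mono_on hab (cv.intervalIntegrable_of_Icc hab) ?_ hvb
          exact ((intervalIntegrable_const.add (iV.const_mul _)).const_mul _).const_mul _
      _ = M * (m ^ 2 / α * ((b - a) * (β * (1 / (2 * m))) + ρ * ∫ t in a..b, |θ₂ t| / D t)) := by
          rw [intervalIntegral.integral_const_mul, intervalIntegral.integral_const_mul,
            intervalIntegral.integral_add intervalIntegrable_const (iV.const_mul _),
            intervalIntegral.integral_const_mul, intervalIntegral.integral_const_mul,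
            intervalIntegral.integral_const, smul_eq_mul]
          ring
      _ ≤ M * (m ^ 2 / α * (ρ * (β * (1 / m)) + ρ * (7 / m))) := by
          gcongr
          · linarith
          · exact V.trans hV7
      _ = _ := by field_simp
  -- integration by parts
  have ibp : ∀ ζ, ∫ t in a..b, κ (ζ - θ t) * (w t : ℂ) =
      Q (ζ - θ a) * (u a : ℂ) - Q (ζ - θ b) * (u b : ℂ) +
        ∫ t in a..b, (Q (ζ - θ t) * (u₁ t : ℂ) + κ (ζ - θ t) * (v t : ℂ)) := by
    intro ζ
    have cκθ : ContinuousOn (fun t => κ (ζ - θ t)) (Icc a b) := by fun_prop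
    have cQθ : ContinuousOn (fun t => Q (ζ - θ t)) (Icc a b) := by fun_prop
    have j1 : ContinuousOn (fun t => κ (ζ - θ t) * (θ₁ t : ℂ) * (u t : ℂ) -
        Q (ζ - θ t) * (u₁ t : ℂ)) (Icc a b) := by
      have cu := continuousOn_of_hasDerivAt hud
      exact (((cκθ.mul (Complex.continuous_ofReal.comp_continuousOn cθ₁)).mul
        (Complex.continuous_ofReal.comp_continuousOn cu))).sub
        (cQθ.mul (Complex.continuous_ofReal.comp_continuousOn cu₁))
    have j2 : ContinuousOn (fun t => Q (ζ - θ t) * (u₁ t : ℂ) + κ (ζ - θ t) * (v t : ℂ))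
        (Icc a b) :=
      (cQθ.mul (Complex.continuous_ofReal.comp_continuousOn cu₁)).add
        (cκθ.mul (Complex.continuous_ofReal.comp_continuousOn cv))
    have hder : ∀ t ∈ uIcc a b, HasDerivAt (fun t => -(Q (ζ - θ t) * (u t : ℂ)))
        (κ (ζ - θ t) * (θ₁ t : ℂ) * (u t : ℂ) - Q (ζ - θ t) * (u₁ t : ℂ)) t := by
      intro t ht
      rw [uIcc_of_le hab] at ht
      have d1 : HasDerivAt (fun t => Q (ζ - θ t)) (-(κ (ζ - θ t) * (θ₁ t : ℂ))) t := by
        have h1 : HasDerivAt (fun t => ζ - θ t) (-θ₁ t) t := (h₀ t ht).const_sub ζ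
        refine ((hQ (ζ - θ t)).scomp t h1).congr_deriv ?_
        rw [Complex.real_smul]; push_cast; ring
      refine ((d1.mul (hud t ht).ofReal_comp).neg).congr_deriv ?_
      ring
    have ftc := intervalIntegral.integral_eq_sub_of_hasDerivAt hder
      (j1.intervalIntegrable_of_Icc hab)
    have : ∫ t in a..b, κ (ζ - θ t) * (w t : ℂ) = ∫ t in a..b,
        ((κ (ζ - θ t) * (θ₁ t : ℂ) * (u t : ℂ) - Q (ζ - θ t) * (u₁ t : ℂ)) +
          (Q (ζ - θ t) * (u₁ t : ℂ) + κ (ζ - θ t) * (v t : ℂ))) := by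
      congr 1 with t
      have hw' : (w t : ℂ) = (θ₁ t : ℂ) * (u t : ℂ) + (v t : ℂ) := by
        norm_cast
        simp only [hu, hv]
        have := (hD t).ne'
        have e : w t * ((θ₁ t ^ 2 + m ^ 2) / (θ₁ t ^ 2 + m ^ 2)) = w t := by
          rw [div_self this, mul_one]
        linear_combination -e
      rw [hw']; ring
    rw [this, intervalIntegral.integral_add (j1.intervalIntegrable_of_Icc hab)
      (j2.intervalIntegrable_of_Icc hab), ftc]
    ring
  have er : ∀ x : ℝ, ‖(x : ℂ)‖ₑ = ENNReal.ofReal |x| := fun x => by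
    rw [← ofReal_norm, Complex.norm_real, Real.norm_eq_abs]
  have shiftQ : ∀ c : ℝ, ∫⁻ ζ, ‖Q (ζ - c)‖ₑ ≤ B₁ := fun c => by
    rw [lintegral_sub_right_eq_self (fun z => ‖Q z‖ₑ)]; exact hB₁
  have shiftκ : ∀ c : ℝ, ∫⁻ ζ, ‖κ (ζ - c)‖ₑ ≤ B₀ := fun c => by
    rw [lintegral_sub_right_eq_self (fun z => ‖κ z‖ₑ)]; exact hB₀
  -- away from `[a, b]` the data are irrelevant: cut them off to have measurable functions
  set I := volume.restrict (Ioc a b) with hI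
  have mθ : AEMeasurable θ I := (cθ.mono Ioc_subset_Icc_self).aemeasurable measurableSet_Ioc
  have mu₁ : AEMeasurable u₁ I := (cu₁.mono Ioc_subset_Icc_self).aemeasurable measurableSet_Ioc
  have mv : AEMeasurable v I := (cv.mono Ioc_subset_Icc_self).aemeasurable measurableSet_Ioc
  have bd : ∀ ζ, ‖∫ t in a..b, κ (ζ - θ t) * (w t : ℂ)‖ₑ ≤
      ‖Q (ζ - θ a)‖ₑ * ENNReal.ofReal |u a| + ‖Q (ζ - θ b)‖ₑ * ENNReal.ofReal |u b| +
        ∫⁻ t, (‖Q (ζ - θ t)‖ₑ * ENNReal.ofReal |u₁ t| + ‖κ (ζ - θ t)‖ₑ * ENNReal.ofReal |v t|) ∂I := by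
    intro ζ
    rw [ibp ζ]
    refine (enorm_add_le _ _).trans (add_le_add (enorm_sub_le.trans ?_) ?_)
    · rw [enorm_mul, enorm_mul, er, er]
    · rw [intervalIntegral.integral_of_le hab]
      refine (enorm_integral_le_lintegral_enorm _).trans (lintegral_mono fun t => ?_)
      refine (enorm_add_le _ _).trans ?_
      rw [enorm_mul, enorm_mul, er, er]
  have mQ : Measurable fun z => ‖Q z‖ₑ := cQ.measurable.enorm
  have mκ : Measurable fun z => ‖κ z‖ₑ := hκ.measurable.enorm
  have hfub : ∀ (q : ℝ → ℝ≥0∞) (g : ℝ → ℝ) (B : ℝ≥0∞), Measurable q → AEMeasurable g I →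
      (∀ c, ∫⁻ ζ, q (ζ - c) ≤ B) →
      ∫⁻ ζ, ∫⁻ t, q (ζ - θ t) * ENNReal.ofReal |g t| ∂I ≤ B * ∫⁻ t, ENNReal.ofReal |g t| ∂I := by
    intro q g B hq hg hB
    have h1 : AEMeasurable (Function.uncurry fun ζ t => q (ζ - θ t) * ENNReal.ofReal |g t|)
        (volume.prod I) := by
      have mθ2 : AEMeasurable (fun z : ℝ × ℝ => z.1 - θ z.2) (volume.prod I) :=
        measurable_fst.aemeasurable.sub mθ.comp_snd
      have mg2 : AEMeasurable (fun z : ℝ × ℝ => ENNReal.ofReal |g z.2|) (volume.prod I) :=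
        (hg.norm.comp_snd).ennreal_ofReal
      exact (hq.comp_aemeasurable mθ2).mul mg2
    rw [lintegral_lintegral_swap h1, ← lintegral_const_mul'' _ (by exact hg.norm.ennreal_ofReal)]
    refine lintegral_mono fun t => ?_
    simp only
    have hm' : Measurable fun ζ => q (ζ - θ t) := hq.comp (measurable_id.sub_const _)
    rw [lintegral_mul_const _ hm']
    gcongr
    exact hB _
  have toReal : ∀ (g : ℝ → ℝ), ContinuousOn g (Icc a b) → ∫⁻ t, ENNReal.ofReal |g t| ∂I =
      ENNReal.ofReal (∫ t in a..b, |g t|) := by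
    intro g hg
    rw [intervalIntegral.integral_of_le hab, ofReal_integral_eq_lintegral_ofReal]
    · exact (hg.abs.integrableOn_Icc).mono_set Ioc_subset_Icc_self
    · exact ae_of_all _ fun t => abs_nonneg _
  have mQ2 : AEMeasurable (Function.uncurry fun ζ t => ‖Q (ζ - θ t)‖ₑ * ENNReal.ofReal |u₁ t|)
      (volume.prod I) := by
    have mθ2 : AEMeasurable (fun z : ℝ × ℝ => z.1 - θ z.2) (volume.prod I) :=
      measurable_fst.aemeasurable.sub mθ.comp_snd
    exact (mQ.comp_aemeasurable mθ2).mul (mu₁.norm.comp_snd).ennreal_ofReal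
  calc ∫⁻ ζ, ‖∫ t in a..b, κ (ζ - θ t) * (w t : ℂ)‖ₑ
      ≤ ∫⁻ ζ, (‖Q (ζ - θ a)‖ₑ * ENNReal.ofReal |u a| + ‖Q (ζ - θ b)‖ₑ * ENNReal.ofReal |u b| +
        ((∫⁻ t, ‖Q (ζ - θ t)‖ₑ * ENNReal.ofReal |u₁ t| ∂I) +
          ∫⁻ t, ‖κ (ζ - θ t)‖ₑ * ENNReal.ofReal |v t| ∂I)) := by
        refine lintegral_mono fun ζ => (bd ζ).trans (le_of_eq ?_)
        congr 1
        rw [lintegral_add_left']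
        have : AEMeasurable (fun t => ζ - θ t) I := aemeasurable_const.sub mθ
        exact (mQ.comp_aemeasurable this).mul (mu₁.norm).ennreal_ofReal
    _ = (∫⁻ ζ, ‖Q (ζ - θ a)‖ₑ) * ENNReal.ofReal |u a| +
        (∫⁻ ζ, ‖Q (ζ - θ b)‖ₑ) * ENNReal.ofReal |u b| +
        ((∫⁻ ζ, ∫⁻ t, ‖Q (ζ - θ t)‖ₑ * ENNReal.ofReal |u₁ t| ∂I) +
          ∫⁻ ζ, ∫⁻ t, ‖κ (ζ - θ t)‖ₑ * ENNReal.ofReal |v t| ∂I) := by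
        have m1 : ∀ c : ℝ, Measurable fun ζ => ‖Q (ζ - c)‖ₑ := fun c => mQ.comp (by fun_prop)
        rw [lintegral_add_left (by exact ((m1 _).mul_const _).add ((m1 _).mul_const _)),
          lintegral_add_left (by exact (m1 _).mul_const _), lintegral_mul_const _ (m1 _),
          lintegral_mul_const _ (m1 _), lintegral_add_left' (by exact mQ2.lintegral_prod_right')]
    _ ≤ B₁ * ENNReal.ofReal (M * (1 / (2 * m))) + B₁ * ENNReal.ofReal (M * (1 / (2 * m))) +
        (B₁ * ENNReal.ofReal (M * (8 / m)) +
          B₀ * ENNReal.ofReal (M * (m * ρ / α * (β + 7)))) := by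
        refine add_le_add (add_le_add ?_ ?_) (add_le_add ?_ ?_)
        · exact mul_le_mul' (shiftQ _) (ENNReal.ofReal_le_ofReal (hub a (left_mem_Icc.2 hab)))
        · exact mul_le_mul' (shiftQ _) (ENNReal.ofReal_le_ofReal (hub b (right_mem_Icc.2 hab)))
        · refine (hfub _ _ B₁ mQ mu₁ shiftQ).trans ?_
          rw [toReal _ cu₁]
          gcongr
        · refine (hfub _ _ B₀ mκ mv shiftκ).trans ?_
          rw [toReal _ cv]
          gcongr
          refine le_trans (le_of_eq ?_) Iv
          refine intervalIntegral.integral_congr fun t ht => ?_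
          rw [uIcc_of_le hab] at ht
          have := hD t
          exact abs_of_nonneg (mul_nonneg (hw0 t ht) (by positivity))
    _ = _ := by
        have e9 : ENNReal.ofReal (M * (9 / m)) = ENNReal.ofReal (M * (1 / (2 * m))) +
            ENNReal.ofReal (M * (1 / (2 * m))) + ENNReal.ofReal (M * (8 / m)) := by
          rw [← ENNReal.ofReal_add (by positivity) (by positivity),
            ← ENNReal.ofReal_add (by positivity) (by positivity)]
          congr 1
          field_simp
          ring
        rw [e9]; ring

end vanDerCorput

/-! ### Geometry of admissible curves -/

section curve

namespace IsAdmissibleCurve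

variable {γ : ℝ → ℝ}

lemma hasDerivAt (hγ : IsAdmissibleCurve γ) (t : ℝ) : HasDerivAt γ (deriv γ t) t :=
  ((hγ.contDiff.differentiable (by norm_num)) t).hasDerivAt

lemma hasDerivAt_deriv (hγ : IsAdmissibleCurve γ) (t : ℝ) :
    HasDerivAt (deriv γ) (iteratedDeriv 2 γ t) t := by
  have h := ((hγ.contDiff.differentiable_iteratedDeriv 1 (by norm_num)) t).hasDerivAt
  rw [← iteratedDeriv_succ, iteratedDeriv_one] at h
  exact h

lemma hasDerivAt_deriv2 (hγ : IsAdmissibleCurve γ) (t : ℝ) :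
    HasDerivAt (iteratedDeriv 2 γ) (iteratedDeriv 3 γ t) t := by
  have := ((hγ.contDiff.differentiable_iteratedDeriv 2 (by norm_num)) t).hasDerivAt
  rwa [← iteratedDeriv_succ] at this

lemma continuous_deriv2 (hγ : IsAdmissibleCurve γ) : Continuous (iteratedDeriv 2 γ) :=
  hγ.contDiff.continuous_iteratedDeriv 2 (by norm_num)

lemma deriv2_pos (hγ : IsAdmissibleCurve γ) {t : ℝ} (ht : 0 < t) : 0 < iteratedDeriv 2 γ t := by
  refine lt_of_le_of_ne ?_ (hγ.deriv2_ne_zero t ht).symm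
  have hm : MonotoneOn (deriv γ) (Ioi 0) :=
    hγ.convexOn.monotoneOn_deriv fun x _ => (hγ.hasDerivAt x).differentiableAt
  have h := hm.derivWithin_nonneg (x := t)
  rwa [derivWithin_of_isOpen isOpen_Ioi ht, (hγ.hasDerivAt_deriv t).deriv] at h

lemma strictMonoOn_deriv (hγ : IsAdmissibleCurve γ) : StrictMonoOn (deriv γ) (Ici 0) := by
  refine strictMonoOn_of_deriv_pos (convex_Ici 0)
    (fun x _ => (hγ.hasDerivAt_deriv x).continuousAt.continuousWithinAt) fun x hx => ?_
  rw [interior_Ici] at hx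
  rw [(hγ.hasDerivAt_deriv x).deriv]
  exact hγ.deriv2_pos hx

lemma deriv_pos (hγ : IsAdmissibleCurve γ) {t : ℝ} (ht : 0 < t) : 0 < deriv γ t := by
  have := hγ.strictMonoOn_deriv self_mem_Ici (mem_Ici.2 ht.le) ht
  rwa [hγ.deriv_zero] at this

lemma strictMonoOn (hγ : IsAdmissibleCurve γ) : StrictMonoOn γ (Ici 0) := by
  refine strictMonoOn_of_deriv_pos (convex_Ici 0)
    (fun x _ => (hγ.hasDerivAt x).continuousAt.continuousWithinAt) fun x hx => ?_
  rw [interior_Ici] at hx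
  exact hγ.deriv_pos hx

lemma pos (hγ : IsAdmissibleCurve γ) {t : ℝ} (ht : 0 < t) : 0 < γ t := by
  have := hγ.strictMonoOn self_mem_Ici (mem_Ici.2 ht.le) ht
  rwa [hγ.zero] at this

lemma convexOn_Ici (hγ : IsAdmissibleCurve γ) : ConvexOn ℝ (Ici 0) γ := by
  refine MonotoneOn.convexOn_of_deriv (convex_Ici 0)
    (fun x _ => (hγ.hasDerivAt x).continuousAt.continuousWithinAt)
    (fun x _ => (hγ.hasDerivAt x).differentiableAt.differentiableWithinAt) ?_
  exact (hγ.strictMonoOn_deriv.monotoneOn).mono interior_subset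

lemma map_mul_le (hγ : IsAdmissibleCurve γ) {c t : ℝ} (hc0 : 0 ≤ c) (hc1 : c ≤ 1) (ht : 0 ≤ t) :
    γ (c * t) ≤ c * γ t := by
  have := hγ.convexOn_Ici.2 (self_mem_Ici (a := (0 : ℝ))) (mem_Ici.2 ht) (sub_nonneg.2 hc1) hc0
    (by ring)
  simpa [hγ.zero] using this

lemma mul_map_le (hγ : IsAdmissibleCurve γ) {c t : ℝ} (hc : 1 ≤ c) (ht : 0 ≤ t) :
    c * γ t ≤ γ (c * t) := by
  have hc0 : 0 < c := by linarith
  have := hγ.map_mul_le (c := c⁻¹) (t := c * t) (by positivity) (inv_le_one_of_one_le₀ hc)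
    (by positivity)
  rw [inv_mul_cancel_left₀ hc0.ne'] at this
  calc c * γ t ≤ c * (c⁻¹ * γ (c * t)) := by gcongr
    _ = γ (c * t) := by field_simp

lemma div_le_deriv (hγ : IsAdmissibleCurve γ) {t : ℝ} (ht : 0 < t) : γ t / t ≤ deriv γ t := by
  have := hγ.convexOn_Ici.slope_le_deriv (self_mem_Ici (a := (0 : ℝ))) (mem_Ici.2 ht.le) ht
    (hγ.hasDerivAt t).differentiableAt
  rwa [slope_def_field, hγ.zero, sub_zero, sub_zero] at this

lemma tendsto_atTop (hγ : IsAdmissibleCurve γ) : Tendsto γ atTop atTop := by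
  refine tendsto_atTop_mono' _ (f₁ := fun t => t * γ 1) ?_
    (tendsto_id.atTop_mul_const (hγ.pos one_pos))
  filter_upwards [eventually_ge_atTop 1] with t ht
  simpa using hγ.mul_map_le ht zero_le_one

/-- The integrated form of the lower bound for the derivative of `γ''/γ'`. -/
lemma exists_curvature_le (hγ : IsAdmissibleCurve γ) : ∃ C : ℝ, 0 < C ∧ ∀ s t : ℝ, 0 < s → 0 < t →
    C * |t - s| / (s * t) ≤
      |iteratedDeriv 2 γ t / deriv γ t - iteratedDeriv 2 γ s / deriv γ s| := by
  obtain ⟨C, hC, hcurv⟩ := hγ.curvature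
  refine ⟨C, hC, ?_⟩
  set G : ℝ → ℝ := fun s => iteratedDeriv 2 γ s / deriv γ s with hG
  have hGd : ∀ t ∈ Ioi (0 : ℝ), HasDerivAt G (deriv G t) t := fun t ht =>
    (((hγ.hasDerivAt_deriv2 t).div (hγ.hasDerivAt_deriv t)
      (hγ.deriv_pos ht).ne').differentiableAt).hasDerivAt
  have hne : ∀ t ∈ Ioi (0 : ℝ), deriv G t ≠ 0 := fun t ht h => by
    have := hcurv t ht
    rw [h, abs_zero] at this
    have : 0 < C / t ^ 2 := by have := mem_Ioi.1 ht; positivity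
    linarith
  have hE : ∀ t ∈ Ioi (0 : ℝ), HasDerivAt (fun s => C / s) (-(C / t ^ 2)) t := fun t ht => by
    have := (hasDerivAt_inv (mem_Ioi.1 ht).ne').const_mul C
    refine (this.congr_deriv ?_)
    field_simp
  -- either `G + C/s` or `-G + C/s` is increasing
  have key : ∀ F : ℝ → ℝ, ∀ F' : ℝ → ℝ, (∀ t ∈ Ioi (0 : ℝ), HasDerivAt F (F' t) t) →
      (∀ t ∈ Ioi (0 : ℝ), C / t ^ 2 ≤ F' t) → ∀ s t : ℝ, 0 < s → s ≤ t →
      C * (t - s) / (s * t) ≤ F t - F s := by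
    intro F F' hF hF' s t hs hst
    have hm : MonotoneOn (fun s => F s + C / s) (Ioi 0) := by
      refine monotoneOn_of_deriv_nonneg (convex_Ioi 0)
        (fun x hx => ((hF x hx).add (hE x hx)).continuousAt.continuousWithinAt)
        (fun x hx => ((hF x (interior_subset hx)).add
          (hE x (interior_subset hx))).differentiableAt.differentiableWithinAt) fun x hx => ?_
      have hx := interior_subset hx
      have hd : HasDerivAt (fun s => F s + C / s) (F' x + -(C / x ^ 2)) x := (hF x hx).add (hE x hx)
      rw [hd.deriv]
      linarith [hF' x hx]
    have ht := hs.trans_le hst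
    have := hm (mem_Ioi.2 hs) (mem_Ioi.2 ht) hst
    have e : C * (t - s) / (s * t) = C / s - C / t := by field_simp
    simp only at this
    rw [e]; linarith
  have main : ∀ s t : ℝ, 0 < s → s ≤ t → C * (t - s) / (s * t) ≤ |G t - G s| := by
    intro s t hs hst
    rcases hasDerivWithinAt_forall_lt_or_forall_gt_of_forall_ne (convex_Ioi (0 : ℝ))
      (fun x hx => (hGd x hx).hasDerivWithinAt) hne with h | h
    · refine (key (fun s => -G s) (fun s => -deriv G s) (fun t ht => (hGd t ht).neg)
        (fun t ht => ?_) s t hs hst).trans ?_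
      · have := hcurv t ht
        rwa [abs_of_neg (h t ht)] at this
      · rw [abs_sub_comm]
        exact (le_of_eq (by ring)).trans (le_abs_self _)
    · refine (key G (deriv G) hGd (fun t ht => ?_) s t hs hst).trans (le_abs_self _)
      have := hcurv t ht
      rwa [abs_of_pos (h t ht)] at this
  intro s t hs ht
  rcases le_total s t with h | h
  · rw [abs_of_nonneg (sub_nonneg.2 h)]
    exact main s t hs h
  · rw [abs_sub_comm, abs_of_nonneg (sub_nonneg.2 h), abs_sub_comm, mul_comm s]
    exact main t s ht h

/-- For every shift `s` the quotient `γ''(t)/γ''(t - s)` is monotone or antitone: its logarithmic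
derivative is a difference of two values of `γ'''/γ''`. -/
lemma monotoneOn_or_antitoneOn_ratio (hγ : IsAdmissibleCurve γ) (s : ℝ) {a b : ℝ} (ha : 0 < a)
    (has : 0 < a - s) :
    MonotoneOn (fun t => iteratedDeriv 2 γ t / iteratedDeriv 2 γ (t - s)) (Icc a b) ∨
    AntitoneOn (fun t => iteratedDeriv 2 γ t / iteratedDeriv 2 γ (t - s)) (Icc a b) := by
  set g := iteratedDeriv 2 γ with hg
  set L : ℝ → ℝ := fun t => iteratedDeriv 3 γ t / g t with hL
  have p1 : ∀ t ∈ Icc a b, 0 < t := fun t ht => ha.trans_le ht.1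
  have p2 : ∀ t ∈ Icc a b, 0 < t - s := fun t ht => by linarith [ht.1]
  have hd : ∀ t ∈ Icc a b, HasDerivAt (fun t => g t / g (t - s))
      (g t / g (t - s) * (L t - L (t - s))) t := by
    intro t ht
    have q1 := hγ.deriv2_pos (p1 t ht)
    have q2 := hγ.deriv2_pos (p2 t ht)
    have d2 : HasDerivAt (fun t => g (t - s)) (iteratedDeriv 3 γ (t - s)) t :=
      (hγ.hasDerivAt_deriv2 (t - s)).comp_sub_const t s
    refine ((hγ.hasDerivAt_deriv2 t).div d2 q2.ne').congr_deriv ?_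
    simp only [hL]
    rw [← hg] at q1 q2 ⊢
    field_simp
  have hcont : ContinuousOn (fun t => g t / g (t - s)) (Icc a b) := continuousOn_of_hasDerivAt hd
  have hq : ∀ t ∈ Icc a b, 0 ≤ g t / g (t - s) := fun t ht =>
    (div_pos (hγ.deriv2_pos (p1 t ht)) (hγ.deriv2_pos (p2 t ht))).le
  have up : (∀ t ∈ Icc a b, 0 ≤ L t - L (t - s)) →
      MonotoneOn (fun t => g t / g (t - s)) (Icc a b) := fun h =>
    monotoneOn_of_deriv_nonneg (convex_Icc a b) hcont
      (fun x hx => (hd x (interior_subset hx)).differentiableAt.differentiableWithinAt) fun x hx => by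
        rw [(hd x (interior_subset hx)).deriv]
        exact mul_nonneg (hq x (interior_subset hx)) (h x (interior_subset hx))
  have down : (∀ t ∈ Icc a b, L t - L (t - s) ≤ 0) →
      AntitoneOn (fun t => g t / g (t - s)) (Icc a b) := fun h =>
    antitoneOn_of_deriv_nonpos (convex_Icc a b) hcont
      (fun x hx => (hd x (interior_subset hx)).differentiableAt.differentiableWithinAt) fun x hx => by
        rw [(hd x (interior_subset hx)).deriv]
        exact mul_nonpos_of_nonneg_of_nonpos (hq x (interior_subset hx)) (h x (interior_subset hx))
  -- a constant `γ'''/γ''` is monotone as well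
  have hthird : MonotoneOn L (Ioi 0) ∨ AntitoneOn L (Ioi 0) := by
    rcases hγ.third_order with h | h | ⟨c, h⟩
    · exact Or.inl h.monotoneOn
    · exact Or.inr h.antitoneOn
    · exact Or.inl fun x hx y hy _ => by simp only [hL]; rw [h x hx, h y hy]
  rcases hthird with h | h <;> rcases le_total 0 s with hs | hs
  · exact Or.inl (up fun t ht => sub_nonneg.2 (h (p2 t ht) (p1 t ht) (by linarith)))
  · exact Or.inr (down fun t ht => sub_nonpos.2 (h (p1 t ht) (p2 t ht) (by linarith)))
  · exact Or.inr (down fun t ht => sub_nonpos.2 (h (p2 t ht) (p1 t ht) (by linarith)))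
  · exact Or.inl (up fun t ht => sub_nonneg.2 (h (p1 t ht) (p2 t ht) (by linarith)))

/-- The first two derivatives of the phase `θ(t) = u γ(t) - v γ(t - s)` are not simultaneously
small. -/
lemma exists_phase_lower_bound (hγ : IsAdmissibleCurve γ) : ∃ C₂ C₃ : ℝ, 0 < C₂ ∧ 0 < C₃ ∧
    ∀ u v s t : ℝ, 0 < t → 0 < t - s →
      C₃ * (|v| * deriv γ (t - s)) * |s| / t ≤
        C₂ * ((t - s) / t) * |u * deriv γ t - v * deriv γ (t - s)| +
          (t - s) * |u * iteratedDeriv 2 γ t - v * iteratedDeriv 2 γ (t - s)| := by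
  obtain ⟨C₃, hC₃, hcurv⟩ := hγ.exists_curvature_le
  obtain ⟨C₂, hC₂, hgrow⟩ := hγ.growth
  refine ⟨C₂, C₃, hC₂, hC₃, fun u v s t ht hts => ?_⟩
  set τ := t - s with hτ
  have g1 := hγ.deriv_pos ht
  have g1' := hγ.deriv_pos hts
  have g2 := hγ.deriv2_pos ht
  set Gt := iteratedDeriv 2 γ t / deriv γ t with hGt
  set Gτ := iteratedDeriv 2 γ τ / deriv γ τ with hGτ
  have hGt0 : 0 < Gt := div_pos g2 g1
  have hGtle : Gt ≤ C₂ / t := by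
    rw [le_div_iff₀ ht]
    have := hgrow t ht
    rw [mul_div_assoc] at this
    linarith
  -- eliminating `u` between `θ'` and `θ''` leaves a multiple of the difference of two values of
  -- `γ''/γ'`, which the curvature condition bounds from below
  have e : v * deriv γ τ * (Gt - Gτ) =
      (u * iteratedDeriv 2 γ t - v * iteratedDeriv 2 γ τ) - (u * deriv γ t - v * deriv γ τ) * Gt := by
    simp only [hGt, hGτ]
    field_simp
    ring
  have hc := hcurv τ t hts ht
  have hs : t - τ = s := by rw [hτ]; ring
  rw [hs] at hc
  calc C₃ * (|v| * deriv γ τ) * |s| / t = τ * (|v| * deriv γ τ * (C₃ * |s| / (τ * t))) := by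
        field_simp
    _ ≤ τ * (|v| * deriv γ τ * |Gt - Gτ|) := by gcongr
    _ = τ * |v * deriv γ τ * (Gt - Gτ)| := by
        rw [abs_mul (v * deriv γ τ), abs_mul v, abs_of_pos g1']
    _ ≤ τ * (|u * iteratedDeriv 2 γ t - v * iteratedDeriv 2 γ τ| +
          |u * deriv γ t - v * deriv γ τ| * Gt) := by
        rw [e]
        gcongr
        refine (abs_sub _ _).trans ?_
        rw [abs_mul _ Gt, abs_of_pos hGt0]
    _ ≤ τ * (|u * iteratedDeriv 2 γ t - v * iteratedDeriv 2 γ τ| +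
          |u * deriv γ t - v * deriv γ τ| * (C₂ / t)) := by gcongr
    _ = _ := by ring

end IsAdmissibleCurve

end curve

/-! ### The kernel of the composition of two annular operators -/

section oscillatoryKernel

/-- The piece `1_{(r, 2r]}(t) / t` of the Hilbert kernel; it vanishes identically when `r ≤ 0`. -/
noncomputable def annKer (r t : ℝ) : ℝ := (Ioc r (2 * r)).indicator (fun t => 1 / t) t

lemma annKer_of_mem {r t : ℝ} (h : t ∈ Ioc r (2 * r)) : annKer r t = 1 / t := indicator_of_mem h _

lemma annKer_of_notMem {r t : ℝ} (h : t ∉ Ioc r (2 * r)) : annKer r t = 0 := indicator_of_notMem h _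

lemma pos_of_mem_Ioc_two_mul {r t : ℝ} (h : t ∈ Ioc r (2 * r)) : 0 < r ∧ 0 < t := by
  have := h.1.trans_le h.2
  have : 0 < r := by linarith
  exact ⟨this, this.trans h.1⟩

lemma annKer_nonneg (r t : ℝ) : 0 ≤ annKer r t := by
  by_cases h : t ∈ Ioc r (2 * r)
  · rw [annKer_of_mem h]; exact (one_div_pos.2 (pos_of_mem_Ioc_two_mul h).2).le
  · rw [annKer_of_notMem h]

lemma annKer_le (r t : ℝ) :
    annKer r t ≤ (Metric.closedBall (0 : ℝ) (2 * r)).indicator (fun _ => |1 / r|) t := by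
  by_cases h : t ∈ Ioc r (2 * r)
  · obtain ⟨hr, ht⟩ := pos_of_mem_Ioc_two_mul h
    rw [annKer_of_mem h, indicator_of_mem]
    · exact (one_div_le_one_div_of_le hr h.1.le).trans (le_abs_self _)
    · rw [mem_closedBall_zero_iff, Real.norm_eq_abs, abs_of_pos ht]
      exact h.2
  · rw [annKer_of_notMem h]
    exact indicator_nonneg (fun _ _ => by positivity) _

lemma annKer_of_nonpos {r : ℝ} (hr : r ≤ 0) (t : ℝ) : annKer r t = 0 :=
  annKer_of_notMem fun h => absurd (pos_of_mem_Ioc_two_mul h).1 (not_lt.2 hr)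

lemma measurable_uncurry_annKer : Measurable (fun z : ℝ × ℝ => annKer z.1 z.2) := by
  have : (fun z : ℝ × ℝ => annKer z.1 z.2) =
      {z : ℝ × ℝ | z.1 < z.2 ∧ z.2 ≤ 2 * z.1}.indicator (fun z => 1 / z.2) := by
    ext z
    by_cases h : z.2 ∈ Ioc z.1 (2 * z.1)
    · rw [annKer_of_mem h, indicator_of_mem]; exact h
    · rw [annKer_of_notMem h, indicator_of_notMem]; exact h
  rw [this]
  refine Measurable.indicator (by fun_prop) ?_
  exact (measurableSet_lt measurable_fst measurable_snd).inter
    (measurableSet_le measurable_snd (measurable_fst.const_mul 2))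

/-- The kernel, up to a translation, of the composition of two operators
`f ↦ ∫ f(x₁ - t, x₂ - u γ(t)) 1_{(r, 2r]}(t) dt / t`, smoothed in the second variable. -/
noncomputable def oscKer (γ : ℝ → ℝ) (κ : ℝ → ℂ) (u v r r' s ζ : ℝ) : ℂ :=
  ∫ t, κ (ζ - (u * γ t - v * γ (t - s))) * ((annKer r t * annKer r' (t - s) : ℝ) : ℂ)

/-- Exchanging the two operators amounts to the substitution `t ↦ t + s`. -/
lemma oscKer_swap (γ : ℝ → ℝ) (κ : ℝ → ℂ) (u v r r' s ζ : ℝ) :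
    oscKer γ κ u v r r' s ζ = oscKer γ (fun z => κ (-z)) v u r' r (-s) (-ζ) := by
  rw [oscKer, oscKer, ← integral_add_right_eq_self _ s]
  congr 1 with t
  have e : ∀ a b : ℝ, -(-ζ - (a - b)) = ζ - (b - a) := fun a b => by ring
  rw [add_sub_cancel_right, sub_neg_eq_add, e, mul_comm (annKer r' t)]

lemma abs_le_of_annKer_ne_zero {r r' s t : ℝ} (h : annKer r t * annKer r' (t - s) ≠ 0) :
    |s| ≤ 2 * max r r' := by
  have h1 : t ∈ Ioc r (2 * r) := by
    by_contra hn; exact h (by rw [annKer_of_notMem hn, zero_mul])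
  have h2 : t - s ∈ Ioc r' (2 * r') := by
    by_contra hn; exact h (by rw [annKer_of_notMem hn, mul_zero])
  have p1 := (pos_of_mem_Ioc_two_mul h1).2
  have p2 := (pos_of_mem_Ioc_two_mul h2).2
  have m1 := le_max_left r r'
  have m2 := le_max_right r r'
  rw [abs_le]
  constructor <;> linarith [h1.1, h1.2, h2.1, h2.2]

lemma oscKer_eq_zero (γ : ℝ → ℝ) (κ : ℝ → ℂ) (u v : ℝ) {r r' s : ℝ} (ζ : ℝ)
    (h : 2 * max r r' < |s|) : oscKer γ κ u v r r' s ζ = 0 := by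
  rw [oscKer]
  refine integral_eq_zero_of_ae (ae_of_all _ fun t => ?_)
  have : annKer r t * annKer r' (t - s) = 0 := by
    by_contra hn; exact absurd h (not_lt.2 (abs_le_of_annKer_ne_zero hn))
  simp [this]

lemma oscKer_eq_intervalIntegral (γ : ℝ → ℝ) (κ : ℝ → ℂ) (u v r r' s ζ : ℝ)
    (hab : max r (r' + s) ≤ min (2 * r) (2 * r' + s)) :
    oscKer γ κ u v r r' s ζ = ∫ t in max r (r' + s)..min (2 * r) (2 * r' + s),
      κ (ζ - (u * γ t - v * γ (t - s))) * ((1 / (t * (t - s)) : ℝ) : ℂ) := by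
  rw [intervalIntegral.integral_of_le hab, ← integral_indicator measurableSet_Ioc, oscKer]
  congr 1 with t
  by_cases h1 : t ∈ Ioc r (2 * r)
  · by_cases h2 : t - s ∈ Ioc r' (2 * r')
    · rw [annKer_of_mem h1, annKer_of_mem h2, indicator_of_mem, one_div_mul_one_div]
      exact ⟨max_lt h1.1 (by linarith [h2.1]), le_min h1.2 (by linarith [h2.2])⟩
    · rw [annKer_of_notMem h2, indicator_of_notMem]
      · simp
      · rintro ⟨h3, h4⟩
        exact h2 ⟨by linarith [(max_lt_iff.1 h3).2], by linarith [(le_min_iff.1 h4).2]⟩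
  · rw [annKer_of_notMem h1, indicator_of_notMem]
    · simp
    · rintro ⟨h3, h4⟩
      exact h1 ⟨(max_lt_iff.1 h3).1, (le_min_iff.1 h4).1⟩

lemma oscKer_eq_zero_of_lt (γ : ℝ → ℝ) (κ : ℝ → ℂ) (u v : ℝ) {r r' s : ℝ} (ζ : ℝ)
    (hab : min (2 * r) (2 * r' + s) < max r (r' + s)) : oscKer γ κ u v r r' s ζ = 0 := by
  rw [oscKer]
  refine integral_eq_zero_of_ae (ae_of_all _ fun t => ?_)
  have : annKer r t * annKer r' (t - s) = 0 := by
    by_cases h1 : t ∈ Ioc r (2 * r)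
    · by_cases h2 : t - s ∈ Ioc r' (2 * r')
      · have h3 : max r (r' + s) < t := max_lt h1.1 (by linarith [h2.1])
        have h4 : t ≤ min (2 * r) (2 * r' + s) := le_min h1.2 (by linarith [h2.2])
        linarith
      · rw [annKer_of_notMem h2, mul_zero]
    · rw [annKer_of_notMem h1, zero_mul]
  simp [this]

namespace IsAdmissibleCurve

variable {γ : ℝ → ℝ}

/-- The case `r' ≤ r`. The van der Corput estimate is applied to the phase `θ(t) = u γ(t) - v γ(t -
s)` with amplitude `1 / (t (t - s))`. Since `γ` is convex, `N ≤ μ |v| γ(r')` makes the derivative of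
`v γ` at least `N / (μ r')` on the support, hence the lower bound `α` for the phase. -/
lemma exists_lintegral_oscKer_le_of_le (hγ : IsAdmissibleCurve γ) : ∃ C : ℝ, 0 < C ∧
    ∀ κ Q : ℝ → ℂ, Continuous κ → (∀ z, HasDerivAt Q (κ z) z) → ∀ (B : ℝ≥0∞) (μ : ℝ), 0 < μ →
    ∫⁻ z, ‖κ z‖ₑ ≤ B → ∫⁻ z, ‖Q z‖ₑ ≤ B * ENNReal.ofReal (1 / μ) →
    ∀ N u v r r' s : ℝ, 0 < N → 0 < r' → r' ≤ r → s ≠ 0 → N ≤ μ * |v| * γ r' →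
      ∫⁻ ζ, ‖oscKer γ κ u v r r' s ζ‖ₑ ≤ B * ENNReal.ofReal (C / √(N * (r * |s|))) := by
  obtain ⟨C₂, C₃, hC₂, hC₃, hphase⟩ := hγ.exists_phase_lower_bound
  refine ⟨36 / C₃ + (C₂ + 7), by positivity,
    fun κ Q hκ hQ B μ hμ hB₀ hB₁ N u v r r' s hN hr' hrr' hs hv => ?_⟩
  have hr : 0 < r := hr'.trans_le hrr'
  have hs' : 0 < |s| := abs_pos.2 hs
  set a := max r (r' + s) with ha
  set b := min (2 * r) (2 * r' + s) with hb
  rcases lt_or_ge b a with hba | hab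
  · simp [oscKer_eq_zero_of_lt γ κ u v _ hba]
  set D := √(N * (r * |s|)) with hD
  have hD0 : 0 < D := Real.sqrt_pos.2 (by positivity)
  have hD2 : D ^ 2 = N * (r * |s|) := Real.sq_sqrt (by positivity)
  set α := C₃ * N * |s| / (4 * μ * r' * r) with hα
  have hα0 : 0 < α := by positivity
  have t1 : ∀ t ∈ Icc a b, r ≤ t := fun t ht => (le_max_left _ _).trans ht.1
  have t2 : ∀ t ∈ Icc a b, t ≤ 2 * r := fun t ht => ht.2.trans (min_le_left _ _)
  have t3 : ∀ t ∈ Icc a b, r' ≤ t - s := fun t ht => by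
    have := (le_max_right r (r' + s)).trans ht.1; linarith
  have t4 : ∀ t ∈ Icc a b, t - s ≤ 2 * r' := fun t ht => by
    have := ht.2.trans (min_le_right (2 * r) (2 * r' + s)); linarith
  have t0 : ∀ t ∈ Icc a b, 0 < t := fun t ht => hr.trans_le (t1 t ht)
  have t0' : ∀ t ∈ Icc a b, 0 < t - s := fun t ht => hr'.trans_le (t3 t ht)
  simp_rw [oscKer_eq_intervalIntegral γ κ u v r r' s _ hab]
  have hw : ∀ t ∈ Icc a b, HasDerivAt (fun t => 1 / (t * (t - s)))
      (-(2 * t - s) / (t * (t - s)) ^ 2) t := by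
    intro t ht
    have h1 : HasDerivAt (fun t => t * (t - s)) (1 * (t - s) + t * 1) t :=
      (hasDerivAt_id t).mul ((hasDerivAt_id t).sub_const s)
    have h2 := h1.inv (mul_pos (t0 t ht) (t0' t ht)).ne'
    simp only [one_div]
    refine h2.congr_deriv ?_
    ring
  have hlow : ∀ t ∈ Icc a b, α ≤ C₂ * |u * deriv γ t - v * deriv γ (t - s)| +
      r' * |u * iteratedDeriv 2 γ t - v * iteratedDeriv 2 γ (t - s)| := by
    intro t ht
    have h1 := hphase u v s t (t0 t ht) (t0' t ht)
    set X := |u * deriv γ t - v * deriv γ (t - s)|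
    set Y := |u * iteratedDeriv 2 γ t - v * iteratedDeriv 2 γ (t - s)|
    have hX : 0 ≤ X := abs_nonneg _
    have hY : 0 ≤ Y := abs_nonneg _
    have hts := t0' t ht
    have htp := t0 t ht
    have hdp := hγ.deriv_pos hts
    have h2 : C₂ * ((t - s) / t) * X + (t - s) * Y ≤ 2 * (C₂ * X + r' * Y) := by
      have : (t - s) / t ≤ 2 := by
        rw [div_le_iff₀ htp]; linarith [t1 t ht, t4 t ht]
      have e1 : C₂ * ((t - s) / t) * X ≤ C₂ * 2 * X := by gcongr
      have e2 : (t - s) * Y ≤ 2 * r' * Y := by gcongr; exact t4 t ht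
      linarith
    have h3 : N / (μ * r') ≤ |v| * deriv γ (t - s) := by
      have d1 : γ r' / r' ≤ deriv γ (t - s) := (hγ.div_le_deriv hr').trans
        (hγ.strictMonoOn_deriv.monotoneOn (mem_Ici.2 hr'.le) (mem_Ici.2 hts.le) (t3 t ht))
      calc N / (μ * r') ≤ μ * |v| * γ r' / (μ * r') := by gcongr
        _ = |v| * (γ r' / r') := by field_simp
        _ ≤ _ := by gcongr
    have h4 : 2 * α ≤ C₃ * (|v| * deriv γ (t - s)) * |s| / t := by
      calc 2 * α = C₃ * (N / (μ * r')) * |s| / (2 * r) := by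
            simp only [hα]; field_simp; norm_num
        _ ≤ C₃ * (|v| * deriv γ (t - s)) * |s| / t := by
            gcongr
            exact t2 t ht
    linarith
  -- the choice `m = r α / D` balances the two terms of the estimate, both of which become `O(1 /
  -- D)`; the sign of `θ''` is that of `H`, which is monotone
  have key := lintegral_enorm_integral_comp_le hab (θ := fun t => u * γ t - v * γ (t - s))
    (θ₁ := fun t => u * deriv γ t - v * deriv γ (t - s))
    (θ₂ := fun t => u * iteratedDeriv 2 γ t - v * iteratedDeriv 2 γ (t - s))
    (m := r * α / D) (by positivity)
    (fun t _ => ((hγ.hasDerivAt t).const_mul u).sub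
      (((hγ.hasDerivAt (t - s)).comp_sub_const t s).const_mul v))
    (fun t _ => ((hγ.hasDerivAt_deriv t).const_mul u).sub
      (((hγ.hasDerivAt_deriv (t - s)).comp_sub_const t s).const_mul v))
    (by have := hγ.continuous_deriv2; fun_prop)
    (P := fun t => iteratedDeriv 2 γ (t - s))
    (H := fun t => u * (iteratedDeriv 2 γ t / iteratedDeriv 2 γ (t - s)) - v)
    (fun t ht => hγ.deriv2_pos (t0' t ht)) ?_
    (fun t ht => by
      have := (hγ.deriv2_pos (t0' t ht)).ne'
      field_simp)
    hw (ContinuousOn.div (by fun_prop) (by fun_prop) fun t ht =>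
      (pow_pos (mul_pos (t0 t ht) (t0' t ht)) 2).ne')
    (fun t ht => (one_div_pos.2 (mul_pos (t0 t ht) (t0' t ht))).le)
    (fun t ht => div_nonpos_of_nonpos_of_nonneg (by linarith [t0 t ht, t0' t ht]) (by positivity))
    (M := 1 / (r * r'))
    (fun t ht => one_div_le_one_div_of_le (by positivity)
      (mul_le_mul (t1 t ht) (t3 t ht) hr'.le (t0 t ht).le))
    hκ hQ hB₀ hB₁ hα0 hC₂.le (ρ := r') ?_ hlow
  · refine key.trans (le_of_eq ?_)
    rw [mul_assoc B, ← mul_add, ← ENNReal.ofReal_mul (by positivity),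
      ← ENNReal.ofReal_add (by positivity) (by positivity)]
    congr 2
    have e1 : 1 / μ * (1 / (r * r') * (9 / (r * α / D))) = 36 / C₃ / D := by
      have : D / (N * (r * |s|)) = 1 / D := by rw [← hD2]; field_simp
      calc _ = 36 / C₃ * (D / (N * (r * |s|))) := by
            simp only [hα]; field_simp; norm_num
        _ = _ := by rw [this]; ring
    have e2 : 1 / (r * r') * (r * α / D * r' / α * (C₂ + 7)) = (C₂ + 7) / D := by
      field_simp
    rw [e1, e2]
    ring
  · rcases hγ.monotoneOn_or_antitoneOn_ratio s (b := b) (t0 a (left_mem_Icc.2 hab))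
      (t0' a (left_mem_Icc.2 hab)) with h | h <;> rcases le_total 0 u with hu | hu
    · exact Or.inl fun x hx y hy hxy =>
        sub_le_sub_right (mul_le_mul_of_nonneg_left (h hx hy hxy) hu) _
    · exact Or.inr fun x hx y hy hxy =>
        sub_le_sub_right (mul_le_mul_of_nonpos_left (h hx hy hxy) hu) _
    · exact Or.inr fun x hx y hy hxy =>
        sub_le_sub_right (mul_le_mul_of_nonneg_left (h hx hy hxy) hu) _
    · exact Or.inl fun x hx y hy hxy =>
        sub_le_sub_right (mul_le_mul_of_nonpos_left (h hx hy hxy) hu) _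
  · have h1 := le_max_right r (r' + s)
    have h2 := min_le_right (2 * r) (2 * r' + s)
    linarith

/-- The `L¹` norm of the composition kernel, in the second variable. The gain `N ^ (-1/2)` comes
from the size of `u` and `v`. -/
lemma exists_lintegral_oscKer_le (hγ : IsAdmissibleCurve γ) : ∃ C : ℝ, 0 < C ∧
    ∀ κ Q : ℝ → ℂ, Continuous κ → (∀ z, HasDerivAt Q (κ z) z) → ∀ (B : ℝ≥0∞) (μ : ℝ), 0 < μ →
    ∫⁻ z, ‖κ z‖ₑ ≤ B → ∫⁻ z, ‖Q z‖ₑ ≤ B * ENNReal.ofReal (1 / μ) →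
    ∀ N u v r r' s : ℝ, 0 < N → 0 < r → 0 < r' → s ≠ 0 → N ≤ μ * |u| * γ r →
      N ≤ μ * |v| * γ r' →
      ∫⁻ ζ, ‖oscKer γ κ u v r r' s ζ‖ₑ ≤
        B * ENNReal.ofReal (C / √(N * (max r r' * |s|))) := by
  obtain ⟨C, hC, h⟩ := hγ.exists_lintegral_oscKer_le_of_le
  refine ⟨C, hC, fun κ Q hκ hQ B μ hμ hB₀ hB₁ N u v r r' s hN hr hr' hs hu hv => ?_⟩
  rcases le_total r' r with hrr' | hrr'
  · rw [max_eq_left hrr']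
    exact h κ Q hκ hQ B μ hμ hB₀ hB₁ N u v r r' s hN hr' hrr' hs hv
  · rw [max_eq_right hrr']
    simp_rw [oscKer_swap γ κ u v r r' s]
    rw [lintegral_neg_eq_self (fun ζ => ‖oscKer γ (fun z => κ (-z)) v u r' r (-s) ζ‖ₑ)]
    have := h (fun z => κ (-z)) (fun z => -Q (-z)) (hκ.comp continuous_neg)
      (fun z => ?_) B μ hμ ?_ ?_ N v u r' r (-s) hN hr hrr' (neg_ne_zero.2 hs) hu
    · rwa [abs_neg] at this
    · have h1 := (hQ (-z)).scomp z (hasDerivAt_neg z)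
      refine h1.neg.congr_deriv ?_
      simp
    · rwa [lintegral_neg_eq_self (fun z => ‖κ z‖ₑ)]
    · simp_rw [enorm_neg]
      rwa [lintegral_neg_eq_self (fun z => ‖Q z‖ₑ)]

end IsAdmissibleCurve

end oscillatoryKernel

/-! ### The `T T*` method -/

section adjoint

variable {X Z : Type*} [MeasurableSpace X] [MeasurableSpace Z] {μ : Measure X} {ν : Measure Z}

lemma lpn_two_sq (F : X → ℝ≥0∞) : lpn 2 μ F ^ 2 = ∫⁻ x, F x ^ 2 ∂μ := by
  have := lpn_rpow (μ := μ) two_pos F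
  simpa only [ENNReal.rpow_two] using this

lemma enorm_integral_mul_conj {F : X → ℂ} (hF : Measurable F) (h : ∫⁻ x, ‖F x‖ₑ ^ 2 ∂μ ≠ ⊤) :
    ‖∫ x, F x * conj (F x) ∂μ‖ₑ = ∫⁻ x, ‖F x‖ₑ ^ 2 ∂μ := by
  have e : ∀ x, ENNReal.ofReal (‖F x‖ ^ 2) = ‖F x‖ₑ ^ 2 := fun x => by
    rw [ENNReal.ofReal_pow (norm_nonneg _), ofReal_norm]
  have hi : Integrable (fun x => ‖F x‖ ^ 2) μ := by
    refine ⟨(hF.norm.pow_const 2).aestronglyMeasurable, ?_⟩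
    rw [hasFiniteIntegral_iff_ofReal (ae_of_all _ fun x => by positivity)]
    simp_rw [e]
    exact h.lt_top
  have e1 : ∀ x, F x * conj (F x) = ((‖F x‖ ^ 2 : ℝ) : ℂ) := fun x => by
    rw [Complex.mul_conj']; norm_cast
  simp_rw [e1]
  rw [integral_complex_ofReal, ← ofReal_norm, Complex.norm_real, Real.norm_eq_abs,
    abs_of_nonneg (integral_nonneg fun x => by positivity),
    ofReal_integral_eq_lintegral_ofReal hi (ae_of_all _ fun x => by positivity)]
  simp_rw [e]

variable [SigmaFinite μ] [SigmaFinite ν] {L : X → Z → ℂ} {A D : ℝ≥0∞}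

/-- The norm of the transposed operator `h ↦ ∫ L(x, ·) h(x) dx` is read off from the kernel of `T
T*` by expanding the square. -/
lemma lpn_two_transposed_le (hL : Measurable (Function.uncurry L)) (hA : A ≠ ⊤)
    (habs : ∀ F : Z → ℝ≥0∞, Measurable F →
      lpn 2 μ (fun x => ∫⁻ z, ‖L x z‖ₑ * F z ∂ν) ≤ A * lpn 2 ν F)
    (hD : ∀ h : X → ℝ≥0∞, Measurable h →
      ∫⁻ p, h p.1 * h p.2 * ‖∫ z, L p.1 z * conj (L p.2 z) ∂ν‖ₑ ∂(μ.prod μ) ≤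
        (D * lpn 2 μ h) ^ 2)
    {h : X → ℂ} (hh : Measurable h) (hfin : lpn 2 μ (fun x => ‖h x‖ₑ) ≠ ⊤) :
    lpn 2 ν (fun z => ‖∫ x, L x z * h x ∂μ‖ₑ) ≤ D * lpn 2 μ (fun x => ‖h x‖ₑ) := by
  set S : Z → ℂ := fun z => ∫ x, L x z * h x ∂μ with hS
  have hLn : Measurable (Function.uncurry fun x z => ‖L x z‖ₑ) := hL.enorm
  have mS : Measurable S := by
    have : Measurable (Function.uncurry fun z x => L x z * h x) :=
      (hL.comp measurable_swap).mul (hh.comp measurable_snd)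
    exact (this.stronglyMeasurable.integral_prod_right (ν := μ)).measurable
  have habs' := lpn_two_transpose_le hLn habs hh.enorm
  set U : Z → ℝ≥0∞ := fun z => ∫⁻ x, ‖L x z‖ₑ * ‖h x‖ₑ ∂μ with hU
  have hU2 : ∫⁻ z, U z ^ 2 ∂ν < ⊤ := by
    rw [← lpn_two_sq]
    exact ENNReal.pow_lt_top (habs'.trans_lt (ENNReal.mul_lt_top hA.lt_top hfin.lt_top))
  have hSU : ∀ z, ‖S z‖ₑ ≤ U z := fun z => by
    refine (enorm_integral_le_lintegral_enorm _).trans (le_of_eq ?_)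
    simp_rw [enorm_mul]
    rfl
  have hfinS : ∫⁻ z, ‖S z‖ₑ ^ 2 ∂ν ≠ ⊤ :=
    (lt_of_le_of_lt (lintegral_mono fun z => by have := hSU z; gcongr) hU2).ne
  -- the square of the norm, as an integral over `Z × (X × X)`
  set J : Z → X × X → ℂ := fun z p => (L p.1 z * h p.1) * conj (L p.2 z * h p.2) with hJ
  have mJ : Measurable (Function.uncurry J) := by
    have m1 : Measurable fun q : Z × (X × X) => L q.2.1 q.1 * h q.2.1 :=
      (hL.comp ((measurable_snd.fst).prodMk measurable_fst)).mul (hh.comp measurable_snd.fst)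
    have m2 : Measurable fun q : Z × (X × X) => L q.2.2 q.1 * h q.2.2 :=
      (hL.comp ((measurable_snd.snd).prodMk measurable_fst)).mul (hh.comp measurable_snd.snd)
    exact m1.mul (Complex.continuous_conj.measurable.comp m2)
  have hSJ : ∀ z, S z * conj (S z) = ∫ p, J z p ∂(μ.prod μ) := fun z => by
    rw [hJ, integral_prod_mul (fun x => L x z * h x) (fun y => conj (L y z * h y)),
      integral_conj]
  have iJ : Integrable (Function.uncurry J) (ν.prod (μ.prod μ)) := by
    refine ⟨mJ.aestronglyMeasurable, ?_⟩
    rw [hasFiniteIntegral_iff_enorm, lintegral_prod _ mJ.enorm.aemeasurable]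
    refine lt_of_le_of_lt (lintegral_mono fun z => le_of_eq ?_) hU2
    have m1 : Measurable fun x => ‖L x z‖ₑ * ‖h x‖ₑ :=
      ((hL.comp (measurable_id.prodMk measurable_const)).enorm).mul hh.enorm
    simp only [Function.uncurry, hJ, enorm_mul, RCLike.enorm_conj, map_mul]
    rw [lintegral_prod_mul m1.aemeasurable m1.aemeasurable, sq]
  rw [← ENNReal.pow_le_pow_left_iff two_ne_zero, lpn_two_sq]
  rw [← enorm_integral_mul_conj mS hfinS]
  simp_rw [hSJ]
  rw [integral_integral_swap iJ]
  refine (enorm_integral_le_lintegral_enorm _).trans (le_trans (lintegral_mono fun p => ?_)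
    (hD _ hh.enorm))
  have e : ∀ z, J z p = h p.1 * conj (h p.2) * (L p.1 z * conj (L p.2 z)) := fun z => by
    simp only [hJ, map_mul]; ring
  simp_rw [e]
  rw [integral_const_mul, enorm_mul, enorm_mul, RCLike.enorm_conj]

/-- Bounding an integral operator `T` on `L²` by means of the kernel of `T T*`. The a priori bound
for the operator with kernel `|L|` enters only through Fubini's theorem. -/
lemma lpn_two_le_of_mul_adjoint (hL : Measurable (Function.uncurry L)) (hA : A ≠ ⊤)
    (habs : ∀ F : Z → ℝ≥0∞, Measurable F →
      lpn 2 μ (fun x => ∫⁻ z, ‖L x z‖ₑ * F z ∂ν) ≤ A * lpn 2 ν F)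
    (hD : ∀ h : X → ℝ≥0∞, Measurable h →
      ∫⁻ p, h p.1 * h p.2 * ‖∫ z, L p.1 z * conj (L p.2 z) ∂ν‖ₑ ∂(μ.prod μ) ≤
        (D * lpn 2 μ h) ^ 2)
    {f : Z → ℂ} (hf : Measurable f) (hfin : lpn 2 ν (fun x => ‖f x‖ₑ) ≠ ⊤) :
    lpn 2 μ (fun x => ‖∫ z, L x z * f z ∂ν‖ₑ) ≤ D * lpn 2 ν (fun x => ‖f x‖ₑ) := by
  set F : X → ℂ := fun x => ∫ z, L x z * f z ∂ν with hF
  have mLf : Measurable (Function.uncurry fun x z => L x z * f z) :=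
    hL.mul (hf.comp measurable_snd)
  have mF : Measurable F := (mLf.stronglyMeasurable.integral_prod_right (ν := ν)).measurable
  set U : X → ℝ≥0∞ := fun x => ∫⁻ z, ‖L x z‖ₑ * ‖f z‖ₑ ∂ν with hU
  have mU : Measurable U := Measurable.lintegral_prod_right' (ν := ν)
    (f := fun q : X × Z => ‖L q.1 q.2‖ₑ * ‖f q.2‖ₑ) (hL.enorm.mul (hf.comp measurable_snd).enorm)
  have hUfin : lpn 2 μ U < ⊤ :=
    (habs _ hf.enorm).trans_lt (ENNReal.mul_lt_top hA.lt_top hfin.lt_top)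
  have hFU : ∀ x, ‖F x‖ₑ ≤ U x := fun x => by
    refine (enorm_integral_le_lintegral_enorm _).trans (le_of_eq ?_)
    simp_rw [enorm_mul]
    rfl
  have hFfin : lpn 2 μ (fun x => ‖F x‖ₑ) < ⊤ :=
    (lpn_mono two_pos (ae_of_all _ hFU)).trans_lt hUfin
  have hFfin2 : ∫⁻ x, ‖F x‖ₑ ^ 2 ∂μ ≠ ⊤ := by
    rw [← lpn_two_sq]; exact (ENNReal.pow_lt_top hFfin).ne
  -- duality with `F` itself: `‖F‖² = ∫ f · (transpose of T applied to conj F)`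
  set h : X → ℂ := fun x => conj (F x) with hh
  have mh : Measurable h := Complex.continuous_conj.measurable.comp mF
  have hhn : ∀ x, ‖h x‖ₑ = ‖F x‖ₑ := fun x => RCLike.enorm_conj _
  have hhfin : lpn 2 μ (fun x => ‖h x‖ₑ) ≠ ⊤ := by simp_rw [hhn]; exact hFfin.ne
  have hS := lpn_two_transposed_le hL hA habs hD mh hhfin
  have mS : Measurable fun z => ∫ x, L x z * h x ∂μ := by
    have : Measurable (Function.uncurry fun z x => L x z * h x) :=
      (hL.comp measurable_swap).mul (mh.comp measurable_snd)
    exact (this.stronglyMeasurable.integral_prod_right (ν := μ)).measurable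
  have iJ : Integrable (Function.uncurry fun x z => L x z * f z * h x) (μ.prod ν) := by
    have mJ : Measurable (Function.uncurry fun x z => L x z * f z * h x) :=
      mLf.mul (mh.comp measurable_fst)
    refine ⟨mJ.aestronglyMeasurable, ?_⟩
    rw [hasFiniteIntegral_iff_enorm, lintegral_prod _ mJ.enorm.aemeasurable]
    have h2 : (2 : ℝ).HolderConjugate 2 := Real.HolderConjugate.two_two
    calc ∫⁻ x, ∫⁻ z, ‖Function.uncurry (fun x z => L x z * f z * h x) (x, z)‖ₑ ∂ν ∂μ
        = ∫⁻ x, U x * ‖h x‖ₑ ∂μ := by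
          refine lintegral_congr fun x => ?_
          simp only [Function.uncurry, enorm_mul]
          have m1 : Measurable fun z => ‖L x z‖ₑ * ‖f z‖ₑ :=
            ((hL.comp (measurable_const.prodMk measurable_id)).enorm).mul hf.enorm
          rw [lintegral_mul_const _ m1]
      _ ≤ lpn 2 μ U * lpn 2 μ (fun x => ‖h x‖ₑ) :=
          lintegral_mul_le_lpn h2 mU.aemeasurable mh.enorm.aemeasurable
      _ < ⊤ := ENNReal.mul_lt_top hUfin hhfin.lt_top
  have key : lpn 2 μ (fun x => ‖F x‖ₑ) ^ 2 ≤
      lpn 2 ν (fun z => ‖f z‖ₑ) * (D * lpn 2 μ (fun x => ‖F x‖ₑ)) := by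
    rw [lpn_two_sq, ← enorm_integral_mul_conj mF hFfin2]
    have e1 : ∀ x, F x * conj (F x) = ∫ z, L x z * f z * h x ∂ν := fun x => by
      rw [integral_mul_const]
    simp_rw [e1]
    rw [integral_integral_swap iJ]
    have e2 : ∀ z, ∫ x, L x z * f z * h x ∂μ = f z * ∫ x, L x z * h x ∂μ := fun z => by
      rw [← integral_const_mul]
      congr 1 with x
      ring
    simp_rw [e2]
    refine (enorm_integral_le_lintegral_enorm _).trans ?_
    simp_rw [enorm_mul]
    refine (lintegral_mul_le_lpn Real.HolderConjugate.two_two hf.enorm.aemeasurable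
      mS.enorm.aemeasurable).trans ?_
    refine mul_le_mul' le_rfl (hS.trans (le_of_eq ?_))
    simp_rw [hhn]
  by_cases h0 : lpn 2 μ (fun x => ‖F x‖ₑ) = 0
  · rw [h0]; exact zero_le
  · rw [sq, ← mul_assoc, mul_comm (lpn 2 ν _)] at key
    exact (ENNReal.mul_le_mul_iff_left h0 hFfin.ne).1 key

end adjoint

/-! ### Annular operators: size -/

section annularOperator

lemma lpn_volume_prod {p : ℝ} (hp : 0 < p) {F : ℝ × ℝ → ℝ≥0∞} (hF : Measurable F) :
    lpn p volume F = lpn p volume (fun x => lpn p volume (fun y => F (x, y))) :=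
  lpn_prod hp hF

/-- Young's inequality in the second variable, followed by Minkowski's inequality in the first. -/
lemma lpn_fiber_le {p : ℝ} (hp : 1 ≤ p) {b : ℝ → ℝ → ℝ≥0∞} (hb : Measurable (Function.uncurry b))
    {F : ℝ × ℝ → ℝ≥0∞} (hF : Measurable F) :
    lpn p volume (fun x => ∫⁻ z : ℝ × ℝ, b z.1 (x - z.2) * F z) ≤
      ∫⁻ z₁, (∫⁻ ζ, b z₁ ζ) * lpn p volume (fun z₂ => F (z₁, z₂)) := by
  have mJ : Measurable fun q : (ℝ × ℝ) × ℝ => b q.1.2 (q.1.1 - q.2) * F (q.1.2, q.2) := by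
    have m1 : Measurable fun q : (ℝ × ℝ) × ℝ => (q.1.2, q.1.1 - q.2) := by fun_prop
    have m2 : Measurable fun q : (ℝ × ℝ) × ℝ => (q.1.2, q.2) := by fun_prop
    exact (hb.comp m1).mul (hF.comp m2)
  have e : ∀ x, ∫⁻ z : ℝ × ℝ, b z.1 (x - z.2) * F z =
      ∫⁻ z₁, ∫⁻ z₂, b z₁ (x - z₂) * F (z₁, z₂) := fun x => by
    rw [Measure.volume_eq_prod, lintegral_prod]
    have m1 : Measurable fun z : ℝ × ℝ => (z.1, x - z.2) := by fun_prop
    exact ((hb.comp m1).mul hF).aemeasurable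
  simp_rw [e]
  refine (lpn_lintegral_le hp (F := fun x z₁ => ∫⁻ z₂, b z₁ (x - z₂) * F (z₁, z₂))
    mJ.lintegral_prod_right').trans (lintegral_mono fun z₁ => ?_)
  exact lpn_convolution_le' hp (hF.comp (measurable_const.prodMk measurable_id))
    (hb.comp (measurable_const.prodMk measurable_id))

/-- A kernel `k` on the line, concentrated at frequencies of size `μ`: both `k` and `μ` times its
primitive `q` are bounded in `L¹`. -/
structure IsBandKernel (B : ℝ≥0∞) (μ : ℝ) (k q : ℝ → ℂ) : Prop where
  cont : Continuous k
  hasDerivAt : ∀ z, HasDerivAt q (k z) z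
  bdd : ∃ c : ℝ, ∀ z, ‖k z‖ ≤ c
  bdd_primitive : ∃ c : ℝ, ∀ z, ‖q z‖ ≤ c
  lintegral_le : ∫⁻ z, ‖k z‖ₑ ≤ B
  lintegral_primitive_le : ∫⁻ z, ‖q z‖ₑ ≤ B * ENNReal.ofReal (1 / μ)

/-- The cross-correlation `ζ ↦ ∫ k(ζ + z) conj (l z) dz`. -/
noncomputable def crossCorr (k l : ℝ → ℂ) (ζ : ℝ) : ℂ := ∫ z, k (ζ + z) * conj (l z)

lemma lintegral_crossCorr_le {k l : ℝ → ℂ} (hk : Measurable k) (hl : Measurable l) :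
    ∫⁻ ζ, ‖crossCorr k l ζ‖ₑ ≤ (∫⁻ z, ‖k z‖ₑ) * ∫⁻ z, ‖l z‖ₑ := by
  calc ∫⁻ ζ, ‖crossCorr k l ζ‖ₑ ≤ ∫⁻ ζ, ∫⁻ z, ‖k (ζ + z)‖ₑ * ‖l z‖ₑ := by
        refine lintegral_mono fun ζ => (enorm_integral_le_lintegral_enorm _).trans (le_of_eq ?_)
        simp_rw [enorm_mul, RCLike.enorm_conj]
    _ = ∫⁻ z, ∫⁻ ζ, ‖k (ζ + z)‖ₑ * ‖l z‖ₑ := by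
        apply lintegral_lintegral_swap
        have m1 : Measurable fun q : ℝ × ℝ => q.1 + q.2 := by fun_prop
        exact ((hk.comp m1).enorm.mul (hl.comp measurable_snd).enorm).aemeasurable
    _ = ∫⁻ z, (∫⁻ ζ, ‖k ζ‖ₑ) * ‖l z‖ₑ := by
        refine lintegral_congr fun z => ?_
        have m1 : Measurable fun ζ => ‖k (ζ + z)‖ₑ := (hk.comp (measurable_add_const z)).enorm
        rw [lintegral_mul_const _ m1, lintegral_add_right_eq_self (fun ζ => ‖k ζ‖ₑ)]
    _ = _ := by rw [lintegral_const_mul _ hl.enorm]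

namespace IsBandKernel

variable {B : ℝ≥0∞} {μ : ℝ} {k q : ℝ → ℂ}

lemma continuous_primitive (h : IsBandKernel B μ k q) : Continuous q :=
  continuous_iff_continuousAt.2 fun z => (h.hasDerivAt z).continuousAt

lemma integrable (h : IsBandKernel B μ k q) (hB : B ≠ ⊤) : Integrable k :=
  ⟨h.cont.aestronglyMeasurable, h.lintegral_le.trans_lt hB.lt_top⟩

lemma integrable_mul_conj (h : IsBandKernel B μ k q) (hB : B ≠ ⊤) {l : ℝ → ℂ} (hl : Continuous l)
    {c : ℝ} (hc : ∀ z, ‖l z‖ ≤ c) (ζ : ℝ) : Integrable fun z => l (ζ + z) * conj (k z) := by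
  have h1 : Integrable fun z => conj (k z) := by
    have := (h.integrable hB)
    exact (RCLike.conjLIE (K := ℂ)).integrable_comp_iff.2 this
  exact h1.bdd_mul (hl.comp (continuous_const.add continuous_id)).aestronglyMeasurable
    (ae_of_all _ fun z => hc _)

lemma continuous_crossCorr (h : IsBandKernel B μ k q) (hB : B ≠ ⊤) :
    Continuous (crossCorr k k) := by
  obtain ⟨c, hc⟩ := h.bdd
  have hcont := h.cont
  refine continuous_of_dominated (bound := fun z => c * ‖k z‖)
    (fun ζ => (h.integrable_mul_conj hB h.cont hc ζ).aestronglyMeasurable)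
    (fun ζ => ae_of_all _ fun z => ?_) ((h.integrable hB).norm.const_mul c)
    (ae_of_all _ fun z => by fun_prop)
  rw [norm_mul, RCLike.norm_conj]
  exact mul_le_mul_of_nonneg_right (hc _) (norm_nonneg _)

lemma hasDerivAt_crossCorr (h : IsBandKernel B μ k q) (hB : B ≠ ⊤) (ζ : ℝ) :
    HasDerivAt (crossCorr q k) (crossCorr k k ζ) ζ := by
  obtain ⟨c, hc⟩ := h.bdd
  obtain ⟨c', hc'⟩ := h.bdd_primitive
  refine (hasDerivAt_integral_of_dominated_loc_of_deriv_le (s := univ)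
    (F := fun ζ z => q (ζ + z) * conj (k z)) (F' := fun ζ z => k (ζ + z) * conj (k z))
    (bound := fun z => c * ‖k z‖) univ_mem
    (Eventually.of_forall fun ζ =>
      (h.integrable_mul_conj hB h.continuous_primitive hc' ζ).aestronglyMeasurable)
    (h.integrable_mul_conj hB h.continuous_primitive hc' ζ)
    (h.integrable_mul_conj hB h.cont hc ζ).aestronglyMeasurable
    (ae_of_all _ fun z ζ _ => ?_) ((h.integrable hB).norm.const_mul c)
    (ae_of_all _ fun z ζ _ => ?_)).2
  · rw [norm_mul, RCLike.norm_conj]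
    exact mul_le_mul_of_nonneg_right (hc _) (norm_nonneg _)
  · exact ((h.hasDerivAt (ζ + z)).comp_add_const ζ z).mul_const _

lemma lintegral_crossCorr_le (h : IsBandKernel B μ k q) :
    ∫⁻ ζ, ‖crossCorr k k ζ‖ₑ ≤ B ^ 2 := by
  rw [sq]
  exact (_root_.lintegral_crossCorr_le h.cont.measurable h.cont.measurable).trans
    (mul_le_mul' h.lintegral_le h.lintegral_le)

lemma lintegral_crossCorr_primitive_le (h : IsBandKernel B μ k q) :
    ∫⁻ ζ, ‖crossCorr q k ζ‖ₑ ≤ B ^ 2 * ENNReal.ofReal (1 / μ) := by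
  refine (_root_.lintegral_crossCorr_le h.continuous_primitive.measurable h.cont.measurable).trans
    ((mul_le_mul' h.lintegral_primitive_le h.lintegral_le).trans (le_of_eq ?_))
  ring

end IsBandKernel

/-- The kernel of the operator `f ↦ ∫ ∫ f(x₁ - t, x₂ - u(x₁) γ(t) - z) k(z) dz dt / t`, the integral
in `t` being over `(r(x₁), 2 r(x₁)]`. -/
noncomputable def annKernel (γ u r : ℝ → ℝ) (k : ℝ → ℂ) (x z : ℝ × ℝ) : ℂ :=
  (annKer (r x.1) (x.1 - z.1) : ℂ) * k (x.2 - z.2 - u x.1 * γ (x.1 - z.1))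

variable {γ u r : ℝ → ℝ} {k q : ℝ → ℂ} {B : ℝ≥0∞} {μ : ℝ}

lemma measurable_annKernel (hγ : Continuous γ) (hu : Measurable u) (hr : Measurable r)
    (hk : Continuous k) : Measurable (Function.uncurry (annKernel γ u r k)) := by
  have m1 : Measurable fun w : (ℝ × ℝ) × (ℝ × ℝ) => annKer (r w.1.1) (w.1.1 - w.2.1) := by
    have : Measurable fun w : (ℝ × ℝ) × (ℝ × ℝ) => (r w.1.1, w.1.1 - w.2.1) := by fun_prop
    exact measurable_uncurry_annKer.comp this
  have m2 : Measurable fun w : (ℝ × ℝ) × (ℝ × ℝ) =>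
      k (w.1.2 - w.2.2 - u w.1.1 * γ (w.1.1 - w.2.1)) := by
    have := hk.measurable
    have := hγ.measurable
    fun_prop
  exact m1.complex_ofReal.mul m2

lemma enorm_ofReal_annKer (r t : ℝ) : ‖(annKer r t : ℂ)‖ₑ = ENNReal.ofReal (annKer r t) := by
  rw [← ofReal_norm, Complex.norm_real, Real.norm_eq_abs, abs_of_nonneg (annKer_nonneg r t)]

/-- The annulus `(r, 2r]` lies in a ball of radius `2 r`. For `r ≤ 0` the kernel vanishes. -/
lemma lintegral_annKer_mul_le (r : ℝ) (G : ℝ → ℝ≥0∞) (x : ℝ) :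
    ∫⁻ s, ENNReal.ofReal (annKer r (x - s)) * G s ≤ 4 * hlMax G x := by
  rcases le_or_gt r 0 with hr | hr
  · simp [annKer_of_nonpos hr]
  calc ∫⁻ s, ENNReal.ofReal (annKer r (x - s)) * G s
      ≤ ∫⁻ s, ENNReal.ofReal (1 / r) *
        ((Metric.closedBall (0 : ℝ) (2 * r)).indicator (fun _ => 1) (x - s) * G s) := by
        refine lintegral_mono fun s => ?_
        rw [← mul_assoc]
        gcongr
        refine (ENNReal.ofReal_le_ofReal (annKer_le r (x - s))).trans ?_
        by_cases h : x - s ∈ Metric.closedBall (0 : ℝ) (2 * r)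
        · rw [indicator_of_mem h, indicator_of_mem h, mul_one, abs_of_pos (by positivity)]
        · rw [indicator_of_notMem h]; simp
    _ = ENNReal.ofReal (1 / r) * ∫⁻ s in Metric.closedBall x (2 * r), G s := by
        rw [lintegral_const_mul' _ _ ENNReal.ofReal_ne_top, lintegral_closedBall_eq]
    _ ≤ ENNReal.ofReal (1 / r) * (ENNReal.ofReal (2 * (2 * r)) * hlMax G x) := by
        gcongr
        exact lintegral_closedBall_le_hlMax G x (by positivity)
    _ = 4 * hlMax G x := by
        rw [← mul_assoc, ← ENNReal.ofReal_mul (by positivity)]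
        congr 1
        rw [show 1 / r * (2 * (2 * r)) = 4 by field_simp; norm_num]
        simp

/-- The bound without decay: Young's inequality in the second variable and the maximal function in
the first. Neither `u` nor `r` matters, because the translation by `u(x₁) γ(t)` does not change `L¹`
norms in the second variable. -/
lemma lpn_annKernel_le (hγ : Continuous γ) (hu : Measurable u) (hr : Measurable r)
    (hk : Continuous k) (hB : ∫⁻ z, ‖k z‖ₑ ≤ B) {p : ℝ} (hp : 1 < p) {F : ℝ × ℝ → ℝ≥0∞}
    (hF : Measurable F) :
    lpn p volume (fun x => ∫⁻ z, ‖annKernel γ u r k x z‖ₑ * F z) ≤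
      4 * B * hlConst p * lpn p volume F := by
  have hp0 : 0 < p := by linarith
  have mG : Measurable fun z₁ => lpn p volume fun z₂ => F (z₁, z₂) := measurable_lpn hF
  have mL : Measurable fun x => ∫⁻ z, ‖annKernel γ u r k x z‖ₑ * F z :=
    Measurable.lintegral_prod_right' (f := fun w : (ℝ × ℝ) × (ℝ × ℝ) =>
      ‖annKernel γ u r k w.1 w.2‖ₑ * F w.2)
      ((measurable_annKernel hγ hu hr hk).enorm.mul (hF.comp measurable_snd))
  rw [lpn_volume_prod hp0 mL, lpn_volume_prod hp0 hF]
  have hfib : ∀ x₁, lpn p volume (fun x₂ => ∫⁻ z, ‖annKernel γ u r k (x₁, x₂) z‖ₑ * F z) ≤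
      4 * B * hlMax (fun z₁ => lpn p volume fun z₂ => F (z₁, z₂)) x₁ := by
    intro x₁
    set b : ℝ → ℝ → ℝ≥0∞ := fun z₁ ζ =>
      ENNReal.ofReal (annKer (r x₁) (x₁ - z₁)) * ‖k (ζ - u x₁ * γ (x₁ - z₁))‖ₑ with hb
    have mb : Measurable (Function.uncurry b) := by
      have m1 : Measurable fun w : ℝ × ℝ => (r x₁, x₁ - w.1) := by fun_prop
      have m2 : Measurable fun w : ℝ × ℝ => k (w.2 - u x₁ * γ (x₁ - w.1)) := by
        have := hk.measurable
        have := hγ.measurable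
        fun_prop
      exact (measurable_uncurry_annKer.comp m1).ennreal_ofReal.mul m2.enorm
    have e : ∀ x₂ z, ‖annKernel γ u r k (x₁, x₂) z‖ₑ = b z.1 (x₂ - z.2) := fun x₂ z => by
      simp only [annKernel, hb]
      rw [enorm_mul, enorm_ofReal_annKer]
    simp_rw [e]
    refine (lpn_fiber_le hp.le mb hF).trans ?_
    have hI : ∀ z₁, ∫⁻ ζ, b z₁ ζ ≤ B * ENNReal.ofReal (annKer (r x₁) (x₁ - z₁)) := fun z₁ => by
      simp only [hb]
      rw [lintegral_const_mul' _ _ ENNReal.ofReal_ne_top,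
        lintegral_sub_right_eq_self (fun ζ => ‖k ζ‖ₑ), mul_comm]
      gcongr
    calc _ ≤ ∫⁻ z₁, B * (ENNReal.ofReal (annKer (r x₁) (x₁ - z₁)) *
          lpn p volume fun z₂ => F (z₁, z₂)) := by
          refine lintegral_mono fun z₁ => ?_
          rw [← mul_assoc]
          gcongr
          exact hI z₁
      _ = B * ∫⁻ z₁, ENNReal.ofReal (annKer (r x₁) (x₁ - z₁)) *
          lpn p volume fun z₂ => F (z₁, z₂) := by
          rw [lintegral_const_mul]
          have m1 : Measurable fun z₁ : ℝ => (r x₁, x₁ - z₁) := by fun_prop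
          exact (measurable_uncurry_annKer.comp m1).ennreal_ofReal.mul mG
      _ ≤ B * (4 * hlMax (fun z₁ => lpn p volume fun z₂ => F (z₁, z₂)) x₁) := by
          gcongr
          exact lintegral_annKer_mul_le _ _ _
      _ = _ := by ring
  calc _ ≤ lpn p volume fun x₁ => 4 * B * hlMax (fun z₁ => lpn p volume fun z₂ => F (z₁, z₂)) x₁ :=
        lpn_mono hp0 (ae_of_all _ hfib)
    _ = 4 * B * lpn p volume (hlMax (fun z₁ => lpn p volume fun z₂ => F (z₁, z₂))) :=
        lpn_const_mul hp0 _ (measurable_hlMax mG).aemeasurable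
    _ ≤ 4 * B * (hlConst p * lpn p volume fun z₁ => lpn p volume fun z₂ => F (z₁, z₂)) := by
        gcongr
        exact lpn_hlMax_le hp mG
    _ = _ := by ring

/-- The kernel of `T T*` is of convolution type in the second variable; it is the oscillatory kernel
built from the autocorrelation of `k`. -/
lemma integral_annKernel_mul_conj (hγ : Continuous γ) (h : IsBandKernel B μ k q)
    (hB : B ≠ ⊤) (x y : ℝ × ℝ) :
    ∫ z, annKernel γ u r k x z * conj (annKernel γ u r k y z) =
      oscKer γ (crossCorr k k) (u x.1) (u y.1) (r x.1) (r y.1) (x.1 - y.1) (x.2 - y.2) := by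
  obtain ⟨c, hc⟩ := h.bdd
  have hc0 : 0 ≤ c := (norm_nonneg _).trans (hc 0)
  set a : ℝ → ℝ := fun z₁ => annKer (r x.1) (x.1 - z₁) * annKer (r y.1) (y.1 - z₁) with ha
  have ma : Measurable a := by
    have m1 : Measurable fun z₁ : ℝ => (r x.1, x.1 - z₁) := by fun_prop
    have m2 : Measurable fun z₁ : ℝ => (r y.1, y.1 - z₁) := by fun_prop
    exact (measurable_uncurry_annKer.comp m1).mul (measurable_uncurry_annKer.comp m2)
  have ha0 : ∀ z₁, 0 ≤ a z₁ := fun z₁ => mul_nonneg (annKer_nonneg _ _) (annKer_nonneg _ _)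
  set K : ℝ × ℝ → ℂ := fun z => (a z.1 : ℂ) * (k (x.2 - z.2 - u x.1 * γ (x.1 - z.1)) *
    conj (k (y.2 - z.2 - u y.1 * γ (y.1 - z.1)))) with hK
  have e1 : ∀ z, annKernel γ u r k x z * conj (annKernel γ u r k y z) = K z := fun z => by
    simp only [annKernel, hK, ha, map_mul, Complex.conj_ofReal]
    push_cast
    ring
  simp_rw [e1]
  have mk := h.cont.measurable
  have mγ := hγ.measurable
  have mK : Measurable K := by
    have m3 : Measurable fun z : ℝ × ℝ => conj (k (y.2 - z.2 - u y.1 * γ (y.1 - z.1))) := by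
      apply Complex.continuous_conj.measurable.comp
      fun_prop
    have m4 : Measurable fun z : ℝ × ℝ => k (x.2 - z.2 - u x.1 * γ (x.1 - z.1)) := by fun_prop
    exact (ma.comp measurable_fst).complex_ofReal.mul (m4.mul m3)
  have iK : Integrable K (volume.prod volume) := by
    refine ⟨mK.aestronglyMeasurable, ?_⟩
    rw [hasFiniteIntegral_iff_enorm, lintegral_prod _ mK.enorm.aemeasurable]
    -- of the two factors `k` one is bounded and the other is integrable
    have b1 : ∀ z₁, ∫⁻ z₂, ‖K (z₁, z₂)‖ₑ ≤ ENNReal.ofReal (a z₁) * (ENNReal.ofReal c * B) := by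
      intro z₁
      have b2 : ∀ z₂, ‖K (z₁, z₂)‖ₑ ≤ ENNReal.ofReal (a z₁) * (ENNReal.ofReal c *
          ‖k ((y.2 - u y.1 * γ (y.1 - z₁)) - z₂)‖ₑ) := fun z₂ => by
        simp only [hK, enorm_mul, RCLike.enorm_conj]
        rw [← ofReal_norm (a z₁ : ℂ), Complex.norm_real, Real.norm_eq_abs, abs_of_nonneg (ha0 _),
          sub_right_comm y.2 z₂]
        gcongr
        rw [← ofReal_norm]
        exact ENNReal.ofReal_le_ofReal (hc _)
      refine (lintegral_mono b2).trans ?_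
      rw [lintegral_const_mul' _ _ ENNReal.ofReal_ne_top,
        lintegral_const_mul' _ _ ENNReal.ofReal_ne_top,
        lintegral_sub_left_eq_self (fun z => ‖k z‖ₑ)]
      gcongr
      exact h.lintegral_le
    refine (lintegral_mono b1).trans_lt ?_
    rw [lintegral_mul_const _ ma.ennreal_ofReal]
    refine ENNReal.mul_lt_top ?_ (ENNReal.mul_lt_top ENNReal.ofReal_lt_top hB.lt_top)
    have b3 : ∀ z₁, ENNReal.ofReal (a z₁) ≤ ENNReal.ofReal (|1 / r y.1|) *
        (ENNReal.ofReal (annKer (r x.1) (x.1 - z₁)) * 1) := fun z₁ => by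
      rw [mul_one, ← ENNReal.ofReal_mul (by positivity)]
      refine ENNReal.ofReal_le_ofReal ?_
      simp only [ha]
      rw [mul_comm]
      refine mul_le_mul_of_nonneg_right ((annKer_le _ _).trans ?_) (annKer_nonneg _ _)
      exact indicator_le_self' (fun _ _ => by positivity) _
    refine (lintegral_mono b3).trans_lt ?_
    rw [lintegral_const_mul' _ _ ENNReal.ofReal_ne_top]
    refine ENNReal.mul_lt_top ENNReal.ofReal_lt_top
      ((lintegral_annKer_mul_le (r x.1) (fun _ => 1) x.1).trans_lt ?_)
    refine ENNReal.mul_lt_top (by simp) ((hlMax_le_of_le (fun _ => le_rfl) _).trans_lt ?_)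
    simp
  rw [Measure.volume_eq_prod, integral_prod _ iK]
  have e2 : ∀ z₁, ∫ z₂, K (z₁, z₂) = (a z₁ : ℂ) *
      crossCorr k k (x.2 - y.2 - (u x.1 * γ (x.1 - z₁) - u y.1 * γ (y.1 - z₁))) := fun z₁ => by
    simp only [hK]
    rw [integral_const_mul, crossCorr, ← integral_sub_left_eq_self _ _
      (y.2 - u y.1 * γ (y.1 - z₁))]
    congr 2 with z₂
    congr 2
    · ring_nf
    · ring_nf
  simp_rw [e2]
  rw [oscKer, ← integral_sub_left_eq_self _ _ x.1]
  congr 1 with z₁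
  have e3 : y.1 - (x.1 - z₁) = z₁ - (x.1 - y.1) := by ring
  simp only [ha]
  rw [sub_sub_cancel, e3, mul_comm]

end annularOperator

/-! ### Annular operators: decay on `L²` -/

section annularDecay

/-- The kernel `(r |s|)^(-1/2)` restricted to `|s| ≤ 2 r`. -/
noncomputable def sqrtKer (r s : ℝ) : ℝ≥0∞ :=
  (Metric.closedBall (0 : ℝ) (2 * r)).indicator (fun s => ENNReal.ofReal (1 / √(r * |s|))) s

lemma measurable_uncurry_sqrtKer : Measurable fun w : ℝ × ℝ => sqrtKer w.1 w.2 := by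
  have : (fun w : ℝ × ℝ => sqrtKer w.1 w.2) = {w : ℝ × ℝ | |w.2| ≤ 2 * w.1}.indicator
      (fun w => ENNReal.ofReal (1 / √(w.1 * |w.2|))) := by
    ext w
    by_cases h : |w.2| ≤ 2 * w.1
    · rw [sqrtKer, indicator_of_mem (by simpa using h), indicator_of_mem (by exact h)]
    · rw [sqrtKer, indicator_of_notMem (by simpa using h), indicator_of_notMem (by exact h)]
  rw [this]
  refine Measurable.indicator (by fun_prop) ?_
  exact measurableSet_le measurable_snd.abs (measurable_fst.const_mul 2)

lemma sqrtKer_neg (r s : ℝ) : sqrtKer r (-s) = sqrtKer r s := by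
  by_cases h : |s| ≤ 2 * r
  · rw [sqrtKer, sqrtKer, indicator_of_mem (by simpa using h), indicator_of_mem (by simpa using h),
      abs_neg]
  · rw [sqrtKer, sqrtKer, indicator_of_notMem (by simpa using h),
      indicator_of_notMem (by simpa using h)]

/-- The kernel `(r |s|)^(-1/2)` on `|s| ≤ 2 r` is radially decreasing with mass `O(1)` for every
`r`, so the maximal function controls it even when `r` depends on the point `x`. -/
lemma lintegral_sqrtKer_mul_le (r : ℝ) {G : ℝ → ℝ≥0∞} (hG : Measurable G) (x : ℝ) :
    ∫⁻ s, sqrtKer r (x - s) * G s ≤ 16 * hlMax G x := by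
  rcases le_or_gt r 0 with hr | hr
  · have : ∀ s, sqrtKer r s = 0 := fun s => by
      rw [sqrtKer]
      by_cases h : s ∈ Metric.closedBall (0 : ℝ) (2 * r)
      · rw [indicator_of_mem h, Real.sqrt_eq_zero_of_nonpos
          (mul_nonpos_of_nonpos_of_nonneg hr (abs_nonneg s))]
        simp
      · rw [indicator_of_notMem h]
    simp [this]
  -- dyadic decomposition: on `2⁻ᵏ r < |s| ≤ 2¹⁻ᵏ r` the kernel is at most `(3/2)ᵏ / r`
  have hmaj : ∀ s, sqrtKer r s ≤ ∑' k : ℕ, ENNReal.ofReal ((3 / 2) ^ k / r) *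
      (Metric.closedBall (0 : ℝ) ((1 / 2) ^ k * (2 * r))).indicator (fun _ => 1) s := by
    intro s
    by_cases h : s ∈ Metric.closedBall (0 : ℝ) (2 * r)
    · rw [sqrtKer, indicator_of_mem h]
      rw [mem_closedBall_zero_iff, Real.norm_eq_abs] at h
      rcases eq_or_ne s 0 with rfl | hs
      · simp
      have hs' : 0 < |s| := abs_pos.2 hs
      obtain ⟨n, hn1, hn2⟩ := exists_nat_pow_near_of_lt_one (x := |s| / (2 * r)) (y := 1 / 2)
        (by positivity) ((div_le_one (by positivity)).2 h) (by norm_num) (by norm_num)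
      rw [div_le_iff₀ (by positivity)] at hn2
      rw [lt_div_iff₀ (by positivity)] at hn1
      refine le_trans ?_ (ENNReal.le_tsum n)
      rw [indicator_of_mem (by simpa using hn2), mul_one]
      refine ENNReal.ofReal_le_ofReal ?_
      rw [div_le_div_iff₀ (Real.sqrt_pos.2 (by positivity)) hr, one_mul]
      refine le_of_sq_le_sq ?_ (by positivity)
      rw [mul_pow, Real.sq_sqrt (by positivity)]
      have e1 : (1 : ℝ) ≤ ((3 / 2) ^ n) ^ 2 * (1 / 2) ^ n := by
        rw [← pow_mul, mul_comm n 2, pow_mul, ← mul_pow]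
        exact one_le_pow₀ (by norm_num)
      calc r ^ 2 = 1 * r ^ 2 := (one_mul _).symm
        _ ≤ ((3 / 2) ^ n) ^ 2 * (1 / 2) ^ n * r ^ 2 := by gcongr
        _ = ((3 / 2) ^ n) ^ 2 * (r * ((1 / 2) ^ (n + 1) * (2 * r))) := by ring
        _ ≤ ((3 / 2) ^ n) ^ 2 * (r * |s|) := by gcongr
    · rw [sqrtKer, indicator_of_notMem h]; exact zero_le
  have hsum : ∑' k : ℕ, ENNReal.ofReal ((3 / 2) ^ k / r * (2 * ((1 / 2) ^ k * (2 * r)))) = 16 := by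
    have e : ∀ k : ℕ, (3 / 2 : ℝ) ^ k / r * (2 * ((1 / 2) ^ k * (2 * r))) = 4 * (3 / 4) ^ k := by
      intro k
      rw [show (3 / 4 : ℝ) = 3 / 2 * (1 / 2) by norm_num, mul_pow]
      field_simp
      norm_num
    simp_rw [e]
    rw [← ENNReal.ofReal_tsum_of_nonneg (fun k => by positivity)
      ((summable_geometric_of_lt_one (by norm_num) (by norm_num)).mul_left 4), tsum_mul_left,
      tsum_geometric_of_lt_one (by norm_num) (by norm_num)]
    norm_num
  calc _ ≤ ∫⁻ s, (∑' k : ℕ, ENNReal.ofReal ((3 / 2) ^ k / r) *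
      (Metric.closedBall (0 : ℝ) ((1 / 2) ^ k * (2 * r))).indicator (fun _ => 1) (x - s)) * G s :=
        lintegral_mono fun s => mul_le_mul_left (hmaj _) _
    _ ≤ _ := by
        refine (lintegral_tsum_indicator_mul_le hG (fun k => by positivity)
          (fun k => by positivity) x).trans (le_of_eq ?_)
        rw [hsum]

lemma oscKer_eq_zero_of_nonpos (γ : ℝ → ℝ) (κ : ℝ → ℂ) (u v : ℝ) {r r' : ℝ} (s ζ : ℝ)
    (h : r ≤ 0 ∨ r' ≤ 0) : oscKer γ κ u v r r' s ζ = 0 := by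
  rw [oscKer]
  refine integral_eq_zero_of_ae (ae_of_all _ fun t => ?_)
  rcases h with h | h <;> simp [annKer_of_nonpos h]

lemma measurable_oscKer {γ u r : ℝ → ℝ} {κ : ℝ → ℂ} (hγ : Continuous γ) (hκ : Continuous κ)
    (hu : Measurable u) (hr : Measurable r) : Measurable fun w : (ℝ × ℝ) × ℝ =>
      oscKer γ κ (u w.1.1) (u w.1.2) (r w.1.1) (r w.1.2) (w.1.1 - w.1.2) w.2 := by
  have mκ := hκ.measurable
  have mγ := hγ.measurable
  have m1 : Measurable fun w : ((ℝ × ℝ) × ℝ) × ℝ => κ (w.1.2 - (u w.1.1.1 * γ w.2 -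
      u w.1.1.2 * γ (w.2 - (w.1.1.1 - w.1.1.2)))) := by fun_prop
  have m2 : Measurable fun w : ((ℝ × ℝ) × ℝ) × ℝ => annKer (r w.1.1.1) w.2 := by
    have : Measurable fun w : ((ℝ × ℝ) × ℝ) × ℝ => (r w.1.1.1, w.2) := by fun_prop
    exact measurable_uncurry_annKer.comp this
  have m3 : Measurable fun w : ((ℝ × ℝ) × ℝ) × ℝ =>
      annKer (r w.1.1.2) (w.2 - (w.1.1.1 - w.1.1.2)) := by
    have : Measurable fun w : ((ℝ × ℝ) × ℝ) × ℝ =>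
      (r w.1.1.2, w.2 - (w.1.1.1 - w.1.1.2)) := by fun_prop
    exact measurable_uncurry_annKer.comp this
  exact ((m1.mul (m2.mul m3).complex_ofReal).stronglyMeasurable.integral_prod_right
    (ν := volume) (f := fun (w : (ℝ × ℝ) × ℝ) (t : ℝ) => κ (w.2 - (u w.1.1 * γ t - u w.1.2 * γ (t - (w.1.1 - w.1.2)))) *
      ((annKer (r w.1.1) t * annKer (r w.1.2) (t - (w.1.1 - w.1.2)) : ℝ) : ℂ))).measurable

variable {γ : ℝ → ℝ}

lemma IsAdmissibleCurve.continuous (hγ : IsAdmissibleCurve γ) : Continuous γ :=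
  hγ.contDiff.continuous

/-- The kernel of `T T*` is dominated by a kernel that the maximal function controls. -/
lemma IsAdmissibleCurve.exists_lintegral_oscKer_le_sqrtKer (hγ : IsAdmissibleCurve γ) :
    ∃ C : ℝ≥0∞, C ≠ ⊤ ∧ ∀ (B : ℝ≥0∞) (μ : ℝ) (k q : ℝ → ℂ), B ≠ ⊤ → 0 < μ →
    IsBandKernel B μ k q → ∀ (u r : ℝ → ℝ) (N : ℝ), 0 < N →
    (∀ x, 0 < r x → N ≤ μ * |u x| * γ (r x)) → ∀ x y : ℝ, x ≠ y →
    ∫⁻ ζ, ‖oscKer γ (crossCorr k k) (u x) (u y) (r x) (r y) (x - y) ζ‖ₑ ≤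
      C * B ^ 2 * ENNReal.ofReal (1 / √N) * (sqrtKer (r x) (x - y) + sqrtKer (r y) (x - y)) := by
  obtain ⟨C, hC, h⟩ := hγ.exists_lintegral_oscKer_le
  refine ⟨ENNReal.ofReal C, ENNReal.ofReal_ne_top,
    fun B μ k q hB hμ hk u r N hN hu x y hxy => ?_⟩
  rcases le_or_gt (r x) 0 with hx | hx
  · simp [oscKer_eq_zero_of_nonpos γ _ (u x) (u y) _ _ (Or.inl hx)]
  rcases le_or_gt (r y) 0 with hy | hy
  · simp [oscKer_eq_zero_of_nonpos γ _ (u x) (u y) _ _ (Or.inr hy)]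
  rcases lt_or_ge (2 * max (r x) (r y)) |x - y| with hs | hs
  · simp [oscKer_eq_zero γ _ (u x) (u y) _ hs]
  refine (h _ _ (hk.continuous_crossCorr hB) (hk.hasDerivAt_crossCorr hB) (B ^ 2) μ hμ
    hk.lintegral_crossCorr_le hk.lintegral_crossCorr_primitive_le N (u x) (u y) (r x) (r y) (x - y)
    hN hx hy (sub_ne_zero.2 hxy) (hu x hx) (hu y hy)).trans ?_
  have hle : ENNReal.ofReal (1 / √(max (r x) (r y) * |x - y|)) ≤
      sqrtKer (r x) (x - y) + sqrtKer (r y) (x - y) := by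
    rcases le_total (r x) (r y) with hm | hm
    · rw [max_eq_right hm] at hs ⊢
      refine le_trans (le_of_eq ?_) le_add_self
      rw [sqrtKer, indicator_of_mem (by simpa using hs)]
    · rw [max_eq_left hm] at hs ⊢
      refine le_trans (le_of_eq ?_) le_self_add
      rw [sqrtKer, indicator_of_mem (by simpa using hs)]
  have e : C / √(N * (max (r x) (r y) * |x - y|)) =
      C * (1 / √N) * (1 / √(max (r x) (r y) * |x - y|)) := by
    rw [Real.sqrt_mul hN.le]
    field_simp
  rw [e, ENNReal.ofReal_mul (by positivity), ENNReal.ofReal_mul hC.le]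
  calc _ ≤ B ^ 2 * (ENNReal.ofReal C * ENNReal.ofReal (1 / √N) *
      (sqrtKer (r x) (x - y) + sqrtKer (r y) (x - y))) := by gcongr
    _ = _ := by ring

/-- The form `∫∫ h(x) h(y) K(x₁, y₁, x₂ - y₂)` is bounded by means of the `L¹` norms of `K` in its
last variable. -/
lemma lintegral_bilinear_le {K : (ℝ × ℝ) × ℝ → ℝ≥0∞} (hK : Measurable K) {h : ℝ × ℝ → ℝ≥0∞}
    (hh : Measurable h) :
    ∫⁻ p : (ℝ × ℝ) × (ℝ × ℝ), h p.1 * h p.2 * K ((p.1.1, p.2.1), p.1.2 - p.2.2) ≤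
      ∫⁻ x, ∫⁻ y, lpn 2 volume (fun z => h (x, z)) * lpn 2 volume (fun z => h (y, z)) *
        ∫⁻ ζ, K ((x, y), ζ) := by
  have mp : Measurable fun p : (ℝ × ℝ) × (ℝ × ℝ) =>
      h p.1 * h p.2 * K ((p.1.1, p.2.1), p.1.2 - p.2.2) := by
    have : Measurable fun p : (ℝ × ℝ) × (ℝ × ℝ) => ((p.1.1, p.2.1), p.1.2 - p.2.2) := by fun_prop
    exact ((hh.comp measurable_fst).mul (hh.comp measurable_snd)).mul (hK.comp this)
  rw [Measure.volume_eq_prod, lintegral_prod _ mp.aemeasurable, Measure.volume_eq_prod,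
    lintegral_prod _ mp.lintegral_prod_right'.aemeasurable]
  refine lintegral_mono fun x₁ => ?_
  have e1 : ∀ x₂, ∫⁻ y : ℝ × ℝ, h (x₁, x₂) * h y * K ((x₁, y.1), x₂ - y.2) ∂(volume.prod volume) =
      ∫⁻ y₁, ∫⁻ y₂, h (x₁, x₂) * h (y₁, y₂) * K ((x₁, y₁), x₂ - y₂) := fun x₂ => by
    have m1 : Measurable fun y : ℝ × ℝ => h (x₁, x₂) * h y * K ((x₁, y.1), x₂ - y.2) :=
      mp.comp (measurable_const.prodMk measurable_id)
    rw [lintegral_prod _ m1.aemeasurable]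
  simp only [e1]
  rw [lintegral_lintegral_swap]
  · refine lintegral_mono fun y₁ => ?_
    have mK : Measurable fun ζ => K ((x₁, y₁), ζ) := hK.comp (measurable_const.prodMk measurable_id)
    have mh : ∀ a, Measurable fun z => h (a, z) := fun a =>
      hh.comp (measurable_const.prodMk measurable_id)
    have e2 : ∀ x₂, ∫⁻ y₂, h (x₁, x₂) * h (y₁, y₂) * K ((x₁, y₁), x₂ - y₂) =
        h (x₁, x₂) * ∫⁻ y₂, K ((x₁, y₁), x₂ - y₂) * h (y₁, y₂) := fun x₂ => by
      have m2 : Measurable fun y₂ => K ((x₁, y₁), x₂ - y₂) * h (y₁, y₂) :=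
        (mK.comp (measurable_const.sub measurable_id)).mul (mh y₁)
      rw [← lintegral_const_mul _ m2]
      refine lintegral_congr fun y₂ => ?_
      ring
    simp_rw [e2]
    have m3 : Measurable fun x₂ => ∫⁻ y₂, K ((x₁, y₁), x₂ - y₂) * h (y₁, y₂) := by
      refine Measurable.lintegral_prod_right'
        (f := fun w : ℝ × ℝ => K ((x₁, y₁), w.1 - w.2) * h (y₁, w.2)) ?_
      exact (mK.comp (measurable_fst.sub measurable_snd)).mul ((mh y₁).comp measurable_snd)
    refine (lintegral_mul_le_lpn Real.HolderConjugate.two_two (mh x₁).aemeasurable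
      m3.aemeasurable).trans ?_
    calc _ ≤ lpn 2 volume (fun z => h (x₁, z)) *
        ((∫⁻ ζ, K ((x₁, y₁), ζ)) * lpn 2 volume (fun z => h (y₁, z))) := by
          gcongr
          exact lpn_convolution_le' one_le_two (mh y₁) mK
      _ = _ := by ring
  · have m4 : Measurable fun w : (ℝ × ℝ) × ℝ => h (x₁, w.1.1) * h (w.1.2, w.2) *
        K ((x₁, w.1.2), w.1.1 - w.2) := by
      have : Measurable fun w : (ℝ × ℝ) × ℝ => ((x₁, w.1.1), (w.1.2, w.2)) := by fun_prop
      exact mp.comp this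
    exact m4.lintegral_prod_right'.aemeasurable

/-- The annular operator gains a power of `N` on `L²`. -/
lemma IsAdmissibleCurve.exists_lpn_two_annKernel_le (hγ : IsAdmissibleCurve γ) :
    ∃ C : ℝ≥0∞, C ≠ ⊤ ∧ ∀ (B : ℝ≥0∞) (μ : ℝ) (k q : ℝ → ℂ), B ≠ ⊤ → 0 < μ →
    IsBandKernel B μ k q → ∀ (u r : ℝ → ℝ) (N : ℝ), Measurable u → Measurable r → 0 < N →
    (∀ x, 0 < r x → N ≤ μ * |u x| * γ (r x)) → ∀ f : ℝ × ℝ → ℂ, Measurable f →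
    lpn 2 volume (fun x => ‖f x‖ₑ) ≠ ⊤ →
    lpn 2 volume (fun x => ‖∫ z, annKernel γ u r k x z * f z‖ₑ) ≤
      C * B * ENNReal.ofReal (N ^ (-(1 / 4 : ℝ))) * lpn 2 volume (fun x => ‖f x‖ₑ) := by
  obtain ⟨C, hC, hker⟩ := hγ.exists_lintegral_oscKer_le_sqrtKer
  have hM := hlConst_ne_top one_lt_two
  set C' := (C * 32 * hlConst 2) ^ (1 / 2 : ℝ) with hC'
  have hC'sq : C' ^ 2 = C * 32 * hlConst 2 := by
    rw [hC', ← ENNReal.rpow_two, ← ENNReal.rpow_mul]; norm_num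
  refine ⟨C', by finiteness, fun B μ k q hB hμ hk u r N hu hr hN hur f hf hfin => ?_⟩
  refine lpn_two_le_of_mul_adjoint (measurable_annKernel hγ.continuous hu hr hk.cont)
    (A := 4 * B * hlConst 2) (by finiteness)
    (fun F hF => lpn_annKernel_le hγ.continuous hu hr hk.cont hk.lintegral_le one_lt_two hF)
    (fun h hh => ?_) hf hfin
  simp_rw [integral_annKernel_mul_conj hγ.continuous hk hB]
  set K : (ℝ × ℝ) × ℝ → ℝ≥0∞ := fun w =>
    ‖oscKer γ (crossCorr k k) (u w.1.1) (u w.1.2) (r w.1.1) (r w.1.2) (w.1.1 - w.1.2) w.2‖ₑ with hK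
  have mK : Measurable K :=
    (measurable_oscKer hγ.continuous (hk.continuous_crossCorr hB) hu hr).enorm
  refine (lintegral_bilinear_le mK hh).trans ?_
  set H : ℝ → ℝ≥0∞ := fun x => lpn 2 volume (fun z => h (x, z)) with hH
  have mH : Measurable H := measurable_lpn hh
  set E := C * B ^ 2 * ENNReal.ofReal (1 / √N) with hE
  set S : ℝ → ℝ → ℝ≥0∞ := fun x y => sqrtKer (r x) (x - y) with hS
  have mS : Measurable (Function.uncurry S) := by
    have : Measurable fun w : ℝ × ℝ => (r w.1, w.1 - w.2) := by fun_prop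
    exact measurable_uncurry_sqrtKer.comp this
  have mHH : Measurable fun w : ℝ × ℝ => H w.1 * H w.2 :=
    (mH.comp measurable_fst).mul (mH.comp measurable_snd)
  have step1 : ∫⁻ x, ∫⁻ y, H x * H y * ∫⁻ ζ, K ((x, y), ζ) ≤
      ∫⁻ x, ∫⁻ y, E * (H x * H y * S x y + H x * H y * S y x) := by
    refine lintegral_mono fun x => lintegral_mono_ae ?_
    -- the kernel estimate degenerates on the diagonal, which is a null set
    have : ∀ᵐ y : ℝ, y ≠ x := by simp [ae_iff]
    filter_upwards [this] with y hy
    have := hker B μ k q hB hμ hk u r N hN hur x y hy.symm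
    calc H x * H y * ∫⁻ ζ, K ((x, y), ζ) ≤ H x * H y * (E *
        (sqrtKer (r x) (x - y) + sqrtKer (r y) (x - y))) := by gcongr
      _ = E * (H x * H y * S x y + H x * H y * S y x) := by
          simp only [hS]
          rw [← sqrtKer_neg (r y), neg_sub]
          ring
  have hEtop : E ≠ ⊤ := by finiteness
  have m1 : Measurable fun w : ℝ × ℝ => H w.1 * H w.2 * S w.1 w.2 := mHH.mul mS
  have m2 : Measurable fun w : ℝ × ℝ => H w.1 * H w.2 * S w.2 w.1 :=
    mHH.mul (mS.comp measurable_swap)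
  have step2 : ∫⁻ x, ∫⁻ y, H x * H y * S x y ≤ 16 * hlConst 2 * lpn 2 volume H ^ 2 := by
    calc ∫⁻ x, ∫⁻ y, H x * H y * S x y = ∫⁻ x, H x * ∫⁻ y, sqrtKer (r x) (x - y) * H y := by
          refine lintegral_congr fun x => ?_
          have m3 : Measurable fun y => sqrtKer (r x) (x - y) * H y :=
            (mS.comp (measurable_const.prodMk measurable_id)).mul mH
          rw [← lintegral_const_mul _ m3]
          refine lintegral_congr fun y => ?_
          simp only [hS]
          ring
      _ ≤ ∫⁻ x, H x * (16 * hlMax H x) := by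
          gcongr with x
          exact lintegral_sqrtKer_mul_le _ mH _
      _ = 16 * ∫⁻ x, H x * hlMax H x := by
          rw [← lintegral_const_mul' _ _ (by simp)]
          refine lintegral_congr fun x => ?_
          ring
      _ ≤ 16 * (lpn 2 volume H * (hlConst 2 * lpn 2 volume H)) := by
          gcongr
          refine (lintegral_mul_le_lpn Real.HolderConjugate.two_two mH.aemeasurable
            (measurable_hlMax mH).aemeasurable).trans ?_
          gcongr
          exact lpn_hlMax_le one_lt_two mH
      _ = _ := by ring
  -- the radius `r y` in the second term belongs to the variable that is integrated, hence the swap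
  have step3 : ∫⁻ x, ∫⁻ y, H x * H y * S y x = ∫⁻ x, ∫⁻ y, H x * H y * S x y := by
    rw [lintegral_lintegral_swap m2.aemeasurable]
    simp_rw [mul_comm (H _) (H _)]
  have hHn : lpn 2 volume H = lpn 2 volume h := (lpn_volume_prod two_pos hh).symm
  calc _ ≤ ∫⁻ x, ∫⁻ y, E * (H x * H y * S x y + H x * H y * S y x) := step1
    _ = E * ((∫⁻ x, ∫⁻ y, H x * H y * S x y) + ∫⁻ x, ∫⁻ y, H x * H y * S y x) := by
        simp_rw [lintegral_const_mul' E _ hEtop]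
        congr 1
        rw [← lintegral_add_left m1.lintegral_prod_right']
        refine lintegral_congr fun x => ?_
        have m3 : Measurable fun y => H x * H y * S x y :=
          m1.comp (measurable_const.prodMk measurable_id)
        rw [lintegral_add_left m3]
    _ ≤ E * (16 * hlConst 2 * lpn 2 volume h ^ 2 + 16 * hlConst 2 * lpn 2 volume h ^ 2) := by
        rw [step3, ← hHn]
        gcongr
    _ = C' ^ 2 * B ^ 2 * ENNReal.ofReal (1 / √N) * lpn 2 volume h ^ 2 := by
        rw [hC'sq, hE]; ring
    _ = _ := by
        have : ENNReal.ofReal (1 / √N) = ENNReal.ofReal (N ^ (-(1 / 4 : ℝ))) ^ 2 := by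
          rw [← ENNReal.ofReal_pow (by positivity), ← Real.rpow_natCast, ← Real.rpow_mul hN.le,
            Real.sqrt_eq_rpow, one_div, ← Real.rpow_neg hN.le]
          norm_num
        rw [this]; ring

end annularDecay

/-! ### Annular operators: decay on `L^p` -/

section annularLp

lemma ae_lt_top_of_lpn_ne_top {α : Type*} [MeasurableSpace α] {μ : Measure α} {p : ℝ} (hp : 0 < p)
    {F : α → ℝ≥0∞} (hF : Measurable F) (h : lpn p μ F ≠ ⊤) : ∀ᵐ x ∂μ, F x < ⊤ := by
  have h1 : ∫⁻ x, F x ^ p ∂μ ≠ ⊤ := by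
    rw [← lpn_rpow hp]
    exact ENNReal.rpow_ne_top_of_nonneg hp.le h
  filter_upwards [ae_lt_top (hF.pow_const p) h1] with x hx
  by_contra hn
  rw [not_lt_top_iff.1 hn, ENNReal.top_rpow_of_pos hp] at hx
  exact lt_irrefl _ hx

/-- The operator with kernel `annKernel`. -/
noncomputable def annOp (γ u r : ℝ → ℝ) (k : ℝ → ℂ) (f : ℝ × ℝ → ℂ) (x : ℝ × ℝ) : ℂ :=
  ∫ z, annKernel γ u r k x z * f z

variable {γ u r : ℝ → ℝ} {k q : ℝ → ℂ} {B : ℝ≥0∞} {μ : ℝ}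

lemma measurable_annOp (hγ : Continuous γ) (hu : Measurable u) (hr : Measurable r)
    (hk : Continuous k) {f : ℝ × ℝ → ℂ} (hf : Measurable f) : Measurable (annOp γ u r k f) :=
  (((measurable_annKernel hγ hu hr hk).mul
    (hf.comp measurable_snd)).stronglyMeasurable.integral_prod_right (ν := volume)
    (f := fun (x z : ℝ × ℝ) => annKernel γ u r k x z * f z)).measurable

lemma lpn_annOp_le (hγ : Continuous γ) (hu : Measurable u) (hr : Measurable r)
    (hk : Continuous k) (hB : ∫⁻ z, ‖k z‖ₑ ≤ B) {p : ℝ} (hp : 1 < p) {f : ℝ × ℝ → ℂ}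
    (hf : Measurable f) : lpn p volume (fun x => ‖annOp γ u r k f x‖ₑ) ≤
      4 * B * hlConst p * lpn p volume (fun x => ‖f x‖ₑ) := by
  refine le_trans (lpn_mono (by linarith) (ae_of_all _ fun x => ?_))
    (lpn_annKernel_le hγ hu hr hk hB hp hf.enorm)
  refine (enorm_integral_le_lintegral_enorm _).trans (le_of_eq ?_)
  simp_rw [enorm_mul]

/-- Interpolation of an `L²` bound with decay and a bound without decay in another `L^{p'}`. -/
lemma lpn_annOp_interpolate (hγ : Continuous γ) (hu : Measurable u) (hr : Measurable r)
    (hk : Continuous k) (hB : ∫⁻ z, ‖k z‖ₑ ≤ B) (hBt : B ≠ ⊤) {p₀ p p₁ : ℝ} (h0 : 1 < p₀)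
    (h01 : p₀ < p) (h1 : p < p₁) {B₀ B₁ : ℝ≥0∞} {c : ℝ} (hc : 0 < c)
    (hb₀ : ∀ f : ℝ × ℝ → ℂ, Measurable f → lpn p₀ volume (fun x => ‖annOp γ u r k f x‖ₑ) ≤
      B₀ * lpn p₀ volume (fun x => ‖f x‖ₑ))
    (hb₁ : ∀ f : ℝ × ℝ → ℂ, Measurable f → lpn p₁ volume (fun x => ‖annOp γ u r k f x‖ₑ) ≤
      B₁ * lpn p₁ volume (fun x => ‖f x‖ₑ))
    {f : ℝ × ℝ → ℂ} (hf : Measurable f) (hfin : lpn p volume (fun x => ‖f x‖ₑ) ≠ ⊤) :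
    lpn p volume (fun x => ‖annOp γ u r k f x‖ₑ) ≤
      (B₀ ^ p₀ * ENNReal.ofReal (2 ^ p₀ * (p / (p - p₀) * c ^ (p₀ - p))) +
        B₁ ^ p₁ * ENNReal.ofReal (2 ^ p₁ * (p / (p₁ - p) * c ^ (p₁ - p)))) ^ (1 / p) *
          lpn p volume (fun a => ‖f a‖ₑ) := by
  have hp : 1 < p := h0.trans h01
  have mhi : ∀ s, Measurable ({a | c * s < ‖f a‖}.indicator f) := fun s =>
    hf.indicator (measurableSet_lt measurable_const hf.norm)
  have mlo : ∀ s, Measurable ({a | ‖f a‖ ≤ c * s}.indicator f) := fun s =>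
    hf.indicator (measurableSet_le hf.norm measurable_const)
  have hM := hlConst_ne_top hp
  have mL := measurable_annKernel hγ hu hr hk
  have mU : Measurable fun x => ∫⁻ z, ‖annKernel γ u r k x z‖ₑ * ‖f z‖ₑ :=
    Measurable.lintegral_prod_right' (f := fun w : (ℝ × ℝ) × (ℝ × ℝ) =>
      ‖annKernel γ u r k w.1 w.2‖ₑ * ‖f w.2‖ₑ) (mL.enorm.mul (hf.comp measurable_snd).enorm)
  have hae := ae_lt_top_of_lpn_ne_top (by linarith : 0 < p) mU
    ((lpn_annKernel_le hγ hu hr hk hB hp hf.enorm).trans_lt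
      (ENNReal.mul_lt_top (by finiteness) hfin.lt_top)).ne
  refine lpn_le_of_interpolation (by linarith) h01 h1 hf (measurable_annOp hγ hu hr hk hf).enorm
    (F₀ := fun s x => ‖annOp γ u r k ({a | c * s < ‖f a‖}.indicator f) x‖ₑ)
    (F₁ := fun s x => ‖annOp γ u r k ({a | ‖f a‖ ≤ c * s}.indicator f) x‖ₑ)
    (fun s => (measurable_annOp hγ hu hr hk (mhi s)).enorm)
    (fun s => (measurable_annOp hγ hu hr hk (mlo s)).enorm) hc (fun s _ => ?_)
    (fun s _ => hb₀ _ (mhi s)) (fun s _ => hb₁ _ (mlo s))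
  filter_upwards [hae] with x hx
  have mLx : Measurable (annKernel γ u r k x) := mL.comp (measurable_const.prodMk measurable_id)
  have int : ∀ g : ℝ × ℝ → ℂ, Measurable g → (∀ z, ‖g z‖ₑ ≤ ‖f z‖ₑ) →
      Integrable fun z => annKernel γ u r k x z * g z := by
    intro g hg hgf
    refine ⟨(mLx.mul hg).aestronglyMeasurable, ?_⟩
    refine lt_of_le_of_lt (lintegral_mono fun z => ?_) hx
    rw [enorm_mul]
    gcongr
    exact hgf z
  have e : annOp γ u r k f x = annOp γ u r k ({a | c * s < ‖f a‖}.indicator f) x +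
      annOp γ u r k ({a | ‖f a‖ ≤ c * s}.indicator f) x := by
    rw [annOp, annOp, annOp, ← integral_add (int _ (mhi s) fun z => ?_) (int _ (mlo s) fun z => ?_)]
    · congr 1 with z
      rw [← mul_add]
      congr 1
      by_cases h : c * s < ‖f z‖
      · rw [indicator_of_mem (by exact h), indicator_of_notMem (by exact not_le.2 h), add_zero]
      · rw [indicator_of_notMem (by exact h), indicator_of_mem (by exact not_lt.1 h), zero_add]
    · exact enorm_indicator_le_enorm_self _ _
    · exact enorm_indicator_le_enorm_self _ _
  rw [e]
  exact enorm_add_le _ _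

/-- Of two powers of `N ≥ 1` the one with the slower decay is kept. -/
lemma add_mul_rpow_rpow_le {X Y : ℝ≥0∞} {N a b e p : ℝ} (hN : 1 ≤ N) (ha : e ≤ a) (hb : e ≤ b)
    (hp : 0 < p) : (X * ENNReal.ofReal (N ^ (-a)) + Y * ENNReal.ofReal (N ^ (-b))) ^ (1 / p) ≤
      (X + Y) ^ (1 / p) * ENNReal.ofReal (N ^ (-(e / p))) := by
  have hN0 : 0 < N := by linarith
  have h : ∀ c, e ≤ c → ENNReal.ofReal (N ^ (-c)) ≤ ENNReal.ofReal (N ^ (-e)) := fun c hc =>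
    ENNReal.ofReal_le_ofReal (Real.rpow_le_rpow_of_exponent_le hN (by linarith))
  have e1 : ENNReal.ofReal (N ^ (-(e / p))) = ENNReal.ofReal (N ^ (-e)) ^ (1 / p) := by
    rw [ENNReal.ofReal_rpow_of_pos (by positivity), ← Real.rpow_mul hN0.le]
    congr 2
    ring
  rw [e1, ← ENNReal.mul_rpow_of_nonneg _ _ (by positivity), add_mul]
  exact ENNReal.rpow_le_rpow (add_le_add (mul_le_mul' le_rfl (h a ha)) (mul_le_mul' le_rfl (h b hb)))
    (by positivity)

/-- The annular operator gains a power of `N` on every `L^p`. -/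
lemma IsAdmissibleCurve.exists_lpn_annOp_le (hγ : IsAdmissibleCurve γ) {p : ℝ} (hp : 1 < p)
    (hB : B ≠ ⊤) : ∃ C : ℝ≥0∞, C ≠ ⊤ ∧ ∃ δ : ℝ, 0 < δ ∧ ∀ (μ : ℝ) (k q : ℝ → ℂ), 0 < μ →
    IsBandKernel B μ k q → ∀ (u r : ℝ → ℝ) (N : ℝ), Measurable u → Measurable r → 1 ≤ N →
    (∀ x, 0 < r x → N ≤ μ * |u x| * γ (r x)) → ∀ f : ℝ × ℝ → ℂ, Measurable f →
    lpn p volume (fun x => ‖f x‖ₑ) ≠ ⊤ →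
    lpn p volume (fun x => ‖annOp γ u r k f x‖ₑ) ≤
      C * ENNReal.ofReal (N ^ (-δ)) * lpn p volume (fun x => ‖f x‖ₑ) := by
  obtain ⟨C, hC, h⟩ := hγ.exists_lpn_two_annKernel_le
  -- a nonzero constant makes the `L²` bound valid for all `f`
  set A := C * B + 1 with hA
  have hAt : A ≠ ⊤ := by finiteness
  have hA0 : A ≠ 0 := by simp [hA]
  have hp0 : 0 < p := by linarith
  have two : ∀ (μ : ℝ) (k q : ℝ → ℂ), 0 < μ →
      IsBandKernel B μ k q → ∀ (u r : ℝ → ℝ) (N : ℝ), Measurable u → Measurable r → 1 ≤ N →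
      (∀ x, 0 < r x → N ≤ μ * |u x| * γ (r x)) → ∀ f : ℝ × ℝ → ℂ, Measurable f →
      lpn 2 volume (fun x => ‖annOp γ u r k f x‖ₑ) ≤
        A * ENNReal.ofReal (N ^ (-(1 / 4 : ℝ))) * lpn 2 volume (fun x => ‖f x‖ₑ) := by
    intro μ k q hμ hk u r N hu hr hN hur f hf
    have hN0 : 0 < N := by linarith
    by_cases hfin : lpn 2 volume (fun x => ‖f x‖ₑ) = ⊤
    · rw [hfin, ENNReal.mul_top]
      · exact le_top
      · refine mul_ne_zero hA0 ?_
        simpa using Real.rpow_pos_of_pos hN0 _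
    · refine (h B μ k q hB hμ hk u r N hu hr hN0 hur f hf hfin).trans ?_
      gcongr
      exact le_self_add
  rcases lt_trichotomy p 2 with h2 | h2 | h2
  -- interpolate between `L^{p₀}`, without decay, and `L²`; the height `c = N ^ (1/4)` gives the
  -- powers `N ^ (-(p - p₀) / 4)` and `N ^ (-p / 4)`
  · set p₀ := (1 + p) / 2 with hp₀
    have h1 : 1 < p₀ := by linarith
    have h01 : p₀ < p := by linarith
    have hM := hlConst_ne_top h1
    set X : ℝ≥0∞ := (4 * B * hlConst p₀) ^ p₀ * ENNReal.ofReal (2 ^ p₀ * (p / (p - p₀))) with hX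
    set Y : ℝ≥0∞ := A ^ (2 : ℝ) * ENNReal.ofReal (2 ^ (2 : ℝ) * (p / (2 - p))) with hY
    have hXt : X ≠ ⊤ := ENNReal.mul_ne_top
      (ENNReal.rpow_ne_top_of_nonneg (by linarith) (by finiteness)) ENNReal.ofReal_ne_top
    have hYt : Y ≠ ⊤ := ENNReal.mul_ne_top
      (ENNReal.rpow_ne_top_of_nonneg (by norm_num) hAt) ENNReal.ofReal_ne_top
    refine ⟨(X + Y) ^ (1 / p), ENNReal.rpow_ne_top_of_nonneg (by positivity) (by finiteness),
      (p - 1) / 8 / p, by have := sub_pos.2 hp; positivity, ?_⟩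
    intro μ k q hμ hk u r N hu hr hN hur f hf hfin
    have hN0 : 0 < N := by linarith
    refine (lpn_annOp_interpolate hγ.continuous hu hr hk.cont hk.lintegral_le hB h1 h01 h2
      (c := N ^ (1 / 4 : ℝ)) (by positivity)
      (fun f hf => lpn_annOp_le hγ.continuous hu hr hk.cont hk.lintegral_le h1 hf)
      (two μ k q hμ hk u r N hu hr hN hur) hf hfin).trans ?_
    refine mul_le_mul_left (le_trans (le_of_eq ?_)
      (add_mul_rpow_rpow_le (X := X) (Y := Y) (a := (p - p₀) / 4) (b := p / 4) hN ?_ ?_ hp0)) _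
    · congr 2
      · rw [hX, mul_assoc (_ ^ p₀), ← ENNReal.ofReal_mul (by have := sub_pos.2 h01; positivity),
          ← Real.rpow_mul hN0.le]
        congr 2
        rw [show (1 / 4 : ℝ) * (p₀ - p) = -((p - p₀) / 4) by ring]
        ring
      · rw [ENNReal.mul_rpow_of_nonneg _ _ (by norm_num), hY, mul_assoc, mul_assoc,
          ENNReal.ofReal_rpow_of_pos (by positivity), ← ENNReal.ofReal_mul (by positivity),
          ← ENNReal.ofReal_mul (by have := sub_pos.2 h2; positivity), ← Real.rpow_mul hN0.le,
          ← Real.rpow_mul hN0.le]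
        congr 2
        have : N ^ (-(p / 4)) = N ^ (-(1 / 4 : ℝ) * 2) * N ^ ((1 / 4 : ℝ) * (2 - p)) := by
          rw [← Real.rpow_add hN0]
          congr 1
          ring
        rw [this]
        ring
    · linarith
    · linarith
  · subst h2
    refine ⟨A, hAt, 1 / 4, by norm_num, fun μ k q hμ hk u r N hu hr hN hur f hf _ =>
      two μ k q hμ hk u r N hu hr hN hur f hf⟩
  -- interpolate between `L²` and `L^{p + 1}`, without decay; the height `c = N ^ (-1 / (4 p))` is
  -- small enough for the `L²` term to keep its decay and gives `N ^ (-1 / (4 p))` in the other one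
  · set p₁ := p + 1 with hp₁
    have h1 : 1 < p₁ := by linarith
    have h11 : p < p₁ := by linarith
    have hM := hlConst_ne_top h1
    set X : ℝ≥0∞ := A ^ (2 : ℝ) * ENNReal.ofReal (2 ^ (2 : ℝ) * (p / (p - 2))) with hX
    set Y : ℝ≥0∞ := (4 * B * hlConst p₁) ^ p₁ * ENNReal.ofReal (2 ^ p₁ * (p / (p₁ - p))) with hY
    have hYt : Y ≠ ⊤ := ENNReal.mul_ne_top
      (ENNReal.rpow_ne_top_of_nonneg (by linarith) (by finiteness)) ENNReal.ofReal_ne_top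
    have hXt : X ≠ ⊤ := ENNReal.mul_ne_top
      (ENNReal.rpow_ne_top_of_nonneg (by norm_num) hAt) ENNReal.ofReal_ne_top
    refine ⟨(X + Y) ^ (1 / p), ENNReal.rpow_ne_top_of_nonneg (by positivity) (by finiteness),
      1 / (4 * p) / p, by positivity, ?_⟩
    intro μ k q hμ hk u r N hu hr hN hur f hf hfin
    have hN0 : 0 < N := by linarith
    refine (lpn_annOp_interpolate hγ.continuous hu hr hk.cont hk.lintegral_le hB one_lt_two h2 h11
      (c := N ^ (-(1 / (4 * p)))) (by positivity)
      (two μ k q hμ hk u r N hu hr hN hur)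
      (fun f hf => lpn_annOp_le hγ.continuous hu hr hk.cont hk.lintegral_le h1 hf) hf hfin).trans ?_
    have hpp : 1 / (4 * p) * p = 1 / 4 := by field_simp
    have hp4 : 1 / (4 * p) ≤ 1 / 4 := one_div_le_one_div_of_le (by norm_num) (by linarith)
    refine mul_le_mul_left (le_trans (le_of_eq ?_)
      (add_mul_rpow_rpow_le (X := X) (Y := Y) (a := 1 / 2 - 1 / (4 * p) * (p - 2))
        (b := 1 / (4 * p)) hN ?_ ?_ hp0)) _
    · congr 2
      · rw [ENNReal.mul_rpow_of_nonneg _ _ (by norm_num), hX, mul_assoc, mul_assoc,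
          ENNReal.ofReal_rpow_of_pos (by positivity), ← ENNReal.ofReal_mul (by positivity),
          ← ENNReal.ofReal_mul (by have := sub_pos.2 h2; positivity), ← Real.rpow_mul hN0.le,
          ← Real.rpow_mul hN0.le]
        congr 2
        have : N ^ (-(1 / 2 - 1 / (4 * p) * (p - 2))) =
            N ^ (-(1 / 4 : ℝ) * 2) * N ^ (-(1 / (4 * p)) * (2 - p)) := by
          rw [← Real.rpow_add hN0]
          congr 1
          ring
        rw [this]
        ring
      · rw [hY, mul_assoc (_ ^ p₁), ← ENNReal.ofReal_mul (by have := sub_pos.2 h11; positivity),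
          ← Real.rpow_mul hN0.le, hp₁]
        congr 2
        rw [show -(1 / (4 * p)) * (p + 1 - p) = -(1 / (4 * p)) by ring]
        ring
    · rw [mul_sub, hpp]
      have : 0 < 1 / (4 * p) := by positivity
      linarith
    · exact le_rfl

end annularLp

/-! ### Functions reproduced by a band kernel -/

section bandLimited

/-- `g` is reproduced by convolution with `k` in the second variable, on almost every vertical
line. -/
def Reproduces (k : ℝ → ℂ) (g : ℝ × ℝ → ℂ) : Prop :=
  ∀ᵐ z₁ : ℝ, ∀ y, g (z₁, y) = ∫ z₂, k (y - z₂) * g (z₁, z₂)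

variable {γ u r τ : ℝ → ℝ} {k k₁ q : ℝ → ℂ} {B : ℝ≥0∞} {μ : ℝ} {g : ℝ × ℝ → ℂ}

lemma lpn_ne_top_of_bdd {f : ℝ → ℂ} {c : ℝ} (hc : ∀ z, ‖f z‖ ≤ c) (h : ∫⁻ z, ‖f z‖ₑ ≠ ⊤)
    {s : ℝ} (hs : 1 ≤ s) : lpn s volume (fun z => ‖f z‖ₑ) ≠ ⊤ := by
  have hs0 : 0 < s := by linarith
  refine ENNReal.rpow_ne_top_of_nonneg (by positivity) (ne_of_lt ?_)
  calc ∫⁻ z, ‖f z‖ₑ ^ s ≤ ∫⁻ z, ENNReal.ofReal c ^ (s - 1) * ‖f z‖ₑ := by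
        refine lintegral_mono fun z => ?_
        have e : ‖f z‖ₑ ^ s = ‖f z‖ₑ ^ (s - 1) * ‖f z‖ₑ := by
          conv_rhs => rw [← ENNReal.rpow_one (‖f z‖ₑ), ← ENNReal.rpow_mul, one_mul,
            ← ENNReal.rpow_add_of_nonneg _ _ (by linarith) zero_le_one, sub_add_cancel]
        rw [e]
        gcongr
        rw [← ofReal_norm]
        exact ENNReal.ofReal_le_ofReal (hc z)
    _ = ENNReal.ofReal c ^ (s - 1) * ∫⁻ z, ‖f z‖ₑ := lintegral_const_mul' _ _
        (ENNReal.rpow_ne_top_of_nonneg (by linarith) ENNReal.ofReal_ne_top)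
    _ < ⊤ := ENNReal.mul_lt_top
        (ENNReal.rpow_ne_top_of_nonneg (by linarith) ENNReal.ofReal_ne_top).lt_top h.lt_top

lemma lintegral_hKer_mul_lt_top {p : ℝ} (hp : 1 < p) {G : ℝ → ℝ≥0∞} (hG : Measurable G)
    (hfin : lpn p volume G ≠ ⊤) {ε : ℝ} (hε : 0 < ε) (x : ℝ) :
    ∫⁻ s, ‖hKer ε (x - s)‖ₑ * G s < ⊤ := by
  have hpq := Real.HolderConjugate.conjExponent hp
  have hk : lpn p.conjExponent volume (fun s => ‖hKer ε (x - s)‖ₑ) ≠ ⊤ := by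
    rw [lpn_comp_sub_left (fun t => ‖hKer ε t‖ₑ) x]
    exact lpn_hKer_ne_top hε hpq.symm.lt
  have m1 : Measurable fun s => ‖hKer ε (x - s)‖ₑ :=
    ((measurable_hKer ε).comp (measurable_const.sub measurable_id)).enorm
  exact (lintegral_mul_le_lpn hpq.symm m1.aemeasurable hG.aemeasurable).trans_lt
    (ENNReal.mul_lt_top hk.lt_top hfin.lt_top)

lemma lintegral_annKer_mul_lt_top {p : ℝ} (hp : 1 < p) {G : ℝ → ℝ≥0∞} (hG : Measurable G)
    (hfin : lpn p volume G ≠ ⊤) (r x : ℝ) :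
    ∫⁻ s, ENNReal.ofReal (annKer r (x - s)) * G s < ⊤ := by
  rcases le_or_gt r 0 with hr | hr
  · simp [annKer_of_nonpos hr]
  refine (lintegral_mono fun s => ?_).trans_lt (lintegral_hKer_mul_lt_top hp hG hfin hr x)
  gcongr
  rw [← ofReal_norm, Real.norm_eq_abs]
  refine ENNReal.ofReal_le_ofReal ?_
  by_cases h : x - s ∈ Ioc r (2 * r)
  · rw [annKer_of_mem h, hKer_of_lt (h.1.trans_le (le_abs_self _))]
    exact le_abs_self _
  · rw [annKer_of_notMem h]; exact abs_nonneg _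

/-- Bernstein's inequality on vertical lines: all values are controlled by the `L^p` norm. -/
lemma IsBandKernel.exists_lintegral_mul_le (hk : IsBandKernel B μ k q) (hB : B ≠ ⊤) {p : ℝ}
    (hp : 1 < p) : ∃ c : ℝ≥0∞, c ≠ ⊤ ∧ ∀ G : ℝ → ℝ≥0∞, Measurable G → ∀ y,
      ∫⁻ z, ‖k (y - z)‖ₑ * G z ≤ c * lpn p volume G := by
  have hpq := Real.HolderConjugate.conjExponent hp
  obtain ⟨c, hc⟩ := hk.bdd
  refine ⟨lpn p.conjExponent volume (fun z => ‖k z‖ₑ),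
    lpn_ne_top_of_bdd hc (hk.lintegral_le.trans_lt hB.lt_top).ne hpq.symm.lt.le, fun G hG y => ?_⟩
  have m1 : Measurable fun z => ‖k (y - z)‖ₑ :=
    (hk.cont.measurable.comp (measurable_const.sub measurable_id)).enorm
  refine (lintegral_mul_le_lpn hpq.symm m1.aemeasurable hG.aemeasurable).trans (le_of_eq ?_)
  rw [lpn_comp_sub_left (fun z => ‖k z‖ₑ) y]

/-- On almost every vertical line `g` is bounded, with a bound for every point of the line; so `g`
may be evaluated along a curve although it is only an `L^p` function. -/
lemma enorm_le_of_reproduces {c : ℝ≥0∞} {p : ℝ} (hg : Measurable g) (hrep : Reproduces k g)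
    (hc : ∀ G : ℝ → ℝ≥0∞, Measurable G → ∀ y, ∫⁻ z, ‖k (y - z)‖ₑ * G z ≤ c * lpn p volume G) :
    ∀ᵐ z₁ : ℝ, ∀ y, ‖g (z₁, y)‖ₑ ≤ c * lpn p volume (fun z₂ => ‖g (z₁, z₂)‖ₑ) := by
  filter_upwards [hrep] with z₁ hz y
  rw [hz y]
  refine (enorm_integral_le_lintegral_enorm _).trans ?_
  simp_rw [enorm_mul]
  exact hc _ (hg.comp (measurable_const.prodMk measurable_id)).enorm y

/-- The contribution of the annulus `t ∈ (r(x₁), 2 r(x₁)]` to the Hilbert transform along the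
curve. -/
noncomputable def highPart (γ u r : ℝ → ℝ) (g : ℝ × ℝ → ℂ) (x : ℝ × ℝ) : ℂ :=
  ∫ t, (annKer (r x.1) t : ℂ) * g (x.1 - t, x.2 - u x.1 * γ t)

/-- Inserting the reproducing formula turns the integral along the curve into an integral operator
on the plane. -/
lemma highPart_eq_annOp (hγ : Continuous γ) (hu : Measurable u) (hr : Measurable r)
    (hk : IsBandKernel B μ k q) (hB : B ≠ ⊤) {p : ℝ} (hp : 1 < p) (hg : Measurable g)
    (hfin : lpn p volume (fun x => ‖g x‖ₑ) ≠ ⊤) (hrep : Reproduces k g) (x : ℝ × ℝ) :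
    highPart γ u r g x = annOp γ u r k g x := by
  have hp0 : 0 < p := by linarith
  obtain ⟨c, hct, hc⟩ := hk.exists_lintegral_mul_le hB hp
  have mG : Measurable fun z₁ => lpn p volume (fun z₂ => ‖g (z₁, z₂)‖ₑ) := measurable_lpn hg.enorm
  have hGfin : lpn p volume (fun z₁ => lpn p volume (fun z₂ => ‖g (z₁, z₂)‖ₑ)) ≠ ⊤ := by
    rwa [← lpn_volume_prod hp0 hg.enorm]
  have mK : Measurable fun z => annKernel γ u r k x z * g z :=
    ((measurable_annKernel hγ hu hr hk.cont).comp (measurable_const.prodMk measurable_id)).mul hg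
  have iK : Integrable (fun z => annKernel γ u r k x z * g z) (volume.prod volume) := by
    refine ⟨mK.aestronglyMeasurable, ?_⟩
    rw [hasFiniteIntegral_iff_enorm, lintegral_prod _ mK.enorm.aemeasurable]
    have : ∀ z₁, ∫⁻ z₂, ‖annKernel γ u r k x (z₁, z₂) * g (z₁, z₂)‖ₑ ≤
        c * (ENNReal.ofReal (annKer (r x.1) (x.1 - z₁)) *
          lpn p volume (fun z₂ => ‖g (z₁, z₂)‖ₑ)) := fun z₁ => by
      simp only [annKernel, enorm_mul, enorm_ofReal_annKer, mul_assoc]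
      rw [lintegral_const_mul' _ _ ENNReal.ofReal_ne_top, mul_left_comm]
      gcongr
      have e : ∀ z₂, x.2 - z₂ - u x.1 * γ (x.1 - z₁) = x.2 - u x.1 * γ (x.1 - z₁) - z₂ :=
        fun z₂ => sub_right_comm _ _ _
      simp_rw [e]
      exact hc _ (hg.comp (measurable_const.prodMk measurable_id)).enorm _
    refine (lintegral_mono this).trans_lt ?_
    rw [lintegral_const_mul' _ _ hct]
    exact ENNReal.mul_lt_top hct.lt_top (lintegral_annKer_mul_lt_top hp mG hGfin _ _)
  rw [annOp, Measure.volume_eq_prod, integral_prod _ iK, highPart,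
    ← integral_sub_left_eq_self _ _ x.1]
  refine integral_congr_ae ?_
  filter_upwards [hrep] with z₁ hz
  rw [sub_sub_cancel, hz, ← integral_const_mul]
  congr 1 with z₂
  rw [annKernel, mul_assoc, sub_right_comm x.2]

/-- Beyond the scale `τ` the dyadic annuli are summed as a geometric series: by convexity `2ⁿ = 2ⁿ μ
|u| γ(τ) ≤ μ |u| γ(2ⁿ τ)`, so the `n`-th annular operator has norm `O(2^(-δ n))`. -/
lemma IsAdmissibleCurve.exists_lpn_tsum_highPart_le (hγ : IsAdmissibleCurve γ) {p : ℝ} (hp : 1 < p)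
    (hB : B ≠ ⊤) : ∃ C : ℝ≥0∞, C ≠ ⊤ ∧ ∀ (μ : ℝ) (k q : ℝ → ℂ), 0 < μ →
    IsBandKernel B μ k q → ∀ u τ : ℝ → ℝ, Measurable u → Measurable τ →
    (∀ x, 0 < τ x → μ * |u x| * γ (τ x) = 1) → ∀ g : ℝ × ℝ → ℂ, Measurable g →
    lpn p volume (fun x => ‖g x‖ₑ) ≠ ⊤ → Reproduces k g →
    lpn p volume (fun x => ∑' n : ℕ, ‖highPart γ u (fun y => 2 ^ n * τ y) g x‖ₑ) ≤
      C * lpn p volume (fun x => ‖g x‖ₑ) := by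
  obtain ⟨C, hC, δ, hδ, h⟩ := hγ.exists_lpn_annOp_le hp hB
  have ha : ENNReal.ofReal (2 ^ (-δ)) < 1 := by
    rw [ENNReal.ofReal_lt_one]
    exact Real.rpow_lt_one_of_one_lt_of_neg one_lt_two (by linarith)
  refine ⟨C * (1 - ENNReal.ofReal (2 ^ (-δ)))⁻¹,
    ENNReal.mul_ne_top hC (ENNReal.inv_ne_top.2 (tsub_pos_of_lt ha).ne'),
    fun μ k q hμ hk u τ hu hτ hscale g hg hfin hrep => ?_⟩
  have mr : ∀ n : ℕ, Measurable fun y => 2 ^ n * τ y := fun n => hτ.const_mul _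
  have eq : ∀ n : ℕ, highPart γ u (fun y => 2 ^ n * τ y) g =
      annOp γ u (fun y => 2 ^ n * τ y) k g := fun n =>
    funext fun x => highPart_eq_annOp hγ.continuous hu (mr n) hk hB hp hg hfin hrep x
  simp_rw [eq]
  refine (lpn_tsum_le hp.le fun n =>
    (measurable_annOp hγ.continuous hu (mr n) hk.cont hg).enorm).trans ?_
  calc _ ≤ ∑' n : ℕ, C * ENNReal.ofReal (2 ^ (-δ)) ^ n * lpn p volume (fun x => ‖g x‖ₑ) := by
        refine ENNReal.tsum_le_tsum fun n => ?_
        refine (h μ k q hμ hk u (fun y => 2 ^ n * τ y) (2 ^ n) hu (mr n)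
          (one_le_pow₀ one_le_two) (fun x hx => ?_) g hg hfin).trans (le_of_eq ?_)
        · have hτ0 : 0 < τ x := pos_of_mul_pos_right hx (by positivity)
          calc (2 : ℝ) ^ n = μ * |u x| * (2 ^ n * γ (τ x)) := by
                linear_combination -(2 : ℝ) ^ n * hscale x hτ0
            _ ≤ μ * |u x| * γ (2 ^ n * τ x) := by
                gcongr
                exact hγ.mul_map_le (one_le_pow₀ one_le_two) hτ0.le
        · rw [← ENNReal.ofReal_pow (by positivity), ← Real.rpow_natCast, ← Real.rpow_natCast,
            ← Real.rpow_mul zero_le_two, ← Real.rpow_mul zero_le_two, mul_comm (n : ℝ)]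
    _ = _ := by rw [ENNReal.tsum_mul_right, ENNReal.tsum_mul_left, ENNReal.tsum_geometric]

/-- The `L¹` modulus of continuity of `k` is controlled by its derivative. -/
lemma lintegral_enorm_sub_shift_le (hk : ∀ z, HasDerivAt k (k₁ z) z) (hc : Continuous k₁) (a : ℝ) :
    ∫⁻ ζ, ‖k (ζ - a) - k ζ‖ₑ ≤ ENNReal.ofReal |a| * ∫⁻ z, ‖k₁ z‖ₑ := by
  have h1 : ∀ ζ, ‖k (ζ - a) - k ζ‖ₑ ≤ ∫⁻ s in uIoc 0 a, ‖k₁ (ζ - s)‖ₑ := by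
    intro ζ
    have hd : ∀ s ∈ uIcc 0 a, HasDerivAt (fun s => k (ζ - s)) (-k₁ (ζ - s)) s := fun s _ => by
      have := (hk (ζ - s)).scomp s ((hasDerivAt_id s).const_sub ζ)
      refine this.congr_deriv ?_
      simp
    have ftc := intervalIntegral.integral_eq_sub_of_hasDerivAt hd
      (Continuous.intervalIntegrable (by fun_prop) _ _)
    rw [sub_zero] at ftc
    rw [← ftc, ← ofReal_norm, intervalIntegral.norm_intervalIntegral_eq, ofReal_norm]
    refine (enorm_integral_le_lintegral_enorm _).trans (le_of_eq ?_)
    simp_rw [enorm_neg]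
  refine (lintegral_mono h1).trans (le_of_eq ?_)
  rw [lintegral_lintegral_swap]
  · have h2 : ∀ s, ∫⁻ ζ, ‖k₁ (ζ - s)‖ₑ = ∫⁻ z, ‖k₁ z‖ₑ := fun s =>
      lintegral_sub_right_eq_self (fun z => ‖k₁ z‖ₑ) s
    simp_rw [h2]
    rw [lintegral_const, Measure.restrict_apply_univ, mul_comm, Real.volume_uIoc, sub_zero]
  · have : Continuous fun w : ℝ × ℝ => k₁ (w.1 - w.2) := by fun_prop
    exact this.measurable.enorm.aemeasurable

/-- The contribution of `0 < t ≤ τ(x₁)` to the difference of the Hilbert transform along the curve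
and the Hilbert transform along the horizontal line. -/
noncomputable def lowPart (γ u τ : ℝ → ℝ) (g : ℝ × ℝ → ℂ) (x : ℝ × ℝ) : ℝ≥0∞ :=
  ∫⁻ t, (Ioc 0 (τ x.1)).indicator (fun t => ENNReal.ofReal (1 / t)) t *
    ‖g (x.1 - t, x.2 - u x.1 * γ t) - g (x.1 - t, x.2)‖ₑ

lemma measurable_indicator_one_div : Measurable fun w : ℝ × ℝ =>
    (Ioc 0 w.1).indicator (fun t => ENNReal.ofReal (1 / t)) w.2 := by
  have : (fun w : ℝ × ℝ => (Ioc 0 w.1).indicator (fun t => ENNReal.ofReal (1 / t)) w.2) =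
      {w : ℝ × ℝ | 0 < w.2 ∧ w.2 ≤ w.1}.indicator (fun w => ENNReal.ofReal (1 / w.2)) := by
    ext w
    by_cases h : w.2 ∈ Ioc 0 w.1
    · rw [indicator_of_mem h, indicator_of_mem (by exact h)]
    · rw [indicator_of_notMem h, indicator_of_notMem (by exact h)]
  rw [this]
  refine Measurable.indicator (by fun_prop) ?_
  exact (measurableSet_lt measurable_const measurable_snd).inter
    (measurableSet_le measurable_snd measurable_fst)

/-- The kernel majorising `lowPart`. -/
noncomputable def lowKernel (γ u τ : ℝ → ℝ) (k : ℝ → ℂ) (x₁ z₁ ζ : ℝ) : ℝ≥0∞ :=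
  (Ioc 0 (τ x₁)).indicator (fun t => ENNReal.ofReal (1 / t)) (x₁ - z₁) *
    ‖k (ζ - u x₁ * γ (x₁ - z₁)) - k ζ‖ₑ

lemma measurable_lowKernel (hγ : Continuous γ) (hu : Measurable u) (hτ : Measurable τ)
    (hk : Continuous k) :
    Measurable fun w : ℝ × ℝ × ℝ => lowKernel γ u τ k w.1 w.2.1 w.2.2 := by
  have m1 : Measurable fun w : ℝ × ℝ × ℝ => (τ w.1, w.1 - w.2.1) := by fun_prop
  have m2 : Measurable fun w : ℝ × ℝ × ℝ => k (w.2.2 - u w.1 * γ (w.1 - w.2.1)) - k w.2.2 := by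
    have := hk.measurable
    have := hγ.measurable
    fun_prop
  exact (measurable_indicator_one_div.comp m1).mul m2.enorm

/-- Inserting the reproducing formula, the displacement by `u(x₁) γ(t)` is moved from `g` to the
smooth kernel `k`. -/
lemma lowPart_le (hk : IsBandKernel B μ k q) (hB : B ≠ ⊤) {p : ℝ} (hp : 1 < p) (hg : Measurable g)
    (hfin : lpn p volume (fun x => ‖g x‖ₑ) ≠ ⊤) (hrep : Reproduces k g)
    (hγ : Continuous γ) (hu : Measurable u) (hτ : Measurable τ) (x : ℝ × ℝ) :
    lowPart γ u τ g x ≤ ∫⁻ z : ℝ × ℝ, lowKernel γ u τ k x.1 z.1 (x.2 - z.2) * ‖g z‖ₑ := by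
  have hp0 : 0 < p := by linarith
  obtain ⟨c, hct, hc⟩ := hk.exists_lintegral_mul_le hB hp
  have mG : Measurable fun z₁ => lpn p volume (fun z₂ => ‖g (z₁, z₂)‖ₑ) := measurable_lpn hg.enorm
  have hGfin : lpn p volume (fun z₁ => lpn p volume (fun z₂ => ‖g (z₁, z₂)‖ₑ)) ≠ ⊤ := by
    rwa [← lpn_volume_prod hp0 hg.enorm]
  have mb : Measurable fun z : ℝ × ℝ => lowKernel γ u τ k x.1 z.1 (x.2 - z.2) := by
    have : Measurable fun z : ℝ × ℝ => (x.1, z.1, x.2 - z.2) := by fun_prop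
    exact (measurable_lowKernel hγ hu hτ hk.cont).comp this
  rw [Measure.volume_eq_prod, lintegral_prod _ (by exact (mb.mul hg.enorm).aemeasurable), lowPart,
    ← lintegral_sub_left_eq_self _ x.1]
  refine lintegral_mono_ae ?_
  filter_upwards [hrep, ae_lt_top_of_lpn_ne_top hp0 mG hGfin] with z₁ hz hzfin
  have mg : Measurable fun z₂ => g (z₁, z₂) := hg.comp (measurable_const.prodMk measurable_id)
  have int : ∀ y, Integrable fun z₂ => k (y - z₂) * g (z₁, z₂) := fun y => by
    refine ⟨((hk.cont.measurable.comp (measurable_const.sub measurable_id)).mul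
      mg).aestronglyMeasurable, ?_⟩
    rw [hasFiniteIntegral_iff_enorm]
    simp_rw [enorm_mul]
    exact (hc _ mg.enorm y).trans_lt (ENNReal.mul_lt_top hct.lt_top hzfin)
  rw [sub_sub_cancel]
  simp only [lowKernel, mul_assoc]
  have hne : (Ioc 0 (τ x.1)).indicator (fun t => ENNReal.ofReal (1 / t)) (x.1 - z₁) ≠ ⊤ := by
    by_cases h : x.1 - z₁ ∈ Ioc 0 (τ x.1)
    · rw [indicator_of_mem h]; exact ENNReal.ofReal_ne_top
    · rw [indicator_of_notMem h]; simp
  rw [lintegral_const_mul' _ _ hne]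
  gcongr
  rw [hz, hz, ← integral_sub (int _) (int _)]
  refine (enorm_integral_le_lintegral_enorm _).trans (le_of_eq ?_)
  refine lintegral_congr fun z₂ => ?_
  rw [← sub_mul, enorm_mul, sub_right_comm x.2]

/-- By convexity `γ(t) ≤ (t / τ) γ(τ)`, so the displacement is at most `t / (μ τ)` and cancels the
singularity `1 / t`. -/
lemma IsAdmissibleCurve.lintegral_lowKernel_le (hγ : IsAdmissibleCurve γ) (hμ : 0 < μ)
    (hk₁ : ∀ z, HasDerivAt k (k₁ z) z) (hc : Continuous k₁)
    (hB₁ : ∫⁻ z, ‖k₁ z‖ₑ ≤ B * ENNReal.ofReal μ)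
    (hscale : ∀ x, 0 < τ x → μ * |u x| * γ (τ x) = 1) (x z : ℝ) :
    ∫⁻ ζ, lowKernel γ u τ k x z ζ ≤ B * (ENNReal.ofReal (1 / τ x) *
      (Metric.closedBall (0 : ℝ) (τ x)).indicator (fun _ => 1) (x - z)) := by
  simp only [lowKernel]
  by_cases h : x - z ∈ Ioc 0 (τ x)
  · set t := x - z with ht
    have ht0 : 0 < t := h.1
    have hτ0 : 0 < τ x := ht0.trans_le h.2
    have hmem : t ∈ Metric.closedBall (0 : ℝ) (τ x) := by
      rw [mem_closedBall_zero_iff, Real.norm_eq_abs, abs_of_pos ht0]; exact h.2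
    rw [indicator_of_mem h, indicator_of_mem hmem, lintegral_const_mul' _ _ ENNReal.ofReal_ne_top,
      mul_one]
    have hle : 1 / t * (|u x * γ t| * μ) ≤ 1 / τ x := by
      have h1 := hγ.map_mul_le (c := t / τ x) (t := τ x) (by positivity)
        ((div_le_one hτ0).2 h.2) hτ0.le
      rw [div_mul_cancel₀ _ hτ0.ne'] at h1
      rw [abs_mul, abs_of_pos (hγ.pos ht0)]
      calc 1 / t * (|u x| * γ t * μ) ≤ 1 / t * (|u x| * (t / τ x * γ (τ x)) * μ) := by gcongr
        _ = μ * |u x| * γ (τ x) * (1 / τ x) := by field_simp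
        _ = 1 / τ x := by rw [hscale x hτ0, one_mul]
    calc _ ≤ ENNReal.ofReal (1 / t) * (ENNReal.ofReal |u x * γ t| * (B * ENNReal.ofReal μ)) := by
          gcongr
          exact (lintegral_enorm_sub_shift_le hk₁ hc _).trans (by gcongr)
      _ = B * ENNReal.ofReal (1 / t * (|u x * γ t| * μ)) := by
          rw [ENNReal.ofReal_mul (by positivity), ENNReal.ofReal_mul (by positivity)]
          ring
      _ ≤ B * ENNReal.ofReal (1 / τ x) := by gcongr
  · rw [indicator_of_notMem h]; simp

/-- Up to the scale `τ` the curve may be replaced by the horizontal line: after Young's inequality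
in the second variable only an average over `|t| ≤ τ(x₁)` remains, and the maximal function controls
it. -/
lemma IsAdmissibleCurve.lpn_lowPart_le (hγ : IsAdmissibleCurve γ) {p : ℝ} (hp : 1 < p)
    (hB : B ≠ ⊤) (hμ : 0 < μ) (hk : IsBandKernel B μ k q)
    (hk₁ : ∀ z, HasDerivAt k (k₁ z) z) (hc : Continuous k₁)
    (hB₁ : ∫⁻ z, ‖k₁ z‖ₑ ≤ B * ENNReal.ofReal μ) (hu : Measurable u) (hτ : Measurable τ)
    (hscale : ∀ x, 0 < τ x → μ * |u x| * γ (τ x) = 1) (hg : Measurable g)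
    (hfin : lpn p volume (fun x => ‖g x‖ₑ) ≠ ⊤) (hrep : Reproduces k g) :
    lpn p volume (lowPart γ u τ g) ≤ 2 * B * hlConst p * lpn p volume (fun x => ‖g x‖ₑ) := by
  have hp0 : 0 < p := by linarith
  have mb := measurable_lowKernel hγ.continuous hu hτ hk.cont
  have mG : Measurable fun z₁ => lpn p volume (fun z₂ => ‖g (z₁, z₂)‖ₑ) := measurable_lpn hg.enorm
  have mV : Measurable fun x : ℝ × ℝ =>
      ∫⁻ z : ℝ × ℝ, lowKernel γ u τ k x.1 z.1 (x.2 - z.2) * ‖g z‖ₑ := by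
    refine Measurable.lintegral_prod_right' (f := fun w : (ℝ × ℝ) × (ℝ × ℝ) =>
      lowKernel γ u τ k w.1.1 w.2.1 (w.1.2 - w.2.2) * ‖g w.2‖ₑ) ?_
    have : Measurable fun w : (ℝ × ℝ) × (ℝ × ℝ) => (w.1.1, w.2.1, w.1.2 - w.2.2) := by fun_prop
    exact (mb.comp this).mul (hg.comp measurable_snd).enorm
  refine (lpn_mono hp0 (ae_of_all _ fun x =>
    lowPart_le hk hB hp hg hfin hrep hγ.continuous hu hτ x)).trans ?_
  rw [lpn_volume_prod hp0 mV, lpn_volume_prod hp0 hg.enorm]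
  set G : ℝ → ℝ≥0∞ := fun z₁ => lpn p volume (fun z₂ => ‖g (z₁, z₂)‖ₑ) with hG
  have hfib : ∀ x₁, lpn p volume (fun x₂ =>
      ∫⁻ z : ℝ × ℝ, lowKernel γ u τ k x₁ z.1 (x₂ - z.2) * ‖g z‖ₑ) ≤ 2 * B * hlMax G x₁ := by
    intro x₁
    have mb' : Measurable (Function.uncurry (lowKernel γ u τ k x₁)) := by
      have : Measurable fun w : ℝ × ℝ => (x₁, w.1, w.2) := by fun_prop
      exact mb.comp this
    refine (lpn_fiber_le hp.le mb' hg.enorm).trans ?_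
    have hI := fun z₁ => hγ.lintegral_lowKernel_le hμ hk₁ hc hB₁ hscale x₁ z₁
    rcases le_or_gt (τ x₁) 0 with hτ0 | hτ0
    · have : ∀ z₁, ∫⁻ ζ, lowKernel γ u τ k x₁ z₁ ζ = 0 := fun z₁ => by
        refine le_antisymm ((hI z₁).trans ?_) zero_le
        rw [ENNReal.ofReal_of_nonpos (one_div_nonpos.2 hτ0)]
        simp
      simp [this]
    calc _ ≤ ∫⁻ z₁, B * ENNReal.ofReal (1 / τ x₁) *
          ((Metric.closedBall (0 : ℝ) (τ x₁)).indicator (fun _ => 1) (x₁ - z₁) * G z₁) := by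
          refine lintegral_mono fun z₁ => ?_
          rw [← mul_assoc]
          refine mul_le_mul_left ((hI z₁).trans (le_of_eq ?_)) _
          ring
      _ = B * ENNReal.ofReal (1 / τ x₁) * ∫⁻ z₁ in Metric.closedBall x₁ (τ x₁), G z₁ := by
          rw [lintegral_const_mul' _ _ (by finiteness), lintegral_closedBall_eq]
      _ ≤ B * ENNReal.ofReal (1 / τ x₁) * (ENNReal.ofReal (2 * τ x₁) * hlMax G x₁) := by
          gcongr
          exact lintegral_closedBall_le_hlMax G x₁ hτ0
      _ = 2 * B * hlMax G x₁ := by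
          rw [show B * ENNReal.ofReal (1 / τ x₁) * (ENNReal.ofReal (2 * τ x₁) * hlMax G x₁) =
            B * (ENNReal.ofReal (1 / τ x₁) * ENNReal.ofReal (2 * τ x₁)) * hlMax G x₁ by ring,
            ← ENNReal.ofReal_mul (by positivity),
            show 1 / τ x₁ * (2 * τ x₁) = 2 by field_simp, ENNReal.ofReal_ofNat]
          ring
  calc _ ≤ lpn p volume fun x₁ => 2 * B * hlMax G x₁ := lpn_mono hp0 (ae_of_all _ hfib)
    _ = 2 * B * lpn p volume (hlMax G) := lpn_const_mul hp0 _ (measurable_hlMax mG).aemeasurable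
    _ ≤ 2 * B * (hlConst p * lpn p volume G) := by
        gcongr
        exact lpn_hlMax_le hp mG
    _ = _ := by ring

/-- The scale `τ(x)` at which the curve `u(x) γ` leaves the strip of width `1/μ`. -/
lemma IsAdmissibleCurve.exists_scale (hγ : IsAdmissibleCurve γ) (hμ : 0 < μ) (hu : Measurable u) :
    ∃ τ : ℝ → ℝ, Measurable τ ∧ (∀ x, u x = 0 → τ x = 0) ∧ (∀ x, u x ≠ 0 → 0 < τ x) ∧
      ∀ x, 0 < τ x → μ * |u x| * γ (τ x) = 1 := by
  have hex : ∀ x, ∃ t : ℝ, (u x = 0 → t = 0) ∧ (u x ≠ 0 → 0 < t ∧ μ * |u x| * γ t = 1) := by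
    intro x
    by_cases h : u x = 0
    · exact ⟨0, fun _ => rfl, fun h' => absurd h h'⟩
    have hpos : 0 < μ * |u x| := mul_pos hμ (abs_pos.2 h)
    obtain ⟨b, hb⟩ := ((hγ.tendsto_atTop.eventually_ge_atTop (1 / (μ * |u x|))).and
      (eventually_ge_atTop 0)).exists
    obtain ⟨t, ht, hγt⟩ := intermediate_value_Icc hb.2 hγ.continuous.continuousOn
      (show 1 / (μ * |u x|) ∈ Icc (γ 0) (γ b) from ⟨by rw [hγ.zero]; positivity, hb.1⟩)
    refine ⟨t, fun h' => absurd h' h, fun _ => ⟨lt_of_le_of_ne ht.1 ?_, ?_⟩⟩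
    · rintro rfl
      rw [hγ.zero] at hγt
      exact absurd hγt (one_div_pos.2 hpos).ne
    · rw [hγt]; field_simp
  choose τ h0 h1 using hex
  have hscale : ∀ x, 0 < τ x → μ * |u x| * γ (τ x) = 1 := fun x hx => by
    by_cases h : u x = 0
    · rw [h0 x h] at hx; exact absurd hx (lt_irrefl _)
    · exact (h1 x h).2
  -- measurability: since `γ` is increasing, `τ x ≤ a` amounts to `1 ≤ μ |u x| γ(a)`
  refine ⟨τ, measurable_of_Iic fun a => ?_, h0, fun x hx => (h1 x hx).1, hscale⟩
  rcases lt_or_ge a 0 with ha | ha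
  · have : τ ⁻¹' Iic a = ∅ := by
      ext x
      simp only [mem_preimage, mem_Iic, mem_empty_iff_false, iff_false, not_le]
      by_cases h : u x = 0
      · rw [h0 x h]; exact ha
      · exact ha.trans (h1 x h).1
    rw [this]; exact MeasurableSet.empty
  · have : τ ⁻¹' Iic a = {x | u x = 0} ∪ {x | 1 ≤ μ * |u x| * γ a} := by
      ext x
      simp only [mem_preimage, mem_Iic, mem_union]
      by_cases h : u x = 0
      · simp [h, h0 x h, ha]
      · have hpos : 0 < μ * |u x| := mul_pos hμ (abs_pos.2 h)
        have h2 : 1 ≤ μ * |u x| * γ a ↔ γ (τ x) ≤ γ a := by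
          rw [← (h1 x h).2, mul_le_mul_iff_right₀ hpos]
        have h3 := hγ.strictMonoOn.le_iff_le (mem_Ici.2 (h1 x h).1.le) (mem_Ici.2 ha)
        constructor
        · exact fun h4 => Or.inr (h2.2 (h3.2 h4))
        · rintro (h4 | h4)
          · exact absurd h4 h
          · exact h3.1 (h2.1 h4)
    rw [this]
    exact (measurableSet_eq_fun hu measurable_const).union
      (measurableSet_le measurable_const ((hu.abs.const_mul μ).mul_const _))

end bandLimited

/-! ### The Hilbert transform along horizontal lines -/

section horizontalHilbert

lemma lpn_volume_prod_symm {p : ℝ} (hp : 0 < p) {F : ℝ × ℝ → ℝ≥0∞} (hF : Measurable F) :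
    lpn p volume F = lpn p volume (fun y => lpn p volume (fun x => F (x, y))) := by
  have h : ∫⁻ z, F z ^ p = ∫⁻ y, ∫⁻ x, F (x, y) ^ p := by
    rw [Measure.volume_eq_prod, lintegral_prod_symm _ (hF.pow_const p).aemeasurable]
  rw [lpn, h, lpn]
  congr 1
  refine lintegral_congr fun y => ?_
  rw [lpn_rpow hp]

lemma hilb_eq_integral (ε : ℝ) (f : ℝ → ℂ) (x : ℝ) :
    hilb ε f x = ∫ t, f (x - t) * (hKer ε t : ℂ) := by
  rw [hilb, ← integral_sub_left_eq_self _ _ x]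
  simp_rw [sub_sub_cancel]

/-- For a compactly supported `C¹` function the singularity `1 / t` is cancelled by the Lipschitz
bound on the odd part. -/
lemma exists_tendsto_hilb_of_contDiff {φ : ℝ → ℂ} (hφ : ContDiff ℝ 1 φ) (hs : HasCompactSupport φ)
    (x : ℝ) : ∃ L, Tendsto (fun ε => hilb ε φ x) (𝓝[>] 0) (𝓝 L) := by
  obtain ⟨K, hK⟩ := hφ.lipschitzWith_of_hasCompactSupport hs one_ne_zero
  obtain ⟨S, hS⟩ := hs.isBounded.subset_closedBall (0 : ℝ)
  have hzero : ∀ y, S < |y| → φ y = 0 := fun y hy => by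
    by_contra hn
    have := hS (subset_tsupport φ hn)
    rw [mem_closedBall_zero_iff, Real.norm_eq_abs] at this
    linarith
  have hint : Integrable φ := hφ.continuous.integrable_of_hasCompactSupport hs
  have hker : ∀ t, t ≠ 0 → Tendsto (fun ε => (hKer ε t : ℂ)) (𝓝[>] 0) (𝓝 ((1 / t : ℝ) : ℂ)) := by
    intro t ht
    refine tendsto_const_nhds.congr' ?_
    filter_upwards [Ioo_mem_nhdsGT (abs_pos.2 ht)] with ε hε
    rw [hKer_of_lt hε.2]
  set D : ℝ → ℂ := fun t => (φ (x - t) - φ (x + t)) * ((1 / t : ℝ) : ℂ) with hD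
  -- the odd kernel only sees the odd part of `t ↦ φ (x - t)`
  have key : ∀ ε, 0 < ε →
      hilb ε φ x = (1 / 2 : ℂ) * ∫ t, (φ (x - t) - φ (x + t)) * (hKer ε t : ℂ) := by
    intro ε hε
    have i1 : Integrable fun t => φ (x - t) * (hKer ε t : ℂ) := by
      have := (integrable_mul_hKer hε hint x).comp_sub_left x
      simpa only [sub_sub_cancel] using this
    have i2 : Integrable fun t => φ (x + t) * (hKer ε t : ℂ) := by
      have := i1.comp_neg.neg
      refine this.congr (ae_of_all _ fun t => ?_)
      simp [hKer_neg]
    have e2 : ∫ t, φ (x + t) * (hKer ε t : ℂ) = -∫ t, φ (x - t) * (hKer ε t : ℂ) := by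
      rw [← integral_neg_eq_self, ← integral_neg]
      congr 1 with t
      rw [hKer_neg, ← sub_eq_add_neg]
      push_cast
      ring
    simp_rw [sub_mul]
    rw [integral_sub i1 i2, e2, hilb_eq_integral]
    ring
  refine ⟨(1 / 2 : ℂ) * ∫ t, D t, ?_⟩
  have lim : Tendsto (fun ε => ∫ t, (φ (x - t) - φ (x + t)) * (hKer ε t : ℂ)) (𝓝[>] 0)
      (𝓝 (∫ t, D t)) := by
    refine tendsto_integral_filter_of_dominated_convergence
      (bound := (Metric.closedBall (0 : ℝ) (S + |x|)).indicator fun _ => 2 * (K : ℝ)) ?_ ?_ ?_ ?_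
    · refine Eventually.of_forall fun ε => ?_
      have := hφ.continuous
      have h1 : Continuous fun t => φ (x - t) - φ (x + t) := by fun_prop
      exact (h1.measurable.mul (measurable_hKer ε).complex_ofReal).aestronglyMeasurable
    · refine Eventually.of_forall fun ε => ae_of_all _ fun t => ?_
      by_cases h : t ∈ Metric.closedBall (0 : ℝ) (S + |x|)
      · rw [indicator_of_mem h, norm_mul, Complex.norm_real, Real.norm_eq_abs]
        have h1 : ‖φ (x - t) - φ (x + t)‖ ≤ K * (2 * |t|) := by
          refine (hK.norm_sub_le _ _).trans (le_of_eq ?_)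
          rw [show x - t - (x + t) = -(2 * t) by ring, norm_neg, Real.norm_eq_abs, abs_mul, abs_two]
        by_cases hε : ε < |t|
        · rcases eq_or_ne t 0 with rfl | ht
          · simp [hKer]
          · rw [hKer_of_lt hε, abs_div, abs_one]
            have := abs_pos.2 ht
            calc _ ≤ K * (2 * |t|) * (1 / |t|) := by gcongr
              _ = 2 * K := by field_simp
        · rw [hKer_of_le (not_lt.1 hε), abs_zero, mul_zero]
          positivity
      · rw [indicator_of_notMem h]
        rw [mem_closedBall_zero_iff, Real.norm_eq_abs, not_le] at h
        rw [hzero (x - t), hzero (x + t)]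
        · simp
        · have := abs_sub_abs_le_abs_sub t (-x)
          rw [abs_neg, sub_neg_eq_add, add_comm t] at this
          linarith
        · have := abs_sub_abs_le_abs_sub t x
          rw [abs_sub_comm t x] at this
          linarith
    · exact (integrable_indicator_iff measurableSet_closedBall).2
        (integrableOn_const measure_closedBall_lt_top.ne)
    · have : ∀ᵐ t : ℝ, t ≠ 0 := by simp [ae_iff]
      filter_upwards [this] with t ht
      exact (hker t ht).const_mul _
  refine (lim.const_mul _).congr' ?_
  filter_upwards [self_mem_nhdsWithin] with ε hε
  rw [key ε hε]

variable {g : ℝ × ℝ → ℂ}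

lemma measurable_hilb_fiber (ε : ℝ) (hg : Measurable g) :
    Measurable fun x : ℝ × ℝ => hilb ε (fun s => g (s, x.2)) x.1 := by
  have m1 : Measurable fun w : (ℝ × ℝ) × ℝ => g (w.2, w.1.2) := by
    have : Measurable fun w : (ℝ × ℝ) × ℝ => (w.2, w.1.2) := by fun_prop
    exact hg.comp this
  have m2 : Measurable fun w : (ℝ × ℝ) × ℝ => hKer ε (w.1.1 - w.2) :=
    (measurable_hKer ε).comp (by fun_prop)
  exact ((m1.mul m2.complex_ofReal).stronglyMeasurable.integral_prod_right (ν := volume)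
    (f := fun (x : ℝ × ℝ) (s : ℝ) => g (s, x.2) * (hKer ε (x.1 - s) : ℂ))).measurable

/-- The maximal truncated Hilbert transform in the first variable. -/
noncomputable def hilbMaxFiber (g : ℝ × ℝ → ℂ) (x : ℝ × ℝ) : ℝ≥0∞ :=
  hilbMax (fun s => g (s, x.2)) x.1

lemma measurable_hilbMaxFiber (hg : Measurable g) : Measurable (hilbMaxFiber g) :=
  Measurable.iSup fun _ => Measurable.iSup fun _ => (measurable_hilb_fiber _ hg).enorm

/-- The one-dimensional maximal theorem on every horizontal line. -/
lemma exists_lpn_hilbMaxFiber_le {p : ℝ} (hp : 1 < p) : ∃ C : ℝ≥0∞, C ≠ ⊤ ∧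
    ∀ g : ℝ × ℝ → ℂ, Measurable g →
      lpn p volume (hilbMaxFiber g) ≤ C * lpn p volume (fun x => ‖g x‖ₑ) := by
  obtain ⟨C, hC, h⟩ := exists_lpn_hilbMax_le hp
  have hp0 : 0 < p := by linarith
  refine ⟨C, hC, fun g hg => ?_⟩
  rw [lpn_volume_prod_symm hp0 (measurable_hilbMaxFiber hg), lpn_volume_prod_symm hp0 hg.enorm]
  have mG : Measurable fun y => lpn p volume fun x => ‖g (x, y)‖ₑ :=
    measurable_lpn (hg.comp measurable_swap).enorm
  calc _ ≤ lpn p volume (fun y => C * lpn p volume fun x => ‖g (x, y)‖ₑ) :=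
        lpn_mono hp0 (ae_of_all _ fun y => h _ (hg.comp (measurable_id.prodMk measurable_const)))
    _ = _ := lpn_const_mul hp0 _ mG.aemeasurable

lemma ae_lpn_fiber_ne_top {p : ℝ} (hp : 0 < p) (hg : Measurable g)
    (hfin : lpn p volume (fun x => ‖g x‖ₑ) ≠ ⊤) :
    ∀ᵐ x : ℝ × ℝ, lpn p volume (fun s => ‖g (s, x.2)‖ₑ) ≠ ⊤ := by
  have mG : Measurable fun y => lpn p volume fun x => ‖g (x, y)‖ₑ :=
    measurable_lpn (hg.comp measurable_swap).enorm
  rw [lpn_volume_prod_symm hp hg.enorm] at hfin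
  have h := ae_lt_top_of_lpn_ne_top hp mG hfin
  exact Measure.quasiMeasurePreserving_snd.ae (h.mono fun y hy => hy.ne)

/-- The Hilbert transform in the first variable exists almost everywhere: the maximal function
controls the distance to smooth approximations. -/
lemma ae_exists_tendsto_hilb {p : ℝ} (hp : 1 < p) (hg : Measurable g)
    (hfin : lpn p volume (fun x => ‖g x‖ₑ) ≠ ⊤) :
    ∀ᵐ x : ℝ × ℝ, ∃ L, Tendsto (fun ε => hilb ε (fun s => g (s, x.2)) x.1) (𝓝[>] 0) (𝓝 L) := by
  have hp0 : 0 < p := by linarith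
  obtain ⟨C, hC, hmax⟩ := exists_lpn_hilbMaxFiber_le hp
  have hP0 : ENNReal.ofReal p ≠ 0 := by simpa using hp0
  have hP1 : 1 ≤ ENNReal.ofReal p := by simpa using hp.le
  have hgL : MemLp g (ENNReal.ofReal p) volume := by
    refine ⟨hg.aestronglyMeasurable, ?_⟩
    rw [eLpNorm_eq_lpn hP0 ENNReal.ofReal_ne_top, ENNReal.toReal_ofReal hp0.le]
    exact hfin.lt_top
  -- smooth approximations with `‖g - φ m‖_p ≤ 2⁻ᵐ`; the maximal functions of the errors are
  -- summable in `L^p`, hence tend to zero almost everywhere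
  have happ : ∀ m : ℕ, ∃ φ : ℝ × ℝ → ℂ, HasCompactSupport φ ∧ ContDiff ℝ ∞ φ ∧
      lpn p volume (fun x => ‖g x - φ x‖ₑ) ≤ ENNReal.ofReal ((1 / 2) ^ m) := by
    intro m
    obtain ⟨φ, h1, h2, h3⟩ := hgL.exist_eLpNorm_sub_le ENNReal.ofReal_ne_top hP1
      (ε := (1 / 2) ^ m) (by positivity)
    rw [eLpNorm_eq_lpn hP0 ENNReal.ofReal_ne_top, ENNReal.toReal_ofReal hp0.le] at h3
    exact ⟨φ, h1, h2, h3⟩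
  choose φ hφs hφc hφ using happ
  have mφ : ∀ m, Measurable (φ m) := fun m => (hφc m).continuous.measurable
  have md : ∀ m, Measurable fun x => g x - φ m x := fun m => hg.sub (mφ m)
  have mM := fun m => measurable_hilbMaxFiber (md m)
  have hsum : lpn p volume (fun x => ∑' m, hilbMaxFiber (fun x => g x - φ m x) x) ≠ ⊤ := by
    refine ((lpn_tsum_le hp.le mM).trans (ENNReal.tsum_le_tsum fun m =>
      (hmax _ (md m)).trans (mul_le_mul' le_rfl (hφ m)))).trans_lt ?_ |>.ne
    rw [ENNReal.tsum_mul_left, ← ENNReal.ofReal_tsum_of_nonneg (fun m => by positivity)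
      (summable_geometric_of_lt_one (by norm_num) (by norm_num))]
    exact ENNReal.mul_lt_top hC.lt_top ENNReal.ofReal_lt_top
  have hdfin : ∀ m, lpn p volume (fun x => ‖g x - φ m x‖ₑ) ≠ ⊤ := fun m =>
    ((hφ m).trans_lt ENNReal.ofReal_lt_top).ne
  filter_upwards [ae_lt_top_of_lpn_ne_top hp0 (Measurable.tsum mM) hsum,
    ae_lpn_fiber_ne_top hp0 hg hfin,
    ae_all_iff.2 fun m => ae_lpn_fiber_ne_top hp0 (md m) (hdfin m)] with x hx hgx hdx
  have hzero := ENNReal.tendsto_atTop_zero_of_tsum_ne_top hx.ne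
  have hfib : Measurable fun s => g (s, x.2) := hg.comp (measurable_id.prodMk measurable_const)
  have hdfib : ∀ m, Measurable fun s => g (s, x.2) - φ m (s, x.2) := fun m =>
    (md m).comp (measurable_id.prodMk measurable_const)
  -- Cauchy criterion: within `η / 4` the truncations for `g` and for `φ m` agree, and the latter
  -- converge
  rw [← cauchy_map_iff_exists_tendsto, Metric.cauchy_iff]
  refine ⟨inferInstance, fun η hη => ?_⟩
  obtain ⟨m, hm⟩ := (hzero.eventually_lt_const
    (show (0 : ℝ≥0∞) < ENNReal.ofReal (η / 4) by simpa using hη)).exists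
  have hcs : HasCompactSupport fun s => φ m (s, x.2) := by
    refine HasCompactSupport.intro (K := Prod.fst '' tsupport (φ m))
      ((hφs m).isCompact.image continuous_fst) fun s hsn => ?_
    by_contra hn
    exact hsn ⟨(s, x.2), subset_tsupport _ hn, rfl⟩
  have hcd : ContDiff ℝ 1 fun s => φ m (s, x.2) :=
    ((hφc m).of_le (by exact_mod_cast le_top)).comp (contDiff_id.prodMk contDiff_const)
  obtain ⟨L, hL⟩ := exists_tendsto_hilb_of_contDiff hcd hcs x.1
  refine ⟨Metric.ball L (η / 2), ?_, fun y hy z hz => ?_⟩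
  · rw [mem_map]
    filter_upwards [hL (Metric.ball_mem_nhds L (show 0 < η / 4 by positivity)),
      self_mem_nhdsWithin] with ε hε hε0
    have e : hilb ε (fun s => g (s, x.2)) x.1 - hilb ε (fun s => φ m (s, x.2)) x.1 =
        hilb ε (fun s => g (s, x.2) - φ m (s, x.2)) x.1 := by
      have i1 := integrable_mul_hKer_of_lpn hp hfib hgx hε0 x.1
      have i2 := integrable_mul_hKer_of_lpn hp (hdfib m) (hdx m) hε0 x.1
      have i3 : Integrable fun s => φ m (s, x.2) * (hKer ε (x.1 - s) : ℂ) := by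
        refine (i1.sub i2).congr (ae_of_all _ fun s => ?_)
        simp only [Pi.sub_apply]
        ring
      rw [hilb, hilb, hilb, ← integral_sub i1 i3]
      congr 1 with s
      ring
    have h1 : ‖hilb ε (fun s => g (s, x.2) - φ m (s, x.2)) x.1‖ < η / 4 := by
      have := (enorm_hilb_le_hilbMax hp (hdfib m) (hdx m) hε0 x.1).trans_lt hm
      rw [← ofReal_norm] at this
      exact (ENNReal.ofReal_lt_ofReal_iff (by positivity)).1 this
    rw [mem_preimage, mem_ball_iff_norm] at hε ⊢
    calc _ = ‖hilb ε (fun s => g (s, x.2) - φ m (s, x.2)) x.1 +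
        (hilb ε (fun s => φ m (s, x.2)) x.1 - L)‖ := by rw [← e]; congr 1; ring
      _ ≤ _ := norm_add_le _ _
      _ < η / 4 + η / 4 := add_lt_add h1 hε
      _ = η / 2 := by ring
  · rw [Metric.mem_ball] at hy hz
    calc dist y z ≤ dist y L + dist z L := dist_triangle_right _ _ _
      _ < η := by linarith

end horizontalHilbert

/-! ### Principal values on the line -/

section principalValue

lemma enorm_le_of_hasSum {f : ℕ → ℂ} {s : ℂ} (h : HasSum f s) : ‖s‖ₑ ≤ ∑' n, ‖f n‖ₑ := by
  refine le_of_tendsto' (h.tendsto_sum_nat.enorm) fun N => ?_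
  exact (enorm_sum_le _ _).trans (ENNReal.sum_le_tsum _)

lemma integrable_annKer_mul {a : ℝ → ℂ} {τ r : ℝ} (hr : τ ≤ r) (ma : Measurable a)
    (h : Integrable fun t => a t * (hKer τ t : ℂ)) : Integrable fun t => (annKer r t : ℂ) * a t := by
  have m1 : Measurable (annKer r) :=
    measurable_uncurry_annKer.comp (measurable_const.prodMk measurable_id)
  refine h.mono (m1.complex_ofReal.mul ma).aestronglyMeasurable (ae_of_all _ fun t => ?_)
  rw [norm_mul, norm_mul, mul_comm]
  gcongr
  rw [Complex.norm_real, Complex.norm_real, Real.norm_eq_abs, Real.norm_eq_abs]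
  by_cases ht : t ∈ Ioc r (2 * r)
  · rw [annKer_of_mem ht, hKer_of_lt ((hr.trans_lt ht.1).trans_le (le_abs_self t))]
  · rw [annKer_of_notMem ht, abs_zero]; exact abs_nonneg _

/-- Decomposition of a truncated integral into dyadic annuli. -/
lemma enorm_integral_mul_hKer_le {a : ℝ → ℂ} {τ : ℝ} (hτ : 0 < τ) (ma : Measurable a)
    (h : Integrable fun t => a t * (hKer τ t : ℂ)) :
    ‖∫ t, a t * (hKer τ t : ℂ)‖ₑ ≤ (∑' n : ℕ, ‖∫ t, (annKer (2 ^ n * τ) t : ℂ) * a t‖ₑ) +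
      ∑' n : ℕ, ‖∫ t, (annKer (2 ^ n * τ) t : ℂ) * a (-t)‖ₑ := by
  set ρ : ℕ → ℝ := fun n => 2 ^ n * τ with hρ
  have hρτ : ∀ n, τ ≤ ρ n := fun n => le_mul_of_one_le_left hτ.le (one_le_pow₀ one_le_two)
  have hρs : ∀ n, ρ (n + 1) = 2 * ρ n := fun n => by simp only [hρ]; ring
  have hmono : Monotone ρ := monotone_nat_of_le_succ fun n => by
    rw [hρs]; linarith [hρτ n]
  set S : ℕ → Set ℝ := fun n => (fun t => |t|) ⁻¹' Ioc (ρ n) (ρ (n + 1)) with hS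
  have mS : ∀ n, MeasurableSet (S n) := fun n => measurable_norm measurableSet_Ioc
  have hdisj : Pairwise (Function.onFun Disjoint S) := fun i j hij =>
    (hmono.pairwise_disjoint_on_Ioc_succ hij).preimage _
  have hU : ⋃ n, S n = {t : ℝ | τ < |t|} := by
    have hunb : ¬BddAbove (range ρ) := by
      refine not_bddAbove_of_tendsto_atTop (l := atTop) ?_
      exact (tendsto_pow_atTop_atTop_of_one_lt one_lt_two).atTop_mul_const hτ
    have := iUnion_Ioc_map_succ_eq_Ioi (f := ρ) (fun n => hmono (zero_le)) hunb
    simp only [hS]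
    rw [← preimage_iUnion]
    refine (congrArg _ this).trans ?_
    ext t
    simp [hρ]
  have hi : IntegrableOn (fun t => a t * ((1 / t : ℝ) : ℂ)) (⋃ n, S n) := by
    rw [hU, ← integrable_indicator_iff (measurableSet_lt_abs τ)]
    refine h.congr (ae_of_all _ fun t => ?_)
    simp only
    by_cases ht : τ < |t|
    · rw [indicator_of_mem (by exact ht), hKer_of_lt ht]
    · rw [indicator_of_notMem (by exact ht), hKer_of_le (not_lt.1 ht)]; simp
  have hsum := hasSum_integral_iUnion mS hdisj hi
  have e1 : ∫ t in ⋃ n, S n, a t * ((1 / t : ℝ) : ℂ) = ∫ t, a t * (hKer τ t : ℂ) := by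
    rw [hU, ← integral_indicator (measurableSet_lt_abs τ)]
    congr 1 with t
    by_cases ht : τ < |t|
    · rw [indicator_of_mem (by exact ht), hKer_of_lt ht]
    · rw [indicator_of_notMem (by exact ht), hKer_of_le (not_lt.1 ht)]; simp
  have hneg : Integrable fun t => a (-t) * (hKer τ t : ℂ) := by
    refine (h.comp_neg.neg).congr (ae_of_all _ fun t => ?_)
    simp [hKer_neg]
  have i1 := fun n => integrable_annKer_mul (hρτ n) ma h
  have i2 := fun n => integrable_annKer_mul (hρτ n) (ma.comp measurable_neg) hneg
  -- the two halves of the annulus; the sign comes from `1 / t` at negative `t`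
  have e2 : ∀ n, ∫ t in S n, a t * ((1 / t : ℝ) : ℂ) =
      (∫ t, (annKer (ρ n) t : ℂ) * a t) - ∫ t, (annKer (ρ n) t : ℂ) * a (-t) := fun n => by
    have i3 : Integrable fun t => (annKer (ρ n) (-t) : ℂ) * a t := by
      simpa using (i2 n).comp_neg
    rw [← integral_indicator (mS n), ← integral_neg_eq_self (fun t => (annKer (ρ n) t : ℂ) * a (-t))]
    simp only [neg_neg]
    rw [← integral_sub (i1 n) i3]
    congr 1 with t
    have hρ0 : 0 < ρ n := hτ.trans_le (hρτ n)
    by_cases ht : t ∈ S n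
    · rw [indicator_of_mem ht]
      have ht' : ρ n < |t| ∧ |t| ≤ 2 * ρ n := by rw [← hρs]; exact ht
      rcases le_total 0 t with h0 | h0
      · rw [abs_of_nonneg h0] at ht'
        rw [annKer_of_mem ht', annKer_of_notMem (t := -t) fun hn => by linarith [hn.1]]
        simp [mul_comm]
      · rw [abs_of_nonpos h0] at ht'
        rw [annKer_of_mem ht', annKer_of_notMem (t := t) fun hn => by linarith [hn.1]]
        push_cast
        rw [one_div, one_div, inv_neg]
        ring
    · rw [indicator_of_notMem ht, annKer_of_notMem (t := t), annKer_of_notMem (t := -t)]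
      · simp
      · intro hn
        refine ht ?_
        have := (pos_of_mem_Ioc_two_mul hn).2
        have e : |t| = -t := abs_of_neg (by linarith)
        exact ⟨hn.1.trans_eq e.symm, e.trans_le (hn.2.trans_eq (hρs n).symm)⟩
      · intro hn
        refine ht ?_
        have := (pos_of_mem_Ioc_two_mul hn).2
        have e : |t| = t := abs_of_pos this
        exact ⟨hn.1.trans_eq e.symm, e.trans_le (hn.2.trans_eq (hρs n).symm)⟩
  rw [← e1, ← ENNReal.tsum_add]
  refine (enorm_le_of_hasSum hsum).trans (ENNReal.tsum_le_tsum fun n => ?_)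
  rw [e2]
  exact enorm_sub_le

/-- Comparison of two principal value integrals on the line. If `(a - b) / t` is integrable near
`0`, the difference of the truncations converges, and the limit is estimated by the part `|t| ≤ τ`
of the difference and by the parts `|t| > τ` of the two integrals, that of `a` being split into
dyadic annuli. -/
lemma exists_tendsto_integral_sub_mul_hKer {a b : ℝ → ℂ} (ma : Measurable a) (mb : Measurable b)
    (ha : ∀ ε, 0 < ε → Integrable fun t => a t * (hKer ε t : ℂ))
    (hb : ∀ ε, 0 < ε → Integrable fun t => b t * (hKer ε t : ℂ)) {τ : ℝ} (hτ : 0 < τ)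
    {A₁ A₂ : ℝ≥0∞} (hA₁ : A₁ ≠ ⊤) (hA₂ : A₂ ≠ ⊤)
    (h₁ : ∫⁻ t, (Ioc 0 τ).indicator (fun t => ENNReal.ofReal (1 / t)) t * ‖a t - b t‖ₑ = A₁)
    (h₂ : ∫⁻ t, (Ioc 0 τ).indicator (fun t => ENNReal.ofReal (1 / t)) t * ‖a (-t) - b (-t)‖ₑ = A₂) :
    ∃ L : ℂ, Tendsto (fun ε => (∫ t, a t * (hKer ε t : ℂ)) - ∫ t, b t * (hKer ε t : ℂ)) (𝓝[>] 0)
      (𝓝 L) ∧ ‖L‖ₑ ≤ A₁ + A₂ + ((∑' n : ℕ, ‖∫ t, (annKer (2 ^ n * τ) t : ℂ) * a t‖ₑ) +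
        ∑' n : ℕ, ‖∫ t, (annKer (2 ^ n * τ) t : ℂ) * a (-t)‖ₑ) +
        ‖∫ t, b t * (hKer τ t : ℂ)‖ₑ := by
  set E : ℝ → ℂ := fun t => (a t - b t) * ((1 / t : ℝ) : ℂ) with hE
  have mE : Measurable E := (ma.sub mb).mul (by fun_prop)
  have hen : ∀ t, 0 < t → ‖E t‖ₑ = ENNReal.ofReal (1 / t) * ‖a t - b t‖ₑ := fun t ht => by
    simp only [hE]
    rw [enorm_mul, mul_comm, ← ofReal_norm ((1 / t : ℝ) : ℂ), Complex.norm_real, Real.norm_eq_abs,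
      abs_of_pos (one_div_pos.2 ht)]
  have hen' : ∀ t, 0 < t → ‖E (-t)‖ₑ = ENNReal.ofReal (1 / t) * ‖a (-t) - b (-t)‖ₑ := fun t ht => by
    simp only [hE]
    rw [enorm_mul, mul_comm, ← ofReal_norm ((1 / -t : ℝ) : ℂ), Complex.norm_real, Real.norm_eq_abs,
      abs_div, abs_neg, ← abs_div, abs_of_pos (one_div_pos.2 ht)]
  have near : ∫⁻ t in {t : ℝ | τ < |t|}ᶜ, ‖E t‖ₑ ≤ A₁ + A₂ := by
    have hsub : {t : ℝ | τ < |t|}ᶜ ⊆ Icc (-τ) 0 ∪ Ioc 0 τ := fun t ht => by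
      simp only [mem_compl_iff, mem_ofPred_eq, not_lt] at ht
      rw [abs_le] at ht
      rcases le_or_gt t 0 with h0 | h0
      · exact Or.inl ⟨ht.1, h0⟩
      · exact Or.inr ⟨h0, ht.2⟩
    refine (lintegral_mono_set hsub).trans ((lintegral_union_le _ _ _).trans ?_)
    rw [add_comm]
    refine add_le_add ?_ ?_
    · rw [← h₁, ← lintegral_indicator measurableSet_Ioc]
      refine lintegral_mono fun t => ?_
      by_cases ht : t ∈ Ioc 0 τ
      · rw [indicator_of_mem ht, indicator_of_mem ht, hen t ht.1]
      · rw [indicator_of_notMem ht, indicator_of_notMem ht]; simp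
    · have e : ∫⁻ t in Icc (-τ) 0, ‖E t‖ₑ = ∫⁻ t in Ioc 0 τ, ‖E (-t)‖ₑ := by
        rw [restrict_Ioc_eq_restrict_Icc, ← lintegral_indicator measurableSet_Icc,
          ← lintegral_indicator measurableSet_Icc,
          ← lintegral_neg_eq_self (fun t => (Icc (-τ) 0).indicator (fun t => ‖E t‖ₑ) t)]
        refine lintegral_congr fun t => ?_
        by_cases ht : t ∈ Icc 0 τ
        · rw [indicator_of_mem ht, indicator_of_mem (by constructor <;> linarith [ht.1, ht.2])]
        · rw [indicator_of_notMem ht, indicator_of_notMem]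
          rintro ⟨h3, h4⟩
          exact ht ⟨by linarith, by linarith⟩
      rw [e, ← h₂, ← lintegral_indicator measurableSet_Ioc]
      refine lintegral_mono fun t => ?_
      by_cases ht : t ∈ Ioc 0 τ
      · rw [indicator_of_mem ht, indicator_of_mem ht, hen' t ht.1]
      · rw [indicator_of_notMem ht, indicator_of_notMem ht]; simp
  have ind : ∀ ε t, (a t - b t) * (hKer ε t : ℂ) = {t : ℝ | ε < |t|}.indicator E t := fun ε t => by
    by_cases ht : ε < |t|
    · rw [indicator_of_mem (by exact ht), hKer_of_lt ht]
    · rw [indicator_of_notMem (by exact ht), hKer_of_le (not_lt.1 ht)]; simp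
  have hab : ∀ ε, 0 < ε → Integrable ({t : ℝ | ε < |t|}.indicator E) := fun ε hε => by
    refine ((ha ε hε).sub (hb ε hε)).congr (ae_of_all _ fun t => ?_)
    rw [← ind]
    simp only [Pi.sub_apply]
    ring
  have iE : Integrable E := by
    have i1 : IntegrableOn E {t : ℝ | τ < |t|}ᶜ :=
      ⟨mE.aestronglyMeasurable, near.trans_lt (ENNReal.add_lt_top.2 ⟨hA₁.lt_top, hA₂.lt_top⟩)⟩
    have i2 : IntegrableOn E {t : ℝ | τ < |t|} :=
      (integrable_indicator_iff (measurableSet_lt_abs τ)).1 (hab τ hτ)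
    have := i2.union i1
    rwa [union_compl_self, integrableOn_univ] at this
  have split : ∀ ε, 0 < ε → (∫ t, a t * (hKer ε t : ℂ)) - ∫ t, b t * (hKer ε t : ℂ) =
      ∫ t, {t : ℝ | ε < |t|}.indicator E t := fun ε hε => by
    rw [← integral_sub (ha ε hε) (hb ε hε)]
    congr 1 with t
    rw [← ind, sub_mul]
  refine ⟨∫ t, E t, ?_, ?_⟩
  · have lim : Tendsto (fun ε => ∫ t, {t : ℝ | ε < |t|}.indicator E t) (𝓝[>] 0) (𝓝 (∫ t, E t)) := by
      refine tendsto_integral_filter_of_dominated_convergence (bound := fun t => ‖E t‖)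
        (Eventually.of_forall fun ε =>
          (mE.indicator (measurableSet_lt_abs ε)).aestronglyMeasurable)
        (Eventually.of_forall fun ε => ae_of_all _ fun t => norm_indicator_le_norm_self _ _)
        iE.norm ?_
      have : ∀ᵐ t : ℝ, t ≠ 0 := by simp [ae_iff]
      filter_upwards [this] with t ht
      refine tendsto_const_nhds.congr' ?_
      filter_upwards [Ioo_mem_nhdsGT (abs_pos.2 ht)] with ε hε
      rw [indicator_of_mem (by exact hε.2)]
    refine lim.congr' ?_
    filter_upwards [self_mem_nhdsWithin] with ε hε
    rw [split ε hε]
  · rw [← integral_add_compl (measurableSet_lt_abs τ) iE, ← integral_indicator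
      (measurableSet_lt_abs τ), ← split τ hτ, add_comm, add_assoc (A₁ + A₂)]
    refine (enorm_add_le _ _).trans (add_le_add ?_ ?_)
    · exact (enorm_integral_le_lintegral_enorm _).trans near
    · exact enorm_sub_le.trans (add_le_add_left (enorm_integral_mul_hKer_le hτ ma (ha τ hτ)) _)

end principalValue

/-! ### The Hilbert transform along the curve -/

section curveHilbertBound

variable {γ u τ : ℝ → ℝ} {k k₁ q : ℝ → ℂ} {B : ℝ≥0∞} {μ : ℝ} {g : ℝ × ℝ → ℂ}

lemma measurable_lowPart (hγ : Continuous γ) (hu : Measurable u) (hτ : Measurable τ)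
    (hg : Measurable g) : Measurable (lowPart γ u τ g) := by
  have mγ := hγ.measurable
  refine Measurable.lintegral_prod_right' (f := fun w : (ℝ × ℝ) × ℝ =>
    (Ioc 0 (τ w.1.1)).indicator (fun t => ENNReal.ofReal (1 / t)) w.2 *
      ‖g (w.1.1 - w.2, w.1.2 - u w.1.1 * γ w.2) - g (w.1.1 - w.2, w.1.2)‖ₑ) ?_
  have m1 : Measurable fun w : (ℝ × ℝ) × ℝ => (τ w.1.1, w.2) := by fun_prop
  have m2 : Measurable fun w : (ℝ × ℝ) × ℝ => (w.1.1 - w.2, w.1.2 - u w.1.1 * γ w.2) := by fun_prop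
  have m3 : Measurable fun w : (ℝ × ℝ) × ℝ => (w.1.1 - w.2, w.1.2) := by fun_prop
  exact (measurable_indicator_one_div.comp m1).mul ((hg.comp m2).sub (hg.comp m3)).enorm

lemma measurable_reflection : Measurable fun x : ℝ × ℝ => (-x.1, x.2) := by fun_prop

lemma lpn_comp_reflection (p : ℝ) {F : ℝ × ℝ → ℝ≥0∞} (hF : Measurable F) :
    lpn p volume (fun x : ℝ × ℝ => F (-x.1, x.2)) = lpn p volume F := by
  have h : MeasurePreserving (fun x : ℝ × ℝ => (-x.1, x.2)) volume volume :=
    (Measure.measurePreserving_neg (volume : Measure ℝ)).prod (MeasurePreserving.id volume)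
  rw [lpn, lpn, h.lintegral_comp (hF.pow_const p)]

lemma Reproduces.reflection (h : Reproduces k g) : Reproduces k fun x : ℝ × ℝ => g (-x.1, x.2) :=
  (Measure.measurePreserving_neg (volume : Measure ℝ)).quasiMeasurePreserving.ae h

/-- Truncated integrals along any measurable graph converge absolutely, at every point: the values
of `g` on a vertical line are bounded by its `L^p` norm on that line. -/
lemma integrable_comp_mul_hKer (hk : IsBandKernel B μ k q) (hB : B ≠ ⊤) {p : ℝ} (hp : 1 < p)
    (hg : Measurable g) (hfin : lpn p volume (fun x => ‖g x‖ₑ) ≠ ⊤) (hrep : Reproduces k g)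
    {ε : ℝ} (hε : 0 < ε) (x : ℝ) {y : ℝ → ℝ} (hy : Measurable y) :
    Integrable fun t => g (x - t, y t) * (hKer ε t : ℂ) := by
  have hp0 : 0 < p := by linarith
  obtain ⟨c, hct, hc⟩ := hk.exists_lintegral_mul_le hB hp
  have mG : Measurable fun z₁ => lpn p volume (fun z₂ => ‖g (z₁, z₂)‖ₑ) := measurable_lpn hg.enorm
  have hGfin : lpn p volume (fun z₁ => lpn p volume (fun z₂ => ‖g (z₁, z₂)‖ₑ)) ≠ ⊤ := by
    rwa [← lpn_volume_prod hp0 hg.enorm]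
  have m1 : Measurable fun t => (x - t, y t) := by fun_prop
  refine ⟨((hg.comp m1).mul (measurable_hKer ε).complex_ofReal).aestronglyMeasurable, ?_⟩
  rw [hasFiniteIntegral_iff_enorm]
  have hae : ∀ᵐ t : ℝ, ∀ y, ‖g (x - t, y)‖ₑ ≤ c * lpn p volume (fun z₂ => ‖g (x - t, z₂)‖ₑ) :=
    (Measure.measurePreserving_sub_left volume x).quasiMeasurePreserving.ae
      (enorm_le_of_reproduces hg hrep hc)
  calc ∫⁻ t, ‖g (x - t, y t) * (hKer ε t : ℂ)‖ₑ
      ≤ ∫⁻ t, c * (‖hKer ε t‖ₑ * lpn p volume (fun z₂ => ‖g (x - t, z₂)‖ₑ)) := by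
        refine lintegral_mono_ae ?_
        filter_upwards [hae] with t ht
        rw [enorm_mul, ← ofReal_norm (hKer ε t : ℂ), Complex.norm_real, ofReal_norm,
          mul_comm (‖hKer ε t‖ₑ), ← mul_assoc]
        gcongr
        exact ht _
    _ = c * ∫⁻ s, ‖hKer ε (x - s)‖ₑ * lpn p volume (fun z₂ => ‖g (s, z₂)‖ₑ) := by
        rw [lintegral_const_mul' _ _ hct, ← lintegral_sub_left_eq_self _ x]
        simp_rw [sub_sub_cancel]
    _ < ⊤ := ENNReal.mul_lt_top hct.lt_top (lintegral_hKer_mul_lt_top hp mG hGfin hε x)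

lemma indicator_curveIntegrand (ε : ℝ) (x : ℝ × ℝ) (t : ℝ) :
    {t : ℝ | ε < |t|}.indicator (curveIntegrand u γ g x) t =
      g (x.1 - t, x.2 - u x.1 * γ t) * (hKer ε t : ℂ) := by
  by_cases ht : ε < |t|
  · rw [indicator_of_mem (by exact ht), hKer_of_lt ht, curveIntegrand]
    push_cast
    rw [mul_one_div]
  · rw [indicator_of_notMem (by exact ht), hKer_of_le (not_lt.1 ht)]; simp

lemma truncHilbert_eq (ε : ℝ) (x : ℝ × ℝ) :
    truncHilbert u γ g ε x = ∫ t, g (x.1 - t, x.2 - u x.1 * γ t) * (hKer ε t : ℂ) := by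
  rw [truncHilbert, ← integral_indicator (measurableSet_lt_abs ε)]
  simp_rw [indicator_curveIntegrand]

/-- Pointwise domination of the Hilbert transform along the curve by bounded operators: the low part
(comparison with the horizontal line up to the scale `τ(x₁)`), the annuli beyond that scale, and the
maximal Hilbert transform in the first variable. It occurs twice: for the horizontal principal value
itself and for its truncation at `τ(x₁)`. The half `t < 0` of the integral is treated by reflecting
`x₁`. -/
lemma IsAdmissibleCurve.exists_curveHilbert_bound (hγ : IsAdmissibleCurve γ) {p : ℝ} (hp : 1 < p)
    (hB : B ≠ ⊤) : ∃ C : ℝ≥0∞, C ≠ ⊤ ∧ ∀ (μ : ℝ) (k k₁ q : ℝ → ℂ), 0 < μ → IsBandKernel B μ k q →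
    (∀ z, HasDerivAt k (k₁ z) z) → Continuous k₁ → ∫⁻ z, ‖k₁ z‖ₑ ≤ B * ENNReal.ofReal μ →
    ∀ u : ℝ → ℝ, Measurable u → ∀ g : ℝ × ℝ → ℂ, Measurable g →
    lpn p volume (fun x => ‖g x‖ₑ) ≠ ⊤ → Reproduces k g →
    ∃ V : ℝ × ℝ → ℝ≥0∞, lpn p volume V ≤ C * lpn p volume (fun x => ‖g x‖ₑ) ∧ ∀ᵐ x : ℝ × ℝ,
      (∀ ε : ℝ, 0 < ε → IntegrableOn (curveIntegrand u γ g x) {t : ℝ | ε < |t|}) ∧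
      ∃ L : ℂ, Tendsto (fun ε => truncHilbert u γ g ε x) (𝓝[>] 0) (𝓝 L) ∧ ‖L‖ₑ ≤ V x := by
  have hp0 : 0 < p := by linarith
  obtain ⟨C₁, hC₁, hhigh⟩ := hγ.exists_lpn_tsum_highPart_le hp hB
  obtain ⟨C₂, hC₂, hmax⟩ := exists_lpn_hilbMaxFiber_le hp
  have hM := hlConst_ne_top hp
  obtain ⟨e, he, hsymm⟩ : ∃ e : ℝ, |e| = 1 ∧ ∀ t, γ (-t) = e * γ t := by
    rcases hγ.odd_or_even with h | h
    · exact ⟨-1, by simp, fun t => by rw [h t]; ring⟩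
    · exact ⟨1, by simp, fun t => by rw [h t]; ring⟩
  refine ⟨2 * B * hlConst p + 2 * B * hlConst p + (C₁ + C₁) + 2 * C₂, by finiteness,
    fun μ k k₁ q hμ hk hk₁ hc hB₁ u hu g hg hfin hrep => ?_⟩
  obtain ⟨τ, hτ, hτ0, hτpos, hscale⟩ := hγ.exists_scale hμ hu
  -- the reflected data: `γ` being odd or even, the half `t < 0` is an integral over `t > 0` for a
  -- function `u'` of the same modulus as the reflection of `u`
  set g' : ℝ × ℝ → ℂ := fun x => g (-x.1, x.2) with hg'
  set u' : ℝ → ℝ := fun y => e * u (-y) with hu'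
  set τ' : ℝ → ℝ := fun y => τ (-y) with hτ'
  have mg' : Measurable g' := hg.comp measurable_reflection
  have mu' : Measurable u' := (hu.comp measurable_neg).const_mul e
  have mτ' : Measurable τ' := hτ.comp measurable_neg
  have hgn : lpn p volume (fun x => ‖g' x‖ₑ) = lpn p volume (fun x => ‖g x‖ₑ) :=
    lpn_comp_reflection p hg.enorm
  have hfin' : lpn p volume (fun x => ‖g' x‖ₑ) ≠ ⊤ := by rwa [hgn]
  have hrep' : Reproduces k g' := hrep.reflection
  have hscale' : ∀ y, 0 < τ' y → μ * |u' y| * γ (τ' y) = 1 := fun y hy => by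
    simp only [hu', abs_mul, he, one_mul]
    exact hscale (-y) hy
  -- the majorants
  set W₁ := lowPart γ u τ g with hW₁
  set W₂ := lowPart γ u' τ' g' with hW₂
  set H₁ : ℝ × ℝ → ℝ≥0∞ := fun x => ∑' n : ℕ, ‖highPart γ u (fun y => 2 ^ n * τ y) g x‖ₑ with hH₁
  set H₂ : ℝ × ℝ → ℝ≥0∞ :=
    fun x => ∑' n : ℕ, ‖highPart γ u' (fun y => 2 ^ n * τ' y) g' x‖ₑ with hH₂
  have mW₁ : Measurable W₁ := measurable_lowPart hγ.continuous hu hτ hg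
  have mW₂ : Measurable W₂ := measurable_lowPart hγ.continuous mu' mτ' mg'
  have mhigh : ∀ {u τ : ℝ → ℝ} {g : ℝ × ℝ → ℂ}, Measurable u → Measurable τ → Measurable g →
      Measurable fun x => ∑' n : ℕ, ‖highPart γ u (fun y => 2 ^ n * τ y) g x‖ₑ := by
    intro u τ g hu hτ hg
    refine Measurable.tsum fun n => Measurable.enorm ?_
    have mγ := hγ.continuous.measurable
    have m1 : Measurable fun w : (ℝ × ℝ) × ℝ => (2 ^ n * τ w.1.1, w.2) := by fun_prop
    have m2 : Measurable fun w : (ℝ × ℝ) × ℝ => (w.1.1 - w.2, w.1.2 - u w.1.1 * γ w.2) := by fun_prop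
    exact (((measurable_uncurry_annKer.comp m1).complex_ofReal.mul
      (hg.comp m2)).stronglyMeasurable.integral_prod_right (ν := volume)
      (f := fun (x : ℝ × ℝ) (t : ℝ) => (annKer (2 ^ n * τ x.1) t : ℂ) *
        g (x.1 - t, x.2 - u x.1 * γ t))).measurable
  have mH₁ : Measurable H₁ := mhigh hu hτ hg
  have mH₂ : Measurable H₂ := mhigh mu' mτ' mg'
  have mM := measurable_hilbMaxFiber hg
  have bW₁ : lpn p volume W₁ ≤ 2 * B * hlConst p * lpn p volume (fun x => ‖g x‖ₑ) :=
    hγ.lpn_lowPart_le hp hB hμ hk hk₁ hc hB₁ hu hτ hscale hg hfin hrep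
  have bW₂ : lpn p volume (fun x : ℝ × ℝ => W₂ (-x.1, x.2)) ≤
      2 * B * hlConst p * lpn p volume (fun x => ‖g x‖ₑ) := by
    rw [lpn_comp_reflection p mW₂, ← hgn]
    exact hγ.lpn_lowPart_le hp hB hμ hk hk₁ hc hB₁ mu' mτ' hscale' mg' hfin' hrep'
  have bH₁ : lpn p volume H₁ ≤ C₁ * lpn p volume (fun x => ‖g x‖ₑ) :=
    hhigh μ k q hμ hk u τ hu hτ hscale g hg hfin hrep
  have bH₂ : lpn p volume (fun x : ℝ × ℝ => H₂ (-x.1, x.2)) ≤ C₁ * lpn p volume (fun x => ‖g x‖ₑ) := by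
    rw [lpn_comp_reflection p mH₂, ← hgn]
    exact hhigh μ k q hμ hk u' τ' mu' mτ' hscale' g' mg' hfin' hrep'
  have mW₂' : Measurable fun x : ℝ × ℝ => W₂ (-x.1, x.2) := mW₂.comp measurable_reflection
  have mH₂' : Measurable fun x : ℝ × ℝ => H₂ (-x.1, x.2) := mH₂.comp measurable_reflection
  refine ⟨fun x => W₁ x + W₂ (-x.1, x.2) + (H₁ x + H₂ (-x.1, x.2)) + 2 * hilbMaxFiber g x, ?_, ?_⟩
  · calc _ ≤ lpn p volume W₁ + lpn p volume (fun x : ℝ × ℝ => W₂ (-x.1, x.2)) +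
          (lpn p volume H₁ + lpn p volume (fun x : ℝ × ℝ => H₂ (-x.1, x.2))) +
          2 * lpn p volume (hilbMaxFiber g) := by
          rw [← lpn_const_mul hp0 2 mM.aemeasurable]
          refine (lpn_add_le hp.le ((mW₁.add mW₂').add (mH₁.add mH₂')).aemeasurable
            (mM.const_mul 2).aemeasurable).trans (add_le_add ?_ le_rfl)
          refine (lpn_add_le hp.le (mW₁.add mW₂').aemeasurable
            (mH₁.add mH₂').aemeasurable).trans (add_le_add ?_ ?_)
          · exact lpn_add_le hp.le mW₁.aemeasurable mW₂'.aemeasurable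
          · exact lpn_add_le hp.le mH₁.aemeasurable mH₂'.aemeasurable
      _ ≤ _ := add_le_add (add_le_add (add_le_add bW₁ bW₂) (add_le_add bH₁ bH₂))
          (mul_le_mul' le_rfl (hmax g hg))
      _ = _ := by ring
  have fin : ∀ {W : ℝ × ℝ → ℝ≥0∞}, Measurable W →
      lpn p volume W ≤ 2 * B * hlConst p * lpn p volume (fun x => ‖g x‖ₑ) →
      ∀ᵐ x, W x < ⊤ := fun mW bW =>
    ae_lt_top_of_lpn_ne_top hp0 mW (bW.trans_lt (by finiteness)).ne
  filter_upwards [fin mW₁ bW₁, fin mW₂' bW₂, ae_exists_tendsto_hilb hp hg hfin,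
    ae_lpn_fiber_ne_top hp0 hg hfin] with x hx₁ hx₂ hxlim hxfib
  have mcurve : Measurable fun t => x.2 - u x.1 * γ t := by
    have := hγ.continuous.measurable
    fun_prop
  have ia := fun ε (hε : 0 < ε) => integrable_comp_mul_hKer hk hB hp hg hfin hrep hε x.1 mcurve
  have ib := fun ε (hε : 0 < ε) => integrable_comp_mul_hKer hk hB hp hg hfin hrep hε x.1
    (measurable_const (a := x.2))
  refine ⟨fun ε hε => ?_, ?_⟩
  · rw [← integrable_indicator_iff (measurableSet_lt_abs ε)]
    refine (ia ε hε).congr (ae_of_all _ fun t => ?_)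
    rw [indicator_curveIntegrand]
  obtain ⟨L₀, hL₀⟩ := hxlim
  have mfib : Measurable fun s => g (s, x.2) := hg.comp (measurable_id.prodMk measurable_const)
  have hmaxle : ∀ ε, 0 < ε → ‖hilb ε (fun s => g (s, x.2)) x.1‖ₑ ≤ hilbMaxFiber g x := fun ε hε =>
    enorm_hilb_le_hilbMax hp mfib hxfib hε x.1
  have hL₀le : ‖L₀‖ₑ ≤ hilbMaxFiber g x := by
    refine le_of_tendsto hL₀.enorm ?_
    filter_upwards [self_mem_nhdsWithin] with ε hε
    exact hmaxle ε hε
  -- where `u` vanishes the curve is the horizontal line, and no scale `τ` is available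
  by_cases hux : u x.1 = 0
  · refine ⟨L₀, ?_, hL₀le.trans ?_⟩
    · refine hL₀.congr fun ε => ?_
      rw [truncHilbert_eq, hilb_eq_integral]
      simp [hux]
    · rw [two_mul, ← add_assoc]
      exact le_add_self
  have hτx := hτpos _ hux
  set a : ℝ → ℂ := fun t => g (x.1 - t, x.2 - u x.1 * γ t) with ha
  set b : ℝ → ℂ := fun t => g (x.1 - t, x.2) with hb
  have ma : Measurable a := hg.comp ((measurable_const.sub measurable_id).prodMk mcurve)
  have mb : Measurable b := hg.comp ((measurable_const.sub measurable_id).prodMk measurable_const)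
  have refl1 : ∀ t y, g' (-x.1 - t, y) = g (x.1 - -t, y) := fun t y => by
    simp only [hg']
    rw [neg_sub, sub_neg_eq_add, sub_neg_eq_add, add_comm]
  have refl2 : ∀ t, u' (-x.1) * γ t = u x.1 * γ (-t) := fun t => by
    simp only [hu', neg_neg]
    rw [hsymm]
    ring
  have hτneg : τ' (-x.1) = τ x.1 := by simp only [hτ', neg_neg]
  have elow : ∫⁻ t, (Ioc 0 (τ x.1)).indicator (fun t => ENNReal.ofReal (1 / t)) t *
      ‖a (-t) - b (-t)‖ₑ = W₂ (-x.1, x.2) := by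
    simp only [hW₂, lowPart, refl1, refl2, hτneg, ha, hb]
  have ehigh : ∑' n : ℕ, ‖∫ t, (annKer (2 ^ n * τ x.1) t : ℂ) * a (-t)‖ₑ = H₂ (-x.1, x.2) := by
    simp only [hH₂, highPart, refl1, refl2, hτneg, ha]
  obtain ⟨L₁, hL₁, hL₁le⟩ := exists_tendsto_integral_sub_mul_hKer ma mb ia ib hτx hx₁.ne hx₂.ne
    rfl elow
  have ehilb : ∀ ε, ∫ t, b t * (hKer ε t : ℂ) = hilb ε (fun s => g (s, x.2)) x.1 := fun ε =>
    (hilb_eq_integral ε (fun s => g (s, x.2)) x.1).symm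
  refine ⟨L₁ + L₀, ?_, (enorm_add_le _ _).trans ?_⟩
  · refine (hL₁.add hL₀).congr fun ε => ?_
    rw [truncHilbert_eq, ehilb, sub_add_cancel]
  · rw [two_mul, ← add_assoc]
    refine add_le_add (hL₁le.trans ?_) hL₀le
    rw [ehigh, ehilb]
    exact add_le_add le_rfl (hmaxle _ hτx)

end curveHilbertBound

/-! ### Reproducing kernels for Littlewood–Paley pieces -/

section fourier

open SchwartzMap

/-- A smooth, compactly supported function which equals `1 / (2πiξ)` for `1/2 ≤ |ξ| ≤ 2`. -/
lemma exists_schwartzMap_eq_inv : ∃ m : 𝓢(ℝ, ℂ), ∀ ξ : ℝ, 1 / 2 ≤ |ξ| → |ξ| ≤ 2 →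
    2 * Real.pi * Complex.I * ξ * m ξ = 1 := by
  let b : ContDiffBump (0 : ℝ) := ⟨2, 3, by norm_num, by norm_num⟩
  let c : ContDiffBump (0 : ℝ) := ⟨1 / 4, 1 / 2, by norm_num, by norm_num⟩
  -- `c` keeps the denominator away from `0` without changing it where `1/2 ≤ |ξ|`
  have hpos : ∀ ξ : ℝ, ξ ^ 2 + c ξ ≠ 0 := fun ξ => by
    rcases eq_or_ne ξ 0 with rfl | h
    · rw [c.one_of_mem_closedBall (by simp [c])]
      norm_num
    · have := c.nonneg (x := ξ)
      positivity
  let f : ℝ → ℂ := fun ξ => ((b ξ * (ξ / (ξ ^ 2 + c ξ)) : ℝ) : ℂ) * (2 * Real.pi * Complex.I)⁻¹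
  have hf : ContDiff ℝ ∞ f := by
    have h1 : ContDiff ℝ ∞ fun ξ : ℝ => b ξ * (ξ / (ξ ^ 2 + c ξ)) :=
      b.contDiff.mul (contDiff_id.div ((contDiff_id.pow 2).add c.contDiff) hpos)
    exact (Complex.ofRealCLM.contDiff.comp h1).mul contDiff_const
  have hc : HasCompactSupport f := by
    refine b.hasCompactSupport.mono fun ξ hξ => ?_
    contrapose! hξ
    simp only [Function.mem_support, not_not] at hξ ⊢
    simp [f, hξ]
  refine ⟨hc.toSchwartzMap hf, fun ξ h1 h2 => ?_⟩
  have hb : b ξ = 1 := b.one_of_mem_closedBall (by simpa [b] using h2)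
  have hcξ : c ξ = 0 := c.zero_of_le_dist (by simpa [c] using h1)
  have hξ : ξ ≠ 0 := by
    rintro rfl
    norm_num at h1
  have hξ' : (ξ : ℂ) ≠ 0 := by exact_mod_cast hξ
  have hπ : (Real.pi : ℂ) ≠ 0 := by exact_mod_cast Real.pi_ne_zero
  simp only [HasCompactSupport.toSchwartzMap_toFun, f, hb, hcξ]
  push_cast
  have := Complex.I_ne_zero
  field_simp
  simp

/-- A Schwartz function whose derivative reproduces, by convolution, all Schwartz functions with
frequencies in `1/2 ≤ |ξ| ≤ 2`. -/
lemma exists_reproducing_schwartzMap : ∃ Q : 𝓢(ℝ, ℂ), ∀ Ψ : 𝓢(ℝ, ℂ),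
    Function.support Ψ ⊆ {t : ℝ | 1 / 2 ≤ |t| ∧ |t| ≤ 2} →
    ∀ z, ∫ s, derivCLM ℂ ℂ Q (z - s) * (𝓕⁻ Ψ) s = (𝓕⁻ Ψ) z := by
  obtain ⟨m, hm⟩ := exists_schwartzMap_eq_inv
  refine ⟨𝓕⁻ m, fun Ψ hΨ z => ?_⟩
  have hF : ∀ ξ, 𝓕 (derivCLM ℂ ℂ (𝓕⁻ m)) ξ = 2 * Real.pi * Complex.I * ξ * m ξ := fun ξ => by
    have e : ((derivCLM ℂ ℂ (𝓕⁻ m) : 𝓢(ℝ, ℂ)) : ℝ → ℂ) = deriv (𝓕⁻ m : 𝓢(ℝ, ℂ)) :=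
      funext fun x => derivCLM_apply ℂ _ x
    have e2 : 𝓕 ((𝓕⁻ m : 𝓢(ℝ, ℂ)) : ℝ → ℂ) = m := by
      rw [← fourier_coe, FourierTransform.fourier_fourierInv_eq]
    rw [fourier_coe, e, Real.fourier_deriv (𝓕⁻ m).integrable (𝓕⁻ m).differentiable
      (e ▸ (derivCLM ℂ ℂ (𝓕⁻ m)).integrable), e2]
    rfl
  have h : convolution (ContinuousLinearMap.mul ℂ ℂ).flip (𝓕⁻ Ψ) (derivCLM ℂ ℂ (𝓕⁻ m)) =
      𝓕⁻ Ψ := by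
    have h2 : 𝓕 (convolution (ContinuousLinearMap.mul ℂ ℂ).flip (𝓕⁻ Ψ)
        (derivCLM ℂ ℂ (𝓕⁻ m))) = Ψ := by
      rw [fourier_convolution, FourierTransform.fourier_fourierInv_eq]
      ext ξ
      rw [pairing_apply_apply, hF]
      by_cases hξ : Ψ ξ = 0
      · simp [hξ]
      · simp [hm ξ (hΨ hξ).1 (hΨ hξ).2]
    have h3 := congrArg (fun F : 𝓢(ℝ, ℂ) => (𝓕⁻ F : 𝓢(ℝ, ℂ))) h2
    simpa only [FourierTransform.fourierInv_fourier_eq] using h3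
  conv_rhs => rw [← h]
  rw [convolution_apply]
  rfl

lemma lintegral_comp_mul_left {μ : ℝ} (hμ : 0 < μ) {F : ℝ → ℝ≥0∞} (hF : Measurable F) :
    ∫⁻ z, F (μ * z) = ENNReal.ofReal (1 / μ) * ∫⁻ z, F z := by
  rw [← lintegral_map hF (measurable_const_mul μ), Real.map_volume_mul_left hμ.ne',
    lintegral_smul_measure, abs_of_pos (inv_pos.2 hμ), one_div, smul_eq_mul]

lemma SchwartzMap.lintegral_enorm_ne_top (P : 𝓢(ℝ, ℂ)) : ∫⁻ z, ‖P z‖ₑ ≠ ⊤ :=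
  P.integrable.2.ne

lemma lintegral_enorm_dilation {μ : ℝ} (hμ : 0 < μ) (P : 𝓢(ℝ, ℂ)) (n : ℕ) :
    ∫⁻ z, ‖(μ : ℂ) ^ (n + 1) * P (μ * z)‖ₑ = ENNReal.ofReal (μ ^ n) * ∫⁻ z, ‖P z‖ₑ := by
  have h : ‖(μ : ℂ) ^ (n + 1)‖ₑ = ENNReal.ofReal (μ ^ (n + 1)) := by
    rw [← ofReal_norm, norm_pow, Complex.norm_real, Real.norm_of_nonneg hμ.le]
  simp_rw [enorm_mul, h]
  rw [lintegral_const_mul' _ _ ENNReal.ofReal_ne_top,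
    lintegral_comp_mul_left hμ (F := fun z => ‖P z‖ₑ) P.continuous.measurable.enorm, ← mul_assoc,
    ← ENNReal.ofReal_mul (by positivity)]
  congr 2
  field_simp
  ring

lemma SchwartzMap.hasDerivAt_dilation (P : 𝓢(ℝ, ℂ)) (μ z : ℝ) :
    HasDerivAt (fun z => P (μ * z)) (μ * derivCLM ℂ ℂ P (μ * z)) z := by
  rw [derivCLM_apply]
  have h1 : HasDerivAt (fun z : ℝ => μ * z) μ z := by
    simpa using (hasDerivAt_id z).const_mul μ
  have h2 := (P.differentiable (μ * z)).hasDerivAt.scomp z h1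
  refine h2.congr_deriv ?_
  simp

/-- The `L¹`-normalized dilations of the derivative of a Schwartz function. -/
lemma SchwartzMap.isBandKernel_dilation (Q : 𝓢(ℝ, ℂ)) {B : ℝ≥0∞} (hQ : ∫⁻ z, ‖Q z‖ₑ ≤ B)
    (hQ' : ∫⁻ z, ‖derivCLM ℂ ℂ Q z‖ₑ ≤ B) {μ : ℝ} (hμ : 0 < μ) :
    IsBandKernel B μ (fun z => μ * derivCLM ℂ ℂ Q (μ * z)) (fun z => Q (μ * z)) where
  cont := by
    have := (derivCLM ℂ ℂ Q).continuous
    fun_prop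
  hasDerivAt z := Q.hasDerivAt_dilation μ z
  bdd := ⟨μ * SchwartzMap.seminorm ℝ 0 0 (derivCLM ℂ ℂ Q), fun z => by
    rw [norm_mul, Complex.norm_real, Real.norm_of_nonneg hμ.le]
    exact mul_le_mul_of_nonneg_left (norm_le_seminorm ℝ _ _) hμ.le⟩
  bdd_primitive := ⟨SchwartzMap.seminorm ℝ 0 0 Q, fun z => norm_le_seminorm ℝ _ _⟩
  lintegral_le := by
    have := lintegral_enorm_dilation hμ (derivCLM ℂ ℂ Q) 0
    simp only [zero_add, pow_one, pow_zero, ENNReal.ofReal_one, one_mul] at this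
    exact this.trans_le hQ'
  lintegral_primitive_le := by
    rw [lintegral_comp_mul_left hμ (F := fun z => ‖Q z‖ₑ) Q.continuous.measurable.enorm, mul_comm]
    gcongr

variable {ψ : ℝ → ℝ}

/-- The kernel of `P_l` is the `L¹`-normalized dilation by `2^l` of the inverse Fourier transform of
`ψ`. -/
lemma lpKernel_eq_dilation (ψ : ℝ → ℝ) (l : ℤ) (z : ℝ) :
    lpKernel ψ l z = ((2 : ℝ) ^ l : ℝ) * 𝓕⁻ (fun ξ : ℝ => (ψ ξ : ℂ)) ((2 : ℝ) ^ l * z) := by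
  have hμ : (0 : ℝ) < 2 ^ l := by positivity
  rw [lpKernel, Real.fourierInv_eq', Real.fourierInv_eq', ← Complex.real_smul]
  have := Measure.integral_comp_mul_left (fun ξ : ℝ =>
    Complex.exp (((2 * Real.pi * inner ℝ ξ ((2 : ℝ) ^ l * z) : ℝ) : ℂ) * Complex.I) • (ψ ξ : ℂ))
    ((2 : ℝ) ^ (-l))
  rw [zpow_neg, inv_inv, abs_of_pos hμ] at this
  rw [← this]
  congr 1 with ξ
  rw [zpow_neg]
  congr 4
  simp only [RCLike.inner_apply, conj_trivial]
  field_simp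

/-- The convolution kernels of the Littlewood–Paley projections are the dilations of one Schwartz
function, reproduced by the derivative of another one, which does not depend on the cut-off. -/
lemma IsLittlewoodPaleyCutoff.exists_schwartzMap (hψ : IsLittlewoodPaleyCutoff ψ) :
    ∃ P Q : 𝓢(ℝ, ℂ), (∀ l z, lpKernel ψ l z = ((2 : ℝ) ^ l : ℝ) * P ((2 : ℝ) ^ l * z)) ∧
      ∀ z, ∫ s, derivCLM ℂ ℂ Q (z - s) * P s = P z := by
  obtain ⟨Q, hQ⟩ := exists_reproducing_schwartzMap
  have hc : HasCompactSupport fun ξ : ℝ => (ψ ξ : ℂ) := by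
    refine HasCompactSupport.intro (isCompact_Icc (a := (-2 : ℝ)) (b := 2)) fun x hx => ?_
    by_contra hne
    have := (hψ.supp (a := x) fun h => hne (by simp [h])).2
    exact hx (abs_le.1 this)
  let Ψ : 𝓢(ℝ, ℂ) := hc.toSchwartzMap (Complex.ofRealCLM.contDiff.comp hψ.smooth)
  refine ⟨𝓕⁻ Ψ, Q, fun l z => ?_, hQ Ψ ?_⟩
  · rw [lpKernel_eq_dilation, fourierInv_coe]
    rfl
  · intro x hx
    refine hψ.supp fun h => hx ?_
    change ((ψ x : ℝ) : ℂ) = 0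
    simp [h]

/-- The reproducing formula is invariant under `L¹`-normalized dilations. -/
lemma integral_dilation_mul {P K : 𝓢(ℝ, ℂ)} (h : ∀ z, ∫ s, K (z - s) * P s = P z) {μ : ℝ}
    (hμ : 0 < μ) (z : ℝ) :
    ∫ s, (μ * K (μ * (z - s))) * (μ * P (μ * s)) = μ * P (μ * z) := by
  rw [← h (μ * z)]
  have e := Measure.integral_comp_mul_left (fun s => K (μ * z - s) * P s) μ
  rw [abs_of_pos (inv_pos.2 hμ)] at e
  have hμ' : (μ : ℂ) ≠ 0 := by exact_mod_cast hμ.ne'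
  calc _ = ∫ s, ((μ : ℂ) * μ) * (K (μ * z - μ * s) * P (μ * s)) := by
        congr 1 with s
        rw [mul_sub]
        ring
    _ = _ := by
        rw [integral_const_mul, e, Complex.real_smul]
        push_cast
        field_simp

end fourier

/-! ### Littlewood–Paley projections and the uniform bound -/

section littlewoodPaley

variable {ψ : ℝ → ℝ} {l : ℤ} {f f' g g' : ℝ × ℝ → ℂ} {γ u u' : ℝ → ℝ} {p : ℝ}

lemma lpProj_eq (ψ : ℝ → ℝ) (l : ℤ) (f : ℝ × ℝ → ℂ) (x : ℝ × ℝ) :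
    lpProj ψ l f x = ∫ z, lpKernel ψ l (x.2 - z) * f (x.1, z) := by
  rw [lpProj, ← integral_sub_left_eq_self _ volume x.2]
  simp_rw [sub_sub_cancel, mul_comm]

lemma measurable_lpProj (hK : Continuous (lpKernel ψ l)) (hf : Measurable f) :
    Measurable (lpProj ψ l f) := by
  have m : Measurable fun w : (ℝ × ℝ) × ℝ => (w.1.1, w.1.2 - w.2) := by fun_prop
  exact (((hf.comp m).mul (hK.measurable.comp measurable_snd)).stronglyMeasurable.integral_prod_right
    (ν := volume) (f := fun (x : ℝ × ℝ) (z : ℝ) => f (x.1, x.2 - z) * lpKernel ψ l z)).measurable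

lemma lpn_lpProj_le (hK : Continuous (lpKernel ψ l)) (hp : 1 ≤ p) (hf : Measurable f) :
    lpn p volume (fun x => ‖lpProj ψ l f x‖ₑ) ≤
      (∫⁻ z, ‖lpKernel ψ l z‖ₑ) * lpn p volume (fun x => ‖f x‖ₑ) := by
  have hp0 : 0 < p := by linarith
  rw [lpn_volume_prod hp0 (measurable_lpProj hK hf).enorm, lpn_volume_prod hp0 hf.enorm,
    ← lpn_const_mul hp0 _ (measurable_lpn hf.enorm).aemeasurable]
  refine lpn_mono hp0 (ae_of_all _ fun x => ?_)
  have mf : Measurable fun y => f (x, y) := hf.comp (measurable_const.prodMk measurable_id)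
  refine le_trans (lpn_mono hp0 (ae_of_all _ fun y => ?_))
    (lpn_convolution_le' hp mf.enorm hK.measurable.enorm)
  rw [lpProj_eq]
  refine (enorm_integral_le_lintegral_enorm _).trans (le_of_eq ?_)
  simp_rw [enorm_mul]

/-- Littlewood–Paley projections are reproduced by every kernel which reproduces the kernel of the
projection. -/
lemma reproduces_lpProj {B : ℝ≥0∞} {μ : ℝ} {k q : ℝ → ℂ} (hk : IsBandKernel B μ k q) (hB : B ≠ ⊤)
    (hp : 1 < p) (hK : Continuous (lpKernel ψ l)) (hK1 : ∫⁻ z, ‖lpKernel ψ l z‖ₑ ≠ ⊤)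
    (hrep : ∀ z, ∫ s, k (z - s) * lpKernel ψ l s = lpKernel ψ l z) (hf : Measurable f)
    (hfin : lpn p volume (fun x => ‖f x‖ₑ) ≠ ⊤) : Reproduces k (lpProj ψ l f) := by
  have hp0 : 0 < p := by linarith
  set K := lpKernel ψ l with hKdef
  obtain ⟨c, hct, hc⟩ := hk.exists_lintegral_mul_le hB hp
  have mF : Measurable fun z₁ => lpn p volume (fun z₂ => ‖f (z₁, z₂)‖ₑ) := measurable_lpn hf.enorm
  rw [lpn_volume_prod hp0 hf.enorm] at hfin
  filter_upwards [ae_lt_top_of_lpn_ne_top hp0 mF hfin] with x hx y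
  have mf : Measurable fun y => f (x, y) := hf.comp (measurable_const.prodMk measurable_id)
  have mk := hk.cont.measurable
  have mK := hK.measurable
  have m1 : Measurable fun w : ℝ × ℝ => k (y - w.1) * (K (w.1 - w.2) * f (x, w.2)) := by fun_prop
  have m2 : Measurable fun w : ℝ × ℝ => ‖K (w.1 - w.2)‖ₑ * ‖f (x, w.2)‖ₑ := by fun_prop
  have hint : Integrable (fun w : ℝ × ℝ => k (y - w.1) * (K (w.1 - w.2) * f (x, w.2)))
      (volume.prod volume) := by
    refine ⟨m1.aestronglyMeasurable, ?_⟩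
    rw [hasFiniteIntegral_iff_enorm, lintegral_prod _ m1.enorm.aemeasurable]
    calc ∫⁻ z, ∫⁻ w, ‖k (y - z) * (K (z - w) * f (x, w))‖ₑ
        = ∫⁻ z, ‖k (y - z)‖ₑ * ∫⁻ w, ‖K (z - w)‖ₑ * ‖f (x, w)‖ₑ := by
          simp_rw [enorm_mul]
          refine lintegral_congr fun z => ?_
          rw [lintegral_const_mul' _ _ enorm_ne_top]
      _ ≤ c * lpn p volume (fun z => ∫⁻ w, ‖K (z - w)‖ₑ * ‖f (x, w)‖ₑ) :=
          hc _ m2.lintegral_prod_right' y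
      _ ≤ c * ((∫⁻ z, ‖K z‖ₑ) * lpn p volume (fun w => ‖f (x, w)‖ₑ)) :=
          mul_le_mul' le_rfl (lpn_convolution_le' hp.le mf.enorm mK.enorm)
      _ < ⊤ := ENNReal.mul_lt_top hct.lt_top (ENNReal.mul_lt_top hK1.lt_top hx)
  -- Fubini's theorem: `k * (K * f) = (k * K) * f = K * f`
  symm
  calc ∫ z, k (y - z) * lpProj ψ l f (x, z)
      = ∫ z, ∫ w, k (y - z) * (K (z - w) * f (x, w)) := by
        congr 1 with z
        rw [lpProj_eq, integral_const_mul]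
    _ = ∫ w, ∫ z, k (y - z) * (K (z - w) * f (x, w)) := integral_integral_swap hint
    _ = ∫ w, K (y - w) * f (x, w) := by
        congr 1 with w
        rw [← hrep (y - w), ← integral_mul_const,
          ← integral_add_right_eq_self _ w]
        congr 1 with s
        rw [add_sub_cancel_right, sub_add_eq_sub_sub_swap, mul_assoc]
    _ = lpProj ψ l f (x, y) := (lpProj_eq ψ l f (x, y)).symm

/-- Modifying `f` on a null set changes `P_l f` only on a null set of vertical lines, not merely on
a null set of the plane; integrals along a curve do not see such a change. -/
lemma lpProj_congr (h : f =ᵐ[volume] f') :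
    ∀ᵐ z₁ : ℝ, ∀ y, lpProj ψ l f (z₁, y) = lpProj ψ l f' (z₁, y) := by
  filter_upwards [Measure.ae_ae_of_ae_prod h] with z₁ hz y
  rw [lpProj_eq, lpProj_eq]
  refine integral_congr_ae ?_
  filter_upwards [hz] with z hz'
  simp only [hz']

lemma curveIntegrand_congr (h : ∀ᵐ z₁ : ℝ, ∀ y, g (z₁, y) = g' (z₁, y)) {x : ℝ × ℝ}
    (hu : u x.1 = u' x.1) : curveIntegrand u γ g x =ᵐ[volume] curveIntegrand u' γ g' x := by
  filter_upwards [(Measure.measurePreserving_sub_left volume x.1).quasiMeasurePreserving.ae h]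
    with t ht
  simp only [curveIntegrand, hu, ht]

lemma truncHilbert_congr (h : ∀ᵐ z₁ : ℝ, ∀ y, g (z₁, y) = g' (z₁, y)) {x : ℝ × ℝ}
    (hu : u x.1 = u' x.1) (ε : ℝ) : truncHilbert u γ g ε x = truncHilbert u' γ g' ε x :=
  integral_congr_ae (ae_restrict_of_ae (curveIntegrand_congr h hu))

lemma measurable_truncHilbert (hγ : Measurable γ) (hu : Measurable u) (hg : Measurable g) (ε : ℝ) :
    Measurable (truncHilbert u γ g ε) := by
  have m : Measurable fun w : (ℝ × ℝ) × ℝ => (w.1.1 - w.2, w.1.2 - u w.1.1 * γ w.2) := by fun_prop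
  have e : truncHilbert u γ g ε =
      fun x => ∫ t, g (x.1 - t, x.2 - u x.1 * γ t) * (hKer ε t : ℂ) :=
    funext fun x => truncHilbert_eq ε x
  rw [e]
  exact (((hg.comp m).mul ((measurable_hKer ε).complex_ofReal.comp
    measurable_snd)).stronglyMeasurable.integral_prod_right (ν := volume)
    (f := fun (x : ℝ × ℝ) (t : ℝ) => g (x.1 - t, x.2 - u x.1 * γ t) * (hKer ε t : ℂ))).measurable

/-- Almost everywhere limits of the truncations determine the Hilbert transform, measurability
included. -/
lemma aestronglyMeasurable_curveHilbert (hγ : Measurable γ) (hu : Measurable u) (hg : Measurable g)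
    (h : ∀ᵐ x : ℝ × ℝ, ∃ L : ℂ, Tendsto (fun ε => truncHilbert u γ g ε x) (𝓝[>] 0) (𝓝 L)) :
    AEStronglyMeasurable (curveHilbert u γ g) volume := by
  refine aestronglyMeasurable_of_tendsto_ae atTop
    (f := fun (n : ℕ) => truncHilbert u γ g (1 / ((n : ℝ) + 1)))
    (fun n => (measurable_truncHilbert hγ hu hg _).aestronglyMeasurable) ?_
  filter_upwards [h] with x ⟨L, hL⟩
  rw [curveHilbert, hL.limUnder_eq]
  refine hL.comp (tendsto_nhdsWithin_iff.2 ⟨tendsto_one_div_add_atTop_nhds_zero_nat,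
    Eventually.of_forall fun n => ?_⟩)
  rw [mem_Ioi]
  positivity

end littlewoodPaley

theorem theorem1p3 (γ : ℝ → ℝ) (hγ : IsAdmissibleCurve γ)
    (ψ : ℝ → ℝ) (hψ : IsLittlewoodPaleyCutoff ψ)
    (p : ℝ≥0∞) (hp : 1 < p) (hp' : p < ⊤) :
    ∃ C : ℝ, 0 < C ∧
      ∀ u : ℝ → ℝ, AEMeasurable u volume →
      ∀ l : ℤ, ∀ f : ℝ × ℝ → ℂ, MemLp f p volume →
        MemLp (lpProj ψ l f) p volume ∧
        (∀ᵐ x : ℝ × ℝ, PVExists u γ (lpProj ψ l f) x) ∧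
        MemLp (curveHilbert u γ (lpProj ψ l f)) p volume ∧
        eLpNorm (curveHilbert u γ (lpProj ψ l f)) p volume ≤
          ENNReal.ofReal C * eLpNorm (lpProj ψ l f) p volume := by
  have hp0 : p ≠ 0 := (zero_lt_one.trans hp).ne'
  have hpr : 1 < p.toReal := by
    rw [← ENNReal.toReal_one]
    exact (ENNReal.toReal_lt_toReal ENNReal.one_ne_top hp'.ne).2 hp
  have hpr0 : 0 < p.toReal := by linarith
  obtain ⟨P, Q, hP, hQ⟩ := hψ.exists_schwartzMap
  set Q₁ := SchwartzMap.derivCLM ℂ ℂ Q with hQ₁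
  set Q₂ := SchwartzMap.derivCLM ℂ ℂ Q₁ with hQ₂
  set B : ℝ≥0∞ := (∫⁻ z, ‖Q z‖ₑ) + (∫⁻ z, ‖Q₁ z‖ₑ) + ∫⁻ z, ‖Q₂ z‖ₑ with hBdef
  have hB : B ≠ ⊤ := by
    have h0 := Q.lintegral_enorm_ne_top
    have h1 := Q₁.lintegral_enorm_ne_top
    have h2 := Q₂.lintegral_enorm_ne_top
    finiteness
  obtain ⟨C, hC, hmain⟩ := hγ.exists_curveHilbert_bound hpr hB
  refine ⟨C.toReal + 1, by positivity, fun u hu l f hf => ?_⟩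
  set μ : ℝ := 2 ^ l with hμdef
  have hμ : 0 < μ := by positivity
  have hK : lpKernel ψ l = fun z => (μ : ℂ) * P (μ * z) := funext fun z => hP l z
  have hKc : Continuous (lpKernel ψ l) := by
    have := P.continuous
    rw [hK]
    fun_prop
  have hK1 : ∫⁻ z, ‖lpKernel ψ l z‖ₑ ≠ ⊤ := by
    have h := lintegral_enorm_dilation hμ P 0
    simp only [zero_add, pow_one, pow_zero, ENNReal.ofReal_one, one_mul] at h
    rw [hK, h]
    exact P.lintegral_enorm_ne_top
  have hk := Q.isBandKernel_dilation (B := B) (by rw [hBdef, add_assoc]; exact le_self_add)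
    (by rw [hBdef, add_right_comm]; exact le_add_self) hμ
  -- measurable modifications of `u` and `f`
  obtain ⟨u', mu', huu'⟩ := hu
  obtain ⟨f', sf', hff'⟩ := hf.1
  have mf' := sf'.measurable
  have hfin' : lpn p.toReal volume (fun x => ‖f' x‖ₑ) ≠ ⊤ := by
    rw [← eLpNorm_eq_lpn hp0 hp'.ne, ← eLpNorm_congr_ae hff']
    exact hf.2.ne
  set g := lpProj ψ l f with hg
  set g' := lpProj ψ l f' with hg'
  have mg' : Measurable g' := measurable_lpProj hKc mf'
  have hgfin : lpn p.toReal volume (fun x => ‖g' x‖ₑ) ≠ ⊤ :=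
    ((lpn_lpProj_le hKc hpr.le mf').trans_lt
      (ENNReal.mul_lt_top hK1.lt_top hfin'.lt_top)).ne
  have hrep : Reproduces (fun z => μ * Q₁ (μ * z)) g' := by
    refine reproduces_lpProj hk hB hpr hKc hK1 (fun z => ?_) mf' hfin'
    simp_rw [hK]
    exact integral_dilation_mul hQ hμ z
  have hslice : ∀ᵐ z₁ : ℝ, ∀ y, g (z₁, y) = g' (z₁, y) := lpProj_congr hff'
  have hgg' : g =ᵐ[volume] g' := by
    filter_upwards [Measure.quasiMeasurePreserving_fst.ae hslice] with x hx using hx x.2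
  have hu' : ∀ᵐ x : ℝ × ℝ, u x.1 = u' x.1 := Measure.quasiMeasurePreserving_fst.ae huu'
  obtain ⟨V, hV, hae⟩ := hmain μ _ (fun z => (μ : ℂ) ^ 2 * Q₂ (μ * z)) _ hμ hk
    (fun z => ((Q₁.hasDerivAt_dilation μ z).const_mul (μ : ℂ)).congr_deriv (by rw [sq, mul_assoc]))
    (by have := Q₂.continuous; fun_prop)
    (by
      have h := lintegral_enorm_dilation hμ Q₂ 1
      simp only [one_add_one_eq_two, pow_one] at h
      rw [h, mul_comm]
      exact mul_le_mul' le_add_self le_rfl)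
    u' mu' g' mg' hgfin hrep
  have hH : curveHilbert u γ g =ᵐ[volume] curveHilbert u' γ g' := by
    filter_upwards [hu'] with x hx
    simp only [curveHilbert, truncHilbert_congr hslice hx]
  have hHm : AEStronglyMeasurable (curveHilbert u γ g) volume :=
    (aestronglyMeasurable_curveHilbert hγ.continuous.measurable mu' mg'
      (hae.mono fun x hx => ⟨_, hx.2.choose_spec.1⟩)).congr hH.symm
  have hg2 : eLpNorm g p volume = lpn p.toReal volume (fun x => ‖g' x‖ₑ) := by
    rw [eLpNorm_congr_ae hgg', eLpNorm_eq_lpn hp0 hp'.ne]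
  have hgmem : MemLp g p volume :=
    ⟨(mg'.aestronglyMeasurable).congr hgg'.symm, by rw [hg2]; exact hgfin.lt_top⟩
  have hbound : eLpNorm (curveHilbert u γ g) p volume ≤
      ENNReal.ofReal (C.toReal + 1) * eLpNorm g p volume := by
    rw [hg2, eLpNorm_eq_lpn hp0 hp'.ne]
    refine (lpn_mono (G := V) hpr0 ?_).trans (hV.trans (mul_le_mul' ?_ le_rfl))
    · filter_upwards [hH, hae] with x hx ⟨_, L, hL, hLV⟩
      rwa [hx, curveHilbert, hL.limUnder_eq]
    · rw [← ENNReal.ofReal_toReal hC]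
      exact ENNReal.ofReal_le_ofReal (by simp)
  refine ⟨hgmem, ?_, ⟨hHm, hbound.trans_lt (ENNReal.mul_lt_top ENNReal.ofReal_lt_top hgmem.2)⟩,
    hbound⟩
  filter_upwards [hu', hae] with x hx ⟨hint, L, hL, _⟩
  refine ⟨fun ε hε => (hint ε hε).congr (ae_restrict_of_ae (curveIntegrand_congr hslice hx).symm),
    L, ?_⟩
  simpa only [truncHilbert_congr hslice hx] using hL
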